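/- **Setting.** Let $n\ge 3$, $A_0:\mathbb R^n\to\mathbb R$ and $A:\mathbb R^n\to\mathbb R^n$. Write $D_j=\partial_j+iA_j$, $\nabla_A=(D_1,\dots,D_n)$, $\Delta_A=\sum_j D_j^2$, $H=-\Delta_A+A_0$ (operator sum, with domain $D(-\Delta_A)\cap D(A_0)$), where $-\Delta_A$ is the operator on $L^2(\mathbb R^n)$ of the closure of the form $\|\nabla_A\varphi\|_{L^2}^2$, $\varphi\in C_c^\infty(\mathbb R^n\setminus\{0\})$ (its Friedrichs realization). Let $F_{jk}=\partial_jA_k-\partial_kA_j$, let $B_\tau$ be the vector field with components $(B_\tau)_k=\sum_j\frac{x_j}{|x|}F_{jk}$, let $(\partial_rA_0)_+=\max\big(\nabla A_0\cdot\frac{x}{|x|},0\big)$, and let $\nabla_A^\tau u=\nabla_Au-\frac{x}{|x|}\big(\frac{x}{|x|}\cdot\nabla_Au\big)$. **Assumptions.** $A_0,A\in C^1(\mathbb R^n\setminus\{0\})$; $-\Delta_A$ and $H$ are self-adjoint and nonnegative on $L^2$; $\operatorname{div}A=0$ on $\mathbb R^n\setminus\{0\}$; and * if $n=3$, for some $M>0$,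 $$\frac{(M+\frac12)^2}{M}\int_0^\infty\sup_{|x|=r}\big(|x|^{3/2}|B_\tau|\big)^2\,dr+(2M+1)\int_0^\infty\sup_{|x|=r}|x|^2(\partial_rA_0)_+\,dr<\frac12;$$ * if $n\ge4$, $$\big\||x|^2B_\tau\big\|_{L^\infty}^2+2\big\||x|^3(\partial_rA_0)_+\big\|_{L^\infty}<\tfrac23(n-1)(n-3).$$ **Nonlinearity.** $g:[0,\infty)\to\mathbb R$ is continuous, $C^1$ on $(0,\infty)$, $g(0)=0$, and it is defocusing: the continuous function $G$ on $[0,\infty)$ with $G(0)=0$ and $G'(x)=xg'(x)$ for $x>0$ satisfies $G\ge0$. (For example $g(x)=x^p$, $p>0$, with $G(x)=\frac{p}{p+1}x^{p+1}$.) **Solutions.** For $T\in(0,\infty]$ let $I=[0,T]$ if $T<\infty$ and $I=[0,\infty)$ if $T=\infty$. A solution on $I$ is a $u\in C(I;D(H))\cap C^1(I;L^2)$, $D(H)$ with the graph norm, such that for every $t\in I$, a.e. in $x$, $$i\,\partial_tu-A_0u+\Delta_Au=g(|u|^2)u .$$ **Corollary 2.3.** There is a constant $C<\infty$, depending only on $n$,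 $A_0$, $A$ (and, if $n=3$, on $M$), such that for every such $g$, $G$, every $T\in(0,\infty]$ and every solution $u$ on $I$ the following hold. If $n=3$, $$\int_0^T\!\!\int_{\mathbb R^3}\Big(\frac{|\nabla_A^\tau u|^2}{|x|}+\frac{2M\,G(|u|^2)}{|x|}\Big)dx\,dt+\sup_{R>0}\frac1R\int_0^T\!\!\int_{|x|\le R}\big(|\nabla_Au|^2+G(|u|^2)\big)dx\,dt+\sup_{R>0}\frac1{R^2}\int_0^T\!\!\int_{|x|=R}|u|^2\,d\sigma\,dt\le C\sup_{t\in I}\big\|(-\Delta_A)^{1/4}u(t)\big\|_{L^2}^2 .$$ If $n\ge4$, $$\int_0^T\!\!\int_{\mathbb R^n}\frac{|\nabla_A^\tau u|^2}{|x|}dx\,dt+\sup_{R>0}\frac1R\int_0^T\!\!\int_{|x|\le R}\Big(|\nabla_Au|^2+\frac{n-1}2G(|u|^2)\Big)dx\,dt+\int_0^T\!\!\int_{\mathbb R^n}\Big(\frac{|u|^2}{|x|^3}+(n-1)\frac{G(|u|^2)}{|x|}\Big)dx\,dt\le C\sup_{t\in I}\big\|(-\Delta_A)^{1/4}u(t)\big\|_{L^2}^2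 .$$ In the sphere term $|u|^2$ is evaluated at its precise representative, the limit of its averages over small balls. -/

import Mathlib

open MeasureTheory Set Filter Topology
open scoped ENNReal NNReal ContDiff InnerProductSpace

namespace MagneticNLS

noncomputable section

/-! ### Spaces -/

/-- Euclidean space of dimension `n`. -/
abbrev E (n : ℕ) : Type := EuclideanSpace ℝ (Fin n)

/-- Complex vectors with the Hermitian norm; the values of covariant gradients. -/
abbrev CVec (n : ℕ) : Type := EuclideanSpace ℂ (Fin n)

/-- `L²(ℝⁿ; ℂ)`. -/
abbrev L2 (n : ℕ) : Type := Lp ℂ 2 (volume : Measure (E n))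

/-- `L²(ℝⁿ; ℂⁿ)`. -/
abbrev L2Vec (n : ℕ) : Type := Lp (CVec n) 2 (volume : Measure (E n))

/-- The Hilbert space `L²(ℝⁿ; ℂ) ⊕ L²(ℝⁿ; ℂⁿ)`, in which the pairs `(u, ∇_A u)` live. -/
abbrev PairSpace (n : ℕ) : Type := WithLp 2 (L2 n × L2Vec n)

variable {n : ℕ}

/-- The standard unit vector `e_j`. -/
def basisVec (j : Fin n) : E n := EuclideanSpace.single j (1 : ℝ)

/-! ### Gauge potentials -/

/-- `F_{jk} = ∂_j A_k - ∂_k A_j`. -/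
def magneticField (A : E n → E n) (x : E n) (j k : Fin n) : ℝ :=
  (fderiv ℝ A x (basisVec j)) k - (fderiv ℝ A x (basisVec k)) j

/-- `div A = ∑_j ∂_j A_j`. -/
def divergence (A : E n → E n) (x : E n) : ℝ :=
  ∑ j, (fderiv ℝ A x (basisVec j)) j

/-- The trapping component of the magnetic field: the `k`-th entry of `B_τ(x)` is
`∑_j (x_j / |x|) F_{jk}(x)`. In dimension three this is, up to sign, the cross product of `x / |x|`
and `curl A`. -/
def trapping (A : E n → E n) (x : E n) : E n :=
  WithLp.toLp 2 fun k => ∑ j, x j / ‖x‖ * magneticField A x j k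

/-- `(∂_r A₀)_+`, the positive part of the radial derivative `∇A₀ · x / |x|`. -/
def radialDerivPos (A₀ : E n → ℝ) (x : E n) : ℝ :=
  max (fderiv ℝ A₀ x (‖x‖⁻¹ • x)) 0

/-! ### The covariant gradient and the magnetic Sobolev space -/

/-- The classical covariant gradient: `D_j φ = ∂_j φ + i A_j φ`. -/
def covGradFun (A : E n → E n) (φ : E n → ℂ) (x : E n) : CVec n :=
  WithLp.toLp 2 fun j => fderiv ℝ φ x (basisVec j) + Complex.I * (A x j : ℂ) * φ x

/-- The pairs `(φ, ∇_A φ)` with `φ` smooth and compactly supported in `ℝⁿ ∖ {0}`. -/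
def testPairs (A : E n → E n) : Set (PairSpace n) :=
  {p | ∃ φ : E n → ℂ, ContDiff ℝ ∞ φ ∧ HasCompactSupport φ ∧ (0 : E n) ∉ tsupport φ ∧
    (p.fst =ᵐ[volume] φ) ∧ (p.snd =ᵐ[volume] covGradFun A φ)}

/-- The graph of the closed operator `∇_A` on `L²`: the closure of the pairs `(φ, ∇_A φ)`, `φ` a
test function on `ℝⁿ ∖ {0}`. Its first components form the magnetic Sobolev space `H¹_A`. -/
def covGradGraph (A : E n → E n) : Submodule ℂ (PairSpace n) :=
  (Submodule.span ℂ (testPairs A)).topologicalClosure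

open Classical in
/-- `∇_A u` for `u` in `H¹_A` (and `0` for other `u`). For `A` continuous off the origin the second
component is determined by the first one. -/
def covGrad (A : E n → E n) (u : L2 n) : L2Vec n :=
  if h : ∃ w : L2Vec n, WithLp.toLp 2 (u, w) ∈ covGradGraph A then h.choose else 0

/-- The tangential part `w - (x/|x|) ((x/|x|) · w)` of a complex vector `w` at the point `x`. -/
def tangential (x : E n) (w : CVec n) : CVec n :=
  WithLp.toLp 2 fun k =>
    w k - ((x k / ‖x‖ : ℝ) : ℂ) * ∑ j, ((x j / ‖x‖ : ℝ) : ℂ) * w j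

/-! ### The operators `-Δ_A` and `H = -Δ_A + A₀` -/

/-- The graph of `-Δ_A`, the operator of the closed form `‖∇_A u‖²` (the Friedrichs operator):
`-Δ_A u = f` when `u ∈ H¹_A` and `⟨∇_A v, ∇_A u⟩ = ⟨v, f⟩` for all `v ∈ H¹_A`. -/
def negLaplacianGraph (A : E n → E n) : Submodule ℂ (L2 n × L2 n) where
  carrier := {q | ∃ w : L2Vec n, WithLp.toLp 2 (q.1, w) ∈ covGradGraph A ∧
    ∀ p ∈ covGradGraph A, ⟪p.snd, w⟫_ℂ = ⟪p.fst, q.2⟫_ℂ}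
  zero_mem' := ⟨0, (covGradGraph A).zero_mem, fun p _ => by simp⟩
  add_mem' := by
    rintro a b ⟨w, hw, hw'⟩ ⟨z, hz, hz'⟩
    refine ⟨w + z, (covGradGraph A).add_mem hw hz, fun p hp => ?_⟩
    simp only [Prod.snd_add, inner_add_right, hw' p hp, hz' p hp]
  smul_mem' := by
    rintro c a ⟨w, hw, hw'⟩
    refine ⟨c • w, (covGradGraph A).smul_mem c hw, fun p hp => ?_⟩
    simp only [Prod.smul_snd, inner_smul_right, hw' p hp]

/-- The operator `-Δ_A` in `L²`. -/
def negLaplacian (A : E n → E n) : L2 n →ₗ.[ℂ] L2 n :=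
  (negLaplacianGraph A).toLinearPMap

/-- The graph of the multiplication by a real function `V`: the pairs `(u, V u)` in `L² × L²`. -/
def mulGraph (V : E n → ℝ) : Submodule ℂ (L2 n × L2 n) where
  carrier := {q | q.2 =ᵐ[volume] fun x => (V x : ℂ) * q.1 x}
  zero_mem' := by
    have h := Lp.coeFn_zero ℂ 2 (volume : Measure (E n))
    change ((0 : L2 n) : E n → ℂ) =ᵐ[volume] fun x => (V x : ℂ) * (0 : L2 n) x
    filter_upwards [h] with x hx
    rw [hx, Pi.zero_apply, mul_zero]
  add_mem' := by
    intro a b ha hb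
    change ((a.2 + b.2 : L2 n) : E n → ℂ) =ᵐ[volume] fun x => (V x : ℂ) * (a.1 + b.1 : L2 n) x
    filter_upwards [Lp.coeFn_add a.1 b.1, Lp.coeFn_add a.2 b.2, ha, hb] with x h1 h2 h3 h4
    rw [h1, h2, Pi.add_apply, Pi.add_apply, h3, h4, mul_add]
  smul_mem' := by
    intro c a ha
    change ((c • a.2 : L2 n) : E n → ℂ) =ᵐ[volume] fun x => (V x : ℂ) * (c • a.1 : L2 n) x
    filter_upwards [Lp.coeFn_smul c a.1, Lp.coeFn_smul c a.2, ha] with x h1 h2 h3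
    rw [h1, h2, Pi.smul_apply, Pi.smul_apply, h3, smul_eq_mul, smul_eq_mul, mul_left_comm]

/-- Multiplication by a real function `V` in `L²`, on its maximal domain `{u | V u ∈ L²}`. -/
def mulOp (V : E n → ℝ) : L2 n →ₗ.[ℂ] L2 n :=
  (mulGraph V).toLinearPMap

/-- `H = -Δ_A + A₀`, the operator sum, with domain `D(-Δ_A) ∩ D(A₀)`. -/
def hamiltonian (A₀ : E n → ℝ) (A : E n → E n) : L2 n →ₗ.[ℂ] L2 n :=
  negLaplacian A + mulOp A₀

/-- A self-adjoint and positive (that is, nonnegative) operator in `L²`. -/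
def IsSelfAdjointPositive (S : L2 n →ₗ.[ℂ] L2 n) : Prop :=
  IsSelfAdjoint S ∧ ∀ u : S.domain, 0 ≤ (⟪(u : L2 n), S u⟫_ℂ).re

/-! ### The fractional power `(-Δ_A)^{1/4}` -/

/-- The map `H¹_A → L²`, `(u, ∇_A u) ↦ u`, where `H¹_A` has the norm
`(‖u‖² + ‖∇_A u‖²)^{1/2}`. -/
def embed (A : E n → E n) : covGradGraph A →L[ℂ] L2 n :=
  (WithLp.fstL 2 ℂ (L2 n) (L2Vec n)).comp (covGradGraph A).subtypeL

instance (A : E n → E n) : CompleteSpace (covGradGraph A) :=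
  inferInstanceAs (CompleteSpace (Submodule.span ℂ (testPairs A)).topologicalClosure)

/-- The resolvent `R = (1 - Δ_A)⁻¹`. If `J` is the embedding of `H¹_A` in `L²`, then `J J* f` is
the `u ∈ H¹_A` with `⟨v, u⟩ + ⟨∇_A v, ∇_A u⟩ = ⟨v, f⟩` for all `v ∈ H¹_A`. -/
def resolvent (A : E n → E n) : L2 n →L[ℂ] L2 n :=
  (embed A).comp (ContinuousLinearMap.adjoint (embed A))

/-- Powers of a nonnegative self-adjoint operator `L` in a Hilbert space, in terms of its resolvent
`R = (1 + L)⁻¹`: the relation `v = L^s u`. Since `L = (1 - R) R⁻¹` with `R` injective and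
`0 ≤ R ≤ 1`, it says `R^s v = (1 - R)^s u`, where the powers of `R` and `1 - R` are taken in the
continuous functional calculus of `R`. -/
def IsPow {H : Type*} [NormedAddCommGroup H] [InnerProductSpace ℂ H] [CompleteSpace H]
    (R : H →L[ℂ] H) (s : ℝ) (u v : H) : Prop :=
  cfc (fun r : ℝ => r ^ s) R v = cfc (fun r : ℝ => (1 - r) ^ s) R u

/-- `‖(-Δ_A)^{1/4} u‖²_{L²}`; it is `∞` when `u` is not in the domain of `(-Δ_A)^{1/4}`. -/
def quarterNormSq (A : E n → E n) (u : L2 n) : ℝ≥0∞ :=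
  ⨅ v ∈ {v : L2 n | IsPow (resolvent A) (1 / 4) u v}, ‖v‖ₑ ^ 2

/-! ### Conditions on the potentials -/

/-- The standing conditions: `C¹` away from the origin, `-Δ_A` and `H` self-adjoint and positive,
Coulomb gauge. -/
structure GaugeConditions (A₀ : E n → ℝ) (A : E n → E n) : Prop where
  contDiff_A₀ : ContDiffOn ℝ 1 A₀ {0}ᶜ
  contDiff_A : ContDiffOn ℝ 1 A {0}ᶜ
  negLaplacian_pos : IsSelfAdjointPositive (negLaplacian A)
  hamiltonian_pos : IsSelfAdjointPositive (hamiltonian A₀ A)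
  coulomb : ∀ x : E n, x ≠ 0 → divergence A x = 0

/-- The smallness condition in dimension three, with parameter `M`:
`((M + 1/2)² / M) ∫₀^∞ sup_{|x|=r} (|x|^{3/2} |B_τ|)² dr
  + (2M + 1) ∫₀^∞ sup_{|x|=r} |x|² (∂_r A₀)_+ dr < 1/2`. -/
def SmallnessThree (A₀ : E n → ℝ) (A : E n → E n) (M : ℝ) : Prop :=
  ENNReal.ofReal ((M + 1 / 2) ^ 2 / M) *
      (∫⁻ r in Ioi (0 : ℝ), ⨆ x ∈ Metric.sphere (0 : E n) r,
        ENNReal.ofReal ((‖x‖ ^ (3 / 2 : ℝ) * ‖trapping A x‖) ^ 2)) +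
    ENNReal.ofReal (2 * M + 1) *
      (∫⁻ r in Ioi (0 : ℝ), ⨆ x ∈ Metric.sphere (0 : E n) r,
        ENNReal.ofReal (‖x‖ ^ 2 * radialDerivPos A₀ x)) <
  ENNReal.ofReal (1 / 2)

/-- The smallness condition in dimension `n ≥ 4`:
`‖|x|² B_τ‖²_{L^∞} + 2 ‖|x|³ (∂_r A₀)_+‖_{L^∞} < (2/3) (n - 1) (n - 3)`. -/
def SmallnessHigh (A₀ : E n → ℝ) (A : E n → E n) : Prop :=
  eLpNorm (fun x : E n => ‖x‖ ^ 2 * ‖trapping A x‖) ∞ volume ^ 2 +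
    2 * eLpNorm (fun x : E n => ‖x‖ ^ 3 * radialDerivPos A₀ x) ∞ volume <
  ENNReal.ofReal (2 / 3 * ((n : ℝ) - 1) * ((n : ℝ) - 3))

/-! ### The nonlinear equation -/

/-- The defocusing nonlinearities: `g` is real valued, continuous on `[0, ∞)`, `C¹` on `(0, ∞)`,
`g(0) = 0`, and `G ≥ 0` is the function with `G'(x) = x g'(x)` and `G(0) = 0`. For `g(x) = x^p` with
`p > 0` one has `G(x) = p x^{p+1} / (p+1)`. -/
structure Defocusing (g G : ℝ → ℝ) : Prop where
  continuous_g : ContinuousOn g (Ici 0)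
  contDiff_g : ContDiffOn ℝ 1 g (Ioi 0)
  g_zero : g 0 = 0
  continuous_G : ContinuousOn G (Ici 0)
  G_zero : G 0 = 0
  hasDerivAt_G : ∀ x : ℝ, 0 < x → HasDerivAt G (x * deriv g x) x
  G_nonneg : ∀ x : ℝ, 0 ≤ x → 0 ≤ G x

/-- The time interval `[0, T]`, or `[0, ∞)` for `T = ∞`. -/
def timeInterval (T : ℝ≥0∞) : Set ℝ := {t | 0 ≤ t ∧ ENNReal.ofReal t ≤ T}

/-- `u ∈ C(I; D(H)) ∩ C¹(I; L²)`, `I = [0, T]` (or `[0, ∞)`), solves `i D_t u + Δ_A u = g(|u|²) u`,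
that is, `i ∂_t u - H u = g(|u|²) u`. -/
def IsSolution (A₀ : E n → ℝ) (A : E n → E n) (g : ℝ → ℝ) (T : ℝ≥0∞) (u : ℝ → L2 n) : Prop :=
  ∃ Hu du : ℝ → L2 n,
    ContinuousOn Hu (timeInterval T) ∧ ContinuousOn du (timeInterval T) ∧
    ∀ t ∈ timeInterval T,
      (u t, Hu t) ∈ (hamiltonian A₀ A).graph ∧
      HasDerivWithinAt u (du t) (timeInterval T) t ∧
      ∀ᵐ x ∂(volume : Measure (E n)),
        Complex.I * du t x - Hu t x = ((g (‖u t x‖ ^ 2) : ℝ) : ℂ) * u t x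

/-! ### Integrals over spheres -/

/-- The precise value of `|u|²` at the point `x`: the (lower) limit of its averages over small balls.
If `u` has a representative `ũ` that is continuous near `x`, the limit exists and is `|ũ(x)|²`. -/
def preciseSq (u : L2 n) (x : E n) : ℝ≥0∞ :=
  liminf (fun δ : ℝ => ⨍⁻ y in Metric.ball x δ, ‖u y‖ₑ ^ 2 ∂volume) (𝓝[>] (0 : ℝ))

/-- `∫_{|x|=R} f dσ`, with `σ` the surface measure. -/
def sphereIntegral (R : ℝ) (f : E n → ℝ≥0∞) : ℝ≥0∞ :=
  ENNReal.ofReal R ^ (n - 1) *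
    ∫⁻ y : Metric.sphere (0 : E n) 1, f (R • (y : E n)) ∂(volume : Measure (E n)).toSphere

/-! ### The left-hand sides of the estimates -/

/-- `∫₀^T ∫ ( |∇_A^τ u|²/|x| + 2 M G(|u|²)/|x| ) dx dt
  + sup_{R>0} (1/R) ∫₀^T ∫_{|x|≤R} ( |∇_A u|² + G(|u|²) ) dx dt
  + sup_{R>0} (1/R²) ∫₀^T ∫_{|x|=R} |u|² dσ dt`. -/
def smoothingThree (A : E n → E n) (G : ℝ → ℝ) (M : ℝ) (T : ℝ≥0∞) (u : ℝ → L2 n) : ℝ≥0∞ :=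
  (∫⁻ t in timeInterval T, ∫⁻ x : E n,
      (‖tangential x (covGrad A (u t) x)‖ₑ ^ 2 / ‖x‖ₑ +
        ENNReal.ofReal (2 * M * G (‖u t x‖ ^ 2)) / ‖x‖ₑ)) +
  (⨆ R ∈ Ioi (0 : ℝ), (ENNReal.ofReal R)⁻¹ *
      ∫⁻ t in timeInterval T, ∫⁻ x in Metric.closedBall (0 : E n) R,
        (‖covGrad A (u t) x‖ₑ ^ 2 + ENNReal.ofReal (G (‖u t x‖ ^ 2)))) +
  (⨆ R ∈ Ioi (0 : ℝ), (ENNReal.ofReal R ^ 2)⁻¹ *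
      ∫⁻ t in timeInterval T, sphereIntegral R (preciseSq (u t)))

/-- `∫₀^T ∫ |∇_A^τ u|²/|x| dx dt
  + sup_{R>0} (1/R) ∫₀^T ∫_{|x|≤R} ( |∇_A u|² + ((n-1)/2) G(|u|²) ) dx dt
  + ∫₀^T ∫ ( |u|²/|x|³ + (n-1) G(|u|²)/|x| ) dx dt`. -/
def smoothingHigh (A : E n → E n) (G : ℝ → ℝ) (T : ℝ≥0∞) (u : ℝ → L2 n) : ℝ≥0∞ :=
  (∫⁻ t in timeInterval T, ∫⁻ x : E n,
      ‖tangential x (covGrad A (u t) x)‖ₑ ^ 2 / ‖x‖ₑ) +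
  (⨆ R ∈ Ioi (0 : ℝ), (ENNReal.ofReal R)⁻¹ *
      ∫⁻ t in timeInterval T, ∫⁻ x in Metric.closedBall (0 : E n) R,
        (‖covGrad A (u t) x‖ₑ ^ 2 +
          ENNReal.ofReal (((n : ℝ) - 1) / 2 * G (‖u t x‖ ^ 2)))) +
  (∫⁻ t in timeInterval T, ∫⁻ x : E n,
      (‖u t x‖ₑ ^ 2 / ‖x‖ₑ ^ 3 +
        ENNReal.ofReal (((n : ℝ) - 1) * G (‖u t x‖ ^ 2)) / ‖x‖ₑ))

end

end MagneticNLS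

namespace MagneticNLS

noncomputable section

open ENNReal (ofReal ofReal_mul ofReal_le_ofReal ofReal_ne_top ofReal_pow ofReal_add ofNat_ne_top
  ofReal_ofNat mul_ne_top continuous_ofReal ofReal_div_of_pos ofReal_one pow_ne_top
  ofReal_inv_of_pos ofReal_toReal ofReal_lt_top ofReal_le_ofReal_iff ofReal_of_nonpos
  ofReal_add_le mul_iInf_of_ne toReal_nonneg ofReal_natCast)

open Complex (I re_ofReal_mul norm_real reCLM add_re ofRealCLM conj_ofReal mul_re conj_im
  real_smul conjCLE conj_re re_sum abs_re_le_norm im_ofReal_mul add_im imCLM coe_smul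
  continuous_im continuous_re sub_re sub_im neg_im normSq_eq_norm_sq mul_im im_sum I_re I_im
  neg_re I_mul_I conj_I mul_conj)

open Finset (sum_congr mul_sum sum_add_distrib sum_mul sum_sub_distrib sum_neg_distrib)

open Metric (sphere ball closedBall mem_ball)

open ContinuousLinearMap (adjoint comp_apply le_of_opNorm_le isPositive_adjoint_comp_self
  adjoint_inner_right adjoint_inner_left)

open EuclideanSpace (proj norm_sq_eq)

open intervalIntegral (integral_mono_on integral_hasDerivAt_right)

open Real (norm_eq_abs log dist_eq sq_sqrt mul_self_sqrt sqrt_nonneg sqrt_pos)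

variable {n : ℕ}

/-- `f` is continuously differentiable away from the origin. -/
abbrev C1Off {F : Type*} [NormedAddCommGroup F] [NormedSpace ℝ F] (f : E n → F) : Prop :=
  ContDiffOn ℝ 1 f {0}ᶜ

theorem sub_one_nonneg (hn : 3 ≤ n) : (0 : ℝ) ≤ n - 1 := by
  have : (3 : ℝ) ≤ n := by exact_mod_cast hn
  linarith

theorem sub_three_nonneg (hn : 3 ≤ n) : (0 : ℝ) ≤ n - 3 := by
  have : (3 : ℝ) ≤ n := by exact_mod_cast hn
  linarith

section

/-- The partial derivative in the direction `e_j`. -/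
def pd {F : Type*} [NormedAddCommGroup F] [NormedSpace ℝ F] (j : Fin n) (f : E n → F) (x : E n) : F :=
  fderiv ℝ f x (basisVec j)

/-- The covariant derivative `∂_j + i A_j`. -/
def cd (A : E n → E n) (j : Fin n) (f : E n → ℂ) (x : E n) : ℂ := pd j f x + I * (A x j : ℂ) * f x

/-- `C^m` functions with compact support in the complement of the origin. -/
structure OffOrigin {F : Type*} [NormedAddCommGroup F] [NormedSpace ℝ F] (m : WithTop ℕ∞)
    (f : E n → F) : Prop where
  contDiff : ContDiff ℝ m f
  compact : HasCompactSupport f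
  zero_notMem : (0 : E n) ∉ tsupport f

section OffOrigin

variable {F G : Type*} [NormedAddCommGroup F] [NormedSpace ℝ F] [NormedAddCommGroup G]
  [NormedSpace ℝ G] {m : WithTop ℕ∞}

theorem OffOrigin.of_le {k : WithTop ℕ∞} {f : E n → F} (hf : OffOrigin m f) (h : k ≤ m) :
    OffOrigin k f := ⟨hf.contDiff.of_le h, hf.compact, hf.zero_notMem⟩

theorem OffOrigin.mono_support {f : E n → F} {g : E n → G} (hf : OffOrigin m f)
    (hg : ∀ x, x ≠ 0 → x ∈ tsupport f → ContDiffAt ℝ m g x) (h : Function.support g ⊆ tsupport f) :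
    OffOrigin m g := by
  have hsub : tsupport g ⊆ tsupport f := closure_minimal h (isClosed_tsupport f)
  refine ⟨contDiff_iff_contDiffAt.2 fun x => ?_, ?_, fun h0 => hf.zero_notMem (hsub h0)⟩
  · by_cases hx : x ∈ tsupport f
    · exact hg x (fun h0 => hf.zero_notMem (h0 ▸ hx)) hx
    · have : g =ᶠ[𝓝 x] fun _ => 0 := by
        filter_upwards [(isClosed_tsupport f).isOpen_compl.mem_nhds hx] with y hy
        by_contra hne
        exact hy (h hne)
      exact contDiffAt_const.congr_of_eventuallyEq this
  · exact HasCompactSupport.of_support_subset_isCompact hf.compact h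

theorem OffOrigin.smul {f : E n → F} {g : E n → ℝ} (hf : OffOrigin m f)
    (hg : ContDiffOn ℝ m g {0}ᶜ) : OffOrigin m fun x => g x • f x := by
  refine hf.mono_support (fun x hx _ => ?_) fun x hx => ?_
  · exact (hg.contDiffAt (isOpen_compl_singleton.mem_nhds hx)).smul hf.contDiff.contDiffAt
  · refine subset_tsupport _ fun h => hx ?_
    simp [h]

theorem OffOrigin.add {f g : E n → F} (hf : OffOrigin m f) (hg : OffOrigin m g) :
    OffOrigin m fun x => f x + g x := by
  have h := tsupport_add f g
  exact ⟨hf.contDiff.add hg.contDiff, hf.compact.add hg.compact, fun h0 =>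
    (h h0).elim hf.zero_notMem hg.zero_notMem⟩

theorem pd_of_notMem_tsupport {f : E n → F} {x : E n} (hx : x ∉ tsupport f) (j : Fin n) :
    pd j f x = 0 := by
  rw [pd, fderiv_of_notMem_tsupport ℝ hx]
  rfl

theorem OffOrigin.partialDeriv {f : E n → F} (hf : OffOrigin (m + 1) f) (j : Fin n) :
    OffOrigin m (pd j f) := by
  have hs : Function.support (pd j f) ⊆ tsupport f := fun x hx => by
    by_contra hne
    exact hx (pd_of_notMem_tsupport hne j)
  exact ⟨(hf.contDiff.fderiv_right le_rfl).clm_apply contDiff_const,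
    HasCompactSupport.of_support_subset_isCompact hf.compact hs, fun h0 =>
    hf.zero_notMem (closure_minimal hs (isClosed_tsupport f) h0)⟩

theorem OffOrigin.integrable {f : E n → F} (hf : OffOrigin 0 f) : Integrable f :=
  hf.contDiff.continuous.integrable_of_hasCompactSupport hf.compact

theorem contDiffOn_component {A : E n → E n} (hA : ContDiffOn ℝ m A {0}ᶜ) (j : Fin n) :
    ContDiffOn ℝ m (fun x => A x j) {0}ᶜ :=
  (proj (𝕜 := ℝ) j).contDiff.comp_contDiffOn hA

theorem OffOrigin.integral_pd {f : E n → F} (hf : OffOrigin 1 f) (j : Fin n) :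
    ∫ x, pd j f x = 0 := by
  have h0 : OffOrigin 0 f := hf.of_le (by norm_num)
  have := integral_smul_fderiv_eq_neg_fderiv_smul_of_integrable (𝕜 := ℝ) (f := fun _ : E n => (1 : ℝ))
    (g := f) (v := basisVec j) (μ := volume) (by simp)
    (by simp only [one_smul]; exact (OffOrigin.partialDeriv (m := 0) hf j).integrable)
    (by simpa using h0.integrable) (by simp) (fun x _ => hf.contDiff.differentiable one_ne_zero x)
  simpa [pd] using this

theorem integral_sum_pd {Q : Fin n → E n → F} (hQ : ∀ j, OffOrigin 1 (Q j)) :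
    (Integrable fun x => ∑ j, pd j (Q j) x) ∧ ∫ x, ∑ j, pd j (Q j) x = 0 := by
  have hi := fun j => (OffOrigin.partialDeriv (m := 0) (hQ j) j).integrable
  refine ⟨integrable_finsetSum _ fun j _ => hi j, ?_⟩
  rw [integral_finsetSum _ fun j _ => hi j]
  exact Finset.sum_eq_zero fun j _ => (hQ j).integral_pd j

end OffOrigin

theorem OffOrigin.covDeriv {A : E n → E n} (hA : ContDiffOn ℝ 1 A {0}ᶜ) {f : E n → ℂ}
    (hf : OffOrigin 2 f) (j : Fin n) : OffOrigin 1 (cd A j f) := by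
  have h1 : OffOrigin 1 (pd j f) := OffOrigin.partialDeriv (m := 1) (hf.of_le (by norm_num)) j
  have h2 : OffOrigin 1 (fun x => A x j • f x) :=
    (hf.of_le (by norm_num)).smul (contDiffOn_component hA j)
  have h3 : OffOrigin 1 (fun x => I * (A x j • f x)) := by
    refine h2.mono_support (fun x _ _ => contDiffAt_const.mul h2.contDiff.contDiffAt) fun x hx =>
      subset_tsupport _ fun h => hx ?_
    simp only [h, mul_zero]
  convert h1.add h3 using 2 with x
  simp [cd, mul_assoc]

theorem covGradFun_apply (A : E n → E n) (φ : E n → ℂ) (x : E n) (j : Fin n) :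
    covGradFun A φ x j = cd A j φ x := rfl

/-! ### Pointwise calculus -/

section Pointwise

variable {x : E n} {j : Fin n}

theorem pd_add {F : Type*} [NormedAddCommGroup F] [NormedSpace ℝ F] {f g : E n → F}
    (hf : DifferentiableAt ℝ f x) (hg : DifferentiableAt ℝ g x) :
    pd j (fun y => f y + g y) x = pd j f x + pd j g x := by
  simp only [pd]
  rw [fderiv_fun_add hf hg]; rfl

theorem pd_sub {F : Type*} [NormedAddCommGroup F] [NormedSpace ℝ F] {f g : E n → F}
    (hf : DifferentiableAt ℝ f x) (hg : DifferentiableAt ℝ g x) :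
    pd j (fun y => f y - g y) x = pd j f x - pd j g x := by
  simp only [pd]
  rw [fderiv_fun_sub hf hg]; rfl

theorem pd_sum {F ι : Type*} [NormedAddCommGroup F] [NormedSpace ℝ F] {s : Finset ι}
    {f : ι → E n → F} (hf : ∀ i ∈ s, DifferentiableAt ℝ (f i) x) :
    pd j (fun y => ∑ i ∈ s, f i y) x = ∑ i ∈ s, pd j (f i) x := by
  simp only [pd]
  rw [fderiv_fun_sum hf, _root_.sum_apply]

theorem pd_mul {𝔸 : Type*} [NormedCommRing 𝔸] [NormedAlgebra ℝ 𝔸] {f g : E n → 𝔸}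
    (hf : DifferentiableAt ℝ f x) (hg : DifferentiableAt ℝ g x) :
    pd j (fun y => f y * g y) x = pd j f x * g x + f x * pd j g x := by
  simp only [pd]
  rw [fderiv_fun_mul hf hg]
  simp only [_root_.add_apply, _root_.smul_apply, smul_eq_mul]
  ring

theorem pd_const_mul {𝔸 : Type*} [NormedCommRing 𝔸] [NormedAlgebra ℝ 𝔸] {g : E n → 𝔸} (c : 𝔸)
    (hg : DifferentiableAt ℝ g x) : pd j (fun y => c * g y) x = c * pd j g x := by
  simp only [pd]
  rw [fderiv_const_mul hg]
  simp

theorem pd_clm {F G : Type*} [NormedAddCommGroup F] [NormedSpace ℝ F] [NormedAddCommGroup G]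
    [NormedSpace ℝ G] (L : F →L[ℝ] G) {f : E n → F} (hf : DifferentiableAt ℝ f x) :
    pd j (fun y => L (f y)) x = L (pd j f x) := by
  simp only [pd]
  have := (L.hasFDerivAt.comp x hf.hasFDerivAt).fderiv
  rw [Function.comp_def] at this
  rw [this]; rfl

theorem pd_re {f : E n → ℂ} (hf : DifferentiableAt ℝ f x) :
    pd j (fun y => (f y).re) x = (pd j f x).re := pd_clm reCLM hf

theorem pd_ofReal {f : E n → ℝ} (hf : DifferentiableAt ℝ f x) :
    pd j (fun y => (f y : ℂ)) x = ((pd j f x : ℝ) : ℂ) := pd_clm ofRealCLM hf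

theorem pd_conj {f : E n → ℂ} (hf : DifferentiableAt ℝ f x) :
    pd j (fun y => (starRingEnd ℂ) (f y)) x = (starRingEnd ℂ) (pd j f x) :=
  pd_clm conjCLE.toContinuousLinearMap hf

theorem pd_norm_comp (hx : x ≠ 0) {f : ℝ → ℝ} {f' : ℝ} (hf : HasDerivAt f f' ‖x‖) :
    pd j (fun y => f ‖y‖) x = f' * (x j / ‖x‖) := by
  have h1 : HasFDerivAt (fun y : E n => ‖y‖ ^ 2) (2 • (innerSL ℝ x)) x :=
    (hasStrictFDerivAt_norm_sq x).hasFDerivAt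
  have h2 : DifferentiableAt ℝ (fun y : E n => ‖y‖) x :=
    (contDiffAt_norm ℝ hx (n := 1)).differentiableAt one_ne_zero
  have h3 := h2.hasFDerivAt.pow 2
  have h4 := congrArg (fun L => L (basisVec j)) (h1.unique h3)
  have hpos : 0 < ‖x‖ := norm_pos_iff.2 hx
  have h5 : fderiv ℝ (fun y : E n => ‖y‖) x (basisVec j) = x j / ‖x‖ := by
    simp only [basisVec, _root_.smul_apply, innerSL_apply_apply,
      EuclideanSpace.inner_single_right] at h4
    simp at h4
    field_simp
    simp only [basisVec]
    linarith
  have := (hf.comp_hasFDerivAt x h2.hasFDerivAt).fderiv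
  rw [Function.comp_def] at this
  simp only [pd]
  rw [this, _root_.smul_apply, h5, smul_eq_mul]

theorem pd_coord (k : Fin n) : pd j (fun y : E n => y k) x = if k = j then 1 else 0 := by
  have := (proj (𝕜 := ℝ) k : E n →L[ℝ] ℝ).hasFDerivAt (x := x)
  have h2 : pd j (fun y : E n => y k) x = (proj (𝕜 := ℝ) k : E n →L[ℝ] ℝ) (basisVec j) := by
    simp only [pd]
    rw [← this.fderiv]; rfl
  rw [h2]
  simp [basisVec]

theorem cd_mul_conj {A : E n → E n} {f g : E n → ℂ} (hf : DifferentiableAt ℝ f x)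
    (hg : DifferentiableAt ℝ g x) :
    pd j (fun y => f y * (starRingEnd ℂ) (g y)) x =
      cd A j f x * (starRingEnd ℂ) (g x) + f x * (starRingEnd ℂ) (cd A j g x) := by
  have hc : DifferentiableAt ℝ (fun y => (starRingEnd ℂ) (g y)) x :=
    conjCLE.differentiableAt.comp x hg
  rw [pd_mul hf hc, pd_conj hg]
  simp only [cd, map_add, map_mul, conj_I, conj_ofReal]
  ring

end Pointwise

theorem differentiableAt_component {A : E n → E n} (hA : ContDiffOn ℝ 1 A {0}ᶜ) {x : E n}
    (hx : x ≠ 0) (l : Fin n) : DifferentiableAt ℝ (fun y => A y l) x :=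
  ((contDiffOn_component hA l).contDiffAt (isOpen_compl_singleton.mem_nhds hx)).differentiableAt
    one_ne_zero

theorem cd_cd {A : E n → E n} (hA : ContDiffOn ℝ 1 A {0}ᶜ) {f : E n → ℂ} (hf : ContDiff ℝ 2 f)
    (i l : Fin n) {x : E n} (hx : x ≠ 0) : cd A i (cd A l f) x = pd i (pd l f) x +
      I * ((pd i (fun y => A y l) x : ℝ) : ℂ) * f x + I * (A x l) * pd i f x +
      I * (A x i) * pd l f x - (A x i) * (A x l) * f x := by
  have hd : DifferentiableAt ℝ (pd l f) x :=
    ((hf.fderiv_right (m := 1) (by norm_num)).clm_apply contDiff_const).differentiable one_ne_zero x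
  have hAl := differentiableAt_component hA hx l
  have hAC : DifferentiableAt ℝ (fun y => ((A y l : ℝ) : ℂ)) x :=
    ofRealCLM.differentiableAt.comp x hAl
  have hfd : DifferentiableAt ℝ f x := hf.differentiable two_ne_zero x
  have e : cd A l f = fun y => pd l f y + I * ((A y l : ℂ) * f y) := by
    ext y; simp [cd, mul_assoc]
  have hp : DifferentiableAt ℝ (fun y => (A y l : ℂ) * f y) x := hAC.mul hfd
  conv_lhs => rw [cd]
  rw [e, pd_add hd (hp.const_mul _), pd_const_mul _ hp, pd_mul hAC hfd, pd_ofReal hAl]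
  linear_combination ((A x i : ℂ) * (A x l : ℂ) * f x) * I_mul_I

/-- `[D_j, D_k] = i F_{jk}`. -/
theorem cd_comm {A : E n → E n} (hA : ContDiffOn ℝ 1 A {0}ᶜ) {f : E n → ℂ}
    (hf : ContDiff ℝ 2 f) (j k : Fin n) {x : E n} (hx : x ≠ 0) :
    cd A j (cd A k f) x = cd A k (cd A j f) x + I * (magneticField A x j k : ℂ) * f x := by
  have hpdA : ∀ i l, pd i (fun y => A y l) x = (fderiv ℝ A x (basisVec i)) l := fun i l =>
    pd_clm (proj (𝕜 := ℝ) l : E n →L[ℝ] ℝ)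
      ((hA.contDiffAt (isOpen_compl_singleton.mem_nhds hx)).differentiableAt one_ne_zero)
  have hsymm : pd j (pd k f) x = pd k (pd j f) x := by
    have hs := (hf.contDiffAt (x := x)).isSymmSndFDerivAt (by simp)
    have hdf : DifferentiableAt ℝ (fderiv ℝ f) x :=
      (hf.fderiv_right (m := 1) (by norm_num)).differentiable one_ne_zero x
    have e : ∀ i l, pd i (pd l f) x = fderiv ℝ (fderiv ℝ f) x (basisVec i) (basisVec l) := by
      intro i l
      have e2 : pd l f = fun y => fderiv ℝ f y (basisVec l) := rfl
      rw [pd, e2, fderiv_clm_apply hdf (differentiableAt_const _)]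
      simp
    rw [e, e, hs.eq]
  rw [cd_cd hA hf j k hx, cd_cd hA hf k j hx, hsymm, hpdA, hpdA, magneticField]
  push_cast
  ring

end

section

/-! ### Multiplication operators and continuity of integrals on `L²` -/

section Lp

set_option linter.unusedSectionVars false

variable {V W : Type*} [NormedAddCommGroup V] [InnerProductSpace ℂ V]
  [NormedAddCommGroup W] [InnerProductSpace ℂ W]

theorem memLp_field {M : E n → V →ₗ[ℂ] W} (hM : ∀ f : E n → V, AEStronglyMeasurable f volume →
      AEStronglyMeasurable (fun x => M x (f x)) volume)
    {C : ℝ} (hC : ∀ x v, ‖M x v‖ ≤ C * ‖v‖) (f : Lp V 2 (volume : Measure (E n))) :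
    MemLp (fun x => M x (f x)) 2 volume :=
  (Lp.memLp f).of_le_mul (hM _ (Lp.memLp f).1) (ae_of_all _ fun x => hC x (f x))

/-- The operator `f ↦ M(x) f(x)` on `L²`, for a bounded measurable field `M` of linear maps. -/
def fieldCLM (M : E n → V →ₗ[ℂ] W) (hM : ∀ f : E n → V, AEStronglyMeasurable f volume →
      AEStronglyMeasurable (fun x => M x (f x)) volume)
    (C : ℝ) (hC : ∀ x v, ‖M x v‖ ≤ C * ‖v‖) :
    Lp V 2 (volume : Measure (E n)) →L[ℂ] Lp W 2 (volume : Measure (E n)) :=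
  LinearMap.mkContinuous
    { toFun := fun f => (memLp_field hM hC f).toLp _
      map_add' := fun f g => by
        rw [← MemLp.toLp_add]
        apply MemLp.toLp_congr
        filter_upwards [Lp.coeFn_add f g] with x hx
        simp only [hx, Pi.add_apply, map_add]
      map_smul' := fun c f => by
        rw [RingHom.id_apply, ← MemLp.toLp_const_smul]
        apply MemLp.toLp_congr
        filter_upwards [Lp.coeFn_smul c f] with x hx
        simp only [hx, Pi.smul_apply, map_smul] }
    C fun f => by
      refine Lp.norm_le_mul_norm_of_ae_le_mul ?_
      have h := (memLp_field hM hC f).coeFn_toLp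
      exact h.mono fun x hx => (congrArg norm hx).trans_le (hC x (f x))

theorem fieldCLM_ae (M : E n → V →ₗ[ℂ] W) (hM) (C : ℝ) (hC) (f : Lp V 2 (volume : Measure (E n))) :
    fieldCLM M hM C hC f =ᵐ[volume] fun x => M x (f x) :=
  (memLp_field hM hC f).coeFn_toLp

/-- Multiplication by a bounded measurable real function. -/
def weightCLM (m : E n → ℝ) (hm : AEStronglyMeasurable m volume) (C : ℝ) (hC : ∀ x, |m x| ≤ C) :
    Lp V 2 (volume : Measure (E n)) →L[ℂ] Lp V 2 (volume : Measure (E n)) :=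
  fieldCLM (fun x => (m x : ℂ) • LinearMap.id)
    (fun f hf => (Complex.continuous_ofReal.comp_aestronglyMeasurable hm).smul hf) C
    fun x v => by
      simp only [LinearMap.smul_apply, LinearMap.id_apply, norm_smul, norm_real]
      exact mul_le_mul_of_nonneg_right (hC x) (norm_nonneg v)

theorem weightCLM_ae (m : E n → ℝ) (hm) (C : ℝ) (hC) (f : Lp V 2 (volume : Measure (E n))) :
    weightCLM m hm C hC f =ᵐ[volume] fun x => (m x : ℂ) • f x :=
  fieldCLM_ae _ _ _ _ _

theorem re_inner_weightCLM (m : E n → ℝ) (hm) (C : ℝ) (hC) (f g : Lp V 2 (volume : Measure (E n))) :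
    (⟪f, weightCLM m hm C hC g⟫_ℂ).re = ∫ x, m x * (⟪f x, g x⟫_ℂ).re := by
  have h := L2.integrable_inner (𝕜 := ℂ) f (weightCLM m hm C hC g)
  rw [L2.inner_def]
  have e := (reCLM.integral_comp_comm h).symm
  simp only [Complex.reCLM_apply] at e
  rw [e]
  refine integral_congr_ae ?_
  filter_upwards [weightCLM_ae m hm C hC g] with x hx
  simp only [hx, inner_smul_right, re_ofReal_mul]

theorem integrable_weight_inner {m : E n → ℝ} (hm : AEStronglyMeasurable m volume) {C : ℝ}
    (hC : ∀ x, |m x| ≤ C) (f g : Lp V 2 (volume : Measure (E n))) :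
    Integrable fun x => m x * (⟪f x, g x⟫_ℂ).re := by
  have h := (L2.integrable_inner (𝕜 := ℂ) f g).re
  exact h.bdd_mul (c := C) hm (ae_of_all _ hC)

theorem tendsto_weight_inner {ι : Type*} {l : Filter ι} {m : E n → ℝ}
    (hm : AEStronglyMeasurable m volume) {C : ℝ} (hC : ∀ x, |m x| ≤ C)
    {f g : ι → Lp V 2 (volume : Measure (E n))} {f0 g0 : Lp V 2 (volume : Measure (E n))}
    (hf : Tendsto f l (𝓝 f0)) (hg : Tendsto g l (𝓝 g0)) :
    Tendsto (fun i => ∫ x, m x * (⟪f i x, g i x⟫_ℂ).re) l (𝓝 (∫ x, m x * (⟪f0 x, g0 x⟫_ℂ).re)) := by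
  simp only [← re_inner_weightCLM m hm C hC]
  exact (continuous_re.tendsto _).comp
    (hf.inner (((weightCLM m hm C hC).continuous.tendsto _).comp hg))

theorem integral_norm_sq_eq (f : Lp V 2 (volume : Measure (E n))) : ∫ x, ‖f x‖ ^ 2 = ‖f‖ ^ 2 := by
  have := re_inner_weightCLM (fun _ => 1) aestronglyMeasurable_const 1 (by simp) f f
  have e : weightCLM (V := V) (n := n) (fun _ => 1) aestronglyMeasurable_const 1 (by simp) f = f := by
    apply Lp.ext
    filter_upwards [weightCLM_ae (V := V) (n := n) (fun _ => 1) aestronglyMeasurable_const 1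
      (by simp) f] with x hx
    rw [hx]; simp
  rw [e] at this
  have h2 : (⟪f, f⟫_ℂ).re = ‖f‖ ^ 2 := inner_self_eq_norm_sq (𝕜 := ℂ) f
  rw [← h2, this]
  refine integral_congr_ae (ae_of_all _ fun x => ?_)
  have h3 : (⟪f x, f x⟫_ℂ).re = ‖f x‖ ^ 2 := inner_self_eq_norm_sq (𝕜 := ℂ) (f x)
  simp only [h3, one_mul]

theorem integrable_norm_sq (f : Lp V 2 (volume : Measure (E n))) :
    Integrable fun x => ‖f x‖ ^ 2 := (Lp.memLp f).integrable_norm_pow two_ne_zero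

theorem lintegral_enorm_sq (f : Lp V 2 (volume : Measure (E n))) :
    ∫⁻ x, ‖f x‖ₑ ^ 2 = ofReal (‖f‖ ^ 2) := by
  rw [← integral_norm_sq_eq, ofReal_integral_eq_lintegral_ofReal (integrable_norm_sq f)
    (ae_of_all _ fun x => by positivity)]
  refine lintegral_congr fun x => ?_
  rw [ofReal_pow (norm_nonneg _), ofReal_norm]

/-- Integral functionals with a nonnegative integrand that is lower semicontinuous in the value of
the function are lower semicontinuous on `L²`. -/
theorem lowerSemicontinuous_lintegral_Lp {γ : E n → V → ℝ≥0∞} (hγ : ∀ x, LowerSemicontinuous (γ x))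
    (hm : ∀ f : E n → V, AEStronglyMeasurable f volume → AEMeasurable (fun x => γ x (f x)) volume) :
    LowerSemicontinuous fun f : Lp V 2 (volume : Measure (E n)) => ∫⁻ x, γ x (f x) := by
  rw [lowerSemicontinuous_iff_isClosed_preimage]
  intro c
  refine IsSeqClosed.isClosed fun f f0 hf hlim => ?_
  obtain ⟨ns, -, hns⟩ := (tendstoInMeasure_of_tendsto_Lp hlim).exists_seq_tendsto_ae
  have h1 : ∫⁻ x, γ x (f0 x) ≤ ∫⁻ x, liminf (fun i => γ x (f (ns i) x)) atTop := by
    refine lintegral_mono_ae ?_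
    filter_upwards [hns] with x hx
    exact ((hγ x).le_liminf _).trans (liminf_le_liminf_of_le hx)
  refine h1.trans ((lintegral_liminf_le' fun i => hm _ (Lp.memLp _).1).trans ?_)
  refine liminf_le_of_le (by isBoundedDefault) fun b hb => ?_
  obtain ⟨i, hi⟩ := hb.exists
  exact hi.trans (hf (ns i))

end Lp

end

section

/-! ### Radial and tangential parts -/

/-- The radial component `(x/|x|) · w`. -/
def radial (x : E n) (w : CVec n) : ℂ := ∑ j, ((x j / ‖x‖ : ℝ) : ℂ) * w j

theorem sum_sq_coord (x : E n) : ∑ j, x j ^ 2 = ‖x‖ ^ 2 := by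
  rw [norm_sq_eq]; simp

theorem sum_dir_sq {x : E n} (hx : x ≠ 0) : ∑ j, (x j / ‖x‖) ^ 2 = 1 := by
  simp_rw [div_pow, ← Finset.sum_div, sum_sq_coord]
  exact div_self (pow_ne_zero 2 (norm_ne_zero_iff.2 hx))

theorem radial_add (x : E n) (v w : CVec n) : radial x (v + w) = radial x v + radial x w := by
  simp [radial, mul_add, sum_add_distrib]

theorem radial_smul (x : E n) (c : ℂ) (w : CVec n) : radial x (c • w) = c * radial x w := by
  simp only [radial, PiLp.smul_apply, smul_eq_mul, mul_sum]
  exact sum_congr rfl fun j _ => by ring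

theorem norm_sq_eq_radial_add {x : E n} (hx : x ≠ 0) (w : CVec n) :
    ‖w‖ ^ 2 = ‖radial x w‖ ^ 2 + ‖tangential x w‖ ^ 2 := by
  have key : ∀ z : ℂ, ‖z‖ ^ 2 = (z * (starRingEnd ℂ) z).re := fun z => by
    rw [mul_conj, Complex.ofReal_re, normSq_eq_norm_sq]
  rw [norm_sq_eq, norm_sq_eq]
  set ρ := radial x w with hρ
  have h1 : ∀ k, tangential x w k = w k - ((x k / ‖x‖ : ℝ) : ℂ) * ρ := fun k => rfl
  have h2 : ∀ k, ‖tangential x w k‖ ^ 2 = ‖w k‖ ^ 2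
      - 2 * ((((x k / ‖x‖ : ℝ) : ℂ) * w k) * (starRingEnd ℂ) ρ).re
      + (x k / ‖x‖) ^ 2 * ‖ρ‖ ^ 2 := by
    intro k
    rw [h1, key, key (w k), key ρ]
    simp only [map_sub, map_mul, conj_ofReal]
    simp only [mul_re, sub_re, sub_im, mul_im, Complex.ofReal_re,
      Complex.ofReal_im, conj_re, conj_im]
    ring
  simp_rw [h2, sum_add_distrib, sum_sub_distrib, ← sum_mul, ← mul_sum, sum_dir_sq hx]
  have h3 : ∑ k, ((((x k / ‖x‖ : ℝ) : ℂ) * w k) * (starRingEnd ℂ) ρ).re = ‖ρ‖ ^ 2 := by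
    rw [← re_sum, ← sum_mul, key]
    rfl
  rw [h3]; ring

theorem radial_zero_left (w : CVec n) : radial 0 w = 0 := by simp [radial]

theorem norm_radial_le (x : E n) (w : CVec n) : ‖radial x w‖ ≤ ‖w‖ := by
  rcases eq_or_ne x 0 with rfl | hx
  · rw [radial_zero_left, norm_zero]; exact norm_nonneg w
  · have := norm_sq_eq_radial_add hx w
    exact pow_le_pow_iff_left₀ (norm_nonneg _) (norm_nonneg _) two_ne_zero |>.1 (by nlinarith [sq_nonneg ‖tangential x w‖])

theorem norm_tangential_le (x : E n) (w : CVec n) : ‖tangential x w‖ ≤ ‖w‖ := by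
  rcases eq_or_ne x 0 with rfl | hx
  · refine le_of_eq (congrArg norm ?_)
    ext k; simp [tangential]
  · have := norm_sq_eq_radial_add hx w
    exact pow_le_pow_iff_left₀ (norm_nonneg _) (norm_nonneg _) two_ne_zero |>.1 (by nlinarith [sq_nonneg ‖radial x w‖])

theorem aestronglyMeasurable_component {f : E n → CVec n} (hf : AEStronglyMeasurable f volume)
    (j : Fin n) : AEStronglyMeasurable (fun x => f x j) volume :=
  (proj (𝕜 := ℂ) j : CVec n →L[ℂ] ℂ).continuous.comp_aestronglyMeasurable hf

theorem measurable_dir (j : Fin n) : Measurable fun x : E n => x j / ‖x‖ :=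
  ((proj (𝕜 := ℝ) j : E n →L[ℝ] ℝ).continuous.measurable).div measurable_norm

theorem aestronglyMeasurable_radial {f : E n → CVec n} (hf : AEStronglyMeasurable f volume) :
    AEStronglyMeasurable (fun x => radial x (f x)) volume := by
  unfold radial
  refine Finset.aestronglyMeasurable_fun_sum _ fun j _ => ?_
  exact (Complex.continuous_ofReal.comp_aestronglyMeasurable
    (measurable_dir j).aestronglyMeasurable).mul (aestronglyMeasurable_component hf j)

theorem aestronglyMeasurable_toLp {f : Fin n → E n → ℂ}
    (hf : ∀ j, AEStronglyMeasurable (f j) volume) :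
    AEStronglyMeasurable (fun x => (WithLp.toLp 2 fun j => f j x : CVec n)) volume :=
  (PiLp.continuous_toLp 2 (fun _ : Fin n => ℂ)).comp_aestronglyMeasurable
    (aemeasurable_pi_lambda _ fun j => (hf j).aemeasurable).aestronglyMeasurable

theorem aestronglyMeasurable_tangential {f : E n → CVec n} (hf : AEStronglyMeasurable f volume) :
    AEStronglyMeasurable (fun x => tangential x (f x)) volume :=
  aestronglyMeasurable_toLp fun j => (aestronglyMeasurable_component hf j).sub
    ((Complex.continuous_ofReal.comp_aestronglyMeasurable
      (measurable_dir j).aestronglyMeasurable).mul (aestronglyMeasurable_radial hf))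

/-- The radial component as an operator on `L²`. -/
def radialCLM : L2Vec n →L[ℂ] L2 n :=
  fieldCLM (fun x => { toFun := radial x, map_add' := radial_add x, map_smul' := radial_smul x })
    (fun _ hf => aestronglyMeasurable_radial hf) 1 fun x v => by
      rw [one_mul]; exact norm_radial_le x v

theorem radialCLM_ae (w : L2Vec n) : radialCLM w =ᵐ[volume] fun x => radial x (w x) :=
  fieldCLM_ae _ _ _ _ _

theorem tangential_add (x : E n) (v w : CVec n) :
    tangential x (v + w) = tangential x v + tangential x w := by
  ext k
  change _ - _ * radial x _ = (_ - _ * radial x _) + (_ - _ * radial x _)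
  rw [radial_add, PiLp.add_apply]; ring

theorem tangential_smul (x : E n) (c : ℂ) (w : CVec n) :
    tangential x (c • w) = c • tangential x w := by
  ext k
  change _ - _ * radial x _ = c * (_ - _ * radial x _)
  rw [radial_smul, PiLp.smul_apply, smul_eq_mul]; ring

/-- The tangential part as an operator on `L²`. -/
def tangentialCLM : L2Vec n →L[ℂ] L2Vec n :=
  fieldCLM (fun x => { toFun := tangential x, map_add' := tangential_add x,
                       map_smul' := tangential_smul x })
    (fun _ hf => aestronglyMeasurable_tangential hf) 1 fun x v => by
      rw [one_mul]; exact norm_tangential_le x v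

theorem tangentialCLM_ae (w : L2Vec n) : tangentialCLM w =ᵐ[volume] fun x => tangential x (w x) :=
  fieldCLM_ae _ _ _ _ _

/-! ### Test functions in the graph of the covariant gradient -/

section Test

variable {A : E n → E n}

theorem OffOrigin.memLp {m : WithTop ℕ∞} {f : E n → ℂ} (hf : OffOrigin m f) : MemLp f 2 volume :=
  hf.contDiff.continuous.memLp_of_hasCompactSupport hf.compact

theorem OffOrigin.memLp_covGradFun (hA : ContDiffOn ℝ 1 A {0}ᶜ) {f : E n → ℂ}
    (hf : OffOrigin 2 f) : MemLp (covGradFun A f) 2 volume := by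
  have hc : Continuous (covGradFun A f) := (PiLp.continuous_toLp 2 (fun _ : Fin n => ℂ)).comp
      (continuous_pi fun j => (hf.covDeriv hA j).contDiff.continuous)
  refine hc.memLp_of_hasCompactSupport (HasCompactSupport.of_support_subset_isCompact hf.compact
    fun x hx => ?_)
  by_contra hne
  apply hx
  ext j
  simp only [covGradFun]
  rw [fderiv_of_notMem_tsupport ℝ hne, image_eq_zero_of_notMem_tsupport hne]
  simp

/-- The pair `(φ, ∇_A φ)`. -/
def testPair (hA : ContDiffOn ℝ 1 A {0}ᶜ) {f : E n → ℂ} (hf : OffOrigin 2 f) : PairSpace n :=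
  WithLp.toLp 2 (hf.memLp.toLp f, (hf.memLp_covGradFun hA).toLp _)

theorem testPair_fst_ae (hA : ContDiffOn ℝ 1 A {0}ᶜ) {f : E n → ℂ} (hf : OffOrigin 2 f) :
    (testPair hA hf).fst =ᵐ[volume] f := hf.memLp.coeFn_toLp

theorem testPair_snd_ae (hA : ContDiffOn ℝ 1 A {0}ᶜ) {f : E n → ℂ} (hf : OffOrigin 2 f) :
    (testPair hA hf).snd =ᵐ[volume] covGradFun A f := (hf.memLp_covGradFun hA).coeFn_toLp

theorem testPair_mem (hA : ContDiffOn ℝ 1 A {0}ᶜ) {f : E n → ℂ} (hf : OffOrigin ∞ f)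
    (hf2 : OffOrigin 2 f) : testPair hA hf2 ∈ testPairs A :=
  ⟨f, hf.contDiff, hf.compact, hf.zero_notMem, testPair_fst_ae hA hf2, testPair_snd_ae hA hf2⟩

theorem testPair_mem_graph (hA : ContDiffOn ℝ 1 A {0}ᶜ) {f : E n → ℂ} (hf : OffOrigin ∞ f)
    (hf2 : OffOrigin 2 f) : testPair hA hf2 ∈ covGradGraph A :=
  Submodule.le_topologicalClosure _ (Submodule.subset_span (testPair_mem hA hf hf2))

theorem OffOrigin.const_mul {m : WithTop ℕ∞} {f : E n → ℂ} (hf : OffOrigin m f) (c : ℂ) :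
    OffOrigin m fun x => c * f x :=
  hf.mono_support (fun _ _ _ => contDiffAt_const.mul hf.contDiff.contDiffAt)
    fun x hx => subset_tsupport _ fun h => hx (by simp [h])

theorem covGradFun_add {f g : E n → ℂ} {x : E n} (hf : DifferentiableAt ℝ f x)
    (hg : DifferentiableAt ℝ g x) :
    covGradFun A (fun y => f y + g y) x = covGradFun A f x + covGradFun A g x := by
  ext j
  change cd A j _ x = cd A j f x + cd A j g x
  simp only [cd]
  rw [pd_add hf hg]; ring

theorem covGradFun_const_mul {f : E n → ℂ} {x : E n} (c : ℂ) (hf : DifferentiableAt ℝ f x) :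
    covGradFun A (fun y => c * f y) x = c • covGradFun A f x := by
  ext j
  change cd A j _ x = c * cd A j f x
  simp only [cd]
  rw [pd_const_mul c hf]; ring

theorem span_testPairs : (Submodule.span ℂ (testPairs A) : Set (PairSpace n)) = testPairs A := by
  refine Subset.antisymm (fun p hp => ?_) Submodule.subset_span
  refine Submodule.span_induction (p := fun p _ => p ∈ testPairs A) (fun _ h => h) ?_ ?_ ?_ hp
  · refine ⟨fun _ => 0, contDiff_const, HasCompactSupport.zero, by simp [tsupport],
      Lp.coeFn_zero _ _ _, ?_⟩
    filter_upwards [Lp.coeFn_zero (CVec n) 2 (volume : Measure (E n))] with x hx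
    refine hx.trans ?_
    ext j
    simp [covGradFun]
  · rintro p q - - ⟨f, hf, hfc, hf0, hf1, hf2⟩ ⟨g, hg, hgc, hg0, hg1, hg2⟩
    have h := (OffOrigin.mk hf hfc hf0).add (OffOrigin.mk hg hgc hg0)
    refine ⟨_, h.contDiff, h.compact, h.zero_notMem, ?_, ?_⟩
    · filter_upwards [Lp.coeFn_add p.fst q.fst, hf1, hg1] with x h1 h2 h3
      exact h1.trans (by rw [Pi.add_apply, h2, h3])
    · filter_upwards [Lp.coeFn_add p.snd q.snd, hf2, hg2] with x h1 h2 h3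
      refine h1.trans ?_
      rw [Pi.add_apply, h2, h3, covGradFun_add (hf.differentiable (by simp) x)
        (hg.differentiable (by simp) x)]
  · rintro c p - ⟨f, hf, hfc, hf0, hf1, hf2⟩
    have h := (OffOrigin.mk hf hfc hf0).const_mul c
    refine ⟨_, h.contDiff, h.compact, h.zero_notMem, ?_, ?_⟩
    · filter_upwards [Lp.coeFn_smul c p.fst, hf1] with x h1 h2
      exact h1.trans (by rw [Pi.smul_apply, h2, smul_eq_mul])
    · filter_upwards [Lp.coeFn_smul c p.snd, hf2] with x h1 h2
      refine h1.trans ?_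
      rw [Pi.smul_apply, h2, covGradFun_const_mul c (hf.differentiable (by simp) x)]

/-- Closed conditions that hold for the pairs `(φ, ∇_A φ)` hold on the graph of `∇_A`. -/
theorem covGradGraph_induction (hA : ContDiffOn ℝ 1 A {0}ᶜ) {S : Set (PairSpace n)}
    (hS : IsClosed S) (h : ∀ (f : E n → ℂ) (_ : OffOrigin ∞ f) (hf2 : OffOrigin 2 f),
      testPair hA hf2 ∈ S) : (covGradGraph A : Set (PairSpace n)) ⊆ S := by
  rw [covGradGraph, Submodule.topologicalClosure_coe, span_testPairs]
  refine closure_minimal ?_ hS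
  rintro p ⟨f, hf, hfc, hf0, hf1, hf2⟩
  have hf' : OffOrigin ∞ f := ⟨hf, hfc, hf0⟩
  have h2 : OffOrigin 2 f := hf'.of_le (by norm_cast)
  convert h f hf' h2
  refine WithLp.ofLp_injective 2 (Prod.ext ?_ ?_)
  · exact Lp.ext (hf1.trans (testPair_fst_ae hA h2).symm)
  · exact Lp.ext (hf2.trans (testPair_snd_ae hA h2).symm)

end Test

end

section

variable {A : E n → E n}

theorem covGradGraph_isClosed (A : E n → E n) : IsClosed (covGradGraph A : Set (PairSpace n)) :=
  Submodule.isClosed_topologicalClosure _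

theorem covGradGraph_ind' (hA : ContDiffOn ℝ 1 A {0}ᶜ) {S : Set (covGradGraph A)}
    (hS : IsClosed S) (h : ∀ (f : E n → ℂ) (hf : OffOrigin ∞ f) (hf2 : OffOrigin 2 f),
      (⟨testPair hA hf2, testPair_mem_graph hA hf hf2⟩ : covGradGraph A) ∈ S)
    (p : covGradGraph A) : p ∈ S := by
  have hc : IsClosed (Subtype.val '' S) :=
    (covGradGraph_isClosed A).isClosedEmbedding_subtypeVal.isClosedMap _ hS
  obtain ⟨q, hq, hqp⟩ := covGradGraph_induction hA hc (fun f hf hf2 => ⟨_, h f hf hf2, rfl⟩) p.2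
  rwa [← Subtype.ext hqp]

/-! ### Radial integration by parts and Hardy's inequality -/

theorem contDiffOn_one_of_hasDerivAt {h h' : ℝ → ℝ} {U : Set ℝ} (hU : IsOpen U)
    (hd : ∀ r ∈ U, HasDerivAt h (h' r) r) (hc : ContinuousOn h' U) : ContDiffOn ℝ 1 h U := by
  rw [show (1 : WithTop ℕ∞) = 0 + 1 from (zero_add 1).symm, contDiffOn_succ_iff_deriv_of_isOpen hU]
  refine ⟨fun r hr => (hd r hr).differentiableAt.differentiableWithinAt, by simp, ?_⟩
  rw [contDiffOn_zero]
  exact hc.congr fun r hr => (hd r hr).deriv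

theorem contDiffOn_norm_comp {m : WithTop ℕ∞} {h : ℝ → ℝ} (hh : ContDiffOn ℝ m h (Ioi 0)) :
    ContDiffOn ℝ m (fun x : E n => h ‖x‖) {0}ᶜ :=
  hh.comp (fun _ hx => (contDiffAt_norm ℝ hx).contDiffWithinAt) fun _ hx => norm_pos_iff.2 hx

theorem contDiffOn_dir {m : WithTop ℕ∞} (j : Fin n) :
    ContDiffOn ℝ m (fun x : E n => x j / ‖x‖) {0}ᶜ := by
  have h1 : ContDiffOn ℝ m (fun x : E n => x j) {0}ᶜ :=
    (proj (𝕜 := ℝ) j : E n →L[ℝ] ℝ).contDiff.contDiffOn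
  exact h1.div (fun x hx => (contDiffAt_norm ℝ hx).contDiffWithinAt) fun x hx => norm_ne_zero_iff.2 hx

theorem pd_norm_sq (A : E n → E n) {f : E n → ℂ} {x : E n} (hf : DifferentiableAt ℝ f x) (j : Fin n) :
    pd j (fun y => ‖f y‖ ^ 2) x = 2 * (⟪f x, cd A j f x⟫_ℂ).re := by
  have e : (fun y => ‖f y‖ ^ 2) = fun y => (f y * (starRingEnd ℂ) (f y)).re := by
    ext y
    rw [mul_conj, Complex.ofReal_re, normSq_eq_norm_sq]
  have hc : DifferentiableAt ℝ (fun y => (starRingEnd ℂ) (f y)) x :=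
    conjCLE.differentiableAt.comp x hf
  have hm : DifferentiableAt ℝ (fun y => f y * (starRingEnd ℂ) (f y)) x := hf.mul hc
  rw [e, pd_re hm, cd_mul_conj (A := A) hf hf]
  simp only [RCLike.inner_apply, add_re, mul_re, conj_re, conj_im]
  ring

theorem pd_norm_comp_mul_dir {x : E n} (hx : x ≠ 0) {h : ℝ → ℝ} {h' : ℝ} (hd : HasDerivAt h h' ‖x‖)
    (j k : Fin n) :
    pd j (fun y => h ‖y‖ * (y k / ‖y‖)) x =
      (h' - h ‖x‖ / ‖x‖) * (x j / ‖x‖) * (x k / ‖x‖) + if k = j then h ‖x‖ / ‖x‖ else 0 := by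
  have hpos : 0 < ‖x‖ := norm_pos_iff.2 hx
  have hb : HasDerivAt (fun r => h r / r) ((h' * ‖x‖ - h ‖x‖ * 1) / ‖x‖ ^ 2) ‖x‖ :=
    hd.div (hasDerivAt_id _) hpos.ne'
  have hbd : DifferentiableAt ℝ (fun y : E n => h ‖y‖ / ‖y‖) x :=
    hb.differentiableAt.comp x ((contDiffAt_norm ℝ hx (n := 1)).differentiableAt one_ne_zero)
  have hk : DifferentiableAt ℝ (fun y : E n => y k) x :=
    (proj (𝕜 := ℝ) k : E n →L[ℝ] ℝ).differentiableAt
  have e : (fun y : E n => h ‖y‖ * (y k / ‖y‖)) = fun y => h ‖y‖ / ‖y‖ * y k := by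
    ext y; ring
  rw [e, pd_mul hbd hk, pd_norm_comp hx hb, pd_coord]
  split_ifs with hkj
  · field_simp
  · field_simp; ring

theorem ae_ne_zero (hn : 3 ≤ n) : ∀ᵐ x : E n, x ≠ 0 := by
  have : Nonempty (Fin n) := ⟨⟨0, by omega⟩⟩
  exact compl_mem_ae_iff.2 (measure_singleton (μ := (volume : Measure (E n))) (0 : E n))

theorem radial_div (hn : 3 ≤ n) {a a' : ℝ → ℝ} (ha : ∀ r, 0 < r → HasDerivAt a (a' r) r)
    (hc : ContinuousOn a' (Ioi 0)) {k : E n → ℝ} (hk : OffOrigin 1 k) :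
    let F := fun x : E n => (a' ‖x‖ + (n - 1) * a ‖x‖ / ‖x‖) * k x +
      a ‖x‖ * ∑ j, x j / ‖x‖ * pd j k x
    Integrable F ∧ ∫ x, F x = 0 := by
  intro F
  have hX : ∀ j : Fin n, ContDiffOn ℝ 1 (fun y : E n => a ‖y‖ * (y j / ‖y‖)) {0}ᶜ := fun j =>
    (contDiffOn_norm_comp (contDiffOn_one_of_hasDerivAt isOpen_Ioi ha hc)).mul (contDiffOn_dir j)
  obtain ⟨h1, h2⟩ := integral_sum_pd fun j => hk.smul (hX j)
  have e : (fun x => ∑ j, pd j (fun y : E n => (a ‖y‖ * (y j / ‖y‖)) • k y) x) =ᵐ[volume] F := by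
    filter_upwards [ae_ne_zero hn] with x hx
    have hd : ∀ j : Fin n, DifferentiableAt ℝ (fun y : E n => a ‖y‖ * (y j / ‖y‖)) x := fun j =>
      ((hX j).contDiffAt (isOpen_compl_singleton.mem_nhds hx)).differentiableAt one_ne_zero
    have hs : ∀ j, pd j (fun y : E n => (a ‖y‖ * (y j / ‖y‖)) • k y) x =
        ((a' ‖x‖ - a ‖x‖ / ‖x‖) * (x j / ‖x‖) ^ 2 + a ‖x‖ / ‖x‖) * k x +
        a ‖x‖ * (x j / ‖x‖ * pd j k x) := by
      intro j
      simp only [smul_eq_mul]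
      rw [pd_mul (hd j) (hk.contDiff.differentiable one_ne_zero x),
        pd_norm_comp_mul_dir hx (ha _ (norm_pos_iff.2 hx)), if_pos rfl]
      ring
    simp only [hs, sum_add_distrib, ← sum_mul, ← mul_sum, sum_dir_sq hx,
      Finset.sum_const, Finset.card_univ, Fintype.card_fin, nsmul_eq_mul, F]
    ring
  exact ⟨h1.congr e, (integral_congr_ae e).symm.trans h2⟩

theorem OffOrigin.norm_sq {f : E n → ℂ} (hf : OffOrigin 2 f) : OffOrigin 1 fun y => ‖f y‖ ^ 2 := by
  refine (hf.of_le (by norm_num)).mono_support (fun x _ _ => ?_) fun x hx =>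
    subset_tsupport _ fun h => hx (by simp [h])
  exact (hf.contDiff.contDiffAt.of_le (by norm_num)).norm_sq ℝ

/-- `∂_r b`. -/
def radialDeriv (b : E n → ℝ) (x : E n) : ℝ := fderiv ℝ b x (‖x‖⁻¹ • x)

theorem radialDeriv_eq (b : E n → ℝ) (x : E n) : radialDeriv b x = ∑ j, x j / ‖x‖ * pd j b x := by
  have e : ‖x‖⁻¹ • x = ∑ j, (x j / ‖x‖) • basisVec j := by
    ext k
    simp [basisVec, div_eq_inv_mul, Pi.single_apply]
  rw [radialDeriv, e, map_sum]
  simp only [map_smul, smul_eq_mul, pd]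

theorem continuousOn_radialDeriv {b : E n → ℝ} (hb : ContDiffOn ℝ 1 b {0}ᶜ) :
    ContinuousOn (radialDeriv b) {0}ᶜ :=
  (hb.continuousOn_fderiv_of_isOpen isOpen_compl_singleton le_rfl).clm_apply
    ((continuous_norm.continuousOn.inv₀ fun _ hx => norm_ne_zero_iff.2 hx).smul continuousOn_id)

theorem re_inner_radial (x : E n) (z : ℂ) (w : CVec n) :
    (⟪z, radial x w⟫_ℂ).re = ∑ j, x j / ‖x‖ * (⟪z, w j⟫_ℂ).re := by
  rw [radial, inner_sum, re_sum]
  refine sum_congr rfl fun j _ => ?_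
  rw [← smul_eq_mul, inner_smul_right, re_ofReal_mul]

/-- Radial integration by parts for a function of `|f|²`, with a weight. -/
theorem radial_chain_test (hn : 3 ≤ n) {f : E n → ℂ} (hf : OffOrigin 2 f) {a a' : ℝ → ℝ}
    (ha : ∀ r, 0 < r → HasDerivAt a (a' r) r) (hc : ContinuousOn a' (Ioi 0)) {b : E n → ℝ}
    (hb : ContDiffOn ℝ 1 b {0}ᶜ) {γ : ℝ → ℝ} (hγ : Continuous γ) :
    let F := fun x : E n => ((a' ‖x‖ + (n - 1) * a ‖x‖ / ‖x‖) * b x + a ‖x‖ * radialDeriv b x) *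
        (∫ τ in (0 : ℝ)..‖f x‖ ^ 2, γ τ) +
      2 * a ‖x‖ * b x * γ (‖f x‖ ^ 2) * (⟪f x, radial x (covGradFun A f x)⟫_ℂ).re
    Integrable F ∧ ∫ x, F x = 0 := by
  intro F
  set P : ℝ → ℝ := fun s => ∫ τ in (0 : ℝ)..s, γ τ with hP
  have hd : ∀ s, HasDerivAt P (γ s) s := fun s =>
    integral_hasDerivAt_right (hγ.intervalIntegrable _ _)
      (hγ.stronglyMeasurableAtFilter _ _) hγ.continuousAt
  have hPc : ContDiff ℝ 1 P := by
    rw [contDiff_one_iff_deriv, funext fun s => (hd s).deriv]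
    exact ⟨fun s => (hd s).differentiableAt, hγ⟩
  have hk : OffOrigin 1 fun x => P (‖f x‖ ^ 2) := by
    refine hf.norm_sq.mono_support (fun x _ _ =>
      hPc.contDiffAt.comp x hf.norm_sq.contDiff.contDiffAt) fun x hx =>
        subset_tsupport _ fun h => hx ?_
    simp only [h, hP, intervalIntegral.integral_same]
  obtain ⟨h1, h2⟩ := radial_div hn ha hc (hk.smul hb)
  refine (fun e => ⟨h1.congr e, (integral_congr_ae e).symm.trans h2⟩) ?_
  filter_upwards [ae_ne_zero hn] with x hx
  have hfd : DifferentiableAt ℝ (fun y => ‖f y‖ ^ 2) x :=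
    hf.norm_sq.contDiff.differentiable one_ne_zero x
  have hbd : DifferentiableAt ℝ b x :=
    (hb.contDiffAt (isOpen_compl_singleton.mem_nhds hx)).differentiableAt one_ne_zero
  have hp : ∀ j, pd j (fun y => P (‖f y‖ ^ 2)) x =
      γ (‖f x‖ ^ 2) * (2 * (⟪f x, cd A j f x⟫_ℂ).re) := by
    intro j
    have h2 := ((hd (‖f x‖ ^ 2)).comp_hasFDerivAt x hfd.hasFDerivAt).fderiv
    rw [Function.comp_def] at h2
    rw [pd, h2, _root_.smul_apply, smul_eq_mul,
      ← pd_norm_sq A (hf.contDiff.differentiable two_ne_zero x)]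
    rfl
  have hs : ∀ j, x j / ‖x‖ * pd j (fun y => b y * P (‖f y‖ ^ 2)) x =
      x j / ‖x‖ * pd j b x * P (‖f x‖ ^ 2) +
      2 * b x * γ (‖f x‖ ^ 2) * (x j / ‖x‖ * (⟪f x, cd A j f x⟫_ℂ).re) := by
    intro j
    rw [pd_mul hbd (hk.contDiff.differentiable one_ne_zero x), hp]
    ring
  simp only [smul_eq_mul, hs, sum_add_distrib, ← sum_mul, ← mul_sum,
    ← radialDeriv_eq, F, re_inner_radial, covGradFun_apply]
  ring

theorem radial_ibp_test (hn : 3 ≤ n) {f : E n → ℂ} (hf : OffOrigin 2 f)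
    {h h' : ℝ → ℝ} (hd : ∀ r, 0 < r → HasDerivAt h (h' r) r) (hc : ContinuousOn h' (Ioi 0)) :
    let F := fun x : E n => (h' ‖x‖ + (n - 1) * h ‖x‖ / ‖x‖) * ‖f x‖ ^ 2 +
      2 * h ‖x‖ * (⟪f x, radial x (covGradFun A f x)⟫_ℂ).re
    Integrable F ∧ ∫ x, F x = 0 := by
  simpa [radialDeriv] using radial_chain_test (A := A) hn hf hd hc (b := fun _ => 1)
    contDiffOn_const (γ := fun _ => 1) continuous_const

theorem enorm_sq_div_pow {V : Type*} [SeminormedAddCommGroup V] (z : V) {x : E n} (hx : 0 < ‖x‖)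
    (k : ℕ) : ‖z‖ₑ ^ 2 / ‖x‖ₑ ^ k = ofReal (‖z‖ ^ 2 / ‖x‖ ^ k) := by
  rw [ofReal_div_of_pos (by positivity), ofReal_pow (norm_nonneg _),
    ofReal_pow (norm_nonneg _), ofReal_norm, ofReal_norm]

theorem hardy_test (hn : 3 ≤ n) (hA : ContDiffOn ℝ 1 A {0}ᶜ) {f : E n → ℂ} (hf : OffOrigin 2 f) :
    ∫⁻ x, ‖f x‖ₑ ^ 2 / ‖x‖ₑ ^ 2 ≤ 4 * ∫⁻ x, ‖covGradFun A f x‖ₑ ^ 2 := by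
  have hw : ContDiffOn ℝ 0 (fun x : E n => (‖x‖ ^ 2)⁻¹) {0}ᶜ :=
    ((contDiff_norm_sq ℝ).contDiffOn).inv fun x hx => pow_ne_zero 2 (norm_ne_zero_iff.2 hx)
  have hi1 : Integrable fun x : E n => (‖x‖ ^ 2)⁻¹ * ‖f x‖ ^ 2 :=
    ((hf.norm_sq.of_le (k := 0) (by norm_num)).smul hw).integrable
  have hi2 : Integrable fun x : E n => ‖covGradFun A f x‖ ^ 2 :=
    (hf.memLp_covGradFun hA).integrable_norm_pow two_ne_zero
  obtain ⟨hi3, hibp⟩ := radial_ibp_test (A := A) hn hf (h := fun r => r⁻¹)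
    (h' := fun r => -(r ^ 2)⁻¹) (fun r hr => hasDerivAt_inv hr.ne')
    (ContinuousOn.neg (ContinuousOn.inv₀ (by fun_prop) fun r hr => pow_ne_zero 2 (ne_of_gt hr)))
  have hpt : ∀ x : E n, (‖x‖ ^ 2)⁻¹ * ‖f x‖ ^ 2 - 4 * ‖covGradFun A f x‖ ^ 2 ≤
      2 * ((-(‖x‖ ^ 2)⁻¹ + (n - 1) * ‖x‖⁻¹ / ‖x‖) * ‖f x‖ ^ 2 +
      2 * ‖x‖⁻¹ * (⟪f x, radial x (covGradFun A f x)⟫_ℂ).re) := by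
    intro x
    have hn' : (3 : ℝ) ≤ n := by exact_mod_cast hn
    have h1 : |(⟪f x, radial x (covGradFun A f x)⟫_ℂ).re| ≤ ‖f x‖ * ‖covGradFun A f x‖ :=
      (abs_re_le_norm _).trans ((norm_inner_le_norm _ _).trans
        (mul_le_mul_of_nonneg_left (norm_radial_le _ _) (norm_nonneg _)))
    have h3 : 0 ≤ ‖x‖⁻¹ := inv_nonneg.2 (norm_nonneg x)
    rw [← inv_pow, div_eq_mul_inv]
    set y := ‖x‖⁻¹
    have h4 := mul_le_mul_of_nonneg_left (neg_le_of_abs_le h1) h3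
    have h5 : 0 ≤ (n - 3 : ℝ) * (y ^ 2 * ‖f x‖ ^ 2) := mul_nonneg (by linarith) (by positivity)
    nlinarith [sq_nonneg (y * ‖f x‖ - 2 * ‖covGradFun A f x‖)]
  have hfin : ∫ x : E n, (‖x‖ ^ 2)⁻¹ * ‖f x‖ ^ 2 ≤ 4 * ∫ x, ‖covGradFun A f x‖ ^ 2 := by
    have := integral_mono (hi1.sub (hi2.const_mul 4)) (hi3.const_mul 2) hpt
    simp only [Pi.sub_apply] at this
    rw [integral_sub hi1 (hi2.const_mul 4), integral_const_mul, integral_const_mul, hibp] at this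
    linarith
  have e1 : ∫⁻ x, ‖f x‖ₑ ^ 2 / ‖x‖ₑ ^ 2 = ofReal (∫ x : E n, (‖x‖ ^ 2)⁻¹ * ‖f x‖ ^ 2) := by
    rw [ofReal_integral_eq_lintegral_ofReal hi1 (ae_of_all _ fun x => by positivity)]
    refine lintegral_congr_ae ?_
    filter_upwards [ae_ne_zero hn] with x hx
    rw [enorm_sq_div_pow _ (norm_pos_iff.2 hx), div_eq_inv_mul]
  have e2 : ∫⁻ x, ‖covGradFun A f x‖ₑ ^ 2 = ofReal (∫ x, ‖covGradFun A f x‖ ^ 2) := by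
    rw [ofReal_integral_eq_lintegral_ofReal hi2 (ae_of_all _ fun x => by positivity)]
    refine lintegral_congr fun x => ?_
    rw [ofReal_pow (norm_nonneg _), ofReal_norm]
  rw [e1, e2, show (4 : ℝ≥0∞) = ofReal 4 by simp, ← ofReal_mul (by norm_num)]
  exact ofReal_le_ofReal hfin

theorem lowerSemicontinuous_mul_const (c : ℝ≥0∞) : LowerSemicontinuous fun a : ℝ≥0∞ => a * c := by
  rcases eq_or_ne c ⊤ with rfl | hc
  · have : (fun a : ℝ≥0∞ => a * ⊤) = ({0}ᶜ : Set ℝ≥0∞).indicator fun _ => ⊤ := by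
      ext a
      by_cases ha : a = 0
      · simp [ha]
      · simp [ha, ENNReal.mul_top]
    rw [this]
    exact isOpen_compl_singleton.lowerSemicontinuous_indicator zero_le
  · exact (ENNReal.continuous_mul_const hc).lowerSemicontinuous

theorem hardy (hn : 3 ≤ n) (hA : ContDiffOn ℝ 1 A {0}ᶜ) {p : PairSpace n} (hp : p ∈ covGradGraph A) :
    ∫⁻ x, ‖p.fst x‖ₑ ^ 2 / ‖x‖ₑ ^ 2 ≤ 4 * ∫⁻ x, ‖p.snd x‖ₑ ^ 2 := by
  have hl : LowerSemicontinuous fun f : L2 n => ∫⁻ x, ‖f x‖ₑ ^ 2 / ‖x‖ₑ ^ 2 := by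
    refine lowerSemicontinuous_lintegral_Lp (V := ℂ) (γ := fun x z => ‖z‖ₑ ^ 2 / ‖x‖ₑ ^ 2)
      (fun x => ?_) fun f hf => ?_
    · exact LowerSemicontinuous.comp (lowerSemicontinuous_mul_const (‖x‖ₑ ^ 2)⁻¹)
        (g := fun z : ℂ => ‖z‖ₑ ^ 2) (by fun_prop)
    · exact (hf.enorm.pow_const 2).div (measurable_enorm.pow_const 2).aemeasurable
  have hcl : IsClosed {p : PairSpace n | ∫⁻ x, ‖p.fst x‖ₑ ^ 2 / ‖x‖ₑ ^ 2 ≤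
      4 * ofReal (‖p.snd‖ ^ 2)} := by
    have hcont : Continuous fun p : PairSpace n => (p.fst, 4 * ofReal (‖p.snd‖ ^ 2)) := by
      refine Continuous.prodMk (WithLp.fstL 2 ℂ (L2 n) (L2Vec n)).continuous ?_
      refine ENNReal.continuous_const_mul (by simp) |>.comp (continuous_ofReal.comp ?_)
      exact ((WithLp.sndL 2 ℂ (L2 n) (L2Vec n)).continuous.norm.pow 2)
    exact hl.isClosed_epigraph.preimage hcont
  have := covGradGraph_induction hA hcl (fun f hf hf2 => ?_) hp
  · rw [lintegral_enorm_sq]; exact this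
  · simp only [mem_ofPred_eq]
    rw [← lintegral_enorm_sq]
    have e1 : ∫⁻ x, ‖(testPair hA hf2).fst x‖ₑ ^ 2 / ‖x‖ₑ ^ 2 = ∫⁻ x, ‖f x‖ₑ ^ 2 / ‖x‖ₑ ^ 2 :=
      lintegral_congr_ae ((testPair_fst_ae hA hf2).mono fun x hx => by simp only [hx])
    have e2 : ∫⁻ x, ‖(testPair hA hf2).snd x‖ₑ ^ 2 = ∫⁻ x, ‖covGradFun A f x‖ₑ ^ 2 :=
      lintegral_congr_ae ((testPair_snd_ae hA hf2).mono fun x hx => by simp only [hx])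
    rw [e1, e2]
    exact hardy_test hn hA hf2

end

section

variable {A : E n → E n}

section Hardy

theorem enorm_inv_norm_mul_sq {x : E n} (hx : x ≠ 0) (z : ℂ) :
    ‖((‖x‖⁻¹ : ℝ) : ℂ) * z‖ₑ ^ 2 = ‖z‖ₑ ^ 2 / ‖x‖ₑ ^ 2 := by
  rw [enorm_mul, ← ofReal_norm, norm_real, norm_inv, norm_norm,
    ofReal_inv_of_pos (norm_pos_iff.2 hx), ofReal_norm, mul_pow, ← ENNReal.inv_pow,
    ENNReal.div_eq_inv_mul]

theorem memLp_hardy (hn : 3 ≤ n) (hA : ContDiffOn ℝ 1 A {0}ᶜ) (p : covGradGraph A) :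
    MemLp (fun x => ((‖x‖⁻¹ : ℝ) : ℂ) * p.1.fst x) 2 volume := by
  refine ⟨(Measurable.aestronglyMeasurable (by fun_prop)).mul (Lp.memLp p.1.fst).1, ?_⟩
  rw [eLpNorm_lt_top_iff_lintegral_rpow_enorm_lt_top two_ne_zero ofNat_ne_top]
  have hlt : 4 * ∫⁻ x, ‖p.1.snd x‖ₑ ^ 2 < ⊤ := by
    rw [lintegral_enorm_sq]
    exact ENNReal.mul_lt_top (by simp) ofReal_lt_top
  refine lt_of_le_of_lt (le_trans (le_of_eq (lintegral_congr_ae ?_)) (hardy hn hA p.2)) hlt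
  filter_upwards [ae_ne_zero hn] with x hx
  simp only [ENNReal.toReal_ofNat, ENNReal.rpow_ofNat, enorm_inv_norm_mul_sq hx]

theorem norm_hardy_le (hn : 3 ≤ n) (hA : ContDiffOn ℝ 1 A {0}ᶜ) (p : covGradGraph A) :
    ‖(memLp_hardy hn hA p).toLp _‖ ≤ 2 * ‖p.1.snd‖ := by
  have h := hardy hn hA p.2
  have e : ∫⁻ x, ‖p.1.fst x‖ₑ ^ 2 / ‖x‖ₑ ^ 2 = ∫⁻ x, ‖(memLp_hardy hn hA p).toLp _ x‖ₑ ^ 2 := by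
    refine lintegral_congr_ae ?_
    filter_upwards [ae_ne_zero hn, (memLp_hardy hn hA p).coeFn_toLp] with x hx hx2
    rw [hx2, enorm_inv_norm_mul_sq hx]
  rw [e, lintegral_enorm_sq, lintegral_enorm_sq, show (4 : ℝ≥0∞) = ofReal 4 by simp,
    ← ofReal_mul (by norm_num), ofReal_le_ofReal_iff (by positivity)] at h
  exact pow_le_pow_iff_left₀ (norm_nonneg _) (by positivity) two_ne_zero |>.1 (by linarith)

/-- The operator `(u, ∇_A u) ↦ u / |x|`. -/
def hardyCLM (hn : 3 ≤ n) (hA : ContDiffOn ℝ 1 A {0}ᶜ) : covGradGraph A →L[ℂ] L2 n :=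
  LinearMap.mkContinuous
    { toFun := fun p => (memLp_hardy hn hA p).toLp _
      map_add' := fun p q => by
        rw [← MemLp.toLp_add]
        apply MemLp.toLp_congr
        filter_upwards [Lp.coeFn_add p.1.fst q.1.fst] with x hx
        exact (congrArg _ hx).trans (mul_add _ _ _)
      map_smul' := fun c p => by
        rw [RingHom.id_apply, ← MemLp.toLp_const_smul]
        apply MemLp.toLp_congr
        filter_upwards [Lp.coeFn_smul c p.1.fst] with x hx
        exact (congrArg _ hx).trans (mul_left_comm _ _ _) }
    2 fun p => (norm_hardy_le hn hA p).trans (mul_le_mul_of_nonneg_left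
      (WithLp.norm_snd_le (L2 n) _) zero_le_two)

theorem hardyCLM_ae (hn : 3 ≤ n) (hA : ContDiffOn ℝ 1 A {0}ᶜ) (p : covGradGraph A) :
    hardyCLM hn hA p =ᵐ[volume] fun x => ((‖x‖⁻¹ : ℝ) : ℂ) * p.1.fst x :=
  (memLp_hardy hn hA p).coeFn_toLp

theorem norm_hardyCLM_le (hn : 3 ≤ n) (hA : ContDiffOn ℝ 1 A {0}ᶜ) (p : covGradGraph A) :
    ‖hardyCLM hn hA p‖ ≤ 2 * ‖p.1.snd‖ := norm_hardy_le hn hA p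

theorem re_inner_real_mul_left (c : ℝ) (z w : ℂ) : (⟪(c : ℂ) * z, w⟫_ℂ).re = c * (⟪z, w⟫_ℂ).re := by
  rw [← smul_eq_mul, inner_smul_left, conj_ofReal, re_ofReal_mul]

theorem re_inner_real_mul_right (c : ℝ) (z w : ℂ) :
    (⟪z, (c : ℂ) * w⟫_ℂ).re = c * (⟪z, w⟫_ℂ).re := by
  rw [← smul_eq_mul, inner_smul_right, re_ofReal_mul]

theorem re_inner_self_eq (z : ℂ) : (⟪z, z⟫_ℂ).re = ‖z‖ ^ 2 := inner_self_eq_norm_sq (𝕜 := ℂ) z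

variable {m : E n → ℝ} {C : ℝ}

theorem abs_weight_mul_norm_le (hC0 : 0 ≤ C) (hC : ∀ x, x ≠ 0 → |m x| ≤ C / ‖x‖) (x : E n) :
    |m x * ‖x‖| ≤ C := by
  rcases eq_or_ne x 0 with rfl | hx
  · simpa using hC0
  · have hpos : 0 < ‖x‖ := norm_pos_iff.2 hx
    rw [abs_mul, abs_of_pos hpos]
    exact (le_div_iff₀ hpos).1 (hC x hx)

theorem abs_weight_mul_norm_sq_le (hC0 : 0 ≤ C) (hC : ∀ x, x ≠ 0 → |m x| ≤ C / ‖x‖ ^ 2) (x : E n) :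
    |m x * ‖x‖ ^ 2| ≤ C := by
  rcases eq_or_ne x 0 with rfl | hx
  · simpa using hC0
  · have hpos : 0 < ‖x‖ ^ 2 := by have := norm_pos_iff.2 hx; positivity
    rw [abs_mul, abs_of_pos hpos]
    exact (le_div_iff₀ hpos).1 (hC x hx)

theorem weight_inner_eq_hardy (hn : 3 ≤ n) (hA : ContDiffOn ℝ 1 A {0}ᶜ) (p : covGradGraph A)
    (m : E n → ℝ) (g : L2 n) : (fun x => m x * (⟪p.1.fst x, g x⟫_ℂ).re) =ᵐ[volume]
      fun x => (m x * ‖x‖) * (⟪hardyCLM hn hA p x, g x⟫_ℂ).re := by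
  filter_upwards [ae_ne_zero hn, hardyCLM_ae hn hA p] with x hx h
  have hpos : 0 < ‖x‖ := norm_pos_iff.2 hx
  rw [h, re_inner_real_mul_left]
  field_simp

theorem weight_sq_eq_hardy (hn : 3 ≤ n) (hA : ContDiffOn ℝ 1 A {0}ᶜ) (p : covGradGraph A)
    (m : E n → ℝ) : (fun x => m x * ‖p.1.fst x‖ ^ 2) =ᵐ[volume]
      fun x => (m x * ‖x‖ ^ 2) * (⟪hardyCLM hn hA p x, hardyCLM hn hA p x⟫_ℂ).re := by
  filter_upwards [ae_ne_zero hn, hardyCLM_ae hn hA p] with x hx h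
  have hpos : 0 < ‖x‖ := norm_pos_iff.2 hx
  rw [h, re_inner_real_mul_left, re_inner_real_mul_right, re_inner_self_eq]
  field_simp

theorem integrable_hardy_inner (hn : 3 ≤ n) (hA : ContDiffOn ℝ 1 A {0}ᶜ) (p : covGradGraph A)
    (hm : AEStronglyMeasurable m volume) (hC0 : 0 ≤ C) (hC : ∀ x, x ≠ 0 → |m x| ≤ C / ‖x‖)
    (g : L2 n) : Integrable fun x => m x * (⟪p.1.fst x, g x⟫_ℂ).re :=
  (integrable_weight_inner (hm.mul continuous_norm.aestronglyMeasurable)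
    (abs_weight_mul_norm_le hC0 hC) (hardyCLM hn hA p) g).congr
      (weight_inner_eq_hardy hn hA p m g).symm

theorem integrable_hardy_sq (hn : 3 ≤ n) (hA : ContDiffOn ℝ 1 A {0}ᶜ) (p : covGradGraph A)
    (hm : AEStronglyMeasurable m volume) (hC0 : 0 ≤ C) (hC : ∀ x, x ≠ 0 → |m x| ≤ C / ‖x‖ ^ 2) :
    Integrable fun x => m x * ‖p.1.fst x‖ ^ 2 :=
  (integrable_weight_inner (hm.mul (continuous_norm.pow 2).aestronglyMeasurable)
    (abs_weight_mul_norm_sq_le hC0 hC) (hardyCLM hn hA p) (hardyCLM hn hA p)).congr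
      (weight_sq_eq_hardy hn hA p m).symm

theorem tendsto_hardy_inner (hn : 3 ≤ n) (hA : ContDiffOn ℝ 1 A {0}ᶜ) {ι : Type*} {l : Filter ι}
    {p : ι → covGradGraph A} {q : covGradGraph A} (hp : Tendsto p l (𝓝 q))
    {g : ι → L2 n} {g0 : L2 n} (hg : Tendsto g l (𝓝 g0))
    (hm : AEStronglyMeasurable m volume) (hC0 : 0 ≤ C) (hC : ∀ x, x ≠ 0 → |m x| ≤ C / ‖x‖) :
    Tendsto (fun i => ∫ x, m x * (⟪(p i).1.fst x, g i x⟫_ℂ).re) l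
      (𝓝 (∫ x, m x * (⟪q.1.fst x, g0 x⟫_ℂ).re)) := by
  rw [integral_congr_ae (weight_inner_eq_hardy hn hA q m g0)]
  simp_rw [fun i => integral_congr_ae (weight_inner_eq_hardy hn hA (p i) m (g i))]
  exact tendsto_weight_inner (hm.mul continuous_norm.aestronglyMeasurable)
    (abs_weight_mul_norm_le hC0 hC) (((hardyCLM hn hA).continuous.tendsto _).comp hp) hg

theorem tendsto_hardy_sq (hn : 3 ≤ n) (hA : ContDiffOn ℝ 1 A {0}ᶜ) {ι : Type*} {l : Filter ι}
    {p : ι → covGradGraph A} {q : covGradGraph A} (hp : Tendsto p l (𝓝 q))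
    (hm : AEStronglyMeasurable m volume) (hC0 : 0 ≤ C) (hC : ∀ x, x ≠ 0 → |m x| ≤ C / ‖x‖ ^ 2) :
    Tendsto (fun i => ∫ x, m x * ‖(p i).1.fst x‖ ^ 2) l (𝓝 (∫ x, m x * ‖q.1.fst x‖ ^ 2)) := by
  rw [integral_congr_ae (weight_sq_eq_hardy hn hA q m)]
  simp_rw [fun i => integral_congr_ae (weight_sq_eq_hardy hn hA (p i) m)]
  exact tendsto_weight_inner (hm.mul (continuous_norm.pow 2).aestronglyMeasurable)
    (abs_weight_mul_norm_sq_le hC0 hC) (((hardyCLM hn hA).continuous.tendsto _).comp hp)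
      (((hardyCLM hn hA).continuous.tendsto _).comp hp)

/-- The first component on the graph. -/
def fstG (A : E n → E n) : covGradGraph A →L[ℂ] L2 n :=
  (WithLp.fstL 2 ℂ (L2 n) (L2Vec n)).comp (covGradGraph A).subtypeL

/-- The covariant gradient on the graph. -/
def sndG (A : E n → E n) : covGradGraph A →L[ℂ] L2Vec n :=
  (WithLp.sndL 2 ℂ (L2 n) (L2Vec n)).comp (covGradGraph A).subtypeL

theorem aesm_of_continuousOn (hn : 3 ≤ n) {F : Type*} [TopologicalSpace F]
    [TopologicalSpace.PseudoMetrizableSpace F] [SecondCountableTopology F] {f : E n → F}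
    (hf : ContinuousOn f {0}ᶜ) : AEStronglyMeasurable f volume := by
  have h := hf.aestronglyMeasurable (μ := volume) (measurableSet_singleton (0 : E n)).compl
  rwa [Measure.restrict_eq_self_of_ae_mem (s := {0}ᶜ) (ae_ne_zero hn)] at h

theorem measurable_of_Ioi (hn : 3 ≤ n) {h : ℝ → ℝ} (hc : ContinuousOn h (Ioi 0)) :
    AEStronglyMeasurable (fun x : E n => h ‖x‖) volume :=
  aesm_of_continuousOn hn (hc.comp continuous_norm.continuousOn fun _ hx => norm_pos_iff.2 hx)

theorem radial_ibp (hn : 3 ≤ n) (hA : ContDiffOn ℝ 1 A {0}ᶜ) (p : covGradGraph A)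
    {h h' : ℝ → ℝ} (hd : ∀ r, 0 < r → HasDerivAt h (h' r) r) (hc : ContinuousOn h' (Ioi 0))
    (hC0 : 0 ≤ C) (hb : ∀ r, 0 < r → |h r| ≤ C / r) (hb' : ∀ r, 0 < r → |h' r| ≤ C / r ^ 2) :
    ∫ x, h ‖x‖ * (⟪p.1.fst x, radialCLM p.1.snd x⟫_ℂ).re =
      -(1 / 2) * ∫ x, (h' ‖x‖ + (n - 1) * h ‖x‖ / ‖x‖) * ‖p.1.fst x‖ ^ 2 := by
  have hhc : ContinuousOn h (Ioi 0) := fun r hr => (hd r hr).continuousAt.continuousWithinAt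
  have hm1 := measurable_of_Ioi hn hhc
  have hm2 := measurable_of_Ioi hn (h := fun r => h' r + (n - 1) * h r / r)
    (hc.add ((continuousOn_const.mul hhc).div continuousOn_id fun r hr => ne_of_gt hr))
  have hb1 : ∀ x : E n, x ≠ 0 → |h ‖x‖| ≤ C / ‖x‖ := fun x hx => hb _ (norm_pos_iff.2 hx)
  have hn1 : (1 : ℝ) ≤ n := by exact_mod_cast (by omega : 1 ≤ n)
  have hb2 : ∀ x : E n, x ≠ 0 → |h' ‖x‖ + (n - 1) * h ‖x‖ / ‖x‖| ≤ (n * C) / ‖x‖ ^ 2 := by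
    intro x hx
    have hpos := norm_pos_iff.2 hx
    have e : (n * C) / ‖x‖ ^ 2 = C / ‖x‖ ^ 2 + (n - 1) * (C / ‖x‖) / ‖x‖ := by field_simp; ring
    rw [e]
    refine (abs_add_le _ _).trans (add_le_add (hb' _ hpos) ?_)
    rw [abs_div, abs_mul, abs_of_nonneg (by linarith : (0 : ℝ) ≤ n - 1), abs_of_pos hpos]
    gcongr
    exact hb _ hpos
  have hcl : IsClosed {p : covGradGraph A | ∫ x, h ‖x‖ * (⟪p.1.fst x, radialCLM p.1.snd x⟫_ℂ).re =
      -(1 / 2) * ∫ x, (h' ‖x‖ + (n - 1) * h ‖x‖ / ‖x‖) * ‖p.1.fst x‖ ^ 2} := by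
    refine isClosed_eq ?_ (continuous_const.mul ?_)
    · refine continuous_iff_continuousAt.2 fun q => ?_
      exact tendsto_hardy_inner hn hA tendsto_id
        (((radialCLM.comp (sndG A)).continuous.tendsto q)) hm1 hC0 hb1
    · refine continuous_iff_continuousAt.2 fun q => ?_
      exact tendsto_hardy_sq hn hA tendsto_id hm2 (by positivity) hb2
  refine covGradGraph_ind' hA hcl (fun f hf hf2 => ?_) p
  have h0 := (radial_ibp_test (A := A) hn hf2 hd hc).2
  set q : covGradGraph A := ⟨testPair hA hf2, testPair_mem_graph hA hf hf2⟩
  have hi1 := integrable_hardy_inner hn hA q hm1 hC0 hb1 (radialCLM q.1.snd)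
  have hi2 := integrable_hardy_sq hn hA q hm2 (by positivity) hb2
  have h1 : ∫ x, ((h' ‖x‖ + (n - 1) * h ‖x‖ / ‖x‖) * ‖f x‖ ^ 2 +
      2 * h ‖x‖ * (⟪f x, radial x (covGradFun A f x)⟫_ℂ).re) =
      ∫ x, ((h' ‖x‖ + (n - 1) * h ‖x‖ / ‖x‖) * ‖q.1.fst x‖ ^ 2 +
        2 * (h ‖x‖ * (⟪q.1.fst x, radialCLM q.1.snd x⟫_ℂ).re)) := by
    refine integral_congr_ae ?_
    filter_upwards [testPair_fst_ae hA hf2, testPair_snd_ae hA hf2, radialCLM_ae q.1.snd]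
      with x h1 h2 h3
    have h1' : q.1.fst x = f x := h1
    have h2' : q.1.snd x = covGradFun A f x := h2
    rw [h3, h1', h2', mul_assoc]
  rw [h1, integral_add hi2 (hi1.const_mul 2), integral_const_mul] at h0
  simp only [mem_ofPred_eq]
  linarith

end Hardy

end

section

/-! ### Mollification in `L²` -/

section Mollify

open ContinuousLinearMap
open scoped Convolution

theorem tendsto_eLpNorm_translate {U : E n → ℂ} (hU : MemLp U 2 volume) :
    Tendsto (fun t : E n => eLpNorm (fun x => U (x - t) - U x) 2 volume) (𝓝 0) (𝓝 0) := by
  have hmp : ∀ t : E n, MeasurePreserving (fun x : E n => x - t) volume volume := fun t =>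
    measurePreserving_sub_right volume t
  let g : C(E n, C(E n, E n)) :=
    (ContinuousMap.mk (fun a : E n × E n => a.2 - a.1) (by fun_prop)).curry
  have hg : Continuous fun t : E n => Lp.compMeasurePreserving (g t) (hmp t) (hU.toLp U) :=
    continuous_const.compMeasurePreservingLp g.continuous hmp (by simp)
  have h0 : Lp.compMeasurePreserving (g 0) (hmp 0) (hU.toLp U) = hU.toLp U := by
    apply Lp.ext
    filter_upwards [Lp.coeFn_compMeasurePreserving (hU.toLp U) (hmp 0)] with x hx
    refine hx.trans ?_
    simp
  have h1 := hg.tendsto 0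
  rw [h0, tendsto_iff_edist_tendsto_0] at h1
  refine h1.congr fun t => ?_
  rw [Lp.edist_def]
  refine eLpNorm_congr_ae ?_
  have h2 := (hmp t).quasiMeasurePreserving.ae_eq_comp hU.coeFn_toLp
  filter_upwards [Lp.coeFn_compMeasurePreserving (hU.toLp U) (hmp t), hU.coeFn_toLp, h2]
    with x hx hx2 hx3
  rw [Pi.sub_apply, hx2]
  exact congrArg (· - U x) (hx.trans hx3)

theorem enorm_mollify_sub_sq_le (φ : ContDiffBump (0 : E n)) {U : E n → ℂ}
    (hU : LocallyIntegrable U volume) (x : E n) :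
    ‖(φ.normed volume ⋆[lsmul ℝ ℝ, volume] U) x - U x‖ₑ ^ 2 ≤
      ∫⁻ t, ofReal (φ.normed volume t) * ‖U (x - t) - U x‖ₑ ^ 2 := by
  have hce : ConvolutionExistsAt (φ.normed volume) U x (lsmul ℝ ℝ) volume :=
    φ.hasCompactSupport_normed.convolutionExists_left _ φ.continuous_normed hU x
  have hi : Integrable (fun t => φ.normed volume t • U (x - t)) := hce
  have hi2 : Integrable (fun t => φ.normed volume t • U x) := φ.integrable_normed.smul_const _
  have e1 : (φ.normed volume ⋆[lsmul ℝ ℝ, volume] U) x - U x =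
      ∫ t, φ.normed volume t • (U (x - t) - U x) := by
    have : ∫ t, φ.normed volume t • U x = U x := φ.integral_normed_smul volume (U x)
    simp_rw [smul_sub]
    rw [integral_sub hi hi2, this]
    rfl
  set ρ : E n → ℝ≥0∞ := fun t => ofReal (φ.normed volume t) with hρ
  have hρm : Measurable ρ := φ.continuous_normed.measurable.ennreal_ofReal
  have hρ1 : ∫⁻ t, ρ t = 1 := by
    rw [hρ, ← ofReal_integral_eq_lintegral_ofReal φ.integrable_normed
      (ae_of_all _ φ.nonneg_normed), φ.integral_normed, ofReal_one]
  have hm : AEMeasurable (fun t => ρ t * ‖U (x - t) - U x‖ₑ) volume := by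
    have h3 := (hi.sub hi2).1.enorm
    refine h3.congr (ae_of_all _ fun t => ?_)
    simp only [Pi.sub_apply, ← smul_sub, enorm_smul, hρ]
    rw [Real.enorm_eq_ofReal (φ.nonneg_normed t)]
  have h2 : ‖(φ.normed volume ⋆[lsmul ℝ ℝ, volume] U) x - U x‖ₑ ≤
      ∫⁻ t, ρ t * ‖U (x - t) - U x‖ₑ := by
    rw [e1]
    refine (enorm_integral_le_lintegral_enorm _).trans (le_of_eq (lintegral_congr fun t => ?_))
    rw [enorm_smul, Real.enorm_eq_ofReal (φ.nonneg_normed t)]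
  have h3 : ∫⁻ t, ρ t * ‖U (x - t) - U x‖ₑ ≤
      (∫⁻ t, ρ t * ‖U (x - t) - U x‖ₑ ^ 2) ^ (1 / 2 : ℝ) := by
    have hold := ENNReal.lintegral_mul_le_Lp_mul_Lq (volume : Measure (E n))
      (Real.HolderConjugate.two_two) (f := fun t => ρ t ^ (1 / 2 : ℝ))
      (g := fun t => ρ t ^ (-(1 / 2) : ℝ) * (ρ t * ‖U (x - t) - U x‖ₑ))
      (hρm.pow_const _).aemeasurable ((hρm.pow_const _).aemeasurable.mul hm)
    have hfin : ∀ t, ρ t ≠ ⊤ := fun t => ofReal_ne_top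
    have e2 : ∀ t, ρ t ^ (1 / 2 : ℝ) * (ρ t ^ (-(1 / 2) : ℝ) * (ρ t * ‖U (x - t) - U x‖ₑ)) =
        ρ t * ‖U (x - t) - U x‖ₑ := by
      intro t
      rcases eq_or_ne (ρ t) 0 with h0 | h0
      · simp [h0]
      · rw [← mul_assoc, ← ENNReal.rpow_add _ _ h0 (hfin t)]
        simp
    have e3 : ∀ t, (ρ t ^ (-(1 / 2) : ℝ) * (ρ t * ‖U (x - t) - U x‖ₑ)) ^ (2 : ℝ) =
        ρ t * ‖U (x - t) - U x‖ₑ ^ 2 := by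
      intro t
      rcases eq_or_ne (ρ t) 0 with h0 | h0
      · simp [h0]
      · have e5 : ρ t ^ (-(1 / 2) : ℝ) * ρ t = ρ t ^ (1 / 2 : ℝ) := by
          nth_rewrite 2 [← ENNReal.rpow_one (ρ t)]
          rw [← ENNReal.rpow_add _ _ h0 (hfin t)]
          norm_num
        rw [← mul_assoc, e5, ENNReal.mul_rpow_of_nonneg _ _ zero_le_two, ← ENNReal.rpow_mul]
        norm_num
    have e4 : ∀ t, (ρ t ^ (1 / 2 : ℝ)) ^ (2 : ℝ) = ρ t := by
      intro t
      rw [← ENNReal.rpow_mul]; norm_num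
    simp only [Pi.mul_apply, e2, e3, e4] at hold
    rwa [hρ1, ENNReal.one_rpow, one_mul] at hold
  calc _ ≤ ((∫⁻ t, ρ t * ‖U (x - t) - U x‖ₑ ^ 2) ^ (1 / 2 : ℝ)) ^ 2 := by
        gcongr; exact h2.trans h3
    _ = _ := by
        rw [← ENNReal.rpow_natCast, ← ENNReal.rpow_mul]; norm_num [hρ]

theorem tendsto_eLpNorm_mollify {U : E n → ℂ} (hU : MemLp U 2 volume)
    {φ : ℕ → ContDiffBump (0 : E n)} (hφ : Tendsto (fun i => (φ i).rOut) atTop (𝓝 0)) :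
    Tendsto (fun i => eLpNorm (fun x => ((φ i).normed volume ⋆[lsmul ℝ ℝ, volume] U) x - U x) 2
      volume) atTop (𝓝 0) := by
  have hloc : LocallyIntegrable U volume := hU.locallyIntegrable one_le_two
  rw [ENNReal.tendsto_atTop_zero]
  intro ε hε
  rcases eq_or_ne ε ⊤ with rfl | hεt
  · exact ⟨0, fun _ _ => le_top⟩
  have h1 := (ENNReal.tendsto_nhds_zero.1 (tendsto_eLpNorm_translate hU)) ε hε
  obtain ⟨δ, hδ, hball⟩ := Metric.eventually_nhds_iff_ball.1 h1
  obtain ⟨N, hN⟩ := eventually_atTop.1 (hφ.eventually (gt_mem_nhds hδ))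
  refine ⟨N, fun i hi => ?_⟩
  have hsq : ∀ f : E n → ℂ, eLpNorm f 2 volume = (∫⁻ x, ‖f x‖ₑ ^ 2) ^ (1 / 2 : ℝ) := by
    intro f
    rw [eLpNorm_eq_lintegral_rpow_enorm_toReal two_ne_zero ofNat_ne_top]
    simp
  have hle : ∀ f : E n → ℂ, eLpNorm f 2 volume ≤ ε ↔ ∫⁻ x, ‖f x‖ₑ ^ 2 ≤ ε ^ 2 := by
    intro f
    rw [hsq, one_div, ENNReal.rpow_inv_le_iff (by norm_num)]
    norm_num
  rw [hle]
  have hρ1 : ∫⁻ t, ofReal ((φ i).normed volume t) = 1 := by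
    rw [← ofReal_integral_eq_lintegral_ofReal (φ i).integrable_normed
      (ae_of_all _ (φ i).nonneg_normed), (φ i).integral_normed, ofReal_one]
  calc _ ≤ ∫⁻ x, ∫⁻ t, ofReal ((φ i).normed volume t) * ‖U (x - t) - U x‖ₑ ^ 2 :=
        lintegral_mono fun x => enorm_mollify_sub_sq_le (φ i) hloc x
    _ = ∫⁻ t, ∫⁻ x, ofReal ((φ i).normed volume t) * ‖U (x - t) - U x‖ₑ ^ 2 := by
        have m1 : Measurable fun q : E n × E n => ofReal ((φ i).normed volume q.2) :=
          ((φ i).continuous_normed.measurable.comp measurable_snd).ennreal_ofReal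
        have m2 : AEMeasurable (fun q : E n × E n => ‖U (q.1 - q.2) - U q.1‖ₑ ^ 2)
            (volume.prod volume) := ((hU.1.comp_quasiMeasurePreserving
          (quasiMeasurePreserving_sub_of_right_invariant volume volume)).sub
            hU.1.comp_fst).enorm.pow_const 2
        exact lintegral_lintegral_swap (m1.aemeasurable.mul m2)
    _ ≤ ∫⁻ t, ofReal ((φ i).normed volume t) * ε ^ 2 := by
        refine lintegral_mono fun t => ?_
        simp only
        rw [lintegral_const_mul' _ _ ofReal_ne_top]
        by_cases ht : t ∈ ball (0 : E n) δ
        · gcongr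
          exact (hle _).1 (hball t ht)
        · have : (φ i).normed volume t = 0 := by
            have hns : t ∉ Function.support ((φ i).normed volume) := by
              rw [(φ i).support_normed_eq]
              exact fun h => ht (Metric.ball_subset_ball (hN i hi).le h)
            simpa using hns
          simp [this]
    _ = ε ^ 2 := by
        rw [lintegral_mul_const' _ _ (pow_ne_top hεt), hρ1, one_mul]

end Mollify

end

section

variable {A : E n → E n}

/-! ### The weak form of the covariant gradient -/

theorem OffOrigin.ofReal_memLp {m : WithTop ℕ∞} {χ : E n → ℝ} (hχ : OffOrigin m χ) :
    MemLp (fun x => (χ x : ℂ)) 2 volume :=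
  (Complex.continuous_ofReal.comp hχ.contDiff.continuous).memLp_of_hasCompactSupport
    (hχ.compact.comp_left Complex.ofReal_zero)

theorem OffOrigin.mul_component {m : WithTop ℕ∞} (hA : ContDiffOn ℝ m A {0}ᶜ) {χ : E n → ℝ}
    (hχ : OffOrigin m χ) (j : Fin n) : OffOrigin m fun x => A x j * χ x :=
  hχ.smul (contDiffOn_component hA j)

/-- The `j`-th component of a vector valued `L²` function. -/
def compCLM (j : Fin n) : L2Vec n →L[ℂ] L2 n := (proj (𝕜 := ℂ) j : CVec n →L[ℂ] ℂ).compLpL 2 volume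

theorem compCLM_ae (j : Fin n) (w : L2Vec n) : compCLM j w =ᵐ[volume] fun x => w x j :=
  (proj (𝕜 := ℂ) j : CVec n →L[ℂ] ℂ).coeFn_compLpL w

theorem integral_real_mul_eq_inner {χ : E n → ℝ} (hχ : MemLp (fun x => (χ x : ℂ)) 2 volume)
    (f : L2 n) : ∫ x, (χ x : ℂ) * f x = ⟪hχ.toLp _, f⟫_ℂ := by
  rw [L2.inner_def]
  refine integral_congr_ae ?_
  filter_upwards [hχ.coeFn_toLp] with x hx
  rw [hx, RCLike.inner_apply, conj_ofReal, mul_comm]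

theorem integrable_real_mul {χ : E n → ℝ} (hχ : MemLp (fun x => (χ x : ℂ)) 2 volume)
    (f : L2 n) : Integrable fun x => (χ x : ℂ) * f x :=
  hχ.integrable_mul (Lp.memLp f)

theorem weak_grad_test {f : E n → ℂ} (hf : OffOrigin 2 f)
    {χ : E n → ℝ} (hχ : ContDiff ℝ 1 χ) (j : Fin n) :
    ∫ x, (((pd j χ x : ℝ) : ℂ) * f x + (χ x : ℂ) * pd j f x) = 0 := by
  have h : OffOrigin 1 fun x => (χ x : ℂ) * f x := by
    have := (hf.of_le (m := 2) (k := 1) (by norm_num)).smul (g := χ) hχ.contDiffOn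
    simpa only [real_smul] using this
  rw [← h.integral_pd j]
  refine integral_congr_ae (ae_of_all _ fun x => ?_)
  have h1 : DifferentiableAt ℝ χ x := hχ.differentiable one_ne_zero x
  have h2 : DifferentiableAt ℝ (fun y => (χ y : ℂ)) x := ofRealCLM.differentiableAt.comp x h1
  simp only
  rw [pd_mul h2 (hf.contDiff.differentiable two_ne_zero x), pd_ofReal h1]

theorem weak_grad (hA : ContDiffOn ℝ 1 A {0}ᶜ) (p : covGradGraph A) {χ : E n → ℝ}
    (hχ : OffOrigin 1 χ) (j : Fin n) :
    ∫ x, ((pd j χ x : ℝ) : ℂ) * p.1.fst x = -(∫ x, (χ x : ℂ) * compCLM j p.1.snd x) +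
      I * ∫ x, ((A x j * χ x : ℝ) : ℂ) * p.1.fst x := by
  have h1 := (hχ.partialDeriv (m := 0) j).ofReal_memLp
  have h2 := hχ.ofReal_memLp
  have h3 := (hχ.mul_component hA j).ofReal_memLp
  have hcl : IsClosed {p : covGradGraph A | ∫ x, ((pd j χ x : ℝ) : ℂ) * p.1.fst x =
      -(∫ x, (χ x : ℂ) * compCLM j p.1.snd x) +
      I * ∫ x, ((A x j * χ x : ℝ) : ℂ) * p.1.fst x} := by
    simp_rw [integral_real_mul_eq_inner h1, integral_real_mul_eq_inner h2,
      integral_real_mul_eq_inner h3]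
    have c1 := (fstG A).continuous
    have c2 := ((compCLM j).comp (sndG A)).continuous
    exact isClosed_eq (continuous_const.inner c1) ((continuous_const.inner c2).neg.add
      (continuous_const.mul (continuous_const.inner c1)))
  refine covGradGraph_ind' hA hcl (fun f hf hf2 => ?_) p
  set q : covGradGraph A := ⟨testPair hA hf2, testPair_mem_graph hA hf hf2⟩
  have h0 := weak_grad_test hf2 hχ.contDiff j
  have e : ∫ x, (((pd j χ x : ℝ) : ℂ) * f x + (χ x : ℂ) * pd j f x) =
      ∫ x, (((pd j χ x : ℝ) : ℂ) * q.1.fst x + ((χ x : ℂ) * compCLM j q.1.snd x -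
        I * (((A x j * χ x : ℝ) : ℂ) * q.1.fst x))) := by
    refine integral_congr_ae ?_
    filter_upwards [testPair_fst_ae hA hf2, testPair_snd_ae hA hf2, compCLM_ae j q.1.snd]
      with x h1 h2 h3
    have h1' : q.1.fst x = f x := h1
    have h2' : q.1.snd x = covGradFun A f x := h2
    rw [h3, h1', h2', covGradFun_apply, cd]
    push_cast
    ring
  have hi : Integrable fun x => (χ x : ℂ) * compCLM j q.1.snd x -
      I * (((A x j * χ x : ℝ) : ℂ) * q.1.fst x) :=
    (integrable_real_mul h2 _).sub ((integrable_real_mul h3 _).const_mul _)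
  rw [e, integral_add (integrable_real_mul h1 _) hi, integral_sub (integrable_real_mul h2 _)
    ((integrable_real_mul h3 _).const_mul _), integral_const_mul] at h0
  simp only [mem_ofPred_eq]
  linear_combination h0

theorem eq_zero_of_forall_integral_eq_zero (hn : 3 ≤ n) {f : L2 n}
    (h : ∀ χ : E n → ℝ, OffOrigin ∞ χ → ∫ x, (χ x : ℂ) * f x = 0) : f = 0 := by
  have hloc : LocallyIntegrableOn f {0}ᶜ volume :=
    ((Lp.memLp f).locallyIntegrable one_le_two).locallyIntegrableOn _
  have := IsOpen.ae_eq_zero_of_integral_contDiff_smul_eq_zero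
    (isOpen_compl_singleton (x := (0 : E n))) hloc fun χ hχ hc hs => by
      have := h χ ⟨hχ, hc, fun h0 => hs h0 rfl⟩
      simpa only [real_smul] using this
  apply Lp.ext
  filter_upwards [this, ae_ne_zero hn, Lp.coeFn_zero ℂ 2 (volume : Measure (E n))] with x h1 h2 h3
  rw [h1 h2, h3]; rfl

theorem snd_eq_zero_of_fst_eq_zero (hn : 3 ≤ n) (hA : ContDiffOn ℝ 1 A {0}ᶜ) (p : covGradGraph A)
    (h : p.1.fst = 0) : p.1.snd = 0 := by
  have hj : ∀ j, compCLM j p.1.snd = 0 := by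
    intro j
    refine eq_zero_of_forall_integral_eq_zero hn fun χ hχ => ?_
    have hw := weak_grad hA p (hχ.of_le (by norm_cast)) j
    have hz : ∀ m : E n → ℝ, ∫ x, (m x : ℂ) * p.1.fst x = 0 := by
      intro m
      rw [h]
      refine integral_eq_zero_of_ae ?_
      filter_upwards [Lp.coeFn_zero ℂ 2 (volume : Measure (E n))] with x hx
      rw [hx, Pi.zero_apply, mul_zero]
    rw [hz, hz] at hw
    simpa using hw
  apply Lp.ext
  have hall : ∀ᵐ x : E n, ∀ j, p.1.snd x j = 0 := by
    rw [ae_all_iff]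
    intro j
    filter_upwards [compCLM_ae j p.1.snd, Lp.coeFn_zero ℂ 2 (volume : Measure (E n))] with x h1 h2
    rw [← h1, hj j, h2]; rfl
  filter_upwards [hall, Lp.coeFn_zero (CVec n) 2 (volume : Measure (E n))] with x h1 h2
  rw [h2]
  ext j
  exact h1 j

theorem covGrad_eq (hn : 3 ≤ n) (hA : ContDiffOn ℝ 1 A {0}ᶜ) (p : covGradGraph A) :
    covGrad A p.1.fst = p.1.snd := by
  have hex : ∃ w : L2Vec n, WithLp.toLp 2 (p.1.fst, w) ∈ covGradGraph A := ⟨p.1.snd, p.2⟩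
  rw [covGrad, dif_pos hex]
  have h := (covGradGraph A).sub_mem hex.choose_spec p.2
  have := snd_eq_zero_of_fst_eq_zero hn hA ⟨_, h⟩ (sub_self _)
  exact sub_eq_zero.1 this

/-! ### The graph of `-Δ_A` -/

theorem negLaplacianGraph_functional (hn : 3 ≤ n) (hA : ContDiffOn ℝ 1 A {0}ᶜ) :
    ∀ q ∈ negLaplacianGraph A, q.1 = 0 → q.2 = 0 := by
  rintro ⟨u, f⟩ ⟨w, hw, hw'⟩ (rfl : u = 0)
  have hw0 : w = 0 := snd_eq_zero_of_fst_eq_zero hn hA ⟨_, hw⟩ rfl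
  refine eq_zero_of_forall_integral_eq_zero hn fun χ hχ => ?_
  have hχ' : OffOrigin ∞ fun x => (χ x : ℂ) := by
    refine hχ.mono_support (fun x _ _ => ?_) fun x hx => subset_tsupport _ fun h => hx (by simp [h])
    exact ofRealCLM.contDiff.contDiffAt.comp x hχ.contDiff.contDiffAt
  have hχ2 : OffOrigin 2 fun x => (χ x : ℂ) := hχ'.of_le (by norm_cast)
  have := hw' _ (testPair_mem_graph hA hχ' hχ2)
  rw [hw0, inner_zero_right] at this
  rw [integral_real_mul_eq_inner hχ.ofReal_memLp]
  exact this.symm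

theorem mem_graph_negLaplacian (hn : 3 ≤ n) (hA : ContDiffOn ℝ 1 A {0}ᶜ) {q : L2 n × L2 n} :
    q ∈ (negLaplacian A).graph ↔ q ∈ negLaplacianGraph A := by
  rw [negLaplacian, Submodule.toLinearPMap_graph_eq _ (negLaplacianGraph_functional hn hA)]

theorem mulGraph_functional (V : E n → ℝ) : ∀ q ∈ mulGraph V, q.1 = 0 → q.2 = 0 := by
  rintro ⟨u, f⟩ (hq : f =ᵐ[volume] fun x => (V x : ℂ) * u x) (rfl : u = 0)
  apply Lp.ext
  filter_upwards [hq, Lp.coeFn_zero ℂ 2 (volume : Measure (E n))] with x h1 h2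
  rw [h1, h2]; simp

theorem mem_graph_mulOp {V : E n → ℝ} {q : L2 n × L2 n} : q ∈ (mulOp V).graph ↔ q ∈ mulGraph V := by
  rw [mulOp, Submodule.toLinearPMap_graph_eq _ (mulGraph_functional V)]

/-- The elements of the domain of `H`: the two parts of `H u`. -/
theorem exists_of_mem_graph_hamiltonian (hn : 3 ≤ n) (hA : ContDiffOn ℝ 1 A {0}ᶜ) {A₀ : E n → ℝ}
    {u f : L2 n} (h : (u, f) ∈ (hamiltonian A₀ A).graph) :
    ∃ L V : L2 n, (u, L) ∈ negLaplacianGraph A ∧ (V =ᵐ[volume] fun x => (A₀ x : ℂ) * u x) ∧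
      f = L + V := by
  rw [LinearPMap.mem_graph_iff] at h
  obtain ⟨⟨y, hy⟩, rfl, rfl⟩ := h
  have hy' : y ∈ (negLaplacian A).domain ⊓ (mulOp A₀).domain := hy
  refine ⟨negLaplacian A ⟨y, hy'.1⟩, mulOp A₀ ⟨y, hy'.2⟩, ?_, ?_, rfl⟩
  · rw [← mem_graph_negLaplacian hn hA]
    exact LinearPMap.mem_graph _ ⟨y, hy'.1⟩
  · exact mem_graph_mulOp.1 (LinearPMap.mem_graph (mulOp A₀) ⟨y, hy'.2⟩)

theorem isClosed_negLaplacianGraph (hn : 3 ≤ n) (hA : ContDiffOn ℝ 1 A {0}ᶜ)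
    (hs : IsSelfAdjoint (negLaplacian A)) :
    IsClosed (negLaplacianGraph A : Set (L2 n × L2 n)) := by
  have := hs.isClosed
  rw [LinearPMap.IsClosed] at this
  convert this using 1
  ext q
  exact (mem_graph_negLaplacian hn hA).symm

/-- The weak form of `-Δ_A u = f` for real test functions. -/
theorem weak_laplacian (hA : ContDiffOn ℝ 1 A {0}ᶜ) {f : L2 n} {w : L2Vec n}
    (h : ∀ p ∈ covGradGraph A, ⟪p.snd, w⟫_ℂ = ⟪p.fst, f⟫_ℂ) {χ : E n → ℝ} (hχ : OffOrigin ∞ χ) :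
    ∑ j, ((∫ x, ((pd j χ x : ℝ) : ℂ) * compCLM j w x) -
      I * ∫ x, ((A x j * χ x : ℝ) : ℂ) * compCLM j w x) = ∫ x, (χ x : ℂ) * f x := by
  have hχ' : OffOrigin ∞ fun x => (χ x : ℂ) := by
    refine hχ.mono_support (fun x _ _ => ?_) fun x hx => subset_tsupport _ fun h => hx (by simp [h])
    exact ofRealCLM.contDiff.contDiffAt.comp x hχ.contDiff.contDiffAt
  have hχ2 : OffOrigin 2 fun x => (χ x : ℂ) := hχ'.of_le (by norm_cast)
  have hχ1 : OffOrigin 1 χ := hχ.of_le (by norm_cast)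
  have h0 := h _ (testPair_mem_graph hA hχ' hχ2)
  rw [integral_real_mul_eq_inner hχ.ofReal_memLp]
  refine Eq.trans ?_ h0
  have hi1 := fun j => integrable_real_mul (hχ1.partialDeriv (m := 0) j).ofReal_memLp (compCLM j w)
  have hi2 := fun j => (integrable_real_mul (hχ1.mul_component hA j).ofReal_memLp
    (compCLM j w)).const_mul I
  rw [L2.inner_def]
  simp_rw [← integral_const_mul, fun j => (integral_sub (hi1 j) (hi2 j)).symm]
  have hi : ∀ j, Integrable fun x => ((pd j χ x : ℝ) : ℂ) * compCLM j w x -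
      I * (((A x j * χ x : ℝ) : ℂ) * compCLM j w x) := fun j => (hi1 j).sub (hi2 j)
  rw [← integral_finsetSum _ fun j _ => hi j]
  refine integral_congr_ae ?_
  have hall : ∀ᵐ x : E n, ∀ j, compCLM j w x = w x j := ae_all_iff.2 fun j => compCLM_ae j w
  filter_upwards [hall, testPair_snd_ae hA hχ2] with x h1 h2
  simp only [h1]
  have h2' : (testPair hA hχ2).snd x = covGradFun A (fun x => (χ x : ℂ)) x := h2
  rw [h2', PiLp.inner_apply]
  refine sum_congr rfl fun j _ => ?_
  rw [RCLike.inner_apply, covGradFun_apply, cd, pd_ofReal (hχ1.contDiff.differentiable one_ne_zero x)]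
  simp only [map_add, map_mul, conj_I, conj_ofReal]
  push_cast
  ring

end

section

variable {A : E n → E n}

open scoped Convolution

open ContinuousLinearMap in
/-- Mollification at `x` is the integration against a test function, and so are its derivatives. -/
theorem exists_mollify_kernel (φ : ContDiffBump (0 : E n)) (x : E n) :
    ∃ ψ : E n → ℝ, ContDiff ℝ ∞ ψ ∧ HasCompactSupport ψ ∧
      (∀ V : E n → ℂ, (φ.normed volume ⋆[lsmul ℝ ℝ, volume] V) x = ∫ t, (ψ t : ℂ) * V t) ∧
      ∀ U : E n → ℂ, LocallyIntegrable U volume → ∀ j,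
        pd j (φ.normed volume ⋆[lsmul ℝ ℝ, volume] U) x = -∫ t, ((pd j ψ t : ℝ) : ℂ) * U t := by
  set ψ : E n → ℝ := fun t => φ.normed volume (x - t) with hψ
  have hψd : ∀ j t, pd j ψ t = -pd j (φ.normed volume) (x - t) := by
    intro j t
    have hd1 : HasFDerivAt (φ.normed volume) (fderiv ℝ (φ.normed volume) (x - t)) (x - t) :=
      ((φ.contDiff_normed (n := 1)).differentiable one_ne_zero _).hasFDerivAt
    have hd2 : HasFDerivAt (fun t : E n => x - t) (-(ContinuousLinearMap.id ℝ (E n))) t :=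
      (hasFDerivAt_id t).const_sub x
    have hd3 : HasFDerivAt ψ _ t := hd1.comp t hd2
    rw [pd, hd3.fderiv]
    simp [pd]
  refine ⟨ψ, φ.contDiff_normed.comp (contDiff_const.sub contDiff_id),
    φ.hasCompactSupport_normed.comp_homeomorph (Homeomorph.subLeft x), fun V => ?_, fun U hU j => ?_⟩
  · rw [convolution_def, ← integral_sub_left_eq_self (fun t => (ψ t : ℂ) * V t) volume x]
    simp only [hψ, sub_sub_cancel, lsmul_apply, real_smul]
  have hd := HasCompactSupport.hasFDerivAt_convolution_left (𝕜 := ℝ) (μ := (volume : Measure (E n)))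
    (lsmul ℝ ℝ : ℝ →L[ℝ] ℂ →L[ℝ] ℂ) φ.hasCompactSupport_normed
    (φ.contDiff_normed (μ := (volume : Measure (E n))) (n := 1)) hU x
  have hfc : Continuous (fderiv ℝ (φ.normed (volume : Measure (E n)))) :=
    (φ.contDiff_normed (n := 1)).continuous_fderiv one_ne_zero
  have hfs : HasCompactSupport (fderiv ℝ (φ.normed (volume : Measure (E n)))) :=
    φ.hasCompactSupport_normed.fderiv ℝ
  have hex : ConvolutionExistsAt (fderiv ℝ (φ.normed volume)) U x
      ((lsmul ℝ ℝ : ℝ →L[ℝ] ℂ →L[ℝ] ℂ).precompL (E n)) volume :=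
    hfs.convolutionExists_left _ hfc hU x
  have h1 : pd j (φ.normed volume ⋆[lsmul ℝ ℝ, volume] U) x =
      ∫ t, (pd j (φ.normed volume) t) • U (x - t) := by
    rw [pd, hd.fderiv, convolution_def, ContinuousLinearMap.integral_apply hex]
    rfl
  rw [h1, ← integral_sub_left_eq_self (fun t => ((pd j ψ t : ℝ) : ℂ) * U t) volume x]
  simp only [hψd, sub_sub_cancel, real_smul]
  push_cast
  simp only [neg_mul, integral_neg, neg_neg]

theorem exists_cutoff {r0 : ℝ} (h0 : 0 < r0) (r1 : ℝ) : ∃ χ : E n → ℝ, OffOrigin ∞ χ ∧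
    ∀ x, r0 ≤ ‖x‖ → ‖x‖ ≤ r1 → χ =ᶠ[𝓝 x] fun _ => 1 := by
  set M := r1 ^ 2 + r0 ^ 2 with hM
  have hr : 0 < r0 ^ 2 := by positivity
  let b : ContDiffBump M := ⟨M - r0 ^ 2 / 2, M - r0 ^ 2 / 4, by nlinarith [sq_nonneg r1], by linarith⟩
  have hc : ContDiff ℝ ∞ fun x : E n => b (‖x‖ ^ 2) := b.contDiff.comp (contDiff_norm_sq ℝ)
  have hsub : Function.support (fun x : E n => b (‖x‖ ^ 2)) ⊆
      {x | r0 ^ 2 / 4 ≤ ‖x‖ ^ 2 ∧ ‖x‖ ^ 2 ≤ 2 * M} := by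
    intro x hx
    have h1 : ‖x‖ ^ 2 ∈ Function.support b := hx
    rw [b.support_eq, mem_ball, dist_eq, abs_lt] at h1
    have h2 : b.rOut = M - r0 ^ 2 / 4 := rfl
    rw [h2] at h1
    exact ⟨by linarith [h1.1], by linarith [h1.2]⟩
  have hcl : IsClosed {x : E n | r0 ^ 2 / 4 ≤ ‖x‖ ^ 2 ∧ ‖x‖ ^ 2 ≤ 2 * M} :=
    (isClosed_le (α := ℝ) continuous_const (continuous_norm.pow 2)).inter
      (isClosed_le (α := ℝ) (continuous_norm.pow 2) continuous_const)
  refine ⟨fun x => b (‖x‖ ^ 2), ⟨hc, ?_, ?_⟩, fun x hx0 hx1 => ?_⟩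
  · refine HasCompactSupport.of_support_subset_isCompact (isCompact_closedBall (0 : E n)
      (Real.sqrt (2 * M))) fun x hx => ?_
    rw [mem_closedBall_zero_iff]
    exact Real.le_sqrt_of_sq_le (hsub hx).2
  · intro h
    have := (closure_minimal hsub hcl h).1
    simp only [norm_zero] at this
    nlinarith
  · have hlt1 : r0 ^ 2 ≤ ‖x‖ ^ 2 := by gcongr
    have hlt2 : ‖x‖ ^ 2 ≤ r1 ^ 2 := by gcongr
    have hmem : ‖x‖ ^ 2 ∈ ball M b.rIn := by
      rw [mem_ball, dist_eq, abs_lt]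
      have h2 : b.rIn = M - r0 ^ 2 / 2 := rfl
      rw [h2]
      constructor <;> linarith
    have hev := (Metric.isOpen_ball.preimage (continuous_norm.pow 2)).mem_nhds
      (show x ∈ (fun y : E n => ‖y‖ ^ 2) ⁻¹' ball M b.rIn from hmem)
    filter_upwards [hev] with y hy
    exact b.one_of_mem_closedBall (Metric.ball_subset_closedBall hy)

theorem exists_annulus {K : Set (E n)} (hK : IsCompact K) (h0 : (0 : E n) ∉ K) :
    ∃ r0 r1 : ℝ, 0 < r0 ∧ ∀ x ∈ K, r0 ≤ ‖x‖ ∧ ‖x‖ ≤ r1 := by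
  obtain ⟨r0, hr0, hb⟩ := Metric.isOpen_iff.1 hK.isClosed.isOpen_compl 0 h0
  obtain ⟨r1, hr1⟩ := hK.isBounded.subset_closedBall 0
  refine ⟨r0, r1, hr0, fun x hx => ⟨?_, mem_closedBall_zero_iff.1 (hr1 hx)⟩⟩
  by_contra hlt
  exact hb (mem_ball_zero_iff.2 (not_le.1 hlt)) hx

/-- A sequence of mollifiers whose supports lie in the ball of radius `ε` and shrink. -/
theorem exists_bumps {ε : ℝ} (hε : 0 < ε) : ∃ φ : ℕ → ContDiffBump (0 : E n),
    Tendsto (fun i => (φ i).rOut) atTop (𝓝 0) ∧ ∀ i, (φ i).rOut ≤ ε := by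
  have hp : ∀ i : ℕ, 0 < ε / (i + 1) := fun i => by positivity
  refine ⟨fun i => ⟨ε / (i + 1) / 2, ε / (i + 1), half_pos (hp i), half_lt_self (hp i)⟩, ?_, fun i => ?_⟩
  · have := (tendsto_one_div_add_atTop_nhds_zero_nat (𝕜 := ℝ)).const_mul ε
    rw [mul_zero] at this
    exact this.congr fun i => by simp [div_eq_mul_inv]
  · exact div_le_self hε.le (by linarith [(Nat.cast_nonneg i : (0 : ℝ) ≤ i)])

/-- `-Δ_A φ` for twice differentiable functions. -/
def lapA (A : E n → E n) (φ : E n → ℂ) (x : E n) : ℂ := -∑ j, cd A j (cd A j φ) x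

theorem OffOrigin.lapA (hA : ContDiffOn ℝ 1 A {0}ᶜ) {f : E n → ℂ} (hf : OffOrigin 2 f) :
    OffOrigin 0 (lapA A f) := by
  have h0 : ∀ j, OffOrigin 0 (cd A j (cd A j f)) := by
    intro j
    have h1 := hf.covDeriv hA j
    have h2 := OffOrigin.partialDeriv (m := 0) (f := cd A j f) (by simpa using h1) j
    have h3 := ((h1.of_le (k := 0) (by norm_num)).smul
      ((contDiffOn_component hA j).of_le (by norm_num))).const_mul I
    convert h2.add h3 using 2 with x
    simp only [cd, real_smul]
    ring
  have hs : ∀ s : Finset (Fin n), OffOrigin 0 fun x => ∑ j ∈ s, cd A j (cd A j f) x := by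
    intro s
    induction s using Finset.induction_on with
    | empty =>
      simp only [Finset.sum_empty]
      exact ⟨contDiff_const, HasCompactSupport.zero, by simp [tsupport]⟩
    | insert a s ha ih => simpa [Finset.sum_insert ha] using (h0 a).add ih
  convert (hs Finset.univ).const_mul (-1) using 2 with x
  simp [MagneticNLS.lapA]

/-- The inclusion of the `j`-th component. -/
def inclCLM (j : Fin n) : L2 n →L[ℂ] L2Vec n :=
  (LinearMap.toContinuousLinearMap (PiLp.basisFun 2 ℂ (Fin n) j |>
    (LinearMap.toSpanSingleton ℂ (CVec n))) : ℂ →L[ℂ] CVec n).compLpL 2 volume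

theorem inclCLM_ae (j : Fin n) (f : L2 n) :
    inclCLM j f =ᵐ[volume] fun x => EuclideanSpace.single j (f x) := by
  filter_upwards [(LinearMap.toContinuousLinearMap (PiLp.basisFun 2 ℂ (Fin n) j |>
    (LinearMap.toSpanSingleton ℂ (CVec n))) : ℂ →L[ℂ] CVec n).coeFn_compLpL f] with x hx
  refine hx.trans ?_
  ext k
  by_cases h : k = j <;> simp [h]

theorem sum_incl_ae (f : Fin n → L2 n) :
    (∑ j, inclCLM j (f j) : L2Vec n) =ᵐ[volume] fun x => WithLp.toLp 2 fun j => f j x := by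
  have h1 : (∑ j, inclCLM j (f j) : L2Vec n) =ᵐ[volume] fun x => ∑ j, inclCLM j (f j) x := by
    filter_upwards [Lp.coeFn_finsetSum Finset.univ fun j => inclCLM j (f j)] with x hx
    simpa using hx
  have h2 : ∀ᵐ x : E n, ∀ j, inclCLM j (f j) x = EuclideanSpace.single j (f j x) :=
    ae_all_iff.2 fun j => inclCLM_ae j (f j)
  filter_upwards [h1, h2] with x hx hx2
  rw [hx]
  simp only [hx2]
  ext k
  simp

/-! ### Localization -/

theorem OffOrigin.memLp_mul {g : E n → ℝ} (hg : OffOrigin 0 g) (f : L2 n) :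
    MemLp (fun x => (g x : ℂ) * f x) 2 volume := by
  obtain ⟨C, hC⟩ := hg.compact.exists_bound_of_continuous hg.contDiff.continuous
  refine (Lp.memLp f).of_le_mul (c := C)
    ((Complex.continuous_ofReal.comp hg.contDiff.continuous).aestronglyMeasurable.mul
      (Lp.memLp f).1) (ae_of_all _ fun x => ?_)
  rw [norm_mul, norm_real]
  exact mul_le_mul_of_nonneg_right (hC x) (norm_nonneg _)

/-- Multiplication by a continuous function with compact support. -/
def OffOrigin.mulL {g : E n → ℝ} (hg : OffOrigin 0 g) : L2 n →L[ℂ] L2 n :=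
  weightCLM g hg.contDiff.continuous.aestronglyMeasurable
    (hg.compact.exists_bound_of_continuous hg.contDiff.continuous).choose
    (hg.compact.exists_bound_of_continuous hg.contDiff.continuous).choose_spec

theorem OffOrigin.mulL_ae {g : E n → ℝ} (hg : OffOrigin 0 g) (f : L2 n) :
    hg.mulL f =ᵐ[volume] fun x => (g x : ℂ) * f x := weightCLM_ae _ _ _ _ f

theorem OffOrigin.mul_left {m : WithTop ℕ∞} {g ψ : E n → ℝ} (hg : OffOrigin m g)
    (hψ : ContDiff ℝ m ψ) : OffOrigin m fun x => ψ x * g x := hg.smul hψ.contDiffOn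

theorem integrable_mul_mul {g ψ : E n → ℝ} (hg : OffOrigin 0 g) (hψ : Continuous ψ) (f : L2 n) :
    Integrable fun x => (ψ x : ℂ) * ((g x : ℂ) * f x) := by
  have := integrable_real_mul (hg.mul_left (contDiff_zero.2 hψ)).ofReal_memLp f
  refine this.congr (ae_of_all _ fun x => ?_)
  push_cast
  ring

/-- The weak gradient of `χ u`. -/
def localGrad (p : covGradGraph A) (χ : E n → ℝ) (j : Fin n) (x : E n) : ℂ :=
  (χ x : ℂ) * compCLM j p.1.snd x - I * (((A x j * χ x : ℝ) : ℂ) * p.1.fst x) +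
    ((pd j χ x : ℝ) : ℂ) * p.1.fst x

/-- The weak divergence of `χ w`, when `f` is the covariant divergence of `w`. -/
def localDiv (A : E n → E n) (w : L2Vec n) (f : L2 n) (χ : E n → ℝ) (x : E n) : ℂ :=
  (χ x : ℂ) * f x + ∑ j, (I * (((A x j * χ x : ℝ) : ℂ) * compCLM j w x) -
    ((pd j χ x : ℝ) : ℂ) * compCLM j w x)

theorem OffOrigin.memLp_localGrad {χ : E n → ℝ} (hχ : OffOrigin 1 χ) (hA : ContDiffOn ℝ 1 A {0}ᶜ)
    (p : covGradGraph A) (j : Fin n) : MemLp (localGrad p χ j) 2 volume :=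
  (((hχ.of_le zero_le_one).memLp_mul _).sub
    ((((hχ.mul_component hA j).of_le zero_le_one).memLp_mul _).const_mul _)).add
      ((hχ.partialDeriv (m := 0) j).memLp_mul _)

theorem OffOrigin.memLp_localDiv {χ : E n → ℝ} (hχ : OffOrigin 1 χ) (hA : ContDiffOn ℝ 1 A {0}ᶜ)
    (w : L2Vec n) (f : L2 n) : MemLp (localDiv A w f χ) 2 volume :=
  ((hχ.of_le zero_le_one).memLp_mul _).add (memLp_finsetSum _ fun j _ =>
    ((((hχ.mul_component hA j).of_le zero_le_one).memLp_mul _).const_mul _).sub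
      ((hχ.partialDeriv (m := 0) j).memLp_mul _))

theorem weak_grad_local (hA : ContDiffOn ℝ 1 A {0}ᶜ) (p : covGradGraph A) {χ : E n → ℝ}
    (hχ : OffOrigin 1 χ) (j : Fin n) {ψ : E n → ℝ} (hψ : ContDiff ℝ 1 ψ) :
    ∫ x, ((pd j ψ x : ℝ) : ℂ) * ((χ x : ℂ) * p.1.fst x) = -∫ x, (ψ x : ℂ) * localGrad p χ j x := by
  have hw := weak_grad hA p (hχ.mul_left hψ) j
  have hχ0 : OffOrigin 0 χ := hχ.of_le (by norm_num)
  have hp : ∀ x, pd j (fun x => ψ x * χ x) x = pd j ψ x * χ x + ψ x * pd j χ x := fun x =>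
    pd_mul (hψ.differentiable one_ne_zero x) (hχ.contDiff.differentiable one_ne_zero x)
  have hpc : Continuous (pd j ψ) := (hψ.continuous_fderiv one_ne_zero).clm_apply continuous_const
  have i1 := integrable_mul_mul hχ0 hpc p.1.fst
  have i2 := integrable_mul_mul (hχ.partialDeriv (m := 0) j) hψ.continuous p.1.fst
  have i3 := integrable_mul_mul hχ0 hψ.continuous (compCLM j p.1.snd)
  have i4 := integrable_mul_mul ((hχ.mul_component hA j).of_le (k := 0) (by norm_num))
    hψ.continuous p.1.fst
  have e1 : ∫ x, ((pd j (fun x => ψ x * χ x) x : ℝ) : ℂ) * p.1.fst x =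
      (∫ x, ((pd j ψ x : ℝ) : ℂ) * ((χ x : ℂ) * p.1.fst x)) +
      ∫ x, (ψ x : ℂ) * (((pd j χ x : ℝ) : ℂ) * p.1.fst x) := by
    rw [← integral_add i1 i2]
    refine integral_congr_ae (ae_of_all _ fun x => ?_)
    simp only [hp]; push_cast; ring
  have e2 : ∫ x, ((ψ x * χ x : ℝ) : ℂ) * compCLM j p.1.snd x =
      ∫ x, (ψ x : ℂ) * ((χ x : ℂ) * compCLM j p.1.snd x) :=
    integral_congr_ae (ae_of_all _ fun x => by push_cast; ring)
  have e3 : ∫ x, ((A x j * (ψ x * χ x) : ℝ) : ℂ) * p.1.fst x =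
      ∫ x, (ψ x : ℂ) * (((A x j * χ x : ℝ) : ℂ) * p.1.fst x) :=
    integral_congr_ae (ae_of_all _ fun x => by push_cast; ring)
  have e4 : ∫ x, (ψ x : ℂ) * localGrad p χ j x =
      (∫ x, (ψ x : ℂ) * ((χ x : ℂ) * compCLM j p.1.snd x)) -
        I * (∫ x, (ψ x : ℂ) * (((A x j * χ x : ℝ) : ℂ) * p.1.fst x)) +
          ∫ x, (ψ x : ℂ) * (((pd j χ x : ℝ) : ℂ) * p.1.fst x) := by
    have i5 : Integrable fun x => (ψ x : ℂ) * ((χ x : ℂ) * compCLM j p.1.snd x) -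
        I * ((ψ x : ℂ) * (((A x j * χ x : ℝ) : ℂ) * p.1.fst x)) := i3.sub (i4.const_mul _)
    rw [← integral_const_mul, ← integral_sub i3 (i4.const_mul _), ← integral_add i5 i2]
    exact integral_congr_ae (ae_of_all _ fun x => by simp only [localGrad]; ring)
  rw [e1, e2, e3] at hw
  rw [e4]
  linear_combination hw

theorem weak_laplacian_local (hA : ContDiffOn ℝ 1 A {0}ᶜ) {f : L2 n} {w : L2Vec n}
    (h : ∀ p ∈ covGradGraph A, ⟪p.snd, w⟫_ℂ = ⟪p.fst, f⟫_ℂ) {χ : E n → ℝ} (hχ : OffOrigin ∞ χ)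
    {ψ : E n → ℝ} (hψ : ContDiff ℝ ∞ ψ) :
    ∑ j, ∫ x, ((pd j ψ x : ℝ) : ℂ) * ((χ x : ℂ) * compCLM j w x) =
      ∫ x, (ψ x : ℂ) * localDiv A w f χ x := by
  have hw := weak_laplacian hA h (hχ.mul_left hψ)
  have hχ1 : OffOrigin 1 χ := hχ.of_le (by norm_cast)
  have hχ0 : OffOrigin 0 χ := hχ.of_le (by norm_cast)
  have hψ1 : ContDiff ℝ 1 ψ := hψ.of_le (by norm_cast)
  have hp : ∀ j x, pd j (fun x => ψ x * χ x) x = pd j ψ x * χ x + ψ x * pd j χ x := fun j x =>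
    pd_mul (hψ1.differentiable one_ne_zero x) (hχ1.contDiff.differentiable one_ne_zero x)
  have hpc : ∀ j, Continuous (pd j ψ) := fun j =>
    (hψ1.continuous_fderiv one_ne_zero).clm_apply continuous_const
  have i1 := fun j => integrable_mul_mul hχ0 (hpc j) (compCLM j w)
  have i2 := fun j => integrable_mul_mul (hχ1.partialDeriv (m := 0) j) hψ.continuous (compCLM j w)
  have i3 := integrable_mul_mul hχ0 hψ.continuous f
  have i4 := fun j => integrable_mul_mul ((hχ1.mul_component hA j).of_le (k := 0) (by norm_num))
    hψ.continuous (compCLM j w)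
  have e1 : ∀ j, ∫ x, ((pd j (fun x => ψ x * χ x) x : ℝ) : ℂ) * compCLM j w x =
      (∫ x, ((pd j ψ x : ℝ) : ℂ) * ((χ x : ℂ) * compCLM j w x)) +
      ∫ x, (ψ x : ℂ) * (((pd j χ x : ℝ) : ℂ) * compCLM j w x) := by
    intro j
    rw [← integral_add (i1 j) (i2 j)]
    refine integral_congr_ae (ae_of_all _ fun x => ?_)
    simp only [hp]; push_cast; ring
  have e2 : ∫ x, ((ψ x * χ x : ℝ) : ℂ) * f x = ∫ x, (ψ x : ℂ) * ((χ x : ℂ) * f x) :=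
    integral_congr_ae (ae_of_all _ fun x => by push_cast; ring)
  have e3 : ∀ j, ∫ x, ((A x j * (ψ x * χ x) : ℝ) : ℂ) * compCLM j w x =
      ∫ x, (ψ x : ℂ) * (((A x j * χ x : ℝ) : ℂ) * compCLM j w x) := fun j =>
    integral_congr_ae (ae_of_all _ fun x => by push_cast; ring)
  have e4 : ∫ x, (ψ x : ℂ) * localDiv A w f χ x = (∫ x, (ψ x : ℂ) * ((χ x : ℂ) * f x)) +
        ∑ j, (I * (∫ x, (ψ x : ℂ) * (((A x j * χ x : ℝ) : ℂ) * compCLM j w x)) -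
          ∫ x, (ψ x : ℂ) * (((pd j χ x : ℝ) : ℂ) * compCLM j w x)) := by
    have i5 : ∀ j, Integrable fun x => I * ((ψ x : ℂ) * (((A x j * χ x : ℝ) : ℂ) *
        compCLM j w x)) - (ψ x : ℂ) * (((pd j χ x : ℝ) : ℂ) * compCLM j w x) :=
      fun j => ((i4 j).const_mul I).sub (i2 j)
    simp_rw [← integral_const_mul]
    simp_rw [fun j => (integral_sub ((i4 j).const_mul I) (i2 j)).symm]
    rw [← integral_finsetSum _ fun j _ => i5 j,
      ← integral_add i3 (integrable_finsetSum _ fun j _ => i5 j)]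
    refine integral_congr_ae (ae_of_all _ fun x => ?_)
    simp only [localDiv, mul_add, mul_sum]
    congr 1
    exact sum_congr rfl fun j _ => by ring
  rw [e2] at hw
  simp only [e1, e3] at hw
  rw [e4, ← hw, ← sum_add_distrib]
  exact sum_congr rfl fun j _ => by ring

end

section

variable {A : E n → E n}

open scoped Convolution

open ContinuousLinearMap

theorem OffOrigin.of_annulus {F : Type*} [NormedAddCommGroup F] [NormedSpace ℝ F]
    {m : WithTop ℕ∞} {f : E n → F} (hf : ContDiff ℝ m f) {a b : ℝ}
    (ha : 0 < a) (h : ∀ x, f x ≠ 0 → a ≤ ‖x‖ ∧ ‖x‖ ≤ b) :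
    OffOrigin m f ∧ ∀ x, x ∈ tsupport f → a ≤ ‖x‖ ∧ ‖x‖ ≤ b := by
  have hcl : IsClosed {x : E n | a ≤ ‖x‖ ∧ ‖x‖ ≤ b} :=
    (isClosed_le (α := ℝ) continuous_const continuous_norm).inter
      (isClosed_le (α := ℝ) continuous_norm continuous_const)
  have hs : tsupport f ⊆ {x : E n | a ≤ ‖x‖ ∧ ‖x‖ ≤ b} := closure_minimal (fun x hx => h x hx) hcl
  refine ⟨⟨hf, ?_, fun h0 => ?_⟩, fun x hx => hs hx⟩
  · exact HasCompactSupport.of_support_subset_isCompact (isCompact_closedBall (0 : E n) b)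
      fun x hx => mem_closedBall_zero_iff.2 (h x hx).2
  · have := (hs h0).1
    rw [norm_zero] at this
    linarith

theorem tendsto_toLp_mollify {U : E n → ℂ} (hU : MemLp U 2 volume)
    {φ : ℕ → ContDiffBump (0 : E n)} (hφ : Tendsto (fun i => (φ i).rOut) atTop (𝓝 0))
    {G : ℕ → E n → ℂ} (hG : ∀ i, MemLp (G i) 2 volume)
    (he : ∀ i x, G i x = ((φ i).normed volume ⋆[lsmul ℝ ℝ, volume] U) x) :
    Tendsto (fun i => (hG i).toLp _) atTop (𝓝 (hU.toLp _)) := by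
  rw [Lp.tendsto_Lp_iff_tendsto_eLpNorm'' _ _ _ hU]
  refine (tendsto_eLpNorm_mollify hU hφ).congr fun i => ?_
  congr 1
  ext x
  simp [he]

theorem pd_congr {F : Type*} [NormedAddCommGroup F] [NormedSpace ℝ F] {f g : E n → F} {x : E n}
    (h : f =ᶠ[𝓝 x] g) (j : Fin n) : pd j f x = pd j g x := by
  rw [pd, h.fderiv_eq, pd]

section Expressions

variable {a b : Fin n → E n → ℝ} (ha : ∀ j, OffOrigin 0 (a j)) (hb : ∀ j, OffOrigin 0 (b j))

/-- The covariant gradient in terms of the function and its partial derivatives. -/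
def gradExpr (ψ : Fin n → L2 n) (φ : L2 n) : L2Vec n := ∑ j, inclCLM j (ψ j + I • (ha j).mulL φ)

/-- The covariant Laplacian in terms of the function and its partial derivatives. -/
def lapExpr (θ : L2 n) (ψ : Fin n → L2 n) (φ : L2 n) : L2 n :=
  -(θ + ∑ j, (I • (hb j).mulL φ + (2 * I) • (ha j).mulL (ψ j) - (ha j).mulL ((ha j).mulL φ)))

theorem gradExpr_ae (ψ : Fin n → L2 n) (φ : L2 n) :
    gradExpr ha ψ φ =ᵐ[volume] fun x => WithLp.toLp 2 fun j =>
      ψ j x + I * ((a j x : ℂ) * φ x) := by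
  have h : ∀ᵐ x : E n, ∀ j, (ψ j + I • (ha j).mulL φ : L2 n) x =
      ψ j x + I * ((a j x : ℂ) * φ x) := by
    refine ae_all_iff.2 fun j => ?_
    filter_upwards [Lp.coeFn_add (ψ j) (I • (ha j).mulL φ),
      Lp.coeFn_smul I ((ha j).mulL φ), (ha j).mulL_ae φ] with x h1 h2 h3
    rw [h1, Pi.add_apply, h2, Pi.smul_apply, h3, smul_eq_mul]
  filter_upwards [sum_incl_ae fun j => ψ j + I • (ha j).mulL φ, h] with x h1 h2
  rw [gradExpr, h1]
  simp only [h2]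

theorem lapExpr_ae (θ : L2 n) (ψ : Fin n → L2 n) (φ : L2 n) :
    lapExpr ha hb θ ψ φ =ᵐ[volume] fun x => -(θ x + ∑ j, (I * ((b j x : ℂ) * φ x) +
      2 * I * ((a j x : ℂ) * ψ j x) - (a j x : ℂ) * ((a j x : ℂ) * φ x))) := by
  set T : Fin n → L2 n := fun j => I • (hb j).mulL φ +
    (2 * I) • (ha j).mulL (ψ j) - (ha j).mulL ((ha j).mulL φ) with hT
  have h : ∀ᵐ x : E n, ∀ j, T j x = I * ((b j x : ℂ) * φ x) +
      2 * I * ((a j x : ℂ) * ψ j x) - (a j x : ℂ) * ((a j x : ℂ) * φ x) := by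
    refine ae_all_iff.2 fun j => ?_
    filter_upwards [Lp.coeFn_sub (I • (hb j).mulL φ + (2 * I) • (ha j).mulL (ψ j))
      ((ha j).mulL ((ha j).mulL φ)), Lp.coeFn_add (I • (hb j).mulL φ)
      ((2 * I) • (ha j).mulL (ψ j)), Lp.coeFn_smul I ((hb j).mulL φ),
      Lp.coeFn_smul (2 * I) ((ha j).mulL (ψ j)), (hb j).mulL_ae φ, (ha j).mulL_ae (ψ j),
      (ha j).mulL_ae φ, (ha j).mulL_ae ((ha j).mulL φ)] with x h1 h2 h3 h4 h5 h6 h7 h8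
    rw [hT]
    simp only
    rw [h1, Pi.sub_apply, h2, Pi.add_apply, h3, Pi.smul_apply, h4, Pi.smul_apply, h5, h6, h8, h7,
      smul_eq_mul, smul_eq_mul]
  filter_upwards [Lp.coeFn_neg (θ + ∑ j, T j), Lp.coeFn_add θ (∑ j, T j),
    Lp.coeFn_finsetSum Finset.univ T, h] with x h1 h2 h3 h4
  rw [lapExpr, h1, Pi.neg_apply, h2, Pi.add_apply, h3]
  simp only [Finset.sum_apply, h4]

theorem tendsto_gradExpr {ψ : ℕ → Fin n → L2 n} {φ : ℕ → L2 n} {ψ0 : Fin n → L2 n} {φ0 : L2 n}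
    (hψ : ∀ j, Tendsto (fun i => ψ i j) atTop (𝓝 (ψ0 j))) (hφ : Tendsto φ atTop (𝓝 φ0)) :
    Tendsto (fun i => gradExpr ha (ψ i) (φ i)) atTop (𝓝 (gradExpr ha ψ0 φ0)) := by
  refine tendsto_finsetSum _ fun j _ => ((inclCLM j).continuous.tendsto _).comp ?_
  exact (hψ j).add ((((ha j).mulL.continuous.tendsto _).comp hφ).const_smul _)

theorem tendsto_lapExpr {θ : ℕ → L2 n} {ψ : ℕ → Fin n → L2 n} {φ : ℕ → L2 n} {θ0 : L2 n}
    {ψ0 : Fin n → L2 n} {φ0 : L2 n} (hθ : Tendsto θ atTop (𝓝 θ0))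
    (hψ : ∀ j, Tendsto (fun i => ψ i j) atTop (𝓝 (ψ0 j))) (hφ : Tendsto φ atTop (𝓝 φ0)) :
    Tendsto (fun i => lapExpr ha hb (θ i) (ψ i) (φ i)) atTop (𝓝 (lapExpr ha hb θ0 ψ0 φ0)) := by
  refine (hθ.add (tendsto_finsetSum _ fun j _ => ?_)).neg
  have h1 := ((ha j).mulL.continuous.tendsto _).comp hφ
  have h2 := ((hb j).mulL.continuous.tendsto _).comp hφ
  have h3 := ((ha j).mulL.continuous.tendsto _).comp (hψ j)
  have h4 := ((ha j).mulL.continuous.tendsto _).comp h1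
  exact ((h2.const_smul _).add (h3.const_smul _)).sub h4

end Expressions

/-- Elements of the domain of `-Δ_A` are, away from the origin and from infinity, limits of test
functions in the graph norm. -/
theorem exists_local_approx (hn : 3 ≤ n) (hA : ContDiffOn ℝ 1 A {0}ᶜ) (p : covGradGraph A) {f : L2 n}
    (h : ∀ q ∈ covGradGraph A, ⟪q.snd, p.1.snd⟫_ℂ = ⟪q.fst, f⟫_ℂ) {r0 : ℝ} (h₀ : 0 < r0) (r1 : ℝ) :
    ∃ (φ : ℕ → E n → ℂ) (hφ : ∀ i, OffOrigin 2 (φ i)) (U F : L2 n) (W : L2Vec n),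
      Tendsto (fun i => (testPair hA (hφ i)).fst) atTop (𝓝 U) ∧
      Tendsto (fun i => (testPair hA (hφ i)).snd) atTop (𝓝 W) ∧
      Tendsto (fun i => ((hφ i).lapA hA).memLp.toLp _) atTop (𝓝 F) ∧
      ∀ᵐ x, r0 ≤ ‖x‖ → ‖x‖ ≤ r1 → U x = p.1.fst x ∧ W x = p.1.snd x ∧ F x = f x := by
  obtain ⟨χ, hχ, hχ1⟩ := exists_cutoff (n := n) h₀ r1
  obtain ⟨s0, s1, hs0, hs⟩ := exists_annulus hχ.compact hχ.zero_notMem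
  obtain ⟨η, hη, hη1⟩ := exists_cutoff (n := n) (half_pos hs0) (s1 + s0 / 2)
  obtain ⟨ρ, hρ, hρε⟩ := exists_bumps (n := n) (half_pos hs0)
  have hχo : OffOrigin 1 χ := hχ.of_le (by norm_cast)
  have hχz : OffOrigin 0 χ := hχ.of_le (by norm_cast)
  have hdχ : ∀ j, OffOrigin 1 (pd j χ) := fun j =>
    OffOrigin.partialDeriv (m := 1) (hχ.of_le (by norm_cast)) j
  have hAχ : ∀ j, OffOrigin 1 fun x => A x j * χ x := fun j => hχo.mul_component hA j
  set u : L2 n := p.1.fst with hu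
  set w : Fin n → L2 n := fun j => compCLM j p.1.snd with hw
  set U : E n → ℂ := fun x => (χ x : ℂ) * u x with hU
  set V : Fin n → E n → ℂ := localGrad p χ with hV
  set S1 : E n → ℂ := localDiv A p.1.snd f χ with hS1
  set S2 : Fin n → E n → ℂ := fun j => localGrad p (fun x => A x j * χ x) j with hS2
  set S3 : Fin n → E n → ℂ := fun j => localGrad p (pd j χ) j with hS3
  set Z : E n → ℂ := fun x => -(S1 x + ∑ j, (I * S2 j x - S3 j x)) with hZ
  have mU : MemLp U 2 volume := hχz.memLp_mul u
  have mV : ∀ j, MemLp (V j) 2 volume := fun j => hχo.memLp_localGrad hA p j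
  have mS₁ : MemLp S1 2 volume := hχo.memLp_localDiv hA p.1.snd f
  have mS₂ : ∀ j, MemLp (S2 j) 2 volume := fun j => (hAχ j).memLp_localGrad hA p j
  have mS₃ : ∀ j, MemLp (S3 j) 2 volume := fun j => (hdχ j).memLp_localGrad hA p j
  have mZ : MemLp Z 2 volume := (mS₁.add (memLp_finsetSum _ fun j _ =>
    ((mS₂ j).const_mul _).sub (mS₃ j))).neg
  -- the weak derivatives
  have hmul : ∀ {ψ : E n → ℝ} {S : E n → ℂ}, ContDiff ℝ ∞ ψ → HasCompactSupport ψ →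
      MemLp S 2 volume → Integrable fun x => (ψ x : ℂ) * S x := by
    intro ψ S hψ hc hS
    have : MemLp (fun x => (ψ x : ℂ)) 2 (volume : Measure (E n)) :=
      (Complex.continuous_ofReal.comp hψ.continuous).memLp_of_hasCompactSupport
        (hc.comp_left Complex.ofReal_zero)
    exact this.integrable_mul hS
  have weakU : ∀ j (ψ : E n → ℝ), ContDiff ℝ ∞ ψ →
      ∫ x, ((pd j ψ x : ℝ) : ℂ) * U x = -∫ x, (ψ x : ℂ) * V j x := fun j ψ hψ =>
    weak_grad_local hA p hχo j (hψ.of_le (by norm_cast))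
  have weakV : ∀ ψ : E n → ℝ, ContDiff ℝ ∞ ψ → HasCompactSupport ψ →
      ∑ j, ∫ x, ((pd j ψ x : ℝ) : ℂ) * V j x = -∫ x, (ψ x : ℂ) * Z x := by
    intro ψ hψ hc
    have hψ1 : ContDiff ℝ 1 ψ := hψ.of_le (by norm_cast)
    have hpc : ∀ j, ContDiff ℝ ∞ (pd j ψ) := fun j =>
      (hψ.fderiv_right (m := ∞) (by norm_cast)).clm_apply contDiff_const
    have hps : ∀ j, HasCompactSupport (pd j ψ) := fun j => hc.fderiv_apply ℝ _
    have e1 : ∑ j, ∫ x, ((pd j ψ x : ℝ) : ℂ) * ((χ x : ℂ) * w j x) = ∫ x, (ψ x : ℂ) * S1 x :=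
      weak_laplacian_local hA h hχ hψ
    have e2 : ∀ j, ∫ x, ((pd j ψ x : ℝ) : ℂ) * (((A x j * χ x : ℝ) : ℂ) * u x) =
      -∫ x, (ψ x : ℂ) * S2 j x := fun j => weak_grad_local hA p (hAχ j) j hψ1
    have e3 : ∀ j, ∫ x, ((pd j ψ x : ℝ) : ℂ) * (((pd j χ x : ℝ) : ℂ) * u x) =
      -∫ x, (ψ x : ℂ) * S3 j x := fun j => weak_grad_local hA p (hdχ j) j hψ1
    have e4 : ∀ j, ∫ x, ((pd j ψ x : ℝ) : ℂ) * V j x =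
        (∫ x, ((pd j ψ x : ℝ) : ℂ) * ((χ x : ℂ) * w j x)) -
        I * (∫ x, ((pd j ψ x : ℝ) : ℂ) * (((A x j * χ x : ℝ) : ℂ) * u x)) +
        ∫ x, ((pd j ψ x : ℝ) : ℂ) * (((pd j χ x : ℝ) : ℂ) * u x) := by
      intro j
      have i1 := hmul (hpc j) (hps j) (hχz.memLp_mul (w j))
      have i2 := (hmul (hpc j) (hps j) (((hAχ j).of_le zero_le_one).memLp_mul u)).const_mul I
      have i3 := hmul (hpc j) (hps j) (((hdχ j).of_le zero_le_one).memLp_mul u)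
      have i4 : Integrable fun x => ((pd j ψ x : ℝ) : ℂ) * ((χ x : ℂ) * w j x) -
        I * (((pd j ψ x : ℝ) : ℂ) * (((A x j * χ x : ℝ) : ℂ) * u x)) := i1.sub i2
      rw [← integral_const_mul, ← integral_sub i1 i2, ← integral_add i4 i3]
      exact integral_congr_ae (ae_of_all _ fun x => by simp only [hV, localGrad]; ring)
    have e5 : ∫ x, (ψ x : ℂ) * Z x = -((∫ x, (ψ x : ℂ) * S1 x) +
        ∑ j, (I * (∫ x, (ψ x : ℂ) * S2 j x) - ∫ x, (ψ x : ℂ) * S3 j x)) := by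
      have i1 := hmul hψ hc mS₁
      have i2 := fun j => (hmul hψ hc (mS₂ j)).const_mul I
      have i3 := fun j => hmul hψ hc (mS₃ j)
      have i4 : ∀ j, Integrable fun x => I * ((ψ x : ℂ) * S2 j x) - (ψ x : ℂ) * S3 j x :=
        fun j => (i2 j).sub (i3 j)
      simp_rw [← integral_const_mul]
      simp_rw [fun j => (integral_sub (i2 j) (i3 j)).symm]
      rw [← integral_finsetSum _ fun j _ => i4 j,
        ← integral_add i1 (integrable_finsetSum _ fun j _ => i4 j), ← integral_neg]
      refine integral_congr_ae (ae_of_all _ fun x => ?_)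
      simp only [hZ, mul_neg, mul_add, mul_sum]
      congr 2
      exact sum_congr rfl fun j _ => by ring
    rw [e5, neg_neg]
    simp only [e4, e2, e3]
    rw [sum_add_distrib, sum_sub_distrib, e1]
    simp only [sum_neg_distrib, mul_neg, sum_sub_distrib]
    ring
  -- the mollified functions
  set φ : ℕ → E n → ℂ := fun i => (ρ i).normed volume ⋆[lsmul ℝ ℝ, volume] U with hφ
  have locU : LocallyIntegrable U volume := mU.locallyIntegrable one_le_two
  have locV : ∀ j, LocallyIntegrable (V j) volume := fun j => (mV j).locallyIntegrable one_le_two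
  have hφc : ∀ i, ContDiff ℝ ∞ (φ i) := fun i =>
    (ρ i).hasCompactSupport_normed.contDiff_convolution_left _ (ρ i).contDiff_normed locU
  have hφs : ∀ i x, φ i x ≠ 0 → s0 / 2 ≤ ‖x‖ ∧ ‖x‖ ≤ s1 + s0 / 2 := by
    intro i x hx
    obtain ⟨y, hy, z, hz, rfl⟩ := support_convolution_subset _ hx
    rw [(ρ i).support_normed_eq, mem_ball_zero_iff] at hy
    have hz' : z ∈ tsupport χ := by
      refine subset_tsupport _ fun h0 => hz ?_
      simp [hU, h0]
    have h1 := hs z hz'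
    have h2 := hρε i
    have h3 := norm_add_le y z
    have h4 : ‖z‖ ≤ ‖y + z‖ + ‖y‖ := by
      have := norm_sub_le (y + z) y
      rwa [add_sub_cancel_left] at this
    constructor <;> simp only at * <;> linarith
  have hann := fun i => OffOrigin.of_annulus (hφc i) (half_pos hs0) (hφs i)
  have hφ2 : ∀ i, OffOrigin 2 (φ i) := fun i => (hann i).1.of_le (by norm_cast)
  have hdφ : ∀ i j, OffOrigin 1 (pd j (φ i)) := fun i j =>
    OffOrigin.partialDeriv (m := 1) ((hann i).1.of_le (by norm_cast)) j
  have hpφ : ∀ i j x, pd j (φ i) x = ((ρ i).normed volume ⋆[lsmul ℝ ℝ, volume] V j) x := by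
    intro i j x
    obtain ⟨ψ, hψ, -, h1, h2⟩ := exists_mollify_kernel (ρ i) x
    rw [h2 U locU, h1, weakU j ψ hψ, neg_neg]
  have hlφ : ∀ i x, ∑ j, pd j (pd j (φ i)) x = ((ρ i).normed volume ⋆[lsmul ℝ ℝ, volume] Z) x := by
    intro i x
    obtain ⟨ψ, hψ, hc, h1, h2⟩ := exists_mollify_kernel (ρ i) x
    simp only [funext (hpφ i _)]
    simp only [fun j => h2 (V j) (locV j) j, sum_neg_distrib]
    rw [h1, weakV ψ hψ hc, neg_neg]
  have hθ : ∀ i, MemLp (fun x => ∑ j, pd j (pd j (φ i)) x) 2 volume := fun i =>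
    memLp_finsetSum _ fun j _ => ((hdφ i j).partialDeriv (m := 0) j).memLp
  -- convergence
  set a : Fin n → E n → ℝ := fun j x => A x j * η x
  set b : Fin n → E n → ℝ := fun j x => pd j (fun y => A y j) x * η x
  have ha : ∀ j, OffOrigin 0 (a j) := fun j =>
    ((OffOrigin.of_le hη (k := 1) (by norm_cast)).mul_component hA j).of_le zero_le_one
  have hb : ∀ j, OffOrigin 0 (b j) := fun j => (OffOrigin.of_le hη (k := 0) (by norm_cast)).smul
    (contDiffOn_zero.2 (((contDiffOn_component hA j).continuousOn_fderiv_of_isOpen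
      isOpen_compl_singleton le_rfl).clm_apply continuousOn_const))
  have tU := tendsto_toLp_mollify mU hρ (fun i => (hφ2 i).memLp) fun i x => rfl
  have tV := fun j => tendsto_toLp_mollify (mV j) hρ (fun i => (hdφ i j).memLp) fun i x => hpφ i j x
  have tZ := tendsto_toLp_mollify mZ hρ hθ hlφ
  have hfst : ∀ i, (testPair hA (hφ2 i)).fst = (hφ2 i).memLp.toLp _ := fun i =>
    Lp.ext ((testPair_fst_ae hA (hφ2 i)).trans (hφ2 i).memLp.coeFn_toLp.symm)
  have hloc : ∀ i x, η x = 1 ∨ (φ i x = 0 ∧ ∀ j, pd j (φ i) x = 0) := by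
    intro i x
    by_cases hx : x ∈ tsupport (φ i)
    · have := (hann i).2 x hx
      exact Or.inl (hη1 x this.1 this.2).self_of_nhds
    · refine Or.inr ⟨image_eq_zero_of_notMem_tsupport hx, fun j => ?_⟩
      exact pd_of_notMem_tsupport hx j
  have hsnd : ∀ i, (testPair hA (hφ2 i)).snd =
      gradExpr ha (fun j => (hdφ i j).memLp.toLp _) ((hφ2 i).memLp.toLp _) := by
    intro i
    apply Lp.ext
    filter_upwards [testPair_snd_ae hA (hφ2 i), gradExpr_ae ha (fun j => (hdφ i j).memLp.toLp _)
      ((hφ2 i).memLp.toLp _), (hφ2 i).memLp.coeFn_toLp,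
      ae_all_iff.2 fun j => (hdφ i j).memLp.coeFn_toLp] with x h1 h2 h3 h4
    rw [h1, h2]
    ext j
    rw [covGradFun_apply, cd]
    simp only [h3, h4]
    rcases hloc i x with h5 | h5
    · simp only [a, h5, mul_one, mul_assoc]
    · simp [h5.1]
  have hlap : ∀ i, ((hφ2 i).lapA hA).memLp.toLp _ = lapExpr ha hb ((hθ i).toLp _)
      (fun j => (hdφ i j).memLp.toLp _) ((hφ2 i).memLp.toLp _) := by
    intro i
    apply Lp.ext
    filter_upwards [((hφ2 i).lapA hA).memLp.coeFn_toLp, lapExpr_ae ha hb ((hθ i).toLp _)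
      (fun j => (hdφ i j).memLp.toLp _) ((hφ2 i).memLp.toLp _), (hφ2 i).memLp.coeFn_toLp,
      ae_all_iff.2 fun j => (hdφ i j).memLp.coeFn_toLp, (hθ i).coeFn_toLp, ae_ne_zero hn]
      with x h1 h2 h3 h4 h5 h6
    rw [h1, h2, lapA, h3, h5, ← sum_add_distrib]
    congr 1
    refine sum_congr rfl fun j _ => ?_
    rw [h4, cd_cd hA (hφ2 i).contDiff j j h6]
    rcases hloc i x with h7 | h7
    · simp only [a, b, h7, mul_one]
      ring
    · simp [h7.1, h7.2]
  refine ⟨φ, hφ2, mU.toLp _, lapExpr ha hb (mZ.toLp _) (fun j => (mV j).toLp _) (mU.toLp _),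
    gradExpr ha (fun j => (mV j).toLp _) (mU.toLp _), ?_, ?_, ?_, ?_⟩
  · simp only [hfst]
    exact tU
  · simp only [hsnd]
    exact tendsto_gradExpr ha tV tU
  · simp only [hlap]
    exact tendsto_lapExpr ha hb tZ tV tU
  filter_upwards [gradExpr_ae ha (fun j => (mV j).toLp _) (mU.toLp _),
    lapExpr_ae ha hb (mZ.toLp _) (fun j => (mV j).toLp _) (mU.toLp _), mU.coeFn_toLp, mZ.coeFn_toLp,
    ae_all_iff.2 fun j => (mV j).coeFn_toLp, ae_all_iff.2 fun j => compCLM_ae j p.1.snd]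
    with x h1 h2 h3 h4 h5 h6 hx0 hx1
  have hχe := hχ1 x hx0 hx1
  have hχx : χ x = 1 := hχe.self_of_nhds
  have hxs := hs x (subset_tsupport _ (by simp [hχx]))
  have hηx : η x = 1 := (hη1 x (by linarith) (by linarith)).self_of_nhds
  have hd1 : ∀ j, pd j χ x = 0 := fun j => by rw [pd_congr hχe]; simp [pd]
  have hd2 : ∀ j, pd j (pd j χ) x = 0 := fun j => by
    have : pd j χ =ᶠ[𝓝 x] fun _ => 0 := by
      filter_upwards [hχe.eventuallyEq_nhds] with y hy
      rw [pd_congr hy]; simp [pd]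
    rw [pd_congr this]; simp [pd]
  have hd3 : ∀ j, pd j (fun y => A y j * χ y) x = pd j (fun y => A y j) x := fun j => by
    refine pd_congr ?_ j
    filter_upwards [hχe] with y hy
    rw [hy, mul_one]
  have hVx : ∀ j, V j x = p.1.snd x j - I * ((A x j : ℂ) * u x) := by
    intro j
    simp only [hV, localGrad, hχx, hd1, h6]
    push_cast
    ring
  have h3' : (mU.toLp U : L2 n) x = u x := by
    rw [h3]
    simp [hU, hχx]
  refine ⟨h3', ?_, ?_⟩
  · rw [h1]
    ext j
    simp only [h5, h3', hVx, a, hηx]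
    push_cast
    ring
  · rw [h2, h3, h4]
    simp only [h5, hVx, hZ, hS1, hS2, hS3, localGrad, localDiv, a, b, hU, hχx, hηx, hd1, hd2, hd3, h6]
    push_cast
    rw [neg_add_rev, neg_neg, ← sub_eq_neg_add]
    rw [add_assoc, ← sum_add_distrib, add_sub_assoc, ← sum_sub_distrib]
    rw [Finset.sum_eq_zero, add_zero, one_mul]
    intro j _
    linear_combination ((A x j : ℂ) ^ 2 * u x) * I_mul_I

end

section

variable {A : E n → E n}

/-! ### The virial identity -/

/-- The real part of the inner product of two complex numbers. -/
def rip (z w : ℂ) : ℝ := z.re * w.re + z.im * w.im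

theorem re_inner_eq_rip (z w : ℂ) : (⟪z, w⟫_ℂ).re = rip z w := by
  simp only [RCLike.inner_apply, mul_re, conj_re, conj_im, rip]
  ring

theorem rip_comm (z w : ℂ) : rip z w = rip w z := by simp only [rip]; ring

theorem rip_self (z : ℂ) : rip z z = ‖z‖ ^ 2 := by rw [← re_inner_eq_rip, re_inner_self_eq]

theorem rip_sum_left {ι : Type*} (s : Finset ι) (f : ι → ℂ) (w : ℂ) :
    rip (∑ i ∈ s, f i) w = ∑ i ∈ s, rip (f i) w := by
  simp only [rip, re_sum, im_sum, sum_mul, sum_add_distrib]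

theorem rip_sum_right {ι : Type*} (s : Finset ι) (f : ι → ℂ) (w : ℂ) :
    rip w (∑ i ∈ s, f i) = ∑ i ∈ s, rip w (f i) := by
  simp only [rip, re_sum, im_sum, mul_sum, sum_add_distrib]

theorem rip_real_mul_left (c : ℝ) (z w : ℂ) : rip ((c : ℂ) * z) w = c * rip z w := by
  simp only [rip, re_ofReal_mul, im_ofReal_mul]; ring

theorem rip_real_mul_right (c : ℝ) (z w : ℂ) : rip z ((c : ℂ) * w) = c * rip z w := by
  simp only [rip, re_ofReal_mul, im_ofReal_mul]; ring

/-- The algebra behind the virial identity: `d` stands for the covariant derivatives, `D` for the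
second covariant derivatives, `F` for the magnetic field and `ξ` for the direction `x / |x|`. -/
theorem virial_algebra {ξ : Fin n → ℝ} (hξ : ∑ j, ξ j ^ 2 = 1) {d : Fin n → ℂ}
    {D : Fin n → Fin n → ℂ} {φ : ℂ} {F : Fin n → Fin n → ℝ} (hF : ∀ j k, F j k = -F k j)
    (hD : ∀ j k, D j k = D k j + I * (F j k : ℂ) * φ) {a a' b v v' : ℝ}
    (hv : v = a' + (n - 1) * b) :
    ∑ j, ((∑ k, 2 * (((a' - b) * ξ j * ξ k + if k = j then b else 0) * rip (d k) (d j) +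
        a * ξ k * (rip (D j k) (d j) + rip (d k) (D j j)))) +
      (v' * ξ j * rip φ (d j) + v * (rip (d j) (d j) + rip φ (D j j))) -
      (((a' - b) * ξ j * ξ j + b) * (∑ k, rip (d k) (d k)) +
        a * ξ j * ∑ k, 2 * rip (d k) (D j k))) =
    2 * a * rip (∑ j, D j j) (∑ k, (ξ k : ℂ) * d k) + v * rip (∑ j, D j j) φ +
      2 * (a' - b) * rip (∑ k, (ξ k : ℂ) * d k) (∑ k, (ξ k : ℂ) * d k) +
      2 * b * (∑ k, rip (d k) (d k)) + v' * rip (∑ k, (ξ k : ℂ) * d k) φ +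
      ∑ j, (-(2 * a * ∑ k, ξ k * F k j)) * rip (d j) (I * φ) := by
  set N := ∑ k, rip (d k) (d k) with hN
  have T1 : ∑ j, ∑ k, ξ j * ξ k * rip (d k) (d j) =
      rip (∑ k, (ξ k : ℂ) * d k) (∑ k, (ξ k : ℂ) * d k) := by
    rw [rip_sum_right]
    refine sum_congr rfl fun j _ => ?_
    rw [rip_sum_left]
    refine sum_congr rfl fun k _ => ?_
    rw [rip_real_mul_left, rip_real_mul_right]
    ring
  have T2 : ∑ j, ∑ k, (if k = j then b else 0) * rip (d k) (d j) = b * N := by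
    rw [hN, mul_sum]
    refine sum_congr rfl fun j _ => ?_
    rw [Finset.sum_eq_single j] <;> simp +contextual
  have T3 : ∑ j, ∑ k, ξ k * rip (d k) (D j j) = rip (∑ j, D j j) (∑ k, (ξ k : ℂ) * d k) := by
    rw [rip_sum_left]
    refine sum_congr rfl fun j _ => ?_
    rw [rip_sum_right]
    refine sum_congr rfl fun k _ => ?_
    rw [rip_real_mul_right, rip_comm]
  have T4 : ∑ j, ∑ k, ξ k * rip (D j k) (d j) = (∑ j, ∑ k, ξ j * rip (d k) (D j k)) +
      ∑ j, (-(∑ k, ξ k * F k j)) * rip (d j) (I * φ) := by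
    rw [Finset.sum_comm (f := fun j k => ξ j * rip (d k) (D j k)), ← sum_add_distrib]
    refine sum_congr rfl fun j _ => ?_
    rw [← sum_neg_distrib, sum_mul, ← sum_add_distrib]
    refine sum_congr rfl fun k _ => ?_
    rw [hD j k, hF j k]
    simp only [rip, add_re, add_im, mul_re, mul_im, I_re,
      I_im, Complex.ofReal_re, Complex.ofReal_im]
    ring
  have T5 : ∑ j, ξ j * rip φ (d j) = rip (∑ k, (ξ k : ℂ) * d k) φ := by
    rw [rip_sum_left]
    refine sum_congr rfl fun j _ => ?_
    rw [rip_real_mul_left, rip_comm]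
  have T6 : ∑ j, rip φ (D j j) = rip (∑ j, D j j) φ := by
    rw [rip_comm, rip_sum_right]
  have key : ∀ j, ((∑ k, 2 * (((a' - b) * ξ j * ξ k + if k = j then b else 0) * rip (d k) (d j) +
        a * ξ k * (rip (D j k) (d j) + rip (d k) (D j j)))) +
      (v' * ξ j * rip φ (d j) + v * (rip (d j) (d j) + rip φ (D j j))) -
      (((a' - b) * ξ j * ξ j + b) * N + a * ξ j * ∑ k, 2 * rip (d k) (D j k))) =
      2 * (a' - b) * (∑ k, ξ j * ξ k * rip (d k) (d j)) +
      2 * (∑ k, (if k = j then b else 0) * rip (d k) (d j)) +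
      2 * a * (∑ k, ξ k * rip (D j k) (d j)) + 2 * a * (∑ k, ξ k * rip (d k) (D j j)) +
      v' * (ξ j * rip φ (d j)) + v * rip (d j) (d j) + v * rip φ (D j j) -
      (a' - b) * N * ξ j ^ 2 - b * N - 2 * a * ∑ k, ξ j * rip (d k) (D j k) := by
    intro j
    have e1 : (∑ k, 2 * (((a' - b) * ξ j * ξ k + if k = j then b else 0) * rip (d k) (d j) +
        a * ξ k * (rip (D j k) (d j) + rip (d k) (D j j)))) =
        2 * (a' - b) * (∑ k, ξ j * ξ k * rip (d k) (d j)) +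
      2 * (∑ k, (if k = j then b else 0) * rip (d k) (d j)) +
      2 * a * (∑ k, ξ k * rip (D j k) (d j)) + 2 * a * (∑ k, ξ k * rip (d k) (D j j)) := by
      simp only [mul_sum, ← sum_add_distrib]
      exact sum_congr rfl fun k _ => by ring
    have e2 : a * ξ j * ∑ k, 2 * rip (d k) (D j k) = 2 * a * ∑ k, ξ j * rip (d k) (D j k) := by
      simp only [mul_sum]
      exact sum_congr rfl fun k _ => by ring
    rw [e1, e2]
    ring
  have e3 : ∑ j, (-(2 * a * ∑ k, ξ k * F k j)) * rip (d j) (I * φ) =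
      2 * a * ∑ j, (-(∑ k, ξ k * F k j)) * rip (d j) (I * φ) := by
    rw [mul_sum]
    exact sum_congr rfl fun k _ => by ring
  rw [sum_congr rfl fun j _ => key j]
  simp only [sum_add_distrib, sum_sub_distrib, ← mul_sum]
  simp only [← mul_sum] at T4
  rw [T1, T2, T3, T4, T5, T6, hξ, ← hN, e3, hv]
  simp only [Finset.sum_const, Finset.card_univ, Fintype.card_fin, nsmul_eq_mul]
  ring

theorem pd_rip (A : E n → E n) {f g : E n → ℂ} {x : E n} {j : Fin n} (hf : DifferentiableAt ℝ f x)
    (hg : DifferentiableAt ℝ g x) :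
    pd j (fun y => rip (f y) (g y)) x = rip (cd A j f x) (g x) + rip (f x) (cd A j g x) := by
  have hc : DifferentiableAt ℝ (fun y => (starRingEnd ℂ) (g y)) x :=
    conjCLE.differentiableAt.comp x hg
  have hm : DifferentiableAt ℝ (fun y => f y * (starRingEnd ℂ) (g y)) x := hf.mul hc
  have e : (fun y => rip (f y) (g y)) = fun y => (f y * (starRingEnd ℂ) (g y)).re := by
    ext y; simp [rip]
  rw [e, pd_re hm, cd_mul_conj (A := A) hf hg]
  simp [rip]

theorem magneticField_antisymm (A : E n → E n) (x : E n) (j k : Fin n) :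
    magneticField A x j k = -magneticField A x k j := by simp [magneticField]

theorem contDiffAt_rip {f g : E n → ℂ} {x : E n} (hf : ContDiffAt ℝ 1 f x) (hg : ContDiffAt ℝ 1 g x) :
    ContDiffAt ℝ 1 (fun y => rip (f y) (g y)) x :=
  ((reCLM.contDiff.contDiffAt.comp x hf).mul (reCLM.contDiff.contDiffAt.comp x hg)).add
    ((imCLM.contDiff.contDiffAt.comp x hf).mul (imCLM.contDiff.contDiffAt.comp x hg))

theorem differentiableAt_rip {f g : E n → ℂ} {x : E n} (hf : DifferentiableAt ℝ f x)
    (hg : DifferentiableAt ℝ g x) : DifferentiableAt ℝ (fun y => rip (f y) (g y)) x :=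
  ((reCLM.differentiableAt.comp x hf).mul (reCLM.differentiableAt.comp x hg)).add
    ((imCLM.differentiableAt.comp x hf).mul (imCLM.differentiableAt.comp x hg))

/-- The radial multipliers `2 a(r) ∂_r + v(r)`, `v = div (a(r) x/|x|)`, with their derivatives. -/
structure Multiplier (n : ℕ) (a a' v v' : ℝ → ℝ) : Prop where
  deriv_a : ∀ r, 0 < r → HasDerivAt a (a' r) r
  deriv_v : ∀ r, 0 < r → HasDerivAt v (v' r) r
  v_eq : ∀ r, 0 < r → v r = a' r + (n - 1) * (a r / r)
  cont_v' : ContinuousOn v' (Ioi 0)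

section Virial

variable {a a' v v' : ℝ → ℝ}

theorem Multiplier.cont_a (hm : Multiplier n a a' v v') : ContinuousOn a (Ioi 0) :=
  fun r hr => (hm.deriv_a r hr).continuousAt.continuousWithinAt

theorem Multiplier.cont_v (hm : Multiplier n a a' v v') : ContinuousOn v (Ioi 0) :=
  fun r hr => (hm.deriv_v r hr).continuousAt.continuousWithinAt

theorem Multiplier.cont_a' (hm : Multiplier n a a' v v') : ContinuousOn a' (Ioi 0) := by
  have : ContinuousOn (fun r => v r - (n - 1) * (a r / r)) (Ioi 0) :=
    hm.cont_v.sub (continuousOn_const.mul (hm.cont_a.div continuousOn_id fun r hr => ne_of_gt hr))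
  exact this.congr fun r hr => by simp only [hm.v_eq r hr]; ring

/-- The divergence form of the virial identity. -/
theorem virial_div (hn : 3 ≤ n) (hm : Multiplier n a a' v v') (hA : ContDiffOn ℝ 1 A {0}ᶜ) {f : E n → ℂ}
    (hf : OffOrigin 2 f) : ∫ x, (
      -(2 * a ‖x‖ * rip (lapA A f x) (radial x (covGradFun A f x))) - v ‖x‖ * rip (lapA A f x) (f x) +
      2 * a' ‖x‖ * ‖radial x (covGradFun A f x)‖ ^ 2 +
      2 * (a ‖x‖ / ‖x‖) * ‖tangential x (covGradFun A f x)‖ ^ 2 +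
      v' ‖x‖ * rip (radial x (covGradFun A f x)) (f x) +
      ∑ j, (-(2 * a ‖x‖ * trapping A x j)) * rip (cd A j f x) (I * f x)) = 0 := by
  set X : Fin n → E n → ℝ := fun k y => a ‖y‖ * (y k / ‖y‖) with hX
  set d : Fin n → E n → ℂ := fun k => cd A k f with hd
  have hdo : ∀ k, OffOrigin 1 (d k) := fun k => hf.covDeriv hA k
  set Q : Fin n → E n → ℝ := fun j y => (∑ k, 2 * (X k y * rip (d k y) (d j y))) +
    v ‖y‖ * rip (f y) (d j y) - X j y * ∑ k, rip (d k y) (d k y) with hQ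
  have hac : ContDiffOn ℝ 1 a (Ioi 0) := contDiffOn_one_of_hasDerivAt isOpen_Ioi hm.deriv_a hm.cont_a'
  have hvc : ContDiffOn ℝ 1 v (Ioi 0) := contDiffOn_one_of_hasDerivAt isOpen_Ioi hm.deriv_v hm.cont_v'
  have hXc : ∀ k, ContDiffOn ℝ 1 (X k) {0}ᶜ := fun k => (contDiffOn_norm_comp hac).mul (contDiffOn_dir k)
  have hvE : ContDiffOn ℝ 1 (fun y : E n => v ‖y‖) {0}ᶜ := contDiffOn_norm_comp hvc
  have hat : ∀ {g : E n → ℝ} {x : E n}, ContDiffOn ℝ 1 g {0}ᶜ → x ≠ 0 → ContDiffAt ℝ 1 g x :=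
    fun hg hx => hg.contDiffAt (isOpen_compl_singleton.mem_nhds hx)
  have hd0 : ∀ {x}, x ∉ tsupport f → ∀ k, d k x = 0 := by
    intro x hx k
    have h1 : f x = 0 := image_eq_zero_of_notMem_tsupport hx
    simp only [hd, cd, h1, pd_of_notMem_tsupport hx, mul_zero, add_zero]
  have hf1 : OffOrigin 1 f := hf.of_le (by norm_num)
  have hQo : ∀ j, OffOrigin 1 (Q j) := by
    intro j
    refine hf1.mono_support (fun x hx _ => ?_) fun x hx => ?_
    · refine ((ContDiffAt.sum fun k _ => contDiffAt_const.mul ((hat (hXc k) hx).mul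
        (contDiffAt_rip (hdo k).contDiff.contDiffAt (hdo j).contDiff.contDiffAt))).add
        ((hat hvE hx).mul (contDiffAt_rip hf1.contDiff.contDiffAt (hdo j).contDiff.contDiffAt))).sub
        ((hat (hXc j) hx).mul (ContDiffAt.sum fun k _ =>
          contDiffAt_rip (hdo k).contDiff.contDiffAt (hdo k).contDiff.contDiffAt))
    · by_contra hne
      exact hx (by simp [hQ, hd0 hne, rip])
  rw [← (integral_sum_pd hQo).2]
  refine integral_congr_ae ?_
  filter_upwards [ae_ne_zero hn] with x hx0
  have hpos : 0 < ‖x‖ := norm_pos_iff.2 hx0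
  have hfd : DifferentiableAt ℝ f x := hf.contDiff.differentiable two_ne_zero x
  have hdd : ∀ k, DifferentiableAt ℝ (d k) x := fun k =>
    (hdo k).contDiff.differentiable one_ne_zero x
  have hXd : ∀ k, DifferentiableAt ℝ (X k) x := fun k =>
    (hat (hXc k) hx0).differentiableAt one_ne_zero
  have hvd : DifferentiableAt ℝ (fun y : E n => v ‖y‖) x :=
    (hat hvE hx0).differentiableAt one_ne_zero
  have e : ∀ j, pd j (Q j) x = (∑ k, 2 * (((a' ‖x‖ - a ‖x‖ / ‖x‖) * (x j / ‖x‖) * (x k / ‖x‖) +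
        if k = j then a ‖x‖ / ‖x‖ else 0) * rip (d k x) (d j x) +
        a ‖x‖ * (x k / ‖x‖) * (rip (cd A j (d k) x) (d j x) + rip (d k x) (cd A j (d j) x)))) +
      (v' ‖x‖ * (x j / ‖x‖) * rip (f x) (d j x) +
        v ‖x‖ * (rip (d j x) (d j x) + rip (f x) (cd A j (d j) x))) -
      (((a' ‖x‖ - a ‖x‖ / ‖x‖) * (x j / ‖x‖) * (x j / ‖x‖) + a ‖x‖ / ‖x‖) *
        (∑ k, rip (d k x) (d k x)) +
        a ‖x‖ * (x j / ‖x‖) * ∑ k, 2 * rip (d k x) (cd A j (d k) x)) := by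
    intro j
    have s1 : ∀ k, DifferentiableAt ℝ (fun y => X k y * rip (d k y) (d j y)) x := fun k =>
      (hXd k).mul (differentiableAt_rip (hdd k) (hdd j))
    have s2 : DifferentiableAt ℝ (fun y => ∑ k, 2 * (X k y * rip (d k y) (d j y))) x :=
      DifferentiableAt.fun_sum fun k _ => (s1 k).const_mul 2
    have s3 : DifferentiableAt ℝ (fun y => v ‖y‖ * rip (f y) (d j y)) x :=
      hvd.mul (differentiableAt_rip hfd (hdd j))
    have s4 : DifferentiableAt ℝ (fun y => ∑ k, rip (d k y) (d k y)) x :=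
      DifferentiableAt.fun_sum fun k _ => differentiableAt_rip (hdd k) (hdd k)
    have s6 : DifferentiableAt ℝ (fun y => (∑ k, 2 * (X k y * rip (d k y) (d j y))) +
        v ‖y‖ * rip (f y) (d j y)) x := s2.add s3
    have s5 : DifferentiableAt ℝ (fun y => X j y * ∑ k, rip (d k y) (d k y)) x := (hXd j).mul s4
    have t1 : ∀ k, pd j (X k) x = (a' ‖x‖ - a ‖x‖ / ‖x‖) * (x j / ‖x‖) * (x k / ‖x‖) +
        if k = j then a ‖x‖ / ‖x‖ else 0 := fun k =>
      pd_norm_comp_mul_dir hx0 (hm.deriv_a _ hpos) j k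
    simp only [hQ]
    rw [pd_sub s6 s5, pd_add s2 s3, pd_sum fun k _ => (s1 k).const_mul 2,
      pd_mul hvd (differentiableAt_rip hfd (hdd j)), pd_mul (hXd j) s4,
      pd_sum fun k _ => differentiableAt_rip (hdd k) (hdd k), pd_norm_comp hx0 (hm.deriv_v _ hpos),
      pd_rip A hfd (hdd j), t1, if_pos rfl]
    have h1 : ∀ k, pd j (fun y => 2 * (X k y * rip (d k y) (d j y))) x =
        2 * (((a' ‖x‖ - a ‖x‖ / ‖x‖) * (x j / ‖x‖) * (x k / ‖x‖) +
        if k = j then a ‖x‖ / ‖x‖ else 0) * rip (d k x) (d j x) +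
        a ‖x‖ * (x k / ‖x‖) * (rip (cd A j (d k) x) (d j x) + rip (d k x) (cd A j (d j) x))) := by
      intro k
      rw [pd_const_mul _ (s1 k), pd_mul (hXd k) (differentiableAt_rip (hdd k) (hdd j)), t1,
        pd_rip A (hdd k) (hdd j)]
    have h2 : ∀ k, pd j (fun y => rip (d k y) (d k y)) x = 2 * rip (d k x) (cd A j (d k) x) := by
      intro k
      rw [pd_rip A (hdd k) (hdd k), rip_comm (cd A j (d k) x)]
      ring
    simp only [h1, h2]
    rfl
  simp only [e]
  rw [virial_algebra (sum_dir_sq hx0) (magneticField_antisymm A x)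
    (fun j k => cd_comm hA hf.contDiff j k hx0) (hm.v_eq _ hpos)]
  have r1 : radial x (covGradFun A f x) = ∑ k, ((x k / ‖x‖ : ℝ) : ℂ) * d k x := rfl
  have r2 : ∑ k, rip (d k x) (d k x) =
      ‖radial x (covGradFun A f x)‖ ^ 2 + ‖tangential x (covGradFun A f x)‖ ^ 2 := by
    rw [← norm_sq_eq_radial_add hx0, norm_sq_eq]
    exact sum_congr rfl fun k _ => rip_self _
  have r3 : lapA A f x = -∑ j, cd A j (d j) x := rfl
  have r4 : ∀ z w, rip (-z) w = -rip z w := fun z w => by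
    simp only [rip, neg_re, neg_im]
    ring
  rw [r2, ← r1, r3, r4, r4, rip_self]
  have r5 : ∀ j, trapping A x j = ∑ k, x k / ‖x‖ * magneticField A x k j := fun j => rfl
  simp only [r5, hd]
  ring

end Virial

end

section

variable {A : E n → E n} {a a' v v' : ℝ → ℝ}

theorem continuousOn_trapping (hA : ContDiffOn ℝ 1 A {0}ᶜ) (j : Fin n) :
    ContinuousOn (fun x => trapping A x j) {0}ᶜ := by
  have hF : ContinuousOn (fderiv ℝ A) {0}ᶜ :=
    hA.continuousOn_fderiv_of_isOpen isOpen_compl_singleton le_rfl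
  have hc : ∀ i k : Fin n, ContinuousOn (fun x => (fderiv ℝ A x (basisVec i)) k) {0}ᶜ := fun i k =>
    (proj (𝕜 := ℝ) k : E n →L[ℝ] ℝ).continuous.comp_continuousOn (hF.clm_apply continuousOn_const)
  have e : (fun x => trapping A x j) = fun x : E n => ∑ k, x k / ‖x‖ * magneticField A x k j := rfl
  rw [e]
  refine continuousOn_finsetSum _ fun k _ => ?_
  exact (contDiffOn_dir (m := 0) k).continuousOn.mul ((hc k j).sub (hc j k))

theorem continuousOn_norm_comp {h : ℝ → ℝ} (hh : ContinuousOn h (Ioi 0)) :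
    ContinuousOn (fun x : E n => h ‖x‖) {0}ᶜ :=
  hh.comp continuous_norm.continuousOn fun _ hx => norm_pos_iff.2 hx

theorem bound_of_annulus {m : E n → ℝ} (hc : ContinuousOn m {0}ᶜ) {r0 r1 : ℝ} (h0 : 0 < r0)
    (hz : ∀ x, x ≠ 0 → ¬(r0 ≤ ‖x‖ ∧ ‖x‖ ≤ r1) → m x = 0) : ∃ C, ∀ x, |m x| ≤ C := by
  have hcl : IsClosed {x : E n | r0 ≤ ‖x‖ ∧ ‖x‖ ≤ r1} :=
    (isClosed_le (α := ℝ) continuous_const continuous_norm).inter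
      (isClosed_le (α := ℝ) continuous_norm continuous_const)
  have hK : IsCompact {x : E n | r0 ≤ ‖x‖ ∧ ‖x‖ ≤ r1} :=
    (isCompact_closedBall (0 : E n) r1).of_isClosed_subset hcl
      fun x hx => mem_closedBall_zero_iff.2 hx.2
  have hsub : {x : E n | r0 ≤ ‖x‖ ∧ ‖x‖ ≤ r1} ⊆ {0}ᶜ := by
    rintro x hx rfl
    have := hx.1
    rw [norm_zero] at this
    linarith
  obtain ⟨C, hC⟩ := hK.exists_bound_of_continuousOn (hc.mono hsub)
  refine ⟨max (max C 0) |m 0|, fun x => ?_⟩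
  rcases eq_or_ne x 0 with rfl | hx
  · exact le_max_right _ _
  by_cases h : r0 ≤ ‖x‖ ∧ ‖x‖ ≤ r1
  · exact (hC x h).trans ((le_max_left _ _).trans (le_max_left _ _))
  · rw [hz x hx h, abs_zero]
    exact (le_max_right _ _).trans (le_max_left _ _)

/-- The radial multiplier vanishes outside of `[r0, r1]`. -/
structure Multiplier.SupportedIn (a a' v v' : ℝ → ℝ) (r0 r1 : ℝ) : Prop where
  a_zero : ∀ r, 0 < r → ¬(r0 ≤ r ∧ r ≤ r1) → a r = 0
  a'_zero : ∀ r, 0 < r → ¬(r0 ≤ r ∧ r ≤ r1) → a' r = 0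
  v_zero : ∀ r, 0 < r → ¬(r0 ≤ r ∧ r ≤ r1) → v r = 0
  v'_zero : ∀ r, 0 < r → ¬(r0 ≤ r ∧ r ≤ r1) → v' r = 0

theorem Multiplier.supportedIn (hm : Multiplier n a a' v v') {r0 r1 : ℝ}
    (h : ∀ r, 0 < r → ¬(r0 ≤ r ∧ r ≤ r1) → a r = 0) : Multiplier.SupportedIn a a' v v' r0 r1 := by
  have hev : ∀ r, 0 < r → ¬(r0 ≤ r ∧ r ≤ r1) → ∀ᶠ s in 𝓝 r, 0 < s ∧ ¬(r0 ≤ s ∧ s ≤ r1) := by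
    intro r hr hn
    exact ((isOpen_Ioi (a := (0 : ℝ))).mem_nhds hr |> fun h1 => (Filter.eventually_of_mem h1
      fun _ h => h)).and (isClosed_Icc.isOpen_compl.mem_nhds hn)
  have ha' : ∀ r, 0 < r → ¬(r0 ≤ r ∧ r ≤ r1) → a' r = 0 := by
    intro r hr hn
    have : a =ᶠ[𝓝 r] fun _ => 0 := (hev r hr hn).mono fun s hs => h s hs.1 hs.2
    exact (hm.deriv_a r hr).unique ((hasDerivAt_const r (0 : ℝ)).congr_of_eventuallyEq this)
  have hv : ∀ r, 0 < r → ¬(r0 ≤ r ∧ r ≤ r1) → v r = 0 := by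
    intro r hr hn
    rw [hm.v_eq r hr, h r hr hn, ha' r hr hn]
    simp
  refine ⟨h, ha', hv, fun r hr hn => ?_⟩
  have : v =ᶠ[𝓝 r] fun _ => 0 := (hev r hr hn).mono fun s hs => hv s hs.1 hs.2
  exact (hm.deriv_v r hr).unique ((hasDerivAt_const r (0 : ℝ)).congr_of_eventuallyEq this)

theorem integral_combination {f1 f2 f3 f4 f₅ f₆ : E n → ℝ} (i1 : Integrable f1) (i2 : Integrable f2)
    (i3 : Integrable f3) (i4 : Integrable f4) (i₅ : Integrable f₅) (i₆ : Integrable f₆) :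
    -(∫ x, f1 x) - (∫ x, f2 x) + (∫ x, f3 x) + (∫ x, f4 x) + (∫ x, f₅ x) + ∫ x, f₆ x =
      ∫ x, (-f1 x - f2 x + f3 x + f4 x + f₅ x + f₆ x) := by
  have e : (fun x => -f1 x - f2 x + f3 x + f4 x + f₅ x + f₆ x) = -f1 - f2 + f3 + f4 + f₅ + f₆ := rfl
  rw [e, integral_add' ((((i1.neg.sub i2).add i3).add i4).add i₅) i₆,
    integral_add' (((i1.neg.sub i2).add i3).add i4) i₅, integral_add' ((i1.neg.sub i2).add i3) i4,
    integral_add' (i1.neg.sub i2) i3, integral_sub' i1.neg i2, integral_neg']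

/-! ### Weighted integrals of the quadratic expressions -/

theorem rip_ae (f g : L2 n) : (fun x => rip (f x) (g x)) =ᵐ[volume] fun x => (⟪f x, g x⟫_ℂ).re :=
  ae_of_all _ fun _ => (re_inner_eq_rip _ _).symm

theorem rip_radial_ae (f : L2 n) (w : L2Vec n) :
    (fun x => rip (f x) (radial x (w x))) =ᵐ[volume] fun x => (⟪f x, radialCLM w x⟫_ℂ).re := by
  filter_upwards [radialCLM_ae w] with x hx
  rw [hx, re_inner_eq_rip]

theorem radial_sq_ae (w : L2Vec n) : (fun x => ‖radial x (w x)‖ ^ 2) =ᵐ[volume]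
    fun x => (⟪radialCLM w x, radialCLM w x⟫_ℂ).re := by
  filter_upwards [radialCLM_ae w] with x hx
  rw [hx, re_inner_self_eq]

theorem tangential_sq_ae (w : L2Vec n) : (fun x => ‖tangential x (w x)‖ ^ 2) =ᵐ[volume]
    fun x => (⟪tangentialCLM w x, tangentialCLM w x⟫_ℂ).re := by
  filter_upwards [tangentialCLM_ae w] with x hx
  rw [hx]
  exact (inner_self_eq_norm_sq (𝕜 := ℂ) _).symm

theorem rip_comp_ae (j : Fin n) (w : L2Vec n) (u : L2 n) :
    (fun x => rip (w x j) (I * u x)) =ᵐ[volume]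
      fun x => (⟪compCLM j w x, (I • u : L2 n) x⟫_ℂ).re := by
  filter_upwards [compCLM_ae j w, Lp.coeFn_smul I u] with x h1 h2
  rw [h1, h2, re_inner_eq_rip, Pi.smul_apply, smul_eq_mul]

section

variable {V : Type*} [NormedAddCommGroup V] [InnerProductSpace ℂ V] {m : E n → ℝ} {C : ℝ}

theorem integrable_of_ae_inner {f g : Lp V 2 (volume : Measure (E n))} {F : E n → ℝ}
    (h : F =ᵐ[volume] fun x => (⟪f x, g x⟫_ℂ).re) : Integrable F :=
  (L2.integrable_inner (𝕜 := ℂ) f g).re.congr h.symm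

theorem tendsto_integral_of_ae_inner {ι : Type*} {l : Filter ι} (hm : AEStronglyMeasurable m volume)
    (hC : ∀ x, |m x| ≤ C) {f g : ι → Lp V 2 (volume : Measure (E n))}
    {f0 g0 : Lp V 2 (volume : Measure (E n))} (hf : Tendsto f l (𝓝 f0)) (hg : Tendsto g l (𝓝 g0))
    {F : ι → E n → ℝ} {F0 : E n → ℝ} (h : ∀ i, F i =ᵐ[volume] fun x => (⟪f i x, g i x⟫_ℂ).re)
    (h0 : F0 =ᵐ[volume] fun x => (⟪f0 x, g0 x⟫_ℂ).re) :
    Tendsto (fun i => ∫ x, m x * F i x) l (𝓝 (∫ x, m x * F0 x)) := by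
  rw [integral_congr_ae (h0.mono fun x hx => congrArg (m x * ·) hx)]
  simp_rw [fun i => integral_congr_ae ((h i).mono fun x hx => congrArg (m x * ·) hx)]
  exact tendsto_weight_inner hm hC hf hg

end

section

variable {r0 r1 : ℝ}

/-- The virial identity for the elements of the domain of `-Δ_A` and multipliers with compact
support in `(0, ∞)`. -/
theorem virial (hn : 3 ≤ n) (hA : ContDiffOn ℝ 1 A {0}ᶜ) (p : covGradGraph A) {f : L2 n}
    (h : ∀ q ∈ covGradGraph A, ⟪q.snd, p.1.snd⟫_ℂ = ⟪q.fst, f⟫_ℂ) (hm : Multiplier n a a' v v')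
    (h₀ : 0 < r0) (hs : Multiplier.SupportedIn a a' v v' r0 r1) :
    (∫ x, 2 * a ‖x‖ * rip (f x) (radial x (p.1.snd x))) + ∫ x, v ‖x‖ * rip (f x) (p.1.fst x) =
      (∫ x, 2 * a' ‖x‖ * ‖radial x (p.1.snd x)‖ ^ 2) +
      (∫ x, 2 * (a ‖x‖ / ‖x‖) * ‖tangential x (p.1.snd x)‖ ^ 2) +
      (∫ x, v' ‖x‖ * rip (radial x (p.1.snd x)) (p.1.fst x)) +
      ∑ j, ∫ x, (-(2 * a ‖x‖ * trapping A x j)) * rip (p.1.snd x j) (I * p.1.fst x) := by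
  obtain ⟨φ, hφ, U, F, W, tU, tW, tF, hae⟩ := exists_local_approx hn hA p h h₀ r1
  set m1 : E n → ℝ := fun x => 2 * a ‖x‖
  set m2 : E n → ℝ := fun x => v ‖x‖
  set m3 : E n → ℝ := fun x => 2 * a' ‖x‖
  set m4 : E n → ℝ := fun x => 2 * (a ‖x‖ / ‖x‖)
  set m₅ : E n → ℝ := fun x => v' ‖x‖
  set m₆ : Fin n → E n → ℝ := fun j x => -(2 * a ‖x‖ * trapping A x j)
  have c1 : ContinuousOn m1 {0}ᶜ := continuousOn_const.mul (continuousOn_norm_comp hm.cont_a)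
  have c2 : ContinuousOn m2 {0}ᶜ := continuousOn_norm_comp hm.cont_v
  have c3 : ContinuousOn m3 {0}ᶜ := continuousOn_const.mul (continuousOn_norm_comp hm.cont_a')
  have c4 : ContinuousOn m4 {0}ᶜ := continuousOn_const.mul ((continuousOn_norm_comp hm.cont_a).div
    continuous_norm.continuousOn fun x hx => norm_ne_zero_iff.2 hx)
  have c₅ : ContinuousOn m₅ {0}ᶜ := continuousOn_norm_comp hm.cont_v'
  have c₆ : ∀ j, ContinuousOn (m₆ j) {0}ᶜ := fun j => (c1.mul (continuousOn_trapping hA j)).neg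
  have z1 : ∀ x, x ≠ 0 → ¬(r0 ≤ ‖x‖ ∧ ‖x‖ ≤ r1) → m1 x = 0 := fun x hx hr => by
    simp only [m1, hs.a_zero _ (norm_pos_iff.2 hx) hr, mul_zero]
  have z2 : ∀ x, x ≠ 0 → ¬(r0 ≤ ‖x‖ ∧ ‖x‖ ≤ r1) → m2 x = 0 := fun x hx hr =>
    hs.v_zero _ (norm_pos_iff.2 hx) hr
  have z3 : ∀ x, x ≠ 0 → ¬(r0 ≤ ‖x‖ ∧ ‖x‖ ≤ r1) → m3 x = 0 := fun x hx hr => by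
    simp only [m3, hs.a'_zero _ (norm_pos_iff.2 hx) hr, mul_zero]
  have z4 : ∀ x, x ≠ 0 → ¬(r0 ≤ ‖x‖ ∧ ‖x‖ ≤ r1) → m4 x = 0 := fun x hx hr => by
    simp only [m4, hs.a_zero _ (norm_pos_iff.2 hx) hr, mul_zero, zero_div]
  have z₅ : ∀ x, x ≠ 0 → ¬(r0 ≤ ‖x‖ ∧ ‖x‖ ≤ r1) → m₅ x = 0 := fun x hx hr =>
    hs.v'_zero _ (norm_pos_iff.2 hx) hr
  have z₆ : ∀ j x, x ≠ 0 → ¬(r0 ≤ ‖x‖ ∧ ‖x‖ ≤ r1) → m₆ j x = 0 := fun j x hx hr => by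
    simp only [m₆, hs.a_zero _ (norm_pos_iff.2 hx) hr, mul_zero, zero_mul, neg_zero]
  obtain ⟨C1, b1⟩ := bound_of_annulus c1 h₀ z1
  obtain ⟨C2, b2⟩ := bound_of_annulus c2 h₀ z2
  obtain ⟨C3, b3⟩ := bound_of_annulus c3 h₀ z3
  obtain ⟨C4, b4⟩ := bound_of_annulus c4 h₀ z4
  obtain ⟨C₅, b₅⟩ := bound_of_annulus c₅ h₀ z₅
  choose C₆ b₆ using fun j => bound_of_annulus (c₆ j) h₀ (z₆ j)
  have s := fun {m : E n → ℝ} (c : ContinuousOn m {0}ᶜ) => aesm_of_continuousOn hn c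
  have bd := fun {m F : E n → ℝ} {C : ℝ} (c : ContinuousOn m {0}ᶜ) (b : ∀ x, |m x| ≤ C)
    (i : Integrable F) => i.bdd_mul (s c) (ae_of_all _ b)
  let Ψ : L2 n → L2Vec n → L2 n → E n → ℝ := fun U W F x =>
    -(m1 x * rip (F x) (radial x (W x))) - m2 x * rip (F x) (U x) + m3 x * ‖radial x (W x)‖ ^ 2 +
    m4 x * ‖tangential x (W x)‖ ^ 2 + m₅ x * rip (U x) (radial x (W x)) +
    ∑ j, m₆ j x * rip (W x j) (I * U x)
  let S : L2 n → L2Vec n → L2 n → ℝ := fun U W F =>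
    -(∫ x, m1 x * rip (F x) (radial x (W x))) - (∫ x, m2 x * rip (F x) (U x)) +
    (∫ x, m3 x * ‖radial x (W x)‖ ^ 2) + (∫ x, m4 x * ‖tangential x (W x)‖ ^ 2) +
    (∫ x, m₅ x * rip (U x) (radial x (W x))) +
    ∑ j, ∫ x, m₆ j x * rip (W x j) (I * U x)
  have hΨ : ∀ U W F, ∫ x, Ψ U W F x = S U W F := fun U W F => by
    have i₆ := fun j => bd (c₆ j) (b₆ j) (integrable_of_ae_inner (rip_comp_ae j W U))
    simp only [S]
    rw [← integral_finsetSum _ fun j _ => i₆ j, integral_combination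
      (bd c1 b1 (integrable_of_ae_inner (rip_radial_ae F W)))
      (bd c2 b2 (integrable_of_ae_inner (rip_ae F U)))
      (bd c3 b3 (integrable_of_ae_inner (radial_sq_ae W)))
      (bd c4 b4 (integrable_of_ae_inner (tangential_sq_ae W)))
      (bd c₅ b₅ (integrable_of_ae_inner (rip_radial_ae U W))) (integrable_finsetSum _ fun j _ => i₆ j)]
  have hz : ∀ i, S (testPair hA (hφ i)).fst (testPair hA (hφ i)).snd
      (((hφ i).lapA hA).memLp.toLp _) = 0 := fun i => by
    rw [← hΨ, ← virial_div hn hm hA (hφ i)]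
    refine integral_congr_ae ?_
    filter_upwards [testPair_fst_ae hA (hφ i), testPair_snd_ae hA (hφ i),
      ((hφ i).lapA hA).memLp.coeFn_toLp] with x h1 h2 h3
    simp only [Ψ, h1, h2, h3, covGradFun_apply, m1, m2, m3, m4, m₅, m₆, rip_comm (φ i x)]
  have hl : Tendsto (fun i => S (testPair hA (hφ i)).fst (testPair hA (hφ i)).snd
      (((hφ i).lapA hA).memLp.toLp _)) atTop (𝓝 (S U W F)) := by
    have tR := (radialCLM.continuous.tendsto _).comp tW
    have tT := (tangentialCLM.continuous.tendsto _).comp tW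
    exact ((((((tendsto_integral_of_ae_inner (s c1) b1 tF tR (fun _ => rip_radial_ae _ _)
      (rip_radial_ae _ _)).neg.sub
      (tendsto_integral_of_ae_inner (s c2) b2 tF tU (fun _ => rip_ae _ _) (rip_ae _ _))).add
      (tendsto_integral_of_ae_inner (s c3) b3 tR tR (fun _ => radial_sq_ae _) (radial_sq_ae _))).add
      (tendsto_integral_of_ae_inner (s c4) b4 tT tT (fun _ => tangential_sq_ae _)
        (tangential_sq_ae _))).add
      (tendsto_integral_of_ae_inner (s c₅) b₅ tU tR (fun _ => rip_radial_ae _ _)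
        (rip_radial_ae _ _)))).add (tendsto_finsetSum _ fun j _ =>
      tendsto_integral_of_ae_inner (s (c₆ j)) (b₆ j) (((compCLM j).continuous.tendsto _).comp tW)
        (tU.const_smul I) (fun _ => rip_comp_ae _ _ _) (rip_comp_ae _ _ _))
  have e : S U W F = S p.1.fst p.1.snd f := by
    rw [← hΨ, ← hΨ]
    refine integral_congr_ae ?_
    filter_upwards [hae, ae_ne_zero hn] with x h1 h2
    by_cases hx : r0 ≤ ‖x‖ ∧ ‖x‖ ≤ r1
    · obtain ⟨e1, e2, e3⟩ := h1 hx.1 hx.2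
      simp only [Ψ, e1, e2, e3]
    · simp only [Ψ, z1 x h2 hx, z2 x h2 hx, z3 x h2 hx, z4 x h2 hx, z₅ x h2 hx, z₆ _ x h2 hx, zero_mul]
  have h0 := tendsto_nhds_unique hl ((tendsto_const_nhds (x := (0 : ℝ))).congr fun i => (hz i).symm)
  rw [e] at h0
  simp only [S] at h0
  simp only [rip_comm (radial _ _)]
  linarith

end

end

section

variable {A : E n → E n} {a a' v v' : ℝ → ℝ}

/-! ### The chain rule for truncated nonlinearities -/

theorem norm_weightCLM_apply_le {m : E n → ℝ} (hm) {C : ℝ} (hC) (f : L2 n) :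
    ‖weightCLM m hm C hC f‖ ≤ C * ‖f‖ := by
  refine Lp.norm_le_mul_norm_of_ae_le_mul ?_
  filter_upwards [weightCLM_ae m hm C hC f] with x hx
  rw [hx, norm_smul, norm_real]
  exact mul_le_mul_of_nonneg_right (hC x) (norm_nonneg _)

theorem tendsto_varying_weight_inner {m : ℕ → E n → ℝ} {m0 : E n → ℝ}
    (hm : ∀ i, AEStronglyMeasurable (m i) volume) {C : ℝ} (hC : ∀ i x, |m i x| ≤ C)
    (hlim : ∀ᵐ x, Tendsto (fun i => m i x) atTop (𝓝 (m0 x)))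
    {f g : ℕ → L2 n} {f0 g0 : L2 n}
    (hf : Tendsto f atTop (𝓝 f0)) (hg : Tendsto g atTop (𝓝 g0)) :
    Tendsto (fun i => ∫ x, m i x * (⟪f i x, g i x⟫_ℂ).re) atTop
      (𝓝 (∫ x, m0 x * (⟪f0 x, g0 x⟫_ℂ).re)) := by
  have h1 : Tendsto (fun i => ∫ x, m i x * (⟪f0 x, g0 x⟫_ℂ).re) atTop
      (𝓝 (∫ x, m0 x * (⟪f0 x, g0 x⟫_ℂ).re)) := by
    have hint := (L2.integrable_inner (𝕜 := ℂ) f0 g0).re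
    refine tendsto_integral_of_dominated_convergence (fun x => C * |(⟪f0 x, g0 x⟫_ℂ).re|)
      (fun i => (hm i).mul hint.1) (hint.abs.const_mul C) (fun i => ae_of_all _ fun x => ?_) ?_
    · rw [norm_eq_abs, abs_mul]
      exact mul_le_mul_of_nonneg_right (hC i x) (abs_nonneg _)
    · filter_upwards [hlim] with x hx using hx.mul_const _
  have h2 : Tendsto (fun i => (∫ x, m i x * (⟪f i x, g i x⟫_ℂ).re) -
      ∫ x, m i x * (⟪f0 x, g0 x⟫_ℂ).re) atTop (𝓝 0) := by
    have hb : Tendsto (fun i => ‖f i - f0‖ * (C * ‖g i‖) + ‖f0‖ * (C * ‖g i - g0‖)) atTop (𝓝 0) := by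
      have e1 := tendsto_iff_norm_sub_tendsto_zero.1 hf
      have e2 := tendsto_iff_norm_sub_tendsto_zero.1 hg
      have := (e1.mul (hg.norm.const_mul C)).add ((e2.const_mul C).const_mul ‖f0‖)
      simpa using this
    refine squeeze_zero_norm (fun i => ?_) hb
    rw [← re_inner_weightCLM (m i) (hm i) C (hC i), ← re_inner_weightCLM (m i) (hm i) C (hC i),
      ← sub_re]
    set T := weightCLM (V := ℂ) (m i) (hm i) C (hC i)
    have e : ⟪f i, T (g i)⟫_ℂ - ⟪f0, T g0⟫_ℂ = ⟪f i - f0, T (g i)⟫_ℂ + ⟪f0, T (g i - g0)⟫_ℂ := by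
      rw [inner_sub_left, map_sub, inner_sub_right]
      ring
    rw [e, norm_eq_abs]
    refine (abs_re_le_norm _).trans ((norm_add_le _ _).trans (add_le_add ?_ ?_))
    · exact (norm_inner_le_norm _ _).trans (mul_le_mul_of_nonneg_left
        (norm_weightCLM_apply_le _ _ _) (norm_nonneg _))
    · exact (norm_inner_le_norm _ _).trans (mul_le_mul_of_nonneg_left
        (norm_weightCLM_apply_le _ _ _) (norm_nonneg _))
  simpa using h2.add h1

/-- The mean value of `γ` between `0` and `s`. -/
def meanValue (γ : ℝ → ℝ) (s : ℝ) : ℝ := ∫ θ in (0 : ℝ)..1, γ (s * θ)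

theorem continuous_meanValue {γ : ℝ → ℝ} (hγ : Continuous γ) : Continuous (meanValue γ) :=
  intervalIntegral.continuous_parametric_intervalIntegral_of_continuous' (by fun_prop) _ _

theorem meanValue_mul (γ : ℝ → ℝ) (s : ℝ) : meanValue γ s * s = ∫ τ in (0 : ℝ)..s, γ τ := by
  rw [mul_comm, meanValue, intervalIntegral.mul_integral_comp_mul_left, mul_zero, mul_one]

theorem abs_meanValue_le {γ : ℝ → ℝ} {K : ℝ} (hK : ∀ s, |γ s| ≤ K) (s : ℝ) : |meanValue γ s| ≤ K := by
  simpa [meanValue] using intervalIntegral.norm_integral_le_of_norm_le_const (a := 0) (b := 1)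
    (f := fun θ => γ (s * θ)) fun θ _ => hK _

theorem radial_chain (hn : 3 ≤ n) (hA : ContDiffOn ℝ 1 A {0}ᶜ) (p : covGradGraph A)
    (hm : Multiplier n a a' v v') {r0 r1 : ℝ} (h0 : 0 < r0)
    (hs : Multiplier.SupportedIn a a' v v' r0 r1) {b : E n → ℝ} (hb : ContDiffOn ℝ 1 b {0}ᶜ)
    {γ : ℝ → ℝ} (hγ : Continuous γ) {K : ℝ} (hK : ∀ s, |γ s| ≤ K) :
    (∫ x, 2 * a ‖x‖ * b x * γ (‖p.1.fst x‖ ^ 2) * rip (p.1.fst x) (radial x (p.1.snd x))) +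
      ∫ x, (v ‖x‖ * b x + a ‖x‖ * radialDeriv b x) * (∫ τ in (0 : ℝ)..‖p.1.fst x‖ ^ 2, γ τ) = 0 := by
  set m1 : E n → ℝ := fun x => 2 * a ‖x‖ * b x
  set m2 : E n → ℝ := fun x => v ‖x‖ * b x + a ‖x‖ * radialDeriv b x
  have ca := continuousOn_norm_comp (n := n) hm.cont_a
  have c1 : ContinuousOn m1 {0}ᶜ := (continuousOn_const.mul ca).mul hb.continuousOn
  have c2 : ContinuousOn m2 {0}ᶜ := ((continuousOn_norm_comp hm.cont_v).mul hb.continuousOn).add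
    (ca.mul (continuousOn_radialDeriv hb))
  obtain ⟨C1, b1⟩ := bound_of_annulus c1 h0 (r1 := r1) fun x hx hr => by
    simp only [m1, hs.a_zero _ (norm_pos_iff.2 hx) hr, mul_zero, zero_mul]
  obtain ⟨C2, b2⟩ := bound_of_annulus c2 h0 (r1 := r1) fun x hx hr => by
    simp only [m2, hs.a_zero _ (norm_pos_iff.2 hx) hr, hs.v_zero _ (norm_pos_iff.2 hx) hr, zero_mul,
      add_zero]
  have s1 := aesm_of_continuousOn hn c1
  have s2 := aesm_of_continuousOn hn c2
  have hmv := continuous_meanValue hγ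
  have sq : ∀ {δ : ℝ → ℝ} (_ : Continuous δ) (f : L2 n),
      AEStronglyMeasurable (fun x => δ (‖f x‖ ^ 2)) volume := fun hδ f =>
    hδ.comp_aestronglyMeasurable ((Lp.memLp f).1.norm.pow 2)
  have B : ∀ {m : E n → ℝ} {C : ℝ} {δ : ℝ → ℝ} (_ : ∀ x, |m x| ≤ C) (_ : ∀ s, |δ s| ≤ K) (f : L2 n) x,
      |m x * δ (‖f x‖ ^ 2)| ≤ C * K := fun hm hδ f x => by
    rw [abs_mul]
    exact mul_le_mul (hm x) (hδ _) (abs_nonneg _) ((abs_nonneg _).trans (hm x))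
  have key : ∀ q : covGradGraph A,
      ((∫ x, m1 x * γ (‖q.1.fst x‖ ^ 2) * rip (q.1.fst x) (radial x (q.1.snd x))) +
        ∫ x, m2 x * (∫ τ in (0 : ℝ)..‖q.1.fst x‖ ^ 2, γ τ)) =
      (∫ x, (m1 x * γ (‖fstG A q x‖ ^ 2)) * (⟪fstG A q x, radialCLM (sndG A q) x⟫_ℂ).re) +
        ∫ x, (m2 x * meanValue γ (‖fstG A q x‖ ^ 2)) * (⟪fstG A q x, fstG A q x⟫_ℂ).re := by
    refine fun q => congrArg₂ _
      (integral_congr_ae ((rip_radial_ae _ _).mono fun x hx => congrArg (_ * ·) hx))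
      (integral_congr_ae (ae_of_all _ fun x => ?_))
    simp only [re_inner_self_eq, mul_assoc, meanValue_mul]
    rfl
  have hcl : IsClosed {q : covGradGraph A |
      ((∫ x, m1 x * γ (‖q.1.fst x‖ ^ 2) * rip (q.1.fst x) (radial x (q.1.snd x))) +
        ∫ x, m2 x * (∫ τ in (0 : ℝ)..‖q.1.fst x‖ ^ 2, γ τ)) = 0} := by
    simp only [key]
    refine IsSeqClosed.isClosed fun q q0 hq hlim => ?_
    have t1 := ((fstG A).continuous.tendsto q0).comp hlim
    have t2 := ((radialCLM.continuous.comp (sndG A).continuous).tendsto q0).comp hlim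
    obtain ⟨ns, hns, hae⟩ := (tendstoInMeasure_of_tendsto_Lp t1).exists_seq_tendsto_ae
    have hlim' : ∀ {δ : ℝ → ℝ} (m : E n → ℝ), Continuous δ → ∀ᵐ x, Tendsto
        (fun i => m x * δ (‖fstG A (q (ns i)) x‖ ^ 2)) atTop (𝓝 (m x * δ (‖fstG A q0 x‖ ^ 2))) := by
      intro δ m hδ
      filter_upwards [hae] with x hx
      exact ((hδ.tendsto _).comp (hx.norm.pow 2)).const_mul _
    have T1 := tendsto_varying_weight_inner (fun i => s1.mul (sq hγ (fstG A (q (ns i)))))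
      (fun i => B b1 hK (fstG A (q (ns i)))) (hlim' m1 hγ)
      (t1.comp hns.tendsto_atTop) (t2.comp hns.tendsto_atTop)
    have T2 := tendsto_varying_weight_inner (fun i => s2.mul (sq hmv (fstG A (q (ns i)))))
      (fun i => B b2 (abs_meanValue_le hK) (fstG A (q (ns i)))) (hlim' m2 hmv)
      (t1.comp hns.tendsto_atTop) (t1.comp hns.tendsto_atTop)
    exact tendsto_nhds_unique (T1.add T2)
      ((tendsto_const_nhds (x := (0 : ℝ))).congr fun i => (hq (ns i)).symm)
  refine covGradGraph_ind' hA hcl (fun f hf hf2 => (key _).trans ?_) p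
  set q : covGradGraph A := ⟨testPair hA hf2, testPair_mem_graph hA hf hf2⟩
  have i1 := integrable_weight_inner (s1.mul (sq hγ (fstG A q))) (B b1 hK _)
    (fstG A q) (radialCLM (sndG A q))
  have i2 := integrable_weight_inner (s2.mul (sq hmv (fstG A q))) (B b2 (abs_meanValue_le hK) _)
    (fstG A q) (fstG A q)
  rw [← integral_add (by exact i1) (by exact i2),
    ← (radial_chain_test (A := A) hn hf2 hm.deriv_a hm.cont_a' hb hγ).2]
  refine integral_congr_ae ?_
  filter_upwards [radialCLM_ae (sndG A q), testPair_fst_ae hA hf2, testPair_snd_ae hA hf2,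
    ae_ne_zero hn] with x h1 h2 h3 hx
  have h2' : fstG A q x = f x := h2
  have h3' : sndG A q x = covGradFun A f x := h3
  rw [h1, h2', h3', re_inner_self_eq, mul_assoc (m2 x), meanValue_mul]
  simp only [m1, m2, hm.v_eq _ (norm_pos_iff.2 hx)]
  ring

end

section

variable {A : E n → E n} {a a' v v' : ℝ → ℝ}

/-! ### Defocusing nonlinearities -/

section Defocusing

variable {g G : ℝ → ℝ}

theorem Defocusing.continuous_ext (hg : Defocusing g G) : Continuous fun s => g (max s 0) :=
  hg.continuous_g.comp_continuous (continuous_id.max continuous_const) fun _ => mem_Ici.2 (le_max_right _ _)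

theorem Defocusing.hasDerivAt_primitive (hg : Defocusing g G) (s : ℝ) :
    HasDerivAt (fun s => ∫ τ in (0 : ℝ)..s, g (max τ 0)) (g (max s 0)) s :=
  integral_hasDerivAt_right (hg.continuous_ext.intervalIntegrable _ _)
    (hg.continuous_ext.stronglyMeasurableAtFilter _ _) hg.continuous_ext.continuousAt

theorem Defocusing.G_eq (hg : Defocusing g G) {s : ℝ} (hs : 0 ≤ s) :
    G s = s * g s - ∫ τ in (0 : ℝ)..s, g (max τ 0) := by
  rcases hs.eq_or_lt with rfl | hs
  · simp [hg.G_zero]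
  set k : ℝ → ℝ := fun s => s * g s - (∫ τ in (0 : ℝ)..s, g (max τ 0)) - G s with hk
  have hc : ContinuousOn k (Icc 0 s) := by
    have hsub : Icc 0 s ⊆ Ici (0 : ℝ) := fun x hx => hx.1
    refine ((continuousOn_id.mul (hg.continuous_g.mono hsub)).sub
      (fun x _ => (hg.hasDerivAt_primitive x).continuousAt.continuousWithinAt)).sub
        (hg.continuous_G.mono hsub)
  have hd : ∀ x ∈ Ioo 0 s, HasDerivAt k 0 x := by
    intro x hx
    have h1 : HasDerivAt g (deriv g x) x :=
      ((hg.contDiff_g.contDiffAt (isOpen_Ioi.mem_nhds hx.1)).differentiableAt one_ne_zero).hasDerivAt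
    have h2 := (((hasDerivAt_id x).mul h1).sub (hg.hasDerivAt_primitive x)).sub
      (hg.hasDerivAt_G x hx.1)
    have e : 1 * g x + id x * deriv g x - g (max x 0) - x * deriv g x = 0 := by
      rw [max_eq_left hx.1.le]
      simp
    rw [e] at h2
    exact h2
  obtain ⟨c, _, hc'⟩ := exists_hasDerivAt_eq_slope k (fun _ => 0) hs hc hd
  have h0 : k 0 = 0 := by simp [hk, hg.G_zero]
  rw [h0, sub_zero, sub_zero, eq_comm, div_eq_zero_iff] at hc'
  rcases hc' with h | h
  · simp only [hk] at h
    linarith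
  · exact absurd h hs.ne'

theorem Defocusing.primitive_nonneg (hg : Defocusing g G) {s : ℝ} (hs : 0 ≤ s) :
    0 ≤ ∫ τ in (0 : ℝ)..s, g (max τ 0) := by
  rcases hs.eq_or_lt with rfl | hs
  · simp
  have hd : ∀ x, 0 < x → HasDerivAt (meanValue fun s => g (max s 0))
      ((g (max x 0) * x - (∫ τ in (0 : ℝ)..x, g (max τ 0)) * 1) / x ^ 2) x := fun x hx => by
    refine ((hg.hasDerivAt_primitive x).div (hasDerivAt_id x) hx.ne').congr_of_eventuallyEq ?_
    filter_upwards [isOpen_Ioi.mem_nhds hx] with y hy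
    exact eq_div_of_mul_eq (ne_of_gt hy) (meanValue_mul _ y)
  have hmono : MonotoneOn (meanValue fun s => g (max s 0)) (Ici 0) := by
    refine monotoneOn_of_deriv_nonneg (convex_Ici 0)
      (continuous_meanValue hg.continuous_ext).continuousOn ?_ ?_ <;> rw [interior_Ici]
    · exact fun x hx => (hd x hx).differentiableAt.differentiableWithinAt
    · intro x (hx : 0 < x)
      have h1 := hg.G_nonneg x hx.le
      rw [hg.G_eq hx.le] at h1
      rw [(hd x hx).deriv, max_eq_left hx.le]
      exact div_nonneg (by linarith) (sq_nonneg _)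
  have h1 := hmono (mem_Ici.2 le_rfl) (mem_Ici.2 hs.le) hs.le
  have h2 : meanValue (fun s => g (max s 0)) 0 = 0 := by simp [meanValue, hg.g_zero]
  rw [← meanValue_mul]
  exact mul_nonneg (h2.symm.trans_le h1) hs.le

theorem Defocusing.g_nonneg (hg : Defocusing g G) {s : ℝ} (hs : 0 ≤ s) : 0 ≤ g s := by
  rcases hs.eq_or_lt with rfl | hs
  · exact hg.g_zero.ge
  have h1 := hg.G_nonneg s hs.le
  have h2 := hg.primitive_nonneg hs.le
  rw [hg.G_eq hs.le] at h1
  by_contra hneg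
  have := mul_neg_of_pos_of_neg hs (not_le.1 hneg)
  linarith

theorem Defocusing.G_le (hg : Defocusing g G) {s : ℝ} (hs : 0 ≤ s) : G s ≤ s * g s := by
  have := hg.primitive_nonneg hs
  rw [hg.G_eq hs]
  linarith

theorem integrable_rip (f k : L2 n) : Integrable fun x => rip (f x) (k x) :=
  integrable_of_ae_inner (rip_ae f k)

variable {u N : L2 n}

theorem rip_nonlinear (hN : ∀ᵐ x, N x = ((g (‖u x‖ ^ 2) : ℝ) : ℂ) * u x) :
    ∀ᵐ x, rip (N x) (u x) = ‖u x‖ ^ 2 * g (‖u x‖ ^ 2) := by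
  filter_upwards [hN] with x hx
  rw [hx, rip_real_mul_left, rip_self, mul_comm]

theorem Defocusing.aestronglyMeasurable_G (hg : Defocusing g G) (u : L2 n) :
    AEStronglyMeasurable (fun x => G (‖u x‖ ^ 2)) volume := by
  have hc : Continuous fun s => G (max s 0) :=
    hg.continuous_G.comp_continuous (continuous_id.max continuous_const)
      fun _ => mem_Ici.2 (le_max_right _ _)
  have h1 := hc.comp_aestronglyMeasurable ((Lp.memLp u).1.norm.pow 2)
  refine h1.congr (ae_of_all _ fun x => ?_)
  have : max (‖u x‖ ^ 2) 0 = ‖u x‖ ^ 2 := max_eq_left (sq_nonneg _)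
  exact congrArg G this

theorem Defocusing.integrable_G (hg : Defocusing g G)
    (hN : ∀ᵐ x, N x = ((g (‖u x‖ ^ 2) : ℝ) : ℂ) * u x) : Integrable fun x => G (‖u x‖ ^ 2) := by
  refine (integrable_rip N u).mono' (hg.aestronglyMeasurable_G u) ?_
  filter_upwards [rip_nonlinear hN] with x hx
  rw [norm_eq_abs, abs_of_nonneg (hg.G_nonneg _ (sq_nonneg _)), hx]
  exact hg.G_le (sq_nonneg _)

theorem radial_nonlinear (hn : 3 ≤ n) (hA : ContDiffOn ℝ 1 A {0}ᶜ) (p : covGradGraph A)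
    (hm : Multiplier n a a' v v') {r0 r1 : ℝ} (h₀ : 0 < r0)
    (hs : Multiplier.SupportedIn a a' v v' r0 r1) (hg : Defocusing g G)
    (hN : ∀ᵐ x, N x = ((g (‖p.1.fst x‖ ^ 2) : ℝ) : ℂ) * p.1.fst x) :
    (∫ x, 2 * a ‖x‖ * rip (N x) (radial x (p.1.snd x))) + ∫ x, v ‖x‖ * rip (N x) (p.1.fst x) =
      ∫ x, v ‖x‖ * G (‖p.1.fst x‖ ^ 2) := by
  set u := p.1.fst
  set γ : ℝ → ℝ := fun s => g (max s 0) with hγ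
  have hγc : Continuous γ := hg.continuous_ext
  have hγ0 : ∀ s, 0 ≤ γ s := fun s => hg.g_nonneg (le_max_right _ _)
  have c1 : ContinuousOn (fun x : E n => 2 * a ‖x‖) {0}ᶜ :=
    continuousOn_const.mul (continuousOn_norm_comp (n := n) hm.cont_a)
  have c2 : ContinuousOn (fun x : E n => v ‖x‖) {0}ᶜ := continuousOn_norm_comp (n := n) hm.cont_v
  obtain ⟨C1, b1⟩ := bound_of_annulus c1 h₀ (r1 := r1) fun x hx hr => by
    rw [hs.a_zero _ (norm_pos_iff.2 hx) hr, mul_zero]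
  obtain ⟨C2, b2⟩ := bound_of_annulus c2 h₀ (r1 := r1) fun x hx hr => by
    rw [hs.v_zero _ (norm_pos_iff.2 hx) hr]
  have s1 := aesm_of_continuousOn hn c1
  have s2 := aesm_of_continuousOn hn c2
  let γN : ℕ → ℝ → ℝ := fun K s => min (γ s) K
  have hγNc : ∀ K, Continuous (γN K) := fun K => hγc.min continuous_const
  have hγN0 : ∀ K s, 0 ≤ γN K s := fun K s => le_min (hγ0 s) (Nat.cast_nonneg K)
  have hchain := fun K : ℕ => radial_chain hn hA p hm h₀ hs (b := fun _ => 1) contDiffOn_const (hγNc K)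
    (K := K) fun s => by
      rw [abs_of_nonneg (hγN0 K s)]
      exact min_le_right _ _
  simp only [radialDeriv, fderiv_fun_const, Pi.zero_apply, _root_.zero_apply, mul_one, mul_zero,
    add_zero] at hchain
  have hsq : AEStronglyMeasurable (fun x => ‖u x‖ ^ 2) volume := (Lp.memLp u).1.norm.pow 2
  have iR := integrable_rip N (radialCLM p.1.snd)
  have iU := integrable_rip N u
  have mR := (integrable_of_ae_inner (rip_radial_ae u p.1.snd)).1
  have eN : ∀ᵐ x, N x = (γ (‖u x‖ ^ 2) : ℂ) * u x := by
    filter_upwards [hN] with x hx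
    rw [hx]
    simp only [hγ]
    rw [max_eq_left (sq_nonneg _)]
  have L1 : Tendsto (fun K : ℕ => ∫ x, 2 * a ‖x‖ * γN K (‖u x‖ ^ 2) *
      rip (u x) (radial x (p.1.snd x))) atTop
      (𝓝 (∫ x, 2 * a ‖x‖ * rip (N x) (radial x (p.1.snd x)))) := by
    refine tendsto_integral_of_dominated_convergence
      (fun x => C1 * |rip (N x) (radialCLM p.1.snd x)|)
      (fun K => (s1.mul ((hγNc K).comp_aestronglyMeasurable hsq)).mul mR) (iR.abs.const_mul C1)
      (fun K => ?_) ?_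
    · filter_upwards [radialCLM_ae p.1.snd, eN] with x h1 h2
      rw [h1, h2, rip_real_mul_left, norm_eq_abs, mul_assoc, abs_mul (2 * a ‖x‖),
        abs_mul (γN K _), abs_mul (γ _)]
      have h3 : |γN K (‖u x‖ ^ 2)| ≤ |γ (‖u x‖ ^ 2)| := by
        rw [abs_of_nonneg (hγN0 K _), abs_of_nonneg (hγ0 _)]
        exact min_le_left _ _
      exact mul_le_mul (b1 x) (mul_le_mul_of_nonneg_right h3 (abs_nonneg _)) (by positivity)
        ((abs_nonneg _).trans (b1 x))
    · filter_upwards [eN] with x h2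
      rw [h2, rip_real_mul_left, ← mul_assoc]
      refine Tendsto.mul_const _ (Tendsto.const_mul _ ?_)
      refine tendsto_const_nhds.congr' ?_
      filter_upwards [eventually_ge_atTop ⌈γ (‖u x‖ ^ 2)⌉₊] with K hK
      exact (min_eq_left ((Nat.le_ceil _).trans (Nat.cast_le.2 hK))).symm
  have hP : ∀ K s, 0 ≤ s → 0 ≤ ∫ τ in (0 : ℝ)..s, γN K τ ∧
      ∫ τ in (0 : ℝ)..s, γN K τ ≤ ∫ τ in (0 : ℝ)..s, γ τ := fun K s hs =>
    ⟨intervalIntegral.integral_nonneg hs fun τ _ => hγN0 K τ,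
      integral_mono_on hs ((hγNc K).intervalIntegrable _ _)
        (hγc.intervalIntegrable _ _) fun τ _ => min_le_left _ _⟩
  have hPle : ∀ᵐ x, ∫ τ in (0 : ℝ)..‖u x‖ ^ 2, γ τ ≤ |rip (N x) (u x)| := by
    filter_upwards [rip_nonlinear hN] with x hx
    rw [hx]
    refine le_trans ?_ (le_abs_self _)
    have h1 := hg.G_nonneg _ (sq_nonneg ‖u x‖)
    rw [hg.G_eq (sq_nonneg _)] at h1
    linarith
  have hmP : ∀ {δ : ℝ → ℝ}, Continuous δ →
      AEStronglyMeasurable (fun x => ∫ τ in (0 : ℝ)..‖u x‖ ^ 2, δ τ) volume := fun hδ =>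
    (intervalIntegral.continuous_primitive hδ.intervalIntegrable 0).comp_aestronglyMeasurable hsq
  have L2 : Tendsto (fun K : ℕ => ∫ x, v ‖x‖ * ∫ τ in (0 : ℝ)..‖u x‖ ^ 2, γN K τ) atTop
      (𝓝 (∫ x, v ‖x‖ * ∫ τ in (0 : ℝ)..‖u x‖ ^ 2, γ τ)) := by
    refine tendsto_integral_of_dominated_convergence (fun x => C2 * |rip (N x) (u x)|)
      (fun K => s2.mul (hmP (hγNc K))) (iU.abs.const_mul C2) (fun K => ?_)
        (ae_of_all _ fun x => Tendsto.const_mul _ (tendsto_const_nhds.congr' ?_))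
    · filter_upwards [hPle] with x hx
      have h1 := hP K _ (sq_nonneg ‖u x‖)
      rw [norm_eq_abs, abs_mul, abs_of_nonneg h1.1]
      exact mul_le_mul (b2 x) (h1.2.trans hx) h1.1 ((abs_nonneg _).trans (b2 x))
    · obtain ⟨B, hB⟩ := (isCompact_Icc (a := (0 : ℝ)) (b := ‖u x‖ ^ 2)).exists_bound_of_continuousOn
        hγc.continuousOn
      filter_upwards [eventually_ge_atTop ⌈B⌉₊] with K hK
      refine intervalIntegral.integral_congr fun τ hτ => ?_
      rw [uIcc_of_le (sq_nonneg _)] at hτ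
      exact (min_eq_left (((le_abs_self _).trans (hB τ hτ)).trans
        ((Nat.le_ceil _).trans (Nat.cast_le.2 hK)))).symm
  have h0 := tendsto_nhds_unique (L1.add L2)
    ((tendsto_const_nhds (x := (0 : ℝ))).congr fun K => (hchain K).symm)
  have iP : Integrable fun x => v ‖x‖ * ∫ τ in (0 : ℝ)..‖u x‖ ^ 2, γ τ := by
    refine (iU.abs.mono' (hmP hγc) ?_).bdd_mul s2 (ae_of_all _ b2)
    filter_upwards [hPle] with x hx
    rwa [norm_eq_abs, abs_of_nonneg (hg.primitive_nonneg (sq_nonneg _))]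
  have iV : Integrable fun x => v ‖x‖ * rip (N x) (u x) := iU.bdd_mul s2 (ae_of_all _ b2)
  have e2 : ∫ x, v ‖x‖ * G (‖u x‖ ^ 2) = (∫ x, v ‖x‖ * rip (N x) (u x)) -
      ∫ x, v ‖x‖ * ∫ τ in (0 : ℝ)..‖u x‖ ^ 2, γ τ := by
    rw [← integral_sub iV iP]
    refine integral_congr_ae ?_
    filter_upwards [rip_nonlinear hN] with x hx
    rw [hx, hg.G_eq (sq_nonneg _), mul_sub]
  rw [e2]
  linarith

end Defocusing

theorem radial_multiplication (hn : 3 ≤ n) (hA : ContDiffOn ℝ 1 A {0}ᶜ) (p : covGradGraph A)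
    (hm : Multiplier n a a' v v') {r0 r1 : ℝ} (h0 : 0 < r0)
    (hs : Multiplier.SupportedIn a a' v v' r0 r1) {A₀ : E n → ℝ} (hA₀ : ContDiffOn ℝ 1 A₀ {0}ᶜ)
    {V : L2 n} (hV : V =ᵐ[volume] fun x => (A₀ x : ℂ) * p.1.fst x) :
    (∫ x, 2 * a ‖x‖ * rip (V x) (radial x (p.1.snd x))) + ∫ x, v ‖x‖ * rip (V x) (p.1.fst x) =
      -∫ x, a ‖x‖ * radialDeriv A₀ x * ‖p.1.fst x‖ ^ 2 := by
  have h := radial_chain hn hA p hm h0 hs hA₀ (γ := fun _ => 1) continuous_const (K := 1) (by simp)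
  simp only [intervalIntegral.integral_const, sub_zero, smul_eq_mul, mul_one] at h
  have ca := continuousOn_norm_comp (n := n) hm.cont_a
  have cv := continuousOn_norm_comp (n := n) hm.cont_v
  have c1 : ContinuousOn (fun x => v ‖x‖ * A₀ x) {0}ᶜ := cv.mul hA₀.continuousOn
  have c2 : ContinuousOn (fun x => a ‖x‖ * radialDeriv A₀ x) {0}ᶜ := ca.mul (continuousOn_radialDeriv hA₀)
  obtain ⟨C1, b1⟩ := bound_of_annulus c1 h0 (r1 := r1) fun x hx hr => by
    rw [hs.v_zero _ (norm_pos_iff.2 hx) hr, zero_mul]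
  obtain ⟨C2, b2⟩ := bound_of_annulus c2 h0 (r1 := r1) fun x hx hr => by
    rw [hs.a_zero _ (norm_pos_iff.2 hx) hr, zero_mul]
  have i1 : Integrable fun x => v ‖x‖ * A₀ x * ‖p.1.fst x‖ ^ 2 :=
    (integrable_norm_sq p.1.fst).bdd_mul (aesm_of_continuousOn hn c1) (ae_of_all _ b1)
  have i2 : Integrable fun x => a ‖x‖ * radialDeriv A₀ x * ‖p.1.fst x‖ ^ 2 :=
    (integrable_norm_sq p.1.fst).bdd_mul (aesm_of_continuousOn hn c2) (ae_of_all _ b2)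
  have e1 : ∫ x, (v ‖x‖ * A₀ x + a ‖x‖ * radialDeriv A₀ x) * ‖p.1.fst x‖ ^ 2 =
      (∫ x, v ‖x‖ * A₀ x * ‖p.1.fst x‖ ^ 2) + ∫ x, a ‖x‖ * radialDeriv A₀ x * ‖p.1.fst x‖ ^ 2 := by
    rw [← integral_add i1 i2]
    exact integral_congr_ae (ae_of_all _ fun x => by ring)
  have e2 : ∫ x, 2 * a ‖x‖ * rip (V x) (radial x (p.1.snd x)) =
      ∫ x, 2 * a ‖x‖ * A₀ x * rip (p.1.fst x) (radial x (p.1.snd x)) := by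
    refine integral_congr_ae ?_
    filter_upwards [hV] with x hx
    rw [hx, rip_real_mul_left]
    ring
  have e3 : ∫ x, v ‖x‖ * rip (V x) (p.1.fst x) = ∫ x, v ‖x‖ * A₀ x * ‖p.1.fst x‖ ^ 2 := by
    refine integral_congr_ae ?_
    filter_upwards [hV] with x hx
    rw [hx, rip_real_mul_left, rip_self, mul_assoc]
  rw [e1] at h
  rw [e2, e3]
  linarith

end

section

variable {A : E n → E n} {A₀ : E n → ℝ} {a a' v v' : ℝ → ℝ}

/-! ### The virial inequality for compactly supported multipliers -/

theorem sum_dir_trapping (A : E n → E n) (x : E n) : ∑ j, x j / ‖x‖ * trapping A x j = 0 := by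
  have e : ∀ j, trapping A x j = ∑ k, x k / ‖x‖ * magneticField A x k j := fun j => rfl
  simp only [e, mul_sum]
  have h : ∑ j, ∑ k, x j / ‖x‖ * (x k / ‖x‖ * magneticField A x k j) =
      -∑ j, ∑ k, x j / ‖x‖ * (x k / ‖x‖ * magneticField A x k j) := by
    conv_lhs => rw [Finset.sum_comm]
    rw [← sum_neg_distrib]
    refine sum_congr rfl fun j _ => ?_
    rw [← sum_neg_distrib]
    refine sum_congr rfl fun k _ => ?_
    rw [magneticField_antisymm A x j k]
    ring
  linarith

theorem norm_sum_trapping_le (A : E n → E n) (x : E n) (w : CVec n) :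
    ‖∑ j, (trapping A x j : ℂ) * w j‖ ≤ ‖trapping A x‖ * ‖tangential x w‖ := by
  have e1 : ∑ j, (trapping A x j : ℂ) * w j = ∑ j, (trapping A x j : ℂ) * tangential x w j := by
    have h : ∀ j, (trapping A x j : ℂ) * tangential x w j = (trapping A x j : ℂ) * w j -
        ((x j / ‖x‖ * trapping A x j : ℝ) : ℂ) * radial x w := by
      intro j
      simp only [tangential, radial]
      push_cast
      ring
    simp only [h, sum_sub_distrib, ← sum_mul]
    rw [← Complex.ofReal_sum, sum_dir_trapping]
    simp
  set b : CVec n := WithLp.toLp 2 fun j => (trapping A x j : ℂ) with hb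
  have e2 : ∑ j, (trapping A x j : ℂ) * tangential x w j = ⟪b, tangential x w⟫_ℂ := by
    rw [PiLp.inner_apply]
    refine sum_congr rfl fun j _ => ?_
    rw [RCLike.inner_apply, hb]
    simp [mul_comm]
  have e3 : ‖b‖ = ‖trapping A x‖ := by
    rw [EuclideanSpace.norm_eq, EuclideanSpace.norm_eq]
    simp [hb]
  rw [e1, e2, ← e3]
  exact norm_inner_le_norm _ _

theorem abs_rip_le (z w : ℂ) : |rip z w| ≤ ‖z‖ * ‖w‖ := by
  rw [← re_inner_eq_rip]
  exact (abs_re_le_norm _).trans (norm_inner_le_norm _ _)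

theorem sum_trapping_le (A : E n → E n) {x : E n} (hx : x ≠ 0) (w : CVec n) (z : ℂ) {c : ℝ}
    (hc : 0 ≤ c) : -∑ j, (-(2 * c * trapping A x j)) * rip (w j) (I * z) ≤
      3 / 2 * (c / ‖x‖) * ‖tangential x w‖ ^ 2 + c * (2 / 3 * ‖x‖ * ‖trapping A x‖ ^ 2) * ‖z‖ ^ 2 := by
  have hpos : 0 < ‖x‖ := norm_pos_iff.2 hx
  have e : -∑ j, (-(2 * c * trapping A x j)) * rip (w j) (I * z) =
      2 * c * rip (∑ j, (trapping A x j : ℂ) * w j) (I * z) := by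
    rw [rip_sum_left, mul_sum, ← sum_neg_distrib]
    refine sum_congr rfl fun j _ => ?_
    rw [rip_real_mul_left]
    ring
  rw [e]
  set T := ‖tangential x w‖
  set B := ‖trapping A x‖
  have h1 : rip (∑ j, (trapping A x j : ℂ) * w j) (I * z) ≤ B * T * ‖z‖ := by
    refine (le_abs_self _).trans ((abs_rip_le _ _).trans ?_)
    rw [norm_mul, Complex.norm_I, one_mul]
    exact mul_le_mul_of_nonneg_right (norm_sum_trapping_le A x w) (norm_nonneg _)
  have h2 : 2 * (B * T * ‖z‖) ≤ 3 / 2 * (1 / ‖x‖) * T ^ 2 + 2 / 3 * ‖x‖ * B ^ 2 * ‖z‖ ^ 2 := by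
    have h3 : 0 ≤ (3 / 2) * (1 / ‖x‖) * (T - 2 / 3 * ‖x‖ * B * ‖z‖) ^ 2 := by positivity
    have h4 : (3 / 2) * (1 / ‖x‖) * (T - 2 / 3 * ‖x‖ * B * ‖z‖) ^ 2 =
        3 / 2 * (1 / ‖x‖) * T ^ 2 + 2 / 3 * ‖x‖ * B ^ 2 * ‖z‖ ^ 2 - 2 * (B * T * ‖z‖) := by
      field_simp
      ring
    linarith
  calc 2 * c * rip (∑ j, (trapping A x j : ℂ) * w j) (I * z)
      ≤ c * (2 * (B * T * ‖z‖)) := by nlinarith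
    _ ≤ c * (3 / 2 * (1 / ‖x‖) * T ^ 2 + 2 / 3 * ‖x‖ * B ^ 2 * ‖z‖ ^ 2) :=
        mul_le_mul_of_nonneg_left h2 hc
    _ = _ := by ring

theorem continuousOn_norm_trapping (hA : ContDiffOn ℝ 1 A {0}ᶜ) :
    ContinuousOn (fun x => ‖trapping A x‖) {0}ᶜ := by
  have : ContinuousOn (trapping A) {0}ᶜ :=
    (PiLp.continuous_toLp 2 fun _ : Fin n => ℝ).comp_continuousOn
      (continuousOn_pi.2 fun j => continuousOn_trapping hA j)
  exact this.norm

theorem continuousOn_radialDerivPos (hA₀ : ContDiffOn ℝ 1 A₀ {0}ᶜ) :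
    ContinuousOn (radialDerivPos A₀) {0}ᶜ := by
  have h : ContinuousOn (fun x => max (radialDeriv A₀ x) 0) {0}ᶜ :=
    continuous_max.comp_continuousOn ((continuousOn_radialDeriv hA₀).prodMk continuousOn_const)
  exact h

/-- The density of the error terms of the virial inequality. -/
def errorDensity (A₀ : E n → ℝ) (A : E n → E n) (x : E n) : ℝ :=
  2 / 3 * ‖x‖ * ‖trapping A x‖ ^ 2 + radialDerivPos A₀ x

theorem errorDensity_nonneg (A₀ : E n → ℝ) (A : E n → E n) (x : E n) : 0 ≤ errorDensity A₀ A x :=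
  add_nonneg (by positivity) (le_max_right _ _)

theorem continuousOn_errorDensity (hA : ContDiffOn ℝ 1 A {0}ᶜ) (hA₀ : ContDiffOn ℝ 1 A₀ {0}ᶜ) :
    ContinuousOn (errorDensity A₀ A) {0}ᶜ :=
  ((continuousOn_const.mul continuous_norm.continuousOn).mul
    ((continuousOn_norm_trapping hA).pow 2)).add (continuousOn_radialDerivPos hA₀)

/-- The elements `u` of the domain of `H`, with the associated data: `p = (u, ∇_A u)`,
`L = -Δ_A u`, `V = A₀ u`, `N = g(|u|²) u`. -/
structure DomainData (A₀ : E n → ℝ) (A : E n → E n) (g : ℝ → ℝ) (p : covGradGraph A)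
    (L V N : L2 n) : Prop where
  laplacian : ∀ q ∈ covGradGraph A, ⟪q.snd, p.1.snd⟫_ℂ = ⟪q.fst, L⟫_ℂ
  potential : V =ᵐ[volume] fun x => (A₀ x : ℂ) * p.1.fst x
  nonlinear : ∀ᵐ x, N x = ((g (‖p.1.fst x‖ ^ 2) : ℝ) : ℂ) * p.1.fst x

theorem integrable_radial_sq (w : L2Vec n) : Integrable fun x => ‖radial x (w x)‖ ^ 2 :=
  integrable_of_ae_inner (radial_sq_ae w)

theorem integrable_tangential_sq (w : L2Vec n) : Integrable fun x => ‖tangential x (w x)‖ ^ 2 :=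
  integrable_of_ae_inner (tangential_sq_ae w)

theorem integrable_rip_radial (f : L2 n) (w : L2Vec n) :
    Integrable fun x => rip (f x) (radial x (w x)) := integrable_of_ae_inner (rip_radial_ae f w)

theorem integral_rip_add {m : E n → ℝ} (hm : AEStronglyMeasurable m volume) {C : ℝ}
    (hC : ∀ x, |m x| ≤ C) (f k h : L2 n) : ∫ x, m x * rip ((f + k : L2 n) x) (h x) =
      (∫ x, m x * rip (f x) (h x)) + ∫ x, m x * rip (k x) (h x) := by
  rw [← integral_add ((integrable_rip f h).bdd_mul hm (ae_of_all _ hC))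
    ((integrable_rip k h).bdd_mul hm (ae_of_all _ hC))]
  refine integral_congr_ae ?_
  filter_upwards [Lp.coeFn_add f k] with x hx
  rw [hx, Pi.add_apply, ← mul_add]
  simp only [rip, add_re, add_im]
  ring

section

variable {g G : ℝ → ℝ} {p : covGradGraph A} {L V N : L2 n} {r0 r1 : ℝ}

theorem virial_ineq_compact (hn : 3 ≤ n) (hA : ContDiffOn ℝ 1 A {0}ᶜ) (hA₀ : ContDiffOn ℝ 1 A₀ {0}ᶜ)
    (hg : Defocusing g G) (hD : DomainData A₀ A g p L V N) (hm : Multiplier n a a' v v')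
    (h0 : 0 < r0) (hs : Multiplier.SupportedIn a a' v v' r0 r1) (ha : ∀ r, 0 < r → 0 ≤ a r) :
    ofReal ((∫ x, 2 * a' ‖x‖ * ‖radial x (p.1.snd x)‖ ^ 2) +
        (∫ x, 1 / 2 * (a ‖x‖ / ‖x‖) * ‖tangential x (p.1.snd x)‖ ^ 2) +
        (∫ x, v' ‖x‖ * rip (radial x (p.1.snd x)) (p.1.fst x)) +
        (∫ x, v ‖x‖ * G (‖p.1.fst x‖ ^ 2)) -
        ((∫ x, 2 * a ‖x‖ * rip ((L + V + N : L2 n) x) (radial x (p.1.snd x))) +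
          ∫ x, v ‖x‖ * rip ((L + V + N : L2 n) x) (p.1.fst x))) ≤
      ∫⁻ x, ofReal (a ‖x‖ * errorDensity A₀ A x) * ‖p.1.fst x‖ₑ ^ 2 := by
  have hvir := virial hn hA p hD.laplacian hm h0 hs
  have hpot := radial_multiplication hn hA p hm h0 hs hA₀ hD.potential
  have hnon := radial_nonlinear hn hA p hm h0 hs hg hD.nonlinear
  have ca := continuousOn_norm_comp (n := n) hm.cont_a
  have cv := continuousOn_norm_comp (n := n) hm.cont_v
  have c1 : ContinuousOn (fun x : E n => 2 * a ‖x‖) {0}ᶜ := continuousOn_const.mul ca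
  have c3 : ContinuousOn (fun x => a ‖x‖ * radialDeriv A₀ x) {0}ᶜ := ca.mul (continuousOn_radialDeriv hA₀)
  have c4 : ContinuousOn (fun x : E n => a ‖x‖ / ‖x‖) {0}ᶜ := ca.div
    continuous_norm.continuousOn fun x hx => norm_ne_zero_iff.2 hx
  have c₅ : ContinuousOn (fun x => a ‖x‖ * errorDensity A₀ A x) {0}ᶜ :=
    ca.mul (continuousOn_errorDensity hA hA₀)
  have c₆ : ∀ j, ContinuousOn (fun x => -(2 * a ‖x‖ * trapping A x j)) {0}ᶜ := fun j =>
    (c1.mul (continuousOn_trapping hA j)).neg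
  have z : ∀ x : E n, x ≠ 0 → ¬(r0 ≤ ‖x‖ ∧ ‖x‖ ≤ r1) → a ‖x‖ = 0 := fun x hx hr =>
    hs.a_zero _ (norm_pos_iff.2 hx) hr
  obtain ⟨C1, b1⟩ := bound_of_annulus c1 h0 (r1 := r1) fun x hx hr => by
    rw [z x hx hr, mul_zero]
  obtain ⟨C2, b2⟩ := bound_of_annulus cv h0 (r1 := r1) fun x hx hr =>
    hs.v_zero _ (norm_pos_iff.2 hx) hr
  obtain ⟨C3, b3⟩ := bound_of_annulus c3 h0 (r1 := r1) fun x hx hr => by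
    rw [z x hx hr, zero_mul]
  obtain ⟨C4, b4⟩ := bound_of_annulus c4 h0 (r1 := r1) fun x hx hr => by
    rw [z x hx hr, zero_div]
  obtain ⟨C₅, b₅⟩ := bound_of_annulus c₅ h0 (r1 := r1) fun x hx hr => by
    rw [z x hx hr, zero_mul]
  choose C₆ b₆ using fun j => bound_of_annulus (c₆ j) h0 (r1 := r1) fun x hx hr => by
    rw [z x hx hr, mul_zero, zero_mul, neg_zero]
  have s := fun {m : E n → ℝ} (c : ContinuousOn m {0}ᶜ) => aesm_of_continuousOn hn c
  have eR : ∀ f : L2 n, ∫ x, 2 * a ‖x‖ * rip (f x) (radial x (p.1.snd x)) =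
      ∫ x, 2 * a ‖x‖ * rip (f x) (radialCLM p.1.snd x) := by
    intro f
    refine integral_congr_ae ?_
    filter_upwards [radialCLM_ae p.1.snd] with x hx
    rw [hx]
  have hsum : (∫ x, 2 * a ‖x‖ * rip ((L + V + N : L2 n) x) (radial x (p.1.snd x))) +
      ∫ x, v ‖x‖ * rip ((L + V + N : L2 n) x) (p.1.fst x) =
      ((∫ x, 2 * a ‖x‖ * rip (L x) (radial x (p.1.snd x))) + ∫ x, v ‖x‖ * rip (L x) (p.1.fst x)) +
      ((∫ x, 2 * a ‖x‖ * rip (V x) (radial x (p.1.snd x))) + ∫ x, v ‖x‖ * rip (V x) (p.1.fst x)) +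
      ((∫ x, 2 * a ‖x‖ * rip (N x) (radial x (p.1.snd x))) +
        ∫ x, v ‖x‖ * rip (N x) (p.1.fst x)) := by
    simp only [eR]
    rw [integral_rip_add (s c1) b1, integral_rip_add (s c1) b1, integral_rip_add (s cv) b2,
      integral_rip_add (s cv) b2]
    ring
  have i3 : Integrable fun x => a ‖x‖ * radialDeriv A₀ x * ‖p.1.fst x‖ ^ 2 :=
    (integrable_norm_sq p.1.fst).bdd_mul (s c3) (ae_of_all _ b3)
  have i4 : Integrable fun x => a ‖x‖ / ‖x‖ * ‖tangential x (p.1.snd x)‖ ^ 2 :=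
    (integrable_tangential_sq p.1.snd).bdd_mul (s c4) (ae_of_all _ b4)
  have i₅ : Integrable fun x => a ‖x‖ * errorDensity A₀ A x * ‖p.1.fst x‖ ^ 2 :=
    (integrable_norm_sq p.1.fst).bdd_mul (s c₅) (ae_of_all _ b₅)
  have i₆ : ∀ j, Integrable fun x =>
      -(2 * a ‖x‖ * trapping A x j) * rip (p.1.snd x j) (I * p.1.fst x) := fun j =>
    (integrable_of_ae_inner (rip_comp_ae j _ _)).bdd_mul (s (c₆ j)) (ae_of_all _ (b₆ j))
  have e4 : ∀ c : ℝ, ∫ x, c * (a ‖x‖ / ‖x‖) * ‖tangential x (p.1.snd x)‖ ^ 2 =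
      c * ∫ x, a ‖x‖ / ‖x‖ * ‖tangential x (p.1.snd x)‖ ^ 2 := by
    intro c
    rw [← integral_const_mul]
    exact integral_congr_ae (ae_of_all _ fun x => by ring)
  have hle : -(3 / 2 * ∫ x, a ‖x‖ / ‖x‖ * ‖tangential x (p.1.snd x)‖ ^ 2) -
      (∑ j, ∫ x, -(2 * a ‖x‖ * trapping A x j) * rip (p.1.snd x j) (I * p.1.fst x)) +
      (∫ x, a ‖x‖ * radialDeriv A₀ x * ‖p.1.fst x‖ ^ 2) ≤
      ∫ x, a ‖x‖ * errorDensity A₀ A x * ‖p.1.fst x‖ ^ 2 := by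
    have i₇ := integrable_finsetSum Finset.univ fun j _ => i₆ j
    rw [← integral_finsetSum _ fun j _ => i₆ j, ← integral_const_mul]
    have hmono : (∫ x, a ‖x‖ * radialDeriv A₀ x * ‖p.1.fst x‖ ^ 2) ≤
        ∫ x, ((3 / 2 * (a ‖x‖ / ‖x‖ * ‖tangential x (p.1.snd x)‖ ^ 2) +
          ∑ j, -(2 * a ‖x‖ * trapping A x j) * rip (p.1.snd x j) (I * p.1.fst x)) +
          a ‖x‖ * errorDensity A₀ A x * ‖p.1.fst x‖ ^ 2) := by
      refine integral_mono_ae i3 (((i4.const_mul (3 / 2)).add i₇).add i₅) ?_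
      filter_upwards [ae_ne_zero hn] with x hx
      have hax := ha _ (norm_pos_iff.2 hx)
      have h1 := sum_trapping_le A hx (p.1.snd x) (p.1.fst x) hax
      have h2 : radialDeriv A₀ x ≤ radialDerivPos A₀ x := le_max_left _ _
      have h3 : a ‖x‖ * radialDeriv A₀ x * ‖p.1.fst x‖ ^ 2 ≤
          a ‖x‖ * radialDerivPos A₀ x * ‖p.1.fst x‖ ^ 2 := by gcongr
      rw [errorDensity]
      linarith
    rw [integral_add (by exact (i4.const_mul (3 / 2)).add i₇) i₅,
      integral_add (i4.const_mul (3 / 2)) i₇] at hmono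
    linarith
  have hfin : ∫⁻ x, ofReal (a ‖x‖ * errorDensity A₀ A x) * ‖p.1.fst x‖ₑ ^ 2 =
      ofReal (∫ x, a ‖x‖ * errorDensity A₀ A x * ‖p.1.fst x‖ ^ 2) := by
    rw [ofReal_integral_eq_lintegral_ofReal i₅]
    · refine lintegral_congr_ae ?_
      filter_upwards [ae_ne_zero hn] with x hx
      rw [ofReal_mul (mul_nonneg (ha _ (norm_pos_iff.2 hx)) (errorDensity_nonneg _ _ _)),
        ofReal_pow (norm_nonneg _), ofReal_norm]
    · filter_upwards [ae_ne_zero hn] with x hx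
      exact mul_nonneg (mul_nonneg (ha _ (norm_pos_iff.2 hx)) (errorDensity_nonneg _ _ _))
        (sq_nonneg _)
  rw [hfin]
  refine ofReal_le_ofReal (le_trans (le_of_eq ?_) hle)
  rw [hsum, hvir, hpot, hnon, e4, e4]
  ring

end

end

section

variable {A : E n → E n} {A₀ : E n → ℝ} {a a' v v' : ℝ → ℝ}

/-! ### Removing the cutoff -/

theorem exists_log_cutoff : ∃ (c c' c'' : ℕ → ℝ → ℝ) (K : ℝ), 0 ≤ K ∧
    (∀ i r, 0 < r → HasDerivAt (c i) (c' i r) r) ∧ (∀ i r, 0 < r → HasDerivAt (c' i) (c'' i r) r) ∧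
    (∀ i, ContinuousOn (c'' i) (Ioi 0)) ∧ (∀ i r, 0 ≤ c i r ∧ c i r ≤ 1) ∧
    (∀ i r, 0 < r → |c' i r| ≤ K / r) ∧ (∀ i r, 0 < r → |c'' i r| ≤ K / r ^ 2) ∧
    (∀ r, 0 < r → ∀ᶠ i in atTop, c i r = 1 ∧ c' i r = 0 ∧ c'' i r = 0) ∧
    ∀ i, ∃ r0 r1, 0 < r0 ∧ ∀ r, 0 < r → ¬(r0 ≤ r ∧ r ≤ r1) → c i r = 0 := by
  let φ : ContDiffBump (0 : ℝ) := ⟨1, 2, one_pos, one_lt_two⟩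
  have h2 : ContDiff ℝ 2 φ := φ.contDiff
  have h1 : ContDiff ℝ 1 (deriv φ) := h2.deriv' (n := 1)
  have h0 : Continuous (deriv (deriv φ)) := h1.continuous_deriv le_rfl
  have s1 : HasCompactSupport (deriv φ) := φ.hasCompactSupport.deriv
  have s2 : HasCompactSupport (deriv (deriv φ)) := s1.deriv
  obtain ⟨K1, hK1⟩ := h1.continuous.bounded_above_of_compact_support s1
  obtain ⟨K2, hK2⟩ := h0.bounded_above_of_compact_support s2
  have K₁0 : 0 ≤ K1 := (norm_nonneg _).trans (hK1 0)
  have K₂0 : 0 ≤ K2 := (norm_nonneg _).trans (hK2 0)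
  have d1 : ∀ s, HasDerivAt φ (deriv φ s) s := fun s => (h2.differentiable two_ne_zero s).hasDerivAt
  have d2 : ∀ s, HasDerivAt (deriv φ) (deriv (deriv φ) s) s := fun s =>
    (h1.differentiable one_ne_zero s).hasDerivAt
  have hN : ∀ i : ℕ, (1 : ℝ) ≤ i + 1 := fun i => by linarith [Nat.cast_nonneg (α := ℝ) i]
  have dl : ∀ (i : ℕ) (r : ℝ), 0 < r →
      HasDerivAt (fun r => log r / (i + 1)) (r⁻¹ / (i + 1)) r := fun i r hr =>
    (Real.hasDerivAt_log hr.ne').div_const _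
  refine ⟨fun i r => φ (log r / (i + 1)), fun i r => deriv φ (log r / (i + 1)) * (r⁻¹ / (i + 1)),
    fun i r => deriv (deriv φ) (log r / (i + 1)) * (r⁻¹ / (i + 1)) * (r⁻¹ / (i + 1)) +
      deriv φ (log r / (i + 1)) * (-(r ^ 2)⁻¹ / (i + 1)), K2 + K1, by positivity,
    fun i r hr => (d1 _).comp r (dl i r hr),
    fun i r hr => ((d2 _).comp r (dl i r hr)).mul ((hasDerivAt_inv hr.ne').div_const _), ?_,
    fun i r => ⟨φ.nonneg, φ.le_one⟩, ?_, ?_, ?_, ?_⟩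
  · intro i
    have hl : ContinuousOn (fun r : ℝ => log r / (i + 1)) (Ioi 0) := fun r hr =>
      (dl i r hr).continuousAt.continuousWithinAt
    have hi : ContinuousOn (fun r : ℝ => r⁻¹ / ((i : ℝ) + 1)) (Ioi 0) :=
      (continuousOn_inv₀.mono fun r (hr : 0 < r) => hr.ne').div_const _
    refine (((h0.comp_continuousOn hl).mul hi).mul hi).add ((h1.continuous.comp_continuousOn hl).mul ?_)
    exact (((continuousOn_id.pow 2).inv₀ fun r (hr : 0 < r) => pow_ne_zero 2 hr.ne').neg).div_const _
  · intro i r hr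
    rw [abs_mul, abs_of_pos (by have := hN i; positivity : 0 < r⁻¹ / ((i : ℝ) + 1)), div_eq_mul_inv]
    refine mul_le_mul ((hK1 _).trans (by linarith)) ?_ (by have := hN i; positivity) (by positivity)
    exact div_le_self (by positivity) (hN i)
  · intro i r hr
    have hle : r⁻¹ / ((i : ℝ) + 1) ≤ r⁻¹ := div_le_self (by positivity) (hN i)
    have hp : 0 < r⁻¹ / ((i : ℝ) + 1) := by have := hN i; positivity
    have hle' : |-(r ^ 2)⁻¹ / ((i : ℝ) + 1)| ≤ (r ^ 2)⁻¹ := by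
      rw [neg_div, abs_neg, abs_of_pos (by have := hN i; positivity)]
      exact div_le_self (by positivity) (hN i)
    refine (abs_add_le _ _).trans ?_
    rw [abs_mul, abs_mul, abs_mul, abs_of_pos hp, add_div, div_eq_mul_inv, div_eq_mul_inv, mul_assoc]
    refine add_le_add (mul_le_mul (hK2 _) ?_ (by positivity) K₂0)
      (mul_le_mul (hK1 _) hle' (abs_nonneg _) K₁0)
    calc r⁻¹ / ((i : ℝ) + 1) * (r⁻¹ / (i + 1)) ≤ r⁻¹ * r⁻¹ :=
          mul_le_mul hle hle hp.le (by positivity)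
      _ = (r ^ 2)⁻¹ := by rw [sq, mul_inv]
  · intro r hr
    filter_upwards [Filter.eventually_gt_atTop ⌈|log r|⌉₊] with i hi
    have hlt : |log r / (i + 1)| < 1 := by
      have hp : (0 : ℝ) < i + 1 := by linarith [hN i]
      rw [abs_div, abs_of_pos hp, div_lt_one hp]
      have h1 := Nat.le_ceil |log r|
      have h2 : ((⌈|log r|⌉₊ : ℕ) : ℝ) < i := by exact_mod_cast hi
      linarith
    set s := log r / ((i : ℝ) + 1)
    have hnear : ∀ᶠ y in 𝓝 s, |y| < 1 := (continuous_abs.tendsto s).eventually (gt_mem_nhds hlt)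
    have e0 : ∀ y : ℝ, |y| < 1 → φ y = 1 := fun y hy =>
      φ.one_of_mem_closedBall (by simpa [Metric.mem_closedBall, dist_eq] using hy.le)
    have e1 : ∀ y : ℝ, |y| < 1 → deriv φ y = 0 := fun y hy => by
      have : φ =ᶠ[𝓝 y] fun _ => (1 : ℝ) :=
        ((continuous_abs.tendsto y).eventually (gt_mem_nhds hy)).mono fun z hz => e0 z hz
      rw [this.deriv_eq, deriv_const]
    have e2 : deriv (deriv φ) s = 0 := by
      have : deriv φ =ᶠ[𝓝 s] fun _ => (0 : ℝ) := hnear.mono fun z hz => e1 z hz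
      rw [this.deriv_eq, deriv_const]
    exact ⟨e0 s hlt, by rw [e1 s hlt, zero_mul], by rw [e1 s hlt, e2]; simp⟩
  · intro i
    refine ⟨Real.exp (-(2 * (i + 1))), Real.exp (2 * (i + 1)), Real.exp_pos _, fun r hr hr' => ?_⟩
    have hp : (0 : ℝ) < i + 1 := by linarith [hN i]
    refine φ.zero_of_le_dist ?_
    rw [dist_eq, sub_zero]
    change 2 ≤ _
    by_contra hlt
    push Not at hlt
    rw [abs_div, abs_of_pos hp, div_lt_iff₀ hp, abs_lt] at hlt
    refine hr' ⟨?_, ?_⟩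
    · rw [← Real.le_log_iff_exp_le hr]; exact hlt.1.le
    · rw [← Real.log_le_iff_le_exp hr]; exact hlt.2.le

theorem tendsto_weight_mul (hn : 3 ≤ n) {F : E n → ℝ} (hF : Integrable F) {m : ℕ → ℝ → ℝ}
    {m0 : ℝ → ℝ} {C : ℝ} (hm : ∀ i, ContinuousOn (m i) (Ioi 0)) (hC : ∀ i r, 0 < r → |m i r| ≤ C)
    (hlim : ∀ r, 0 < r → ∀ᶠ i in atTop, m i r = m0 r) :
    Tendsto (fun i => ∫ x, m i ‖x‖ * F x) atTop (𝓝 (∫ x, m0 ‖x‖ * F x)) := by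
  refine tendsto_integral_of_dominated_convergence (fun x => C * ‖F x‖)
    (fun i => (measurable_of_Ioi hn (hm i)).mul hF.1) (hF.norm.const_mul C)
    (fun i => ?_) ?_
  · filter_upwards [ae_ne_zero hn] with x hx
    rw [norm_mul]
    exact mul_le_mul_of_nonneg_right (hC i _ (norm_pos_iff.2 hx)) (norm_nonneg _)
  · filter_upwards [ae_ne_zero hn] with x hx
    exact tendsto_const_nhds.congr' ((hlim _ (norm_pos_iff.2 hx)).mono fun i hi => by simp only [hi])

theorem integrable_weight_mul (hn : 3 ≤ n) {F : E n → ℝ} (hF : Integrable F) {m : ℝ → ℝ} {C : ℝ}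
    (hm : ContinuousOn m (Ioi 0)) (hC : ∀ r, 0 < r → |m r| ≤ C) :
    Integrable fun x => m ‖x‖ * F x := by
  refine hF.bdd_mul (c := C) (measurable_of_Ioi hn hm) ?_
  filter_upwards [ae_ne_zero hn] with x hx using hC _ (norm_pos_iff.2 hx)

/-- The radial multipliers `a(|x|) x/|x|` of the estimates, with `v = div (a(|x|) x/|x|)`. -/
structure Weight (n : ℕ) (a a' v v' : ℝ → ℝ) (C : ℝ) : Prop extends Multiplier n a a' v v' where
  nonneg : ∀ r, 0 ≤ r → 0 ≤ a r
  le_const : ∀ r, 0 ≤ r → a r ≤ C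
  le_mul : ∀ r, 0 < r → a r ≤ C * r
  abs_deriv_le : ∀ r, 0 < r → |a' r| ≤ C
  abs_deriv_le' : ∀ r, 0 < r → |a' r| ≤ C / r
  abs_v'_le : ∀ r, 0 < r → |v' r| ≤ C / r

section

variable {C : ℝ}

theorem Weight.const_nonneg (h : Weight n a a' v v' C) : 0 ≤ C := (h.nonneg 0 le_rfl).trans (h.le_const 0 le_rfl)

theorem Weight.abs_v_le (hn : 3 ≤ n) (h : Weight n a a' v v' C) {r : ℝ} (hr : 0 < r) :
    |v r| ≤ n * C := by
  have hn1 := sub_one_nonneg hn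
  rw [h.v_eq r hr]
  refine (abs_add_le _ _).trans ?_
  rw [abs_mul, abs_of_nonneg hn1, abs_of_nonneg (div_nonneg (h.nonneg r hr.le) hr.le)]
  have h1 : a r / r ≤ C := (div_le_iff₀ hr).2 (h.le_mul r hr)
  nlinarith [h.abs_deriv_le r hr]

theorem Weight.abs_v_le' (hn : 3 ≤ n) (h : Weight n a a' v v' C) {r : ℝ} (hr : 0 < r) :
    |v r| ≤ n * C / r := by
  have hn1 := sub_one_nonneg hn
  rw [h.v_eq r hr]
  refine (abs_add_le _ _).trans ?_
  rw [abs_mul, abs_of_nonneg hn1, abs_of_nonneg (div_nonneg (h.nonneg r hr.le) hr.le)]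
  have h1 : a r / r ≤ C / r := div_le_div_of_nonneg_right (h.le_const r hr.le) hr.le
  have h2 : n * C / r = C / r + (n - 1) * (C / r) := by ring
  rw [h2]
  exact add_le_add (h.abs_deriv_le' r hr) (mul_le_mul_of_nonneg_left h1 hn1)

variable {c c' c'' : ℝ → ℝ} {K : ℝ}

theorem Multiplier.mul (h : Multiplier n a a' v v') (h1 : ∀ r, 0 < r → HasDerivAt c (c' r) r)
    (h2 : ∀ r, 0 < r → HasDerivAt c' (c'' r) r) (h3 : ContinuousOn c'' (Ioi 0)) :
    Multiplier n (fun r => c r * a r) (fun r => c' r * a r + c r * a' r)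
      (fun r => c' r * a r + c r * v r)
      (fun r => (c'' r * a r + c' r * a' r) + (c' r * v r + c r * v' r)) where
  deriv_a r hr := (h1 r hr).mul (h.deriv_a r hr)
  deriv_v r hr := ((h2 r hr).mul (h.deriv_a r hr)).add ((h1 r hr).mul (h.deriv_v r hr))
  v_eq r hr := by rw [h.v_eq r hr]; ring
  cont_v' := by
    have c1 : ContinuousOn c (Ioi 0) := fun r hr => (h1 r hr).continuousAt.continuousWithinAt
    have c2 : ContinuousOn c' (Ioi 0) := fun r hr => (h2 r hr).continuousAt.continuousWithinAt
    exact ((h3.mul h.cont_a).add (c2.mul h.cont_a')).add ((c2.mul h.cont_v).add (c1.mul h.cont_v'))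

theorem integrable_hardy_rip_radial (hn : 3 ≤ n) (hA : ContDiffOn ℝ 1 A {0}ᶜ) (p : covGradGraph A) :
    Integrable fun x => ‖x‖⁻¹ * rip (radial x (p.1.snd x)) (p.1.fst x) := by
  refine (integrable_rip_radial (hardyCLM hn hA p) p.1.snd).congr ?_
  filter_upwards [hardyCLM_ae hn hA p] with x hx
  rw [hx, rip_real_mul_left, rip_comm]

theorem Weight.exists_truncation (hn : 3 ≤ n) (h : Weight n a a' v v' C) :
    ∃ (b b' w w' : ℕ → ℝ → ℝ) (r0 r1 : ℕ → ℝ) (B : ℝ), 0 ≤ B ∧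
      (∀ i, 0 < r0 i ∧ Multiplier n (b i) (b' i) (w i) (w' i) ∧
        ∀ r, 0 < r → ¬(r0 i ≤ r ∧ r ≤ r1 i) → b i r = 0) ∧
      (∀ i r, 0 < r → 0 ≤ b i r ∧ b i r ≤ a r ∧ |b' i r| ≤ B ∧ |b' i r| ≤ B / r ∧ |w i r| ≤ B ∧
        |w' i r| ≤ B / r) ∧
      ∀ r, 0 < r → ∀ᶠ i in atTop, b i r = a r ∧ b' i r = a' r ∧ w i r = v r ∧ w' i r = v' r := by
  obtain ⟨c, c', c'', K, K0, d1, d2, ct, c01, b1, b2, hev, hsupp⟩ := exists_log_cutoff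
  have hC := h.const_nonneg
  choose r0 r1 h0 hz using hsupp
  refine ⟨_, _, _, _, r0, r1, (n + 2) * ((K + 1) * C), by positivity, fun i => ⟨h0 i,
    h.toMultiplier.mul (d1 i) (d2 i) (ct i), fun r hr hr' => by rw [hz i r hr hr', zero_mul]⟩,
    fun i r hr => ?_, fun r hr => (hev r hr).mono fun i ⟨e1, e2, e3⟩ => by simp [e1, e2, e3]⟩
  have hm : ∀ {x y α β : ℝ}, |x| ≤ α → |y| ≤ β → |x * y| ≤ α * β := fun hx hy =>
    (abs_mul _ _).trans_le (mul_le_mul hx hy (abs_nonneg _) ((abs_nonneg _).trans hx))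
  have bc : |c i r| ≤ 1 := abs_le.2 ⟨by linarith [c01 i r], (c01 i r).2⟩
  have ha := abs_of_nonneg (h.nonneg r hr.le)
  have ha1 := ha.trans_le (h.le_mul r hr)
  have ha2 := ha.trans_le (h.le_const r hr.le)
  have y1 := hm (b1 i r hr) ha1
  have y2 := hm (b2 i r hr) ha1
  rw [(by field_simp : K / r * (C * r) = K * C)] at y1
  rw [(by field_simp : K / r ^ 2 * (C * r) = K / r * C)] at y2
  have p1 : 0 ≤ K * C := by positivity
  have p2 : 0 ≤ n * C := by positivity
  have p3 : 0 ≤ n * (K * C) := by positivity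
  refine ⟨mul_nonneg (c01 i r).1 (h.nonneg r hr.le),
    mul_le_of_le_one_left (h.nonneg _ hr.le) (c01 i _).2, ?_, ?_, ?_, ?_⟩
  · linarith [abs_add_le (c' i r * a r) (c i r * a' r), hm bc (h.abs_deriv_le r hr)]
  · refine (abs_add_le _ _).trans ((add_le_add (hm (b1 i r hr) ha2)
      (hm bc (h.abs_deriv_le' r hr))).trans ?_)
    rw [(by ring : K / r * C + 1 * (C / r) = (K * C + C) / r)]
    exact div_le_div_of_nonneg_right (by linarith) hr.le
  · linarith [abs_add_le (c' i r * a r) (c i r * v r), hm bc (h.abs_v_le hn hr)]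
  · refine (abs_add_le _ _).trans ((add_le_add ((abs_add_le _ _).trans (add_le_add y2
      (hm (b1 i r hr) (h.abs_deriv_le r hr)))) ((abs_add_le _ _).trans (add_le_add
        (hm (b1 i r hr) (h.abs_v_le hn hr)) (hm bc (h.abs_v'_le r hr))))).trans ?_)
    rw [(by ring : K / r * C + K / r * C + (K / r * (n * C) + 1 * (C / r)) =
      (2 * (K * C) + n * (K * C) + C) / r)]
    exact div_le_div_of_nonneg_right (by linarith) hr.le

theorem virial_ineq {g G : ℝ → ℝ} {p : covGradGraph A} {L V N : L2 n}
    (hn : 3 ≤ n) (hA : ContDiffOn ℝ 1 A {0}ᶜ) (hA₀ : ContDiffOn ℝ 1 A₀ {0}ᶜ)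
    (hg : Defocusing g G) (hD : DomainData A₀ A g p L V N) (h : Weight n a a' v v' C) :
    ofReal ((∫ x, 2 * a' ‖x‖ * ‖radial x (p.1.snd x)‖ ^ 2) +
        (∫ x, 1 / 2 * (a ‖x‖ / ‖x‖) * ‖tangential x (p.1.snd x)‖ ^ 2) +
        (∫ x, v' ‖x‖ * rip (radial x (p.1.snd x)) (p.1.fst x)) +
        (∫ x, v ‖x‖ * G (‖p.1.fst x‖ ^ 2)) -
        ((∫ x, 2 * a ‖x‖ * rip ((L + V + N : L2 n) x) (radial x (p.1.snd x))) +
          ∫ x, v ‖x‖ * rip ((L + V + N : L2 n) x) (p.1.fst x))) ≤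
      ∫⁻ x, ofReal (a ‖x‖ * errorDensity A₀ A x) * ‖p.1.fst x‖ₑ ^ 2 := by
  obtain ⟨b, b', w, w', r0, r1, B, -, hM, hb, hev⟩ := h.exists_truncation hn
  have key := fun i => virial_ineq_compact hn hA hA₀ hg hD (hM i).2.1 (hM i).1
    ((hM i).2.1.supportedIn (hM i).2.2) (fun r hr => (hb i r hr).1)
  have hb0 : ∀ i r, 0 < r → |b i r| ≤ a r := fun i r hr =>
    (abs_of_nonneg (hb i r hr).1).trans_le (hb i r hr).2.1
  have hright : ∀ i, ∫⁻ x, ofReal (b i ‖x‖ * errorDensity A₀ A x) * ‖p.1.fst x‖ₑ ^ 2 ≤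
      ∫⁻ x, ofReal (a ‖x‖ * errorDensity A₀ A x) * ‖p.1.fst x‖ₑ ^ 2 := fun i => by
    refine lintegral_mono_ae ?_
    filter_upwards [ae_ne_zero hn] with x hx
    exact mul_le_mul_left (ofReal_le_ofReal (mul_le_mul_of_nonneg_right
      (hb i _ (norm_pos_iff.2 hx)).2.1 (errorDensity_nonneg _ _ _))) _
  have T1 := tendsto_weight_mul hn (integrable_radial_sq p.1.snd) (m := fun i r => 2 * b' i r)
    (m0 := fun r => 2 * a' r) (C := 2 * B) (fun i => continuousOn_const.mul (hM i).2.1.cont_a')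
    (fun i r hr => by rw [abs_mul, abs_two]; linarith [hb i r hr])
    (fun r hr => (hev r hr).mono fun i e => by rw [e.2.1])
  have T2 := tendsto_weight_mul hn (integrable_tangential_sq p.1.snd) (C := C)
    (m := fun i r => 1 / 2 * (b i r / r)) (m0 := fun r => 1 / 2 * (a r / r))
    (fun i => continuousOn_const.mul ((hM i).2.1.cont_a.div continuousOn_id fun r hr => ne_of_gt hr))
    (fun i r hr => by
      have := (div_le_iff₀ hr).2 ((hb0 i r hr).trans (h.le_mul r hr))
      rw [abs_mul, abs_of_pos one_half_pos, abs_div, abs_of_pos hr]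
      linarith [div_nonneg (abs_nonneg (b i r)) hr.le])
    (fun r hr => (hev r hr).mono fun i e => by rw [e.1])
  have T3 : Tendsto (fun i => ∫ x, w' i ‖x‖ * rip (radial x (p.1.snd x)) (p.1.fst x)) atTop
      (𝓝 (∫ x, v' ‖x‖ * rip (radial x (p.1.snd x)) (p.1.fst x))) := by
    have e : ∀ f : ℝ → ℝ, ∫ x, f ‖x‖ * rip (radial x (p.1.snd x)) (p.1.fst x) =
        ∫ x, (f ‖x‖ * ‖x‖) * (‖x‖⁻¹ * rip (radial x (p.1.snd x)) (p.1.fst x)) := by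
      intro f
      refine integral_congr_ae ?_
      filter_upwards [ae_ne_zero hn] with x hx
      have hpos := norm_pos_iff.2 hx
      field_simp
    simp only [e v', e (w' _)]
    exact tendsto_weight_mul hn (integrable_hardy_rip_radial hn hA p) (m := fun i r => w' i r * r)
      (m0 := fun r => v' r * r) (C := B) (fun i => (hM i).2.1.cont_v'.mul continuousOn_id)
      (fun i r hr => by
        rw [abs_mul, abs_of_pos hr, ← le_div_iff₀ hr]
        exact (hb i r hr).2.2.2.2.2)
      (fun r hr => (hev r hr).mono fun i e => by rw [e.2.2.2])
  have Tv := fun {F : E n → ℝ} (hF : Integrable F) => tendsto_weight_mul hn hF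
    (fun i => (hM i).2.1.cont_v) (fun i r hr => (hb i r hr).2.2.2.2.1)
    (fun r hr => (hev r hr).mono fun i e => e.2.2.1)
  have Ta := tendsto_weight_mul hn (integrable_rip_radial (L + V + N) p.1.snd)
    (m := fun i r => 2 * b i r) (m0 := fun r => 2 * a r) (C := 2 * C)
    (fun i => continuousOn_const.mul (hM i).2.1.cont_a)
    (fun i r hr => by rw [abs_mul, abs_two]; linarith [hb0 i r hr, h.le_const r hr.le])
    (fun r hr => (hev r hr).mono fun i e => by rw [e.1])
  have hlim := (((T1.add T2).add T3).add (Tv (hg.integrable_G hD.nonlinear))).sub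
    (Ta.add (Tv (integrable_rip (L + V + N) p.1.fst)))
  exact le_of_tendsto ((continuous_ofReal.tendsto _).comp hlim)
    (Eventually.of_forall fun i => (key i).trans (hright i))

end

end

section

/-! ### The family of radial weights -/

/-- Nonnegative continuous functions with support in `[s0, s1]`, `0 < s0`. -/
structure RadialKernel (κ : ℝ → ℝ) (s0 s1 : ℝ) : Prop where
  continuous : Continuous κ
  nonneg : ∀ r, 0 ≤ κ r
  pos : 0 < s0
  le : s0 ≤ s1
  left : ∀ r, r ≤ s0 → κ r = 0
  right : ∀ r, s1 ≤ r → κ r = 0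

/-- The incomplete moments `∫₀^r ρ^i κ(ρ) dρ`. -/
def mom (κ : ℝ → ℝ) (i : ℕ) (r : ℝ) : ℝ := ∫ ρ in (0 : ℝ)..r, ρ ^ i * κ ρ

/-- The solution `a` of `(r⁴ a'')' = -r³ κ` with `a(0) = 0` and bounded `a`; here
`c = ∫₀^∞ κ`. -/
def wt (κ : ℝ → ℝ) (c r : ℝ) : ℝ :=
  r / 3 * (c - mom κ 0 r) + mom κ 1 r / 2 - mom κ 3 r / (6 * r ^ 2)

/-- The derivative of `wt`. -/
def wt' (κ : ℝ → ℝ) (c r : ℝ) : ℝ := (c - mom κ 0 r) / 3 + mom κ 3 r / (3 * r ^ 3)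

/-- The divergence of the radial field `wt(|x|) x/|x|`. -/
def wtDiv (n : ℕ) (κ : ℝ → ℝ) (c r : ℝ) : ℝ := wt' κ c r + (n - 1) * (wt κ c r / r)

/-- The derivative of `wtDiv`. -/
def wtDiv' (n : ℕ) (κ : ℝ → ℝ) (c r : ℝ) : ℝ :=
  -(mom κ 3 r / r ^ 4) + (n - 1) * (wt' κ c r / r - wt κ c r / r ^ 2)

namespace RadialKernel

variable {κ : ℝ → ℝ} {s0 s1 : ℝ}

theorem continuous_moment (h : RadialKernel κ s0 s1) (i : ℕ) : Continuous fun ρ => ρ ^ i * κ ρ := (continuous_pow i).mul h.continuous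

theorem hasDerivAt_mom (h : RadialKernel κ s0 s1) (i : ℕ) (r : ℝ) : HasDerivAt (mom κ i) (r ^ i * κ r) r :=
  integral_hasDerivAt_right ((h.continuous_moment i).intervalIntegrable _ _)
    ((h.continuous_moment i).stronglyMeasurableAtFilter _ _) (h.continuous_moment i).continuousAt

theorem mom_nonneg (h : RadialKernel κ s0 s1) (i : ℕ) {r : ℝ} (hr : 0 ≤ r) : 0 ≤ mom κ i r :=
  intervalIntegral.integral_nonneg hr fun ρ hρ => mul_nonneg (pow_nonneg hρ.1 i) (h.nonneg ρ)

theorem mom_sub (h : RadialKernel κ s0 s1) (i : ℕ) (r s : ℝ) : mom κ i s - mom κ i r = ∫ ρ in r..s, ρ ^ i * κ ρ :=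
  intervalIntegral.integral_interval_sub_left ((h.continuous_moment i).intervalIntegrable _ _)
    ((h.continuous_moment i).intervalIntegrable _ _)

theorem mom_left (h : RadialKernel κ s0 s1) (i : ℕ) {r : ℝ} (hr : 0 ≤ r) (hr' : r ≤ s0) : mom κ i r = 0 := by
  rw [mom, intervalIntegral.integral_congr (g := fun _ => 0), intervalIntegral.integral_zero]
  intro ρ hρ
  rw [uIcc_of_le hr] at hρ
  simp only [h.left ρ (hρ.2.trans hr'), mul_zero]

theorem mom_right (h : RadialKernel κ s0 s1) (i : ℕ) {r : ℝ} (hr : s1 ≤ r) : mom κ i r = mom κ i s1 := by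
  rw [← sub_eq_zero, h.mom_sub, intervalIntegral.integral_congr (g := fun _ => 0),
    intervalIntegral.integral_zero]
  intro ρ hρ
  rw [uIcc_of_le hr] at hρ
  simp only [h.right ρ hρ.1, mul_zero]

theorem mom_add_le (h : RadialKernel κ s0 s1) {r : ℝ} (hr : 0 ≤ r) (i k : ℕ) : mom κ (i + k) r ≤ r ^ k * mom κ i r := by
  rw [mom, mom, ← intervalIntegral.integral_const_mul]
  refine integral_mono_on hr ((h.continuous_moment _).intervalIntegrable _ _)
    (((h.continuous_moment _).const_mul _).intervalIntegrable _ _) fun ρ hρ => ?_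
  rw [pow_add, mul_comm (ρ ^ i), mul_assoc]
  exact mul_le_mul_of_nonneg_right (pow_le_pow_left₀ hρ.1 hρ.2 k)
    (mul_nonneg (pow_nonneg hρ.1 i) (h.nonneg ρ))

theorem tail_nonneg (h : RadialKernel κ s0 s1) {r : ℝ} (hr : 0 ≤ r) (i : ℕ) :
    0 ≤ mom κ i s1 - mom κ i r := by
  rcases le_total r s1 with hs | hs
  · rw [h.mom_sub]
    exact intervalIntegral.integral_nonneg hs fun ρ hρ =>
      mul_nonneg (pow_nonneg (hr.trans hρ.1) i) (h.nonneg ρ)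
  · rw [h.mom_right i hs, sub_self]

theorem mul_tail_le (h : RadialKernel κ s0 s1) {r : ℝ} :
    r * (mom κ 0 s1 - mom κ 0 r) ≤ mom κ 1 s1 - mom κ 1 r := by
  rcases le_total r s1 with hs | hs
  · rw [h.mom_sub, h.mom_sub, ← intervalIntegral.integral_const_mul]
    refine integral_mono_on hs (((h.continuous_moment _).const_mul _).intervalIntegrable _ _)
      ((h.continuous_moment _).intervalIntegrable _ _) fun ρ hρ => ?_
    rw [pow_zero, one_mul, pow_one]
    exact mul_le_mul_of_nonneg_right hρ.1 (h.nonneg ρ)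
  · rw [h.mom_right 0 hs, h.mom_right 1 hs]
    simp

theorem mom_one_le (h : RadialKernel κ s0 s1) {r : ℝ} (hr : 0 ≤ r) : mom κ 1 r ≤ r * mom κ 0 r := by
  simpa using h.mom_add_le hr 0 1

theorem mom_three_le (h : RadialKernel κ s0 s1) {r : ℝ} (hr : 0 ≤ r) : mom κ 3 r ≤ r ^ 2 * mom κ 1 r := h.mom_add_le hr 1 2

theorem wt_ge (h : RadialKernel κ s0 s1) {r : ℝ} (hr : 0 ≤ r) :
    mom κ 1 r / 3 + r * (mom κ 0 s1 - mom κ 0 r) / 3 ≤ wt κ (mom κ 0 s1) r := by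
  rw [wt]
  have h1 : mom κ 3 r / (6 * r ^ 2) ≤ mom κ 1 r / 6 := by
    rcases hr.eq_or_lt with rfl | hr'
    · simpa using div_nonneg (h.mom_nonneg 1 le_rfl) (by norm_num)
    · rw [div_le_div_iff₀ (by positivity) (by norm_num)]
      linarith [h.mom_three_le hr]
  linarith

theorem wt_le (h : RadialKernel κ s0 s1) {r : ℝ} (hr : 0 ≤ r) :
    wt κ (mom κ 0 s1) r ≤ mom κ 1 r / 2 + r * (mom κ 0 s1 - mom κ 0 r) / 3 := by
  rw [wt]
  have := div_nonneg (h.mom_nonneg 3 hr) (by positivity : 0 ≤ 6 * r ^ 2)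
  linarith

theorem wt_nonneg (h : RadialKernel κ s0 s1) {r : ℝ} (hr : 0 ≤ r) : 0 ≤ wt κ (mom κ 0 s1) r := by
  have h1 := h.wt_ge hr
  have h2 := h.mom_nonneg 1 hr
  have h3 := mul_nonneg hr (h.tail_nonneg hr 0)
  linarith

theorem wt_le_moment (h : RadialKernel κ s0 s1) {r : ℝ} (hr : 0 ≤ r) : wt κ (mom κ 0 s1) r ≤ mom κ 1 s1 / 2 := by
  have h1 := h.wt_le hr
  have h2 := h.mul_tail_le (r := r)
  have h3 := mul_nonneg hr (h.tail_nonneg hr 0)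
  linarith

theorem wt_le_mul (h : RadialKernel κ s0 s1) {r : ℝ} (hr : 0 ≤ r) : wt κ (mom κ 0 s1) r ≤ mom κ 0 s1 / 2 * r := by
  have h1 := h.wt_le hr
  have h2 := h.mom_one_le hr
  have h3 := mul_nonneg hr (h.tail_nonneg hr 0)
  linarith

theorem wt'_nonneg (h : RadialKernel κ s0 s1) {r : ℝ} (hr : 0 ≤ r) : 0 ≤ wt' κ (mom κ 0 s1) r := by
  rw [wt']
  have h1 := h.tail_nonneg hr 0
  have h2 := div_nonneg (h.mom_nonneg 3 hr) (by positivity : 0 ≤ 3 * r ^ 3)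
  linarith

theorem wt'_le (h : RadialKernel κ s0 s1) {r : ℝ} (hr : 0 < r) : wt' κ (mom κ 0 s1) r ≤ mom κ 0 s1 / 3 := by
  rw [wt']
  have : mom κ 3 r / (3 * r ^ 3) ≤ mom κ 0 r / 3 := by
    rw [div_le_div_iff₀ (by positivity) (by norm_num)]
    have := h.mom_add_le hr.le 0 3
    rw [zero_add] at this
    linarith
  linarith

theorem wt'_le' (h : RadialKernel κ s0 s1) {r : ℝ} (hr : 0 < r) : wt' κ (mom κ 0 s1) r ≤ mom κ 1 s1 / 3 / r := by
  rw [wt', le_div_iff₀ hr, add_mul]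
  have h1 : mom κ 3 r / (3 * r ^ 3) * r ≤ mom κ 1 r / 3 := by
    have e : mom κ 3 r / (3 * r ^ 3) * r = mom κ 3 r / (3 * r ^ 2) := by field_simp
    rw [e, div_le_div_iff₀ (by positivity) (by norm_num)]
    linarith [h.mom_three_le hr.le]
  linarith [h.mul_tail_le (r := r)]

theorem wt_left (h : RadialKernel κ s0 s1) {r : ℝ} (hr : 0 ≤ r) (hr' : r ≤ s0) : wt κ (mom κ 0 s1) r = mom κ 0 s1 / 3 * r := by
  rw [wt, h.mom_left 0 hr hr', h.mom_left 1 hr hr', h.mom_left 3 hr hr']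
  ring

theorem wt'_left (h : RadialKernel κ s0 s1) {r : ℝ} (hr : 0 ≤ r) (hr' : r ≤ s0) : wt' κ (mom κ 0 s1) r = mom κ 0 s1 / 3 := by
  rw [wt', h.mom_left 0 hr hr', h.mom_left 3 hr hr']
  ring

theorem wt_right (h : RadialKernel κ s0 s1) {r : ℝ} (hr : s1 ≤ r) : mom κ 1 s1 / 3 ≤ wt κ (mom κ 0 s1) r := by
  have h1 := h.wt_ge ((h.pos.le.trans h.le).trans hr)
  rw [h.mom_right 0 hr, h.mom_right 1 hr, sub_self] at h1
  linarith

theorem hasDerivAt_wt (h : RadialKernel κ s0 s1) (c : ℝ) {r : ℝ} (hr : 0 < r) : HasDerivAt (wt κ c) (wt' κ c r) r := by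
  have h2 : HasDerivAt (fun r : ℝ => 6 * r ^ 2) (6 * (2 * r)) r := by
    simpa using (hasDerivAt_pow 2 r).const_mul (6 : ℝ)
  have := ((((hasDerivAt_id r).div_const 3).mul ((h.hasDerivAt_mom 0 r).const_sub c)).add
    ((h.hasDerivAt_mom 1 r).div_const 2)).sub ((h.hasDerivAt_mom 3 r).div h2 (by positivity))
  refine HasDerivAt.congr_deriv (show HasDerivAt (wt κ c) _ r from this) ?_
  simp only [wt', id]
  field_simp
  ring

theorem hasDerivAt_wt' (h : RadialKernel κ s0 s1) (c : ℝ) {r : ℝ} (hr : 0 < r) :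
    HasDerivAt (wt' κ c) (-(mom κ 3 r / r ^ 4)) r := by
  have h2 : HasDerivAt (fun r : ℝ => 3 * r ^ 3) (3 * (3 * r ^ 2)) r := by
    simpa using (hasDerivAt_pow 3 r).const_mul (3 : ℝ)
  have := (((h.hasDerivAt_mom 0 r).const_sub c).div_const 3).add
    ((h.hasDerivAt_mom 3 r).div h2 (by positivity))
  refine HasDerivAt.congr_deriv (show HasDerivAt (wt' κ c) _ r from this) ?_
  field_simp
  ring

theorem multiplier (h : RadialKernel κ s0 s1) (n : ℕ) (c : ℝ) :
    Multiplier n (wt κ c) (wt' κ c) (wtDiv n κ c) (wtDiv' n κ c) where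
  deriv_a r hr := h.hasDerivAt_wt c hr
  deriv_v r hr := by
    have := (h.hasDerivAt_wt' c hr).add
      (((h.hasDerivAt_wt c hr).div (hasDerivAt_id r) hr.ne').const_mul ((n : ℝ) - 1))
    refine HasDerivAt.congr_deriv (show HasDerivAt (wtDiv n κ c) _ r from this) ?_
    simp only [wtDiv', id]
    field_simp
  v_eq r hr := rfl
  cont_v' := by
    have c1 : ContinuousOn (mom κ 3) (Ioi 0) := fun r _ =>
      (h.hasDerivAt_mom 3 r).continuousAt.continuousWithinAt
    have c2 : ContinuousOn (wt κ c) (Ioi 0) := fun r hr =>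
      (h.hasDerivAt_wt c hr).continuousAt.continuousWithinAt
    have c3 : ContinuousOn (wt' κ c) (Ioi 0) := fun r hr =>
      (h.hasDerivAt_wt' c hr).continuousAt.continuousWithinAt
    have p : ∀ k : ℕ, ContinuousOn (fun r : ℝ => r ^ k) (Ioi 0) := fun k => (continuous_pow k).continuousOn
    have z : ∀ k : ℕ, ∀ r ∈ Ioi (0 : ℝ), r ^ k ≠ 0 := fun k r hr => pow_ne_zero k (ne_of_gt hr)
    exact (c1.div (p 4) (z 4)).neg.add (continuousOn_const.mul
      ((c3.div continuousOn_id fun r hr => ne_of_gt hr).sub (c2.div (p 2) (z 2))))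

theorem abs_wtDiv'_le (h : RadialKernel κ s0 s1) (hn : 3 ≤ n) {r : ℝ} (hr : 0 < r) :
    |wtDiv' n κ (mom κ 0 s1) r| ≤ n * mom κ 0 s1 / r := by
  have hn1 := sub_one_nonneg hn
  set c := mom κ 0 s1
  have hc : 0 ≤ c := h.mom_nonneg 0 (h.pos.le.trans h.le)
  have h1 : mom κ 3 r / r ^ 4 ≤ c / r := by
    rw [div_le_div_iff₀ (by positivity) hr]
    have h2 := h.mom_add_le hr.le 0 3
    have h3 : mom κ 0 r ≤ c := by linarith [h.tail_nonneg hr.le 0]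
    rw [zero_add] at h2
    calc mom κ 3 r * r ≤ (r ^ 3 * c) * r := by gcongr; exact h2.trans (by gcongr)
      _ = c * r ^ 4 := by ring
  have h1' : 0 ≤ mom κ 3 r / r ^ 4 := div_nonneg (h.mom_nonneg 3 hr.le) (by positivity)
  have h2 : wt' κ c r / r ≤ c / r := by
    gcongr
    linarith [h.wt'_le hr]
  have h2' : 0 ≤ wt' κ c r / r := div_nonneg (h.wt'_nonneg hr.le) hr.le
  have h3 : wt κ c r / r ^ 2 ≤ c / r := by
    rw [div_le_div_iff₀ (by positivity) hr]
    have h4 : wt κ c r ≤ c * r := (h.wt_le_mul hr.le).trans (by gcongr; linarith)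
    calc wt κ c r * r ≤ (c * r) * r := by gcongr
      _ = c * r ^ 2 := by ring
  have h3' : 0 ≤ wt κ c r / r ^ 2 := div_nonneg (h.wt_nonneg hr.le) (by positivity)
  have h5 : n * c / r = c / r + (n - 1) * (c / r) := by ring
  rw [wtDiv', h5]
  refine (abs_add_le _ _).trans (add_le_add (by rw [abs_neg, abs_of_nonneg h1']; exact h1) ?_)
  rw [abs_mul, abs_of_nonneg hn1]
  refine mul_le_mul_of_nonneg_left (abs_le.2 ⟨?_, ?_⟩) hn1 <;> linarith

theorem weight (h : RadialKernel κ s0 s1) (hn : 3 ≤ n) : Weight n (wt κ (mom κ 0 s1)) (wt' κ (mom κ 0 s1))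
    (wtDiv n κ (mom κ 0 s1)) (wtDiv' n κ (mom κ 0 s1)) (n * (mom κ 0 s1 + mom κ 1 s1)) := by
  have hs : 0 ≤ s1 := h.pos.le.trans h.le
  have hc := h.mom_nonneg 0 hs
  have hm := h.mom_nonneg 1 hs
  have hn3 : (3 : ℝ) ≤ n := by exact_mod_cast hn
  have b1 : mom κ 0 s1 ≤ n * (mom κ 0 s1 + mom κ 1 s1) := by nlinarith
  have b2 : mom κ 1 s1 ≤ n * (mom κ 0 s1 + mom κ 1 s1) := by nlinarith
  exact
  { h.multiplier n (mom κ 0 s1) with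
    nonneg := fun r hr => h.wt_nonneg hr
    le_const := fun r hr => (h.wt_le_moment hr).trans (by linarith)
    le_mul := fun r hr => (h.wt_le_mul hr.le).trans (by gcongr; linarith)
    abs_deriv_le := fun r hr => by
      rw [abs_of_nonneg (h.wt'_nonneg hr.le)]
      exact (h.wt'_le hr).trans (by linarith)
    abs_deriv_le' := fun r hr => by
      rw [abs_of_nonneg (h.wt'_nonneg hr.le)]
      exact (h.wt'_le' hr).trans (by gcongr; linarith)
    abs_v'_le := fun r hr => (h.abs_wtDiv'_le hn hr).trans (by gcongr; linarith) }

theorem wtDiv_nonneg (h : RadialKernel κ s0 s1) (hn : 3 ≤ n) {r : ℝ} (hr : 0 ≤ r) : 0 ≤ wtDiv n κ (mom κ 0 s1) r := by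
  have hn1 := sub_one_nonneg hn
  exact add_nonneg (h.wt'_nonneg hr) (mul_nonneg hn1 (div_nonneg (h.wt_nonneg hr) hr))

theorem wtDiv_le (h : RadialKernel κ s0 s1) (hn : 3 ≤ n) {r : ℝ} (hr : 0 < r) :
    wtDiv n κ (mom κ 0 s1) r ≤ n * mom κ 1 s1 / r := by
  have hn1 := sub_one_nonneg hn
  have hm := h.mom_nonneg 1 (h.pos.le.trans h.le)
  have h1 : wt κ (mom κ 0 s1) r / r ≤ mom κ 1 s1 / r := by
    gcongr; linarith [h.wt_le_moment hr.le]
  have h2 : wt' κ (mom κ 0 s1) r ≤ mom κ 1 s1 / r := (h.wt'_le' hr).trans (by gcongr; linarith)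
  have h3 : n * mom κ 1 s1 / r = mom κ 1 s1 / r + (n - 1) * (mom κ 1 s1 / r) := by ring
  rw [h3]
  exact add_le_add h2 (mul_le_mul_of_nonneg_left h1 hn1)

end RadialKernel

end

section

variable {A : E n → E n} {A₀ : E n → ℝ}

/-! ### The positive terms of the virial inequality -/

/-- The derivative of the function `wtDiv' - 2 (n - 3) wt' / r`. -/
def wtAux' (n : ℕ) (κ : ℝ → ℝ) (c r : ℝ) : ℝ := -(r * κ r / r ^ 2 - 2 * mom κ 1 r / r ^ 3) -
    (n - 3) * ((2 * wt' κ c r - r * (mom κ 3 r / r ^ 4)) / r ^ 2 -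
      2 * (wt κ c r + r * wt' κ c r) / r ^ 3)

/-- The function `wtDiv' - 2 (n - 3) wt' / r`. -/
def wtAux (n : ℕ) (κ : ℝ → ℝ) (c r : ℝ) : ℝ :=
  -(mom κ 1 r / r ^ 2) - (n - 3) * ((wt κ c r + r * wt' κ c r) / r ^ 2)

theorem wtAux_eq (κ : ℝ → ℝ) (c : ℝ) {r : ℝ} (hr : 0 < r) :
    wtAux n κ c r = wtDiv' n κ c r - 2 * (n - 3) * wt' κ c r / r := by
  simp only [wtAux, wtDiv', wt', wt]
  field_simp
  ring

theorem wtAux'_eq (κ : ℝ → ℝ) (c : ℝ) {r : ℝ} (hr : 0 < r) :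
    -(1 / 2) * (wtAux' n κ c r + (n - 1) * wtAux n κ c r / r) =
      2 * wt' κ c r * ((n - 3) / 2 / r) ^ 2 +
        (κ r / (2 * r) + (n - 1) * (n - 3) / 2 * (wt κ c r / r ^ 3)) := by
  simp only [wtAux, wtAux', wt', wt]
  field_simp
  ring

namespace RadialKernel

variable {κ : ℝ → ℝ} {s0 s1 : ℝ}

theorem hasDerivAt_wtAux (h : RadialKernel κ s0 s1) (n : ℕ) (c : ℝ) {r : ℝ} (hr : 0 < r) :
    HasDerivAt (wtAux n κ c) (wtAux' n κ c r) r := by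
  have h2 : HasDerivAt (fun r : ℝ => r ^ 2) (2 * r) r := by simpa using hasDerivAt_pow 2 r
  have := ((h.hasDerivAt_mom 1 r).div h2 (by positivity)).neg.sub
    ((((h.hasDerivAt_wt c hr).add ((hasDerivAt_id r).mul (h.hasDerivAt_wt' c hr))).div h2
      (by positivity)).const_mul ((n : ℝ) - 3))
  refine HasDerivAt.congr_deriv (show HasDerivAt (wtAux n κ c) _ r from this) ?_
  simp only [wtAux', id, Pi.add_apply, Pi.mul_apply]
  field_simp
  ring

theorem continuousOn_wtAux' (h : RadialKernel κ s0 s1) (n : ℕ) (c : ℝ) :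
    ContinuousOn (wtAux' n κ c) (Ioi 0) := by
  have c0 : ∀ i, ContinuousOn (mom κ i) (Ioi 0) := fun i r _ =>
    (h.hasDerivAt_mom i r).continuousAt.continuousWithinAt
  have c2 : ContinuousOn (wt κ c) (Ioi 0) := fun r hr =>
    (h.hasDerivAt_wt c hr).continuousAt.continuousWithinAt
  have c3 : ContinuousOn (wt' κ c) (Ioi 0) := fun r hr =>
    (h.hasDerivAt_wt' c hr).continuousAt.continuousWithinAt
  have p : ∀ k : ℕ, ContinuousOn (fun r : ℝ => r ^ k) (Ioi 0) := fun k => (continuous_pow k).continuousOn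
  have z : ∀ k : ℕ, ∀ r ∈ Ioi (0 : ℝ), r ^ k ≠ 0 := fun k r hr => pow_ne_zero k (ne_of_gt hr)
  have i : ContinuousOn (fun r : ℝ => r) (Ioi 0) := continuousOn_id
  exact (((i.mul h.continuous.continuousOn).div (p 2) (z 2)).sub
    ((continuousOn_const.mul (c0 1)).div (p 3) (z 3))).neg.sub (continuousOn_const.mul
      ((((continuousOn_const.mul c3).sub (i.mul ((c0 3).div (p 4) (z 4)))).div (p 2) (z 2)).sub
        ((continuousOn_const.mul (c2.add (i.mul c3))).div (p 3) (z 3))))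

theorem exists_bound_wtAux (h : RadialKernel κ s0 s1) (hn : 3 ≤ n) : ∃ C, 0 ≤ C ∧
    (∀ r, 0 < r → |wtAux n κ (mom κ 0 s1) r| ≤ C / r) ∧
    (∀ r, 0 < r → |wtAux' n κ (mom κ 0 s1) r| ≤ C / r ^ 2) ∧
    ∀ r, 0 < r → |κ r / (2 * r) + (n - 1) * (n - 3) / 2 * (wt κ (mom κ 0 s1) r / r ^ 3)| ≤
      C / r ^ 2 := by
  have hsupp : HasCompactSupport κ :=
    HasCompactSupport.intro (K := Icc s0 s1) isCompact_Icc fun r hr => by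
      rcases lt_or_ge r s0 with h1 | h1
      · exact h.left r h1.le
      · exact h.right r (not_le.1 fun h2 => hr ⟨h1, h2⟩).le
  obtain ⟨K, hK⟩ := h.continuous.bounded_above_of_compact_support hsupp
  have hs : 0 ≤ s1 := h.pos.le.trans h.le
  have K0 : 0 ≤ K := (norm_nonneg _).trans (hK 0)
  have hn3 := sub_three_nonneg hn
  set c := mom κ 0 s1
  have hc : 0 ≤ c := h.mom_nonneg 0 hs
  have hn1 : (0 : ℝ) ≤ (n - 1) * (n - 3) / 2 := by nlinarith
  have hKs : 0 ≤ K * s1 := mul_nonneg K0 hs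
  refine ⟨K * s1 + (4 + 7 * (n - 3)) * c + (n - 1) * (n - 3) / 2 * c, by positivity, ?_⟩
  have B : ∀ r, 0 < r → ∃ k m w q, (κ r = k / r ∧ mom κ 1 r = m * r ∧ wt κ c r = w * r ∧
      mom κ 3 r = q * r ^ 3) ∧ (0 ≤ k ∧ k ≤ K * s1) ∧ (0 ≤ m ∧ m ≤ c) ∧ (0 ≤ w ∧ w ≤ c) ∧
      (0 ≤ wt' κ c r ∧ wt' κ c r ≤ c) ∧ 0 ≤ q ∧ q ≤ c := fun r hr => by
    have h3 : mom κ 0 r ≤ c := by linarith [h.tail_nonneg hr.le 0]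
    have h1 : mom κ 1 r / r ≤ c := (div_le_iff₀ hr).2 (by nlinarith [h.mom_one_le hr.le])
    refine ⟨κ r * r, mom κ 1 r / r, wt κ c r / r, mom κ 3 r / r ^ 3, ⟨?_, ?_, ?_, ?_⟩,
      ⟨mul_nonneg (h.nonneg r) hr.le, ?_⟩, ⟨div_nonneg (h.mom_nonneg 1 hr.le) hr.le, h1⟩,
      ⟨div_nonneg (h.wt_nonneg hr.le) hr.le, (div_le_iff₀ hr).2 ((h.wt_le_mul hr.le).trans (by
        gcongr; linarith))⟩, ⟨h.wt'_nonneg hr.le, (h.wt'_le hr).trans (by linarith)⟩,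
      div_nonneg (h.mom_nonneg 3 hr.le) (by positivity), (div_le_iff₀ (by positivity)).2 ?_⟩
    iterate 4 field_simp
    · rcases le_total r s1 with h1 | h1
      · exact mul_le_mul ((le_abs_self _).trans (hK r)) h1 hr.le K0
      · rwa [h.right r h1, zero_mul]
    · calc mom κ 3 r ≤ r ^ 2 * (c * r) := (h.mom_three_le hr.le).trans (by
            gcongr; exact (div_le_iff₀ hr).1 h1)
        _ = c * r ^ 3 := by ring
  have M : ∀ {y}, 0 ≤ y → y ≤ c → 0 ≤ (n - 3 : ℝ) * y ∧ (n - 3 : ℝ) * y ≤ (n - 3) * c :=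
    fun h0 h1 => ⟨mul_nonneg hn3 h0, mul_le_mul_of_nonneg_left h1 hn3⟩
  have D : ∀ {X Y r : ℝ}, 0 < r → |X| ≤ Y → |X / r| ≤ Y / r := fun hr hX => by
    rw [abs_div, abs_of_pos hr]
    exact div_le_div_of_nonneg_right hX hr.le
  have hnc := mul_nonneg hn3 hc
  have hn1c := mul_nonneg hn1 hc
  refine ⟨fun r hr => ?_, fun r hr => ?_, fun r hr => ?_⟩ <;>
    obtain ⟨k, m, w, q, ⟨e1, e2, e3, e4⟩, ⟨k0, k1⟩, ⟨m0, m1⟩, ⟨w0, w1⟩, ⟨d0, d1⟩, q0, q1⟩ := B r hr <;>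
    obtain ⟨w2, w3⟩ := M w0 w1 <;> obtain ⟨d2, d3⟩ := M d0 d1 <;> obtain ⟨q2, q3⟩ := M q0 q1
  · rw [wtAux, e2, e3, (by field_simp : -(m * r / r ^ 2) - (n - 3) * ((w * r + r * wt' κ c r) /
      r ^ 2) = (-m - ((n - 3) * w + (n - 3) * wt' κ c r)) / r)]
    exact D hr (abs_le.2 ⟨by linarith, by linarith⟩)
  · rw [wtAux', e1, e2, e3, e4, (by field_simp; ring : -(r * (k / r) / r ^ 2 - 2 * (m * r) / r ^ 3) -
      (n - 3) * ((2 * wt' κ c r - r * (q * r ^ 3 / r ^ 4)) / r ^ 2 - 2 * (w * r + r * wt' κ c r) /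
        r ^ 3) = (-k + 2 * m + (n - 3) * q + 2 * ((n - 3) * w)) / r ^ 2)]
    exact D (by positivity) (abs_le.2 ⟨by linarith, by linarith⟩)
  · have w4 := mul_nonneg hn1 w0
    have w5 := mul_le_mul_of_nonneg_left w1 hn1
    rw [e1, e3, (by field_simp : k / r / (2 * r) + (n - 1) * (n - 3) / 2 * (w * r / r ^ 3) =
      (k / 2 + (n - 1) * (n - 3) / 2 * w) / r ^ 2)]
    exact D (by positivity) (abs_le.2 ⟨by linarith, by linarith⟩)

end RadialKernel

theorem norm_add_real_mul_sq (z w : ℂ) (b : ℝ) :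
    ‖z + (b : ℂ) * w‖ ^ 2 = ‖z‖ ^ 2 + 2 * b * rip z w + b ^ 2 * ‖w‖ ^ 2 := by
  rw [← rip_self, ← rip_self, ← rip_self]
  simp only [rip, add_re, add_im, re_ofReal_mul, im_ofReal_mul]
  ring

/-- The positive part of the virial inequality for the weight `wt κ c`. -/
def morawetz (n : ℕ) (κ : ℝ → ℝ) (c : ℝ) (G : ℝ → ℝ) (x : E n) (z : ℂ) (w : CVec n) : ℝ :=
  2 * wt' κ c ‖x‖ * ‖radial x w + (((n - 3) / 2 / ‖x‖ : ℝ) : ℂ) * z‖ ^ 2 +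
    (κ ‖x‖ / (2 * ‖x‖) + (n - 1) * (n - 3) / 2 * (wt κ c ‖x‖ / ‖x‖ ^ 3)) * ‖z‖ ^ 2 +
    1 / 2 * (wt κ c ‖x‖ / ‖x‖) * ‖tangential x w‖ ^ 2 + wtDiv n κ c ‖x‖ * G (‖z‖ ^ 2)

section

variable {κ g G : ℝ → ℝ} {s0 s1 : ℝ} {p : covGradGraph A} {L V N : L2 n}

theorem morawetz_nonneg (h : RadialKernel κ s0 s1) (hn : 3 ≤ n) (hg : Defocusing g G) (x : E n)
    (z : ℂ) (w : CVec n) : 0 ≤ morawetz n κ (mom κ 0 s1) G x z w := by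
  have hn3 := sub_three_nonneg hn
  have hn1 : (0 : ℝ) ≤ (n - 1) * (n - 3) / 2 := by nlinarith
  have h1 := h.wt_nonneg (norm_nonneg x)
  have h2 := h.wt'_nonneg (norm_nonneg x)
  have h3 := h.wtDiv_nonneg hn (norm_nonneg x)
  have h4 := hg.G_nonneg _ (sq_nonneg ‖z‖)
  have h5 := h.nonneg ‖x‖
  unfold morawetz
  positivity

theorem integral_morawetz (h : RadialKernel κ s0 s1) (hn : 3 ≤ n) (hA : ContDiffOn ℝ 1 A {0}ᶜ)
    (hg : Defocusing g G) (hN : ∀ᵐ x, N x = ((g (‖p.1.fst x‖ ^ 2) : ℝ) : ℂ) * p.1.fst x) :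
    Integrable (fun x => morawetz n κ (mom κ 0 s1) G x (p.1.fst x) (p.1.snd x)) ∧
    ∫ x, morawetz n κ (mom κ 0 s1) G x (p.1.fst x) (p.1.snd x) =
      (∫ x, 2 * wt' κ (mom κ 0 s1) ‖x‖ * ‖radial x (p.1.snd x)‖ ^ 2) +
        (∫ x, 1 / 2 * (wt κ (mom κ 0 s1) ‖x‖ / ‖x‖) * ‖tangential x (p.1.snd x)‖ ^ 2) +
        (∫ x, wtDiv' n κ (mom κ 0 s1) ‖x‖ * rip (radial x (p.1.snd x)) (p.1.fst x)) +
        ∫ x, wtDiv n κ (mom κ 0 s1) ‖x‖ * G (‖p.1.fst x‖ ^ 2) := by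
  obtain ⟨C, C0, b1, b2, -⟩ := h.exists_bound_wtAux hn
  have hW := h.weight hn
  set c := mom κ 0 s1
  set M := (n : ℝ) * (c + mom κ 1 s1)
  have hd := fun r hr => h.hasDerivAt_wtAux n c (r := r) hr
  have hi : ContinuousOn (wtAux n κ c) (Ioi 0) := fun r hr =>
    (hd r hr).continuousAt.continuousWithinAt
  have hibp := radial_ibp hn hA p hd (h.continuousOn_wtAux' n c) C0 b1 b2
  have i1 : Integrable fun x => 2 * wt' κ c ‖x‖ * ‖radial x (p.1.snd x)‖ ^ 2 :=
    integrable_weight_mul hn (integrable_radial_sq _) (m := fun r => 2 * wt' κ c r) (C := 2 * M)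
      (continuousOn_const.mul hW.cont_a') fun r hr => by
        rw [abs_mul, abs_two]; linarith [hW.abs_deriv_le r hr]
  have i2 : Integrable fun x => 1 / 2 * (wt κ c ‖x‖ / ‖x‖) * ‖tangential x (p.1.snd x)‖ ^ 2 :=
    integrable_weight_mul hn (integrable_tangential_sq _) (m := fun r => 1 / 2 * (wt κ c r / r))
      (C := M) (continuousOn_const.mul (hW.cont_a.div continuousOn_id fun r hr => ne_of_gt hr))
      fun r hr => by
        have h0 := div_nonneg (hW.nonneg _ hr.le) hr.le
        rw [abs_of_nonneg (by linarith)]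
        linarith [(div_le_iff₀ hr).2 (hW.le_mul r hr)]
  have irip : ∀ {f : ℝ → ℝ} {K : ℝ}, ContinuousOn f (Ioi 0) → (∀ r, 0 < r → |f r| ≤ K / r) →
      Integrable fun x => f ‖x‖ * rip (radial x (p.1.snd x)) (p.1.fst x) := fun {f K} cf bf => by
    refine (integrable_weight_mul hn (integrable_hardy_rip_radial hn hA p) (m := fun r => f r * r)
      (C := K) (cf.mul continuousOn_id) fun r hr => ?_).congr ?_
    · rw [abs_mul, abs_of_pos hr, ← le_div_iff₀ hr]
      exact bf _ hr
    · filter_upwards [ae_ne_zero hn] with x hx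
      have hpos := norm_pos_iff.2 hx
      field_simp
  have i3 := irip hW.cont_v' hW.abs_v'_le
  have i4 := integrable_weight_mul hn (hg.integrable_G hN) hW.cont_v fun r hr => hW.abs_v_le hn hr
  have i5 := irip hi b1
  have i6 : Integrable fun x => (wtAux' n κ c ‖x‖ + (n - 1) * wtAux n κ c ‖x‖ / ‖x‖) *
      ‖p.1.fst x‖ ^ 2 := by
    refine integrable_hardy_sq hn hA p (C := C + |(n : ℝ) - 1| * C) (measurable_of_Ioi hn
      (h := fun r => wtAux' n κ c r + (n - 1) * wtAux n κ c r / r) ((h.continuousOn_wtAux' n c).add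
        ((continuousOn_const.mul hi).div continuousOn_id fun r hr => ne_of_gt hr)))
      (by positivity) fun x hx => ?_
    have hpos := norm_pos_iff.2 hx
    refine (abs_add_le _ _).trans ?_
    rw [abs_div, abs_mul, abs_of_pos hpos, add_div]
    refine add_le_add (b2 _ hpos) ?_
    calc |(n : ℝ) - 1| * |wtAux n κ c ‖x‖| / ‖x‖ ≤ |(n : ℝ) - 1| * (C / ‖x‖) / ‖x‖ := by
          gcongr; exact b1 _ hpos
      _ = |(n : ℝ) - 1| * C / ‖x‖ ^ 2 := by field_simp
  have hpt : (fun x => morawetz n κ c G x (p.1.fst x) (p.1.snd x)) =ᵐ[volume] fun x =>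
      2 * wt' κ c ‖x‖ * ‖radial x (p.1.snd x)‖ ^ 2 +
      1 / 2 * (wt κ c ‖x‖ / ‖x‖) * ‖tangential x (p.1.snd x)‖ ^ 2 +
      wtDiv' n κ c ‖x‖ * rip (radial x (p.1.snd x)) (p.1.fst x) +
      wtDiv n κ c ‖x‖ * G (‖p.1.fst x‖ ^ 2) -
      (wtAux n κ c ‖x‖ * rip (radial x (p.1.snd x)) (p.1.fst x) +
        1 / 2 * ((wtAux' n κ c ‖x‖ + (n - 1) * wtAux n κ c ‖x‖ / ‖x‖) * ‖p.1.fst x‖ ^ 2)) := by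
    filter_upwards [ae_ne_zero hn] with x hx
    have hpos := norm_pos_iff.2 hx
    have e1 := wtAux_eq (n := n) κ c hpos
    have e2 := wtAux'_eq (n := n) κ c hpos
    rw [morawetz, norm_add_real_mul_sq]
    have e3 : κ ‖x‖ / (2 * ‖x‖) + (n - 1) * (n - 3) / 2 * (wt κ c ‖x‖ / ‖x‖ ^ 3) =
      -(1 / 2) * (wtAux' n κ c ‖x‖ + (n - 1) * wtAux n κ c ‖x‖ / ‖x‖) -
        2 * wt' κ c ‖x‖ * ((n - 3) / 2 / ‖x‖) ^ 2 := by linarith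
    rw [e3, e1]
    ring
  have j1 := (((i1.add i2).add i3).add i4)
  have j2 := i5.add (i6.const_mul (1 / 2))
  refine ⟨(j1.sub j2).congr hpt.symm, ?_⟩
  rw [integral_congr_ae hpt, integral_sub (by exact j1) (by exact j2),
    integral_add (by exact (i1.add i2).add i3) i4, integral_add (by exact i1.add i2) i3,
    integral_add i1 i2, integral_add i5 (by exact i6.const_mul (1 / 2)), integral_const_mul]
  have e7 : ∫ x, wtAux n κ c ‖x‖ * (⟪p.1.fst x, radialCLM p.1.snd x⟫_ℂ).re =
      ∫ x, wtAux n κ c ‖x‖ * rip (radial x (p.1.snd x)) (p.1.fst x) := by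
    refine integral_congr_ae ?_
    filter_upwards [radialCLM_ae p.1.snd] with x hx
    rw [hx, re_inner_eq_rip, rip_comm]
  rw [e7] at hibp
  rw [hibp]
  ring

/-- The Morawetz inequality at a fixed time. -/
theorem morawetz_ineq (h : RadialKernel κ s0 s1) (hn : 3 ≤ n) (hA : ContDiffOn ℝ 1 A {0}ᶜ)
    (hA₀ : ContDiffOn ℝ 1 A₀ {0}ᶜ) (hg : Defocusing g G) (hD : DomainData A₀ A g p L V N) {d : ℝ}
    (hd : d = (∫ x, 2 * wt κ (mom κ 0 s1) ‖x‖ * rip ((L + V + N : L2 n) x) (radial x (p.1.snd x))) +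
          ∫ x, wtDiv n κ (mom κ 0 s1) ‖x‖ * rip ((L + V + N : L2 n) x) (p.1.fst x)) :
    (∫⁻ x, ofReal (morawetz n κ (mom κ 0 s1) G x (p.1.fst x) (p.1.snd x))) +
        ofReal (-d) ≤ ofReal d +
      ∫⁻ x, ofReal (wt κ (mom κ 0 s1) ‖x‖ * errorDensity A₀ A x) * ‖p.1.fst x‖ₑ ^ 2 := by
  have h1 := virial_ineq hn hA hA₀ hg hD (h.weight hn)
  obtain ⟨hi, he⟩ := integral_morawetz (p := p) h hn hA hg hD.nonlinear
  rw [← hd, ← he] at h1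
  rw [← ofReal_integral_eq_lintegral_ofReal hi (ae_of_all _ fun x => morawetz_nonneg h hn hg x _ _)]
  set X := ∫ x, morawetz n κ (mom κ 0 s1) G x (p.1.fst x) (p.1.snd x)
  have hX : 0 ≤ X := integral_nonneg fun x => morawetz_nonneg h hn hg x _ _
  refine le_trans ?_ (add_le_add le_rfl h1)
  rcases le_total 0 d with h0 | h0
  · rw [ofReal_of_nonpos (neg_nonpos.2 h0), add_zero]
    refine le_trans (ofReal_le_ofReal (by linarith : X ≤ d + (X - d))) ofReal_add_le
  · rw [ofReal_of_nonpos h0, zero_add, ← ofReal_add hX (neg_nonneg.2 h0)]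
    exact ofReal_le_ofReal (by linarith)

end

end

section

variable {A : E n → E n} {a a' v v' : ℝ → ℝ} {C : ℝ}

/-! ### The Morawetz operator -/

theorem Weight.abs_a_le (h : Weight n a a' v v' C) (x : E n) : |a ‖x‖| ≤ C := by
  rw [abs_of_nonneg (h.nonneg _ (norm_nonneg x))]
  exact h.le_const _ (norm_nonneg x)

theorem Weight.abs_v_mul_le (hn : 3 ≤ n) (h : Weight n a a' v v' C) (x : E n) :
    |v ‖x‖ * ‖x‖| ≤ n * C := by
  rcases eq_or_ne x 0 with rfl | hx
  · have := h.const_nonneg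
    simp only [norm_zero, mul_zero, abs_zero]
    positivity
  · have hpos := norm_pos_iff.2 hx
    rw [abs_mul, abs_of_pos hpos, ← le_div_iff₀ hpos]
    exact h.abs_v_le' hn hpos

/-- The operator `u ↦ a(|x|) ∂_r u + v(|x|)/2 u` on `H¹_A`. -/
def morawetzCLM (hn : 3 ≤ n) (hA : ContDiffOn ℝ 1 A {0}ᶜ) (h : Weight n a a' v v' C) :
    covGradGraph A →L[ℂ] L2 n :=
  (weightCLM (fun x => a ‖x‖) (measurable_of_Ioi hn h.cont_a) C h.abs_a_le).comp
      (radialCLM.comp (sndG A)) +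
    (1 / 2 : ℂ) • (weightCLM (fun x => v ‖x‖ * ‖x‖) ((measurable_of_Ioi hn h.cont_v).mul
      continuous_norm.aestronglyMeasurable) (n * C) (h.abs_v_mul_le hn)).comp (hardyCLM hn hA)

theorem morawetzCLM_ae (hn : 3 ≤ n) (hA : ContDiffOn ℝ 1 A {0}ᶜ) (h : Weight n a a' v v' C)
    (p : covGradGraph A) : morawetzCLM hn hA h p =ᵐ[volume] fun x =>
      (a ‖x‖ : ℂ) * radial x (p.1.snd x) + ((1 / 2 * v ‖x‖ : ℝ) : ℂ) * p.1.fst x := by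
  set W1 := weightCLM (V := ℂ) (fun x : E n => a ‖x‖) (measurable_of_Ioi hn h.cont_a) C
    h.abs_a_le with hW1
  set W2 := weightCLM (V := ℂ) (fun x : E n => v ‖x‖ * ‖x‖) ((measurable_of_Ioi hn h.cont_v).mul
      continuous_norm.aestronglyMeasurable) (n * C) (h.abs_v_mul_le hn) with hW2
  have e : morawetzCLM hn hA h p =
      W1 (radialCLM p.1.snd) + (1 / 2 : ℂ) • W2 (hardyCLM hn hA p) := rfl
  rw [e]
  filter_upwards [ae_ne_zero hn, Lp.coeFn_add (W1 (radialCLM p.1.snd))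
      ((1 / 2 : ℂ) • W2 (hardyCLM hn hA p)),
    Lp.coeFn_smul (1 / 2 : ℂ) (W2 (hardyCLM hn hA p)), hardyCLM_ae hn hA p, radialCLM_ae p.1.snd,
    weightCLM_ae _ _ _ h.abs_a_le (radialCLM p.1.snd),
    weightCLM_ae _ _ _ (h.abs_v_mul_le hn) (hardyCLM hn hA p)] with x hx e1 e2 e3 e4 e5 e6
  have hpos : (‖x‖ : ℂ) ≠ 0 := by exact_mod_cast (norm_pos_iff.2 hx).ne'
  rw [e1, Pi.add_apply, e2, Pi.smul_apply, e5, e6, e3, e4, smul_eq_mul, smul_eq_mul, smul_eq_mul]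
  push_cast
  field_simp

theorem two_mul_re_inner_morawetzCLM (hn : 3 ≤ n) (hA : ContDiffOn ℝ 1 A {0}ᶜ)
    (h : Weight n a a' v v' C) (p : covGradGraph A) (f : L2 n) :
    2 * (⟪f, morawetzCLM hn hA h p⟫_ℂ).re =
      (∫ x, 2 * a ‖x‖ * rip (f x) (radial x (p.1.snd x))) + ∫ x, v ‖x‖ * rip (f x) (p.1.fst x) := by
  have h1 := reCLM.integral_comp_comm (L2.integrable_inner (𝕜 := ℂ) f (morawetzCLM hn hA h p))
  simp only [Complex.reCLM_apply] at h1
  have i1 : Integrable fun x => 2 * a ‖x‖ * rip (f x) (radial x (p.1.snd x)) :=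
    integrable_weight_mul hn (integrable_rip_radial f p.1.snd) (m := fun r => 2 * a r) (C := 2 * C)
      (continuousOn_const.mul h.cont_a) fun r hr => by
        rw [abs_mul, abs_two, abs_of_nonneg (h.nonneg r hr.le)]; linarith [h.le_const r hr.le]
  have i2 := integrable_weight_mul hn (integrable_rip f p.1.fst) h.cont_v fun r hr =>
    h.abs_v_le hn hr
  rw [L2.inner_def, ← h1, ← integral_const_mul, ← integral_add i1 i2]
  refine integral_congr_ae ?_
  filter_upwards [morawetzCLM_ae hn hA h p] with x hx
  rw [hx, re_inner_eq_rip]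
  simp only [rip, add_re, add_im, re_ofReal_mul, im_ofReal_mul]
  ring

theorem norm_morawetzCLM_le (hn : 3 ≤ n) (hA : ContDiffOn ℝ 1 A {0}ᶜ) (h : Weight n a a' v v' C)
    {B : ℝ} (hB : 0 ≤ B) (ha : ∀ r, 0 < r → a r ≤ B) (hv : ∀ r, 0 < r → |v r| ≤ B / r)
    (p : covGradGraph A) : ‖morawetzCLM hn hA h p‖ ≤ 2 * B * ‖p.1.snd‖ := by
  have hle : ‖morawetzCLM hn hA h p‖ ≤
      B * ‖(radialCLM p.1.snd : L2 n)‖ + 1 / 2 * B * ‖hardyCLM hn hA p‖ := by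
    have m1 := (Lp.memLp (radialCLM p.1.snd : L2 n)).norm.const_mul B
    have m2 := (Lp.memLp (hardyCLM hn hA p)).norm.const_mul (1 / 2 * B)
    have hmain : ‖morawetzCLM hn hA h p‖ ≤ ‖m1.toLp _ + m2.toLp _‖ := by
      refine Lp.norm_le_norm_of_ae_le ?_
      filter_upwards [ae_ne_zero hn, morawetzCLM_ae hn hA h p, Lp.coeFn_add (m1.toLp _) (m2.toLp _),
        m1.coeFn_toLp, m2.coeFn_toLp, hardyCLM_ae hn hA p, radialCLM_ae p.1.snd]
        with x hx e1 e2 e3 e4 e5 e6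
      have hpos := norm_pos_iff.2 hx
      rw [e1, e2, Pi.add_apply, e3, e4, e5, e6]
      refine le_trans ?_ (le_abs_self _)
      refine (norm_add_le _ _).trans ?_
      rw [norm_mul, norm_mul, norm_mul, norm_real, norm_real, norm_real,
        norm_eq_abs, norm_eq_abs, norm_eq_abs, abs_mul,
        abs_of_nonneg (h.nonneg _ hpos.le), abs_of_pos (inv_pos.2 hpos),
        abs_of_pos (by norm_num : (0 : ℝ) < 1 / 2)]
      refine add_le_add (mul_le_mul_of_nonneg_right (ha _ hpos) (norm_nonneg _)) ?_
      rw [mul_assoc, mul_assoc, ← mul_assoc B]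
      gcongr
      exact (hv _ hpos).trans_eq (div_eq_mul_inv _ _)
    refine hmain.trans ((norm_add_le _ _).trans (add_le_add ?_ ?_))
    · refine Lp.norm_le_mul_norm_of_ae_le_mul ?_
      filter_upwards [m1.coeFn_toLp] with x hx
      rw [hx, norm_mul, norm_norm, norm_eq_abs, abs_of_nonneg hB]
    · refine Lp.norm_le_mul_norm_of_ae_le_mul ?_
      filter_upwards [m2.coeFn_toLp] with x hx
      rw [hx, norm_mul, norm_norm, norm_eq_abs, abs_of_nonneg (by positivity)]
  have h1 : ‖(radialCLM p.1.snd : L2 n)‖ ≤ ‖p.1.snd‖ := by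
    refine Lp.norm_le_norm_of_ae_le ?_
    filter_upwards [radialCLM_ae p.1.snd] with x hx
    rw [hx]
    exact norm_radial_le _ _
  have h2 := norm_hardyCLM_le hn hA p
  calc _ ≤ _ := hle
    _ ≤ B * ‖p.1.snd‖ + 1 / 2 * B * (2 * ‖p.1.snd‖) := by gcongr
    _ = _ := by ring

theorem re_inner_morawetzCLM_self (hn : 3 ≤ n) (hA : ContDiffOn ℝ 1 A {0}ᶜ)
    (h : Weight n a a' v v' C) (p : covGradGraph A) :
    (⟪p.1.fst, morawetzCLM hn hA h p⟫_ℂ).re = 0 := by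
  obtain ⟨b, b', w, w', r0, r1, B, B0, hM, hb, hev⟩ := h.exists_truncation hn
  have hC := h.const_nonneg
  have hb0 : ∀ i r, 0 < r → |b i r| ≤ C := fun i r hr =>
    (abs_of_nonneg (hb i r hr).1).trans_le ((hb i r hr).2.1.trans (h.le_const r hr.le))
  have key : ∀ i, (∫ x, b i ‖x‖ * rip (p.1.fst x) (radial x (p.1.snd x))) +
      1 / 2 * ∫ x, w i ‖x‖ * ‖p.1.fst x‖ ^ 2 = 0 := by
    intro i
    obtain ⟨-, hMi, hz⟩ := hM i
    set R := max (r1 i) 1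
    have hR : 0 < R := lt_of_lt_of_le one_pos (le_max_right _ _)
    have hbig : ∀ r, 0 < r → ¬ r ≤ R → ¬(r0 i ≤ r ∧ r ≤ r1 i) := fun r hr h1 h2 =>
      h1 (h2.2.trans (le_max_left _ _))
    have hibp := radial_ibp hn hA p hMi.deriv_a hMi.cont_a' (C := (B + C) * R) (by positivity)
      (fun r hr => ?_) (fun r hr => ?_)
    · have e7 : ∫ x, b i ‖x‖ * (⟪p.1.fst x, radialCLM p.1.snd x⟫_ℂ).re =
          ∫ x, b i ‖x‖ * rip (p.1.fst x) (radial x (p.1.snd x)) := by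
        refine integral_congr_ae ?_
        filter_upwards [radialCLM_ae p.1.snd] with x hx
        rw [hx, re_inner_eq_rip]
      have e8 : ∫ x, (b' i ‖x‖ + (n - 1) * b i ‖x‖ / ‖x‖) * ‖p.1.fst x‖ ^ 2 =
          ∫ x, w i ‖x‖ * ‖p.1.fst x‖ ^ 2 := by
        refine integral_congr_ae ?_
        filter_upwards [ae_ne_zero hn] with x hx
        rw [hMi.v_eq _ (norm_pos_iff.2 hx)]
        ring
      rw [← e7, hibp, e8]
      ring
    · rcases le_or_gt r R with h1 | h1
      · rw [le_div_iff₀ hr]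
        exact mul_le_mul ((hb0 i r hr).trans (by linarith)) h1 hr.le (by positivity)
      · rw [hz r hr (hbig r hr h1.not_ge), abs_zero]
        positivity
    · rcases le_or_gt r R with h1 | h1
      · refine (hb i r hr).2.2.2.1.trans ?_
        rw [div_le_div_iff₀ hr (by positivity), sq, ← mul_assoc]
        gcongr
        linarith
      · rw [(hMi.supportedIn hz).a'_zero r hr (hbig r hr h1.not_ge), abs_zero]
        positivity
  have T1 := tendsto_weight_mul hn (integrable_rip_radial p.1.fst p.1.snd)
    (fun i => (hM i).2.1.cont_a) hb0 (fun r hr => (hev r hr).mono fun i e => e.1)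
  have T2 := tendsto_weight_mul hn (integrable_norm_sq p.1.fst) (fun i => (hM i).2.1.cont_v)
    (fun i r hr => (hb i r hr).2.2.2.2.1) (fun r hr => (hev r hr).mono fun i e => e.2.2.1)
  have hlim := T1.add (T2.const_mul (1 / 2))
  simp only [key] at hlim
  have hfin := tendsto_nhds_unique tendsto_const_nhds hlim
  have h2 := two_mul_re_inner_morawetzCLM hn hA h p p.1.fst
  simp only [rip_self, mul_assoc] at h2
  rw [integral_const_mul] at h2
  linarith

theorem inner_morawetzCLM (hn : 3 ≤ n) (hA : ContDiffOn ℝ 1 A {0}ᶜ) (h : Weight n a a' v v' C)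
    (p q : covGradGraph A) :
    ⟪p.1.fst, morawetzCLM hn hA h q⟫_ℂ = -⟪morawetzCLM hn hA h p, q.1.fst⟫_ℂ := by
  set Q := morawetzCLM hn hA h
  have key : ∀ p q : covGradGraph A, (⟪p.1.fst, Q q⟫_ℂ).re + (⟪Q p, q.1.fst⟫_ℂ).re = 0 := by
    intro p q
    have h1 := re_inner_morawetzCLM_self hn hA h (p + q)
    have h2 := re_inner_morawetzCLM_self hn hA h p
    have h3 := re_inner_morawetzCLM_self hn hA h q
    have e : (p + q).1.fst = p.1.fst + q.1.fst := rfl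
    rw [map_add, e, inner_add_left, inner_add_right, inner_add_right] at h1
    simp only [add_re] at h1
    have h4 : (⟪Q p, q.1.fst⟫_ℂ).re = (⟪q.1.fst, Q p⟫_ℂ).re := by
      rw [← inner_conj_symm, conj_re]
    rw [h4]
    linarith
  have k1 := key p q
  have k2 := key p (I • q)
  have e : (I • q).1.fst = I • q.1.fst := rfl
  rw [map_smul, e, inner_smul_right, inner_smul_right] at k2
  simp only [mul_re, I_re, I_im, zero_mul, one_mul, zero_sub] at k2
  apply Complex.ext
  · rw [neg_re]; linarith
  · rw [neg_im]; linarith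

end

section

/-! ### The Heinz inequality for antisymmetric operators -/

section Heinz

theorem le_of_log_convex {a : ℕ → ℝ} {B C : ℝ} (ha : ∀ k, 0 ≤ a k) (hB : 0 ≤ B)
    (hconv : ∀ k, a (k + 1) ^ 2 ≤ a k * a (k + 2)) (hbd : ∀ k, a k ≤ C * B ^ k) :
    a 1 ≤ B * a 0 := by
  by_contra! hlt
  have h1 : 0 < a 1 := lt_of_le_of_lt (mul_nonneg hB (ha 0)) hlt
  have h0 : 0 < a 0 := by
    rcases (ha 0).eq_or_lt with h | h
    · have := hconv 0
      rw [← h, zero_mul] at this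
      nlinarith
    · exact h
  set q := a 1 / a 0 with hq
  have hqB : B < q := (lt_div_iff₀ h0).2 hlt
  have hq0 : 0 < q := div_pos h1 h0
  have hstep : ∀ k, 0 < a k ∧ q * a k ≤ a (k + 1) := by
    intro k
    induction k with
    | zero => exact ⟨h0, by rw [hq, div_mul_cancel₀ _ h0.ne']⟩
    | succ k ih =>
      have hp : 0 < a (k + 1) := lt_of_lt_of_le (mul_pos hq0 ih.1) ih.2
      refine ⟨hp, ?_⟩
      have h2 := hconv k
      have h3 : q * a k * a (k + 1) ≤ a k * a (k + 2) :=
        (mul_le_mul_of_nonneg_right ih.2 hp.le).trans (by rw [← sq]; exact h2)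
      have h4 : a k * (q * a (k + 1)) ≤ a k * a (k + 2) := by linarith
      exact le_of_mul_le_mul_left h4 ih.1
  have hpow : ∀ k, q ^ k * a 0 ≤ a k := by
    intro k
    induction k with
    | zero => simp
    | succ k ih =>
      calc q ^ (k + 1) * a 0 = q * (q ^ k * a 0) := by ring
        _ ≤ q * a k := by gcongr
        _ ≤ a (k + 1) := (hstep k).2
  have hle : ∀ k, a 0 ≤ C * (B / q) ^ k := by
    intro k
    have := (hpow k).trans (hbd k)
    rw [div_pow, ← mul_div_assoc, le_div_iff₀ (by positivity)]
    linarith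
  have hlim : Tendsto (fun k => C * (B / q) ^ k) atTop (𝓝 (C * 0)) :=
    (tendsto_pow_atTop_nhds_zero_of_lt_one (by positivity) ((div_lt_one hq0).2 hqB)).const_mul C
  rw [mul_zero] at hlim
  exact absurd (ge_of_tendsto' hlim hle) (not_le.2 h0)

variable {K H : Type*} [NormedAddCommGroup K] [InnerProductSpace ℂ K] [NormedAddCommGroup H] [InnerProductSpace ℂ H]

/-- Operators that are antisymmetric with respect to a weaker inner product `⟨S f, S g⟩` are bounded
with respect to the weaker norm. -/
theorem norm_inner_le_of_antisymmetric (S Y : K →L[ℂ] K) {B : ℝ} (hB : 0 ≤ B)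
    (hY : ∀ f, ‖Y f‖ ≤ B * ‖f‖) (hskew : ∀ f g, ⟪S f, S (Y g)⟫_ℂ = -⟪S (Y f), S g⟫_ℂ) (f : K) :
    ‖⟪S f, S (Y f)⟫_ℂ‖ ≤ B * ‖S f‖ ^ 2 := by
  set a : ℕ → ℝ := fun k => ‖S (Y^[k] f)‖ with hadef
  have hY' : ∀ k, ‖Y^[k] f‖ ≤ B ^ k * ‖f‖ := by
    intro k
    induction k with
    | zero => simp
    | succ k ih =>
      rw [Function.iterate_succ_apply']
      calc _ ≤ B * ‖Y^[k] f‖ := hY _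
        _ ≤ B * (B ^ k * ‖f‖) := by gcongr
        _ = _ := by ring
  have h := le_of_log_convex (a := a) (B := B) (C := ‖S‖ * ‖f‖) (fun k => norm_nonneg _) hB ?_ ?_
  · have h1 : ‖S (Y f)‖ ≤ B * ‖S f‖ := h
    calc _ ≤ ‖S f‖ * ‖S (Y f)‖ := norm_inner_le_norm _ _
      _ ≤ ‖S f‖ * (B * ‖S f‖) := by gcongr
      _ = _ := by ring
  · intro k
    set z := Y^[k] f with hz
    have e1 : Y^[k + 1] f = Y z := Function.iterate_succ_apply' _ _ _
    have e2 : Y^[k + 2] f = Y (Y z) := by rw [Function.iterate_succ_apply', e1]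
    simp only [hadef, e1, e2, ← hz]
    have h1 := hskew z (Y z)
    have h2 : ((‖S (Y z)‖ ^ 2 : ℝ) : ℂ) = ⟪S (Y z), S (Y z)⟫_ℂ := by
      rw [inner_self_eq_norm_sq_to_K]; norm_cast
    have h3 : ‖S (Y z)‖ ^ 2 = ‖⟪S (Y z), S (Y z)⟫_ℂ‖ := by
      rw [← h2, norm_real, norm_eq_abs, abs_of_nonneg (sq_nonneg _)]
    rw [h3, ← norm_neg, ← h1]
    exact norm_inner_le_norm _ _
  · intro k
    calc a k ≤ ‖S‖ * ‖Y^[k] f‖ := S.le_opNorm _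
      _ ≤ ‖S‖ * (B ^ k * ‖f‖) := by gcongr; exact hY' k
      _ = _ := by ring

variable [CompleteSpace K] [CompleteSpace H] (J : K →L[ℂ] H)

theorem spectrum_adjoint_subset (hJ : ∀ p, ‖J p‖ ≤ ‖p‖) :
    spectrum ℝ (adjoint J ∘L J) ⊆ Icc 0 1 := by
  have hpos := isPositive_adjoint_comp_self J
  have h0 : 0 ≤ adjoint J ∘L J := (ContinuousLinearMap.nonneg_iff_isPositive _).2 hpos
  intro x hx
  refine ⟨spectrum_nonneg_of_nonneg h0 hx, ?_⟩
  have h1 : adjoint J ∘L J ≤ algebraMap ℝ (K →L[ℂ] K) 1 := by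
    rw [map_one, ContinuousLinearMap.le_def]
    refine ⟨?_, fun p => ?_⟩
    · exact ((IsSelfAdjoint.one _).sub hpos.isSelfAdjoint).isSymmetric
    · rw [ContinuousLinearMap.reApplyInnerSelf_apply]
      simp only [sub_apply, one_apply_eq_self, comp_apply, inner_sub_left, map_sub,
        adjoint_inner_left, inner_self_eq_norm_sq]
      have := pow_le_pow_left₀ (norm_nonneg _) (hJ p) 2
      linarith
  exact (le_algebraMap_iff_spectrum_le hpos.isSelfAdjoint).1 h1 x hx

theorem spectrum_comp_adjoint_subset (hJ : ∀ p, ‖J p‖ ≤ ‖p‖) :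
    spectrum ℝ (J ∘L adjoint J) ⊆ Icc 0 1 := by
  have h := spectrum_adjoint_subset (adjoint J) fun p => by
    have h1 : ‖J‖ ≤ 1 := J.opNorm_le_bound zero_le_one fun p => by rw [one_mul]; exact hJ p
    have h2 : ‖adjoint J‖ ≤ 1 := by
      rwa [LinearIsometryEquiv.norm_map]
    exact (le_of_opNorm_le _ h2 p).trans_eq (one_mul _)
  rwa [ContinuousLinearMap.adjoint_adjoint] at h

theorem comp_aeval_adjoint_comp_self (q : Polynomial ℝ) (p : K) :
    J (Polynomial.aeval (adjoint J ∘L J) q p) = Polynomial.aeval (J ∘L adjoint J) q (J p) := by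
  have hk : ∀ (k : ℕ) (p : K), J (((adjoint J ∘L J) ^ k) p) = ((J ∘L adjoint J) ^ k) (J p) := by
    intro k
    induction k with
    | zero => intro p; simp
    | succ k ih =>
      intro p
      rw [pow_succ, pow_succ, mul_apply_eq_comp, mul_apply_eq_comp, ih]
      rfl
  induction q using Polynomial.induction_on' with
  | add a b ha hb =>
    rw [map_add, map_add, add_apply, add_apply, map_add, ha, hb]
  | monomial k c =>
    rw [Polynomial.aeval_monomial, Polynomial.aeval_monomial, Algebra.algebraMap_eq_smul_one,
      Algebra.algebraMap_eq_smul_one, smul_mul_assoc, smul_mul_assoc, one_mul, one_mul, smul_apply,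
      smul_apply, ← hk, ← coe_smul, ← coe_smul, map_smul]

theorem norm_aeval_sub_cfc_le {N : K →L[ℂ] K} (aN : IsSelfAdjoint N) (sN : spectrum ℝ N ⊆ Icc 0 1)
    {f : ℝ → ℝ} (hf : ContinuousOn f (Icc 0 1)) {q : Polynomial ℝ} {ε : ℝ} (hε : 0 ≤ ε)
    (hq : ∀ x ∈ Icc (0 : ℝ) 1, |q.eval x - f x| < ε) : ‖Polynomial.aeval N q - cfc f N‖ ≤ ε := by
  rw [← cfc_polynomial q N aN, ← cfc_sub _ _ N (q.continuous.continuousOn) (hf.mono sN)]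
  exact norm_cfc_le hε fun x hx => (hq x (sN hx)).le

/-- The functional calculi of `J* J` and `J J*` are intertwined by `J`. -/
theorem comp_cfc_adjoint_comp_self (hJ : ∀ p, ‖J p‖ ≤ ‖p‖) {f : ℝ → ℝ}
    (hf : ContinuousOn f (Icc 0 1)) (p : K) :
    J (cfc f (adjoint J ∘L J) p) = cfc f (J ∘L adjoint J) (J p) := by
  have sM := spectrum_adjoint_subset J hJ
  have sR := spectrum_comp_adjoint_subset J hJ
  have aM := (isPositive_adjoint_comp_self J).isSelfAdjoint
  have aR := (ContinuousLinearMap.isPositive_self_comp_adjoint J).isSelfAdjoint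
  have hpoly := comp_aeval_adjoint_comp_self J
  generalize adjoint J ∘L J = M at *
  generalize J ∘L adjoint J = R at *
  refine eq_of_forall_dist_le fun ε hε => ?_
  set δ := ε / (2 * (‖p‖ + 1)) with hδ
  have hp : 0 < ‖p‖ + 1 := by positivity
  have hδ0 : 0 < δ := by positivity
  obtain ⟨q, hq⟩ := exists_polynomial_near_of_continuousOn 0 1 f hf δ hδ0
  have n1 := norm_aeval_sub_cfc_le aM sM hf hδ0.le hq
  have n2 := norm_aeval_sub_cfc_le aR sR hf hδ0.le hq
  have e : J (cfc f M p) - cfc f R (J p) =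
      (Polynomial.aeval R q - cfc f R) (J p) - J ((Polynomial.aeval M q - cfc f M) p) := by
    rw [sub_apply, sub_apply, map_sub, hpoly]
    abel
  rw [dist_eq_norm, e]
  calc _ ≤ ‖(Polynomial.aeval R q - cfc f R) (J p)‖ + ‖J ((Polynomial.aeval M q - cfc f M) p)‖ :=
        norm_sub_le _ _
    _ ≤ δ * ‖p‖ + δ * ‖p‖ := by
        refine add_le_add ?_ ?_
        · exact (le_of_opNorm_le _ n2 _).trans (by gcongr; exact hJ p)
        · exact (hJ _).trans (le_of_opNorm_le _ n1 _)
    _ ≤ ε := by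
        have : δ * (2 * (‖p‖ + 1)) = ε := by rw [hδ]; field_simp
        nlinarith

end Heinz

end

section

section Heinz

variable {K H : Type*} [NormedAddCommGroup K] [InnerProductSpace ℂ K] [CompleteSpace K]
  [NormedAddCommGroup H] [InnerProductSpace ℂ H] [CompleteSpace H]

theorem rpow_quarter_sq {y : ℝ} (hy : 0 ≤ y) : (y ^ (1 / 4 : ℝ)) ^ 2 = √y := by
  rw [← Real.rpow_natCast, ← Real.rpow_mul hy, Real.sqrt_eq_rpow]
  norm_num

theorem sqrt_sub_sqrt_le {a b : ℝ} (hb : 0 ≤ b) (hab : b ≤ a) : √a - √b ≤ √(a - b) := by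
  rw [sub_le_iff_le_add]
  refine Real.sqrt_le_iff.2 ⟨by positivity, ?_⟩
  have h1 := sq_sqrt hb
  have h2 := sq_sqrt (sub_nonneg.2 hab)
  nlinarith [mul_nonneg (sqrt_nonneg b) (sqrt_nonneg (a - b))]

theorem cfc_apply_cfc {N : K →L[ℂ] K} (sN : spectrum ℝ N ⊆ Icc 0 1) {f g h : ℝ → ℝ}
    (hf : ContinuousOn f (Icc 0 1)) (hg : ContinuousOn g (Icc 0 1))
    (hh : ∀ x ∈ Icc (0 : ℝ) 1, f x * g x = h x) (p : K) : cfc f N (cfc g N p) = cfc h N p := by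
  rw [← mul_apply_eq_comp, ← cfc_mul f g N (hf.mono sN) (hg.mono sN)]
  exact congrArg (fun T : K →L[ℂ] K => T p) (cfc_congr fun x hx => hh x (sN hx))

theorem inner_cfc_left (N : K →L[ℂ] K) (f : ℝ → ℝ) (p q : K) :
    ⟪cfc f N p, q⟫_ℂ = ⟪p, cfc f N q⟫_ℂ := by
  have h : IsSelfAdjoint (cfc f N) := cfc_predicate f N
  rw [← adjoint_inner_left]
  rw [ContinuousLinearMap.isSelfAdjoint_iff'.1 h]

theorem tendsto_re_inner_cfc {N : K →L[ℂ] K} (sN : spectrum ℝ N ⊆ Icc 0 1) {F : ℝ → ℝ → ℝ}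
    {f : ℝ → ℝ} (hF : ∀ e, 0 < e → ContinuousOn (F e) (Icc 0 1))
    (hb : ∀ e, 0 < e → ∀ x ∈ Icc (0 : ℝ) 1, |F e x - f x| ≤ √(e + e ^ 2)) (p : K) :
    Tendsto (fun e => (⟪p, cfc (F e) N p⟫_ℂ).re) (𝓝[>] 0) (𝓝 (⟪p, cfc f N p⟫_ℂ).re) := by
  have hη : Tendsto (fun e : ℝ => √(e + e ^ 2)) (𝓝[>] 0) (𝓝 0) := by
    have : Tendsto (fun e : ℝ => √(e + e ^ 2)) (𝓝 0) (𝓝 √(0 + 0 ^ 2)) :=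
      Continuous.tendsto (by fun_prop) 0
    simp only [ne_eq, OfNat.ofNat_ne_zero, not_false_eq_true, zero_pow, add_zero, Real.sqrt_zero] at this
    exact this.mono_left nhdsWithin_le_nhds
  have h1 : Tendsto (fun e => cfc (F e) N) (𝓝[>] 0) (𝓝 (cfc f N)) := by
    refine tendsto_cfc_fun ?_ ?_
    · rw [Metric.tendstoUniformlyOn_iff]
      intro ε hε
      filter_upwards [self_mem_nhdsWithin, hη.eventually (gt_mem_nhds hε)] with e he he' x hx
      rw [dist_comm, dist_eq]
      exact (hb e he x (sN hx)).trans_lt he'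
    · filter_upwards [self_mem_nhdsWithin] with e he using (hF e he).mono sN
  have h2 : Continuous fun T : K →L[ℂ] K => (⟪p, T p⟫_ℂ).re :=
    continuous_re.comp (Continuous.inner continuous_const (ContinuousLinearMap.apply ℂ K p).continuous)
  exact (h2.tendsto _).comp h1

variable {J : K →L[ℂ] H}

theorem norm_comp_cfc_sq (hJ : ∀ p, ‖J p‖ ≤ ‖p‖) {h k : ℝ → ℝ} (hh : ContinuousOn h (Icc 0 1))
    (hk : ∀ x ∈ Icc (0 : ℝ) 1, h x * (x * h x) = k x) (p : K) :
    ‖J (cfc h (adjoint J ∘L J) p)‖ ^ 2 = (⟪p, cfc k (adjoint J ∘L J) p⟫_ℂ).re := by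
  have sM := spectrum_adjoint_subset J hJ
  have aM := (isPositive_adjoint_comp_self J).isSelfAdjoint
  have e1 : ∀ q, ‖J q‖ ^ 2 = (⟪q, (adjoint J ∘L J) q⟫_ℂ).re := by
    intro q
    rw [comp_apply, adjoint_inner_right]
    exact (inner_self_eq_norm_sq (𝕜 := ℂ) _).symm
  rw [e1]
  generalize adjoint J ∘L J = M at *
  have e2 : M (cfc h M p) = cfc (fun x => x * h x) M p := by
    conv_lhs => rw [← cfc_id ℝ M]
    rw [cfc_id ℝ M]
    nth_rewrite 1 [← cfc_id ℝ M]
    exact cfc_apply_cfc sM continuousOn_id hh (fun x _ => rfl) p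
  rw [e2, inner_cfc_left, cfc_apply_cfc sM (g := fun x => x * h x) hh (continuousOn_id.mul hh) hk]

theorem re_inner_cfc_le_of_isPow (hJ : ∀ p, ‖J p‖ ≤ ‖p‖) {p : K} {v : H}
    (hv : IsPow (J ∘L adjoint J) (1 / 4) (J p) v) :
    (⟪p, cfc (fun x => √x * √(1 - x)) (adjoint J ∘L J) p⟫_ℂ).re ≤ ‖v‖ ^ 2 := by
  have sM := spectrum_adjoint_subset J hJ
  have sR := spectrum_comp_adjoint_subset J hJ
  have hpos : ∀ e : ℝ, 0 < e → ∀ x ∈ Icc (0 : ℝ) 1, 0 < x + e := fun e he x hx => by linarith [hx.1]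
  have cq : ContinuousOn (fun x : ℝ => x ^ (1 / 4 : ℝ)) (Icc 0 1) :=
    (Real.continuous_rpow_const (by norm_num)).continuousOn
  have cq' : ContinuousOn (fun x : ℝ => (1 - x) ^ (1 / 4 : ℝ)) (Icc 0 1) :=
    ((Real.continuous_rpow_const (by norm_num)).comp (continuous_const.sub continuous_id)).continuousOn
  have ce : ∀ e : ℝ, 0 < e → ContinuousOn (fun x : ℝ => ((x + e) ^ (1 / 4 : ℝ))⁻¹) (Icc 0 1) :=
    fun e he => ((Real.continuous_rpow_const (by norm_num)).comp
      (continuous_id.add continuous_const)).continuousOn.inv₀ fun x hx =>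
        (Real.rpow_pos_of_pos (hpos e he x hx) _).ne'
  refine le_of_tendsto (tendsto_re_inner_cfc sM (F := fun e x => x / √(x + e) * √(1 - x))
    (fun e he => ?_) (fun e he x hx => ?_) p) ?_
  · refine (continuousOn_id.div (by fun_prop) fun x hx => ?_).mul (by fun_prop)
    exact (sqrt_pos.2 (hpos e he x hx)).ne'
  · have h0 := hpos e he x hx
    have s0 := sqrt_pos.2 h0
    have h1 : √(1 - x) ≤ 1 := Real.sqrt_le_one.2 (by linarith [hx.1])
    have h2 := sqrt_sub_sqrt_le hx.1 (by linarith : x ≤ x + e)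
    have h3 : √x ≤ √(x + e) := Real.sqrt_le_sqrt (by linarith)
    have h4 : √x - x / √(x + e) ≤ √(x + e) - √x := by
      rw [sub_le_iff_le_add, ← sub_le_iff_le_add', le_div_iff₀ s0]
      nlinarith [sq_sqrt hx.1, sq_sqrt h0.le, sqrt_nonneg x, sq_nonneg (√(x + e) - √x)]
    have h5 : 0 ≤ √x - x / √(x + e) := by
      rw [sub_nonneg, div_le_iff₀ s0]
      nlinarith [sq_sqrt hx.1, sqrt_nonneg x]
    have h6 : √(x + e - x) ≤ √(e + e ^ 2) := Real.sqrt_le_sqrt (by nlinarith)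
    rw [← sub_mul, abs_mul, abs_of_nonneg (sqrt_nonneg (1 - x)), abs_sub_comm, abs_of_nonneg h5]
    calc (√x - x / √(x + e)) * √(1 - x) ≤ (√x - x / √(x + e)) * 1 := by gcongr
      _ ≤ _ := by linarith
  · filter_upwards [self_mem_nhdsWithin] with e he
    have k1 := norm_comp_cfc_sq hJ (h := fun x => ((x + e) ^ (1 / 4 : ℝ))⁻¹ * (1 - x) ^ (1 / 4 : ℝ))
      (k := fun x => x / √(x + e) * √(1 - x)) ((ce e he).mul cq') (fun x hx => by
        have h1 := rpow_quarter_sq (hpos e he x hx).le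
        have h2 := rpow_quarter_sq (sub_nonneg.2 hx.2)
        rw [← h1, ← h2]
        field_simp) p
    rw [← k1, comp_cfc_adjoint_comp_self J hJ
      (f := fun x => ((x + e) ^ (1 / 4 : ℝ))⁻¹ * (1 - x) ^ (1 / 4 : ℝ)) ((ce e he).mul cq')]
    rw [← cfc_apply_cfc sR (ce e he) cq' (fun x _ => rfl), ← hv,
      cfc_apply_cfc sR (ce e he) cq (fun x _ => rfl)]
    refine pow_le_pow_left₀ (norm_nonneg _) ?_ 2
    refine (le_of_opNorm_le _ (norm_cfc_le zero_le_one fun x hx => ?_) v).trans_eq (one_mul _)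
    have hx := sR hx
    have h0 := hpos e he x hx
    rw [norm_eq_abs, abs_of_nonneg (mul_nonneg (inv_nonneg.2 (Real.rpow_nonneg h0.le _))
      (Real.rpow_nonneg hx.1 _)), inv_mul_le_iff₀ (Real.rpow_pos_of_pos h0 _), mul_one]
    exact Real.rpow_le_rpow hx.1 (by linarith [mem_Ioi.1 he]) (by norm_num)

theorem norm_inner_le_regularized (hJ : ∀ p, ‖J p‖ ≤ ‖p‖) {Q : K →L[ℂ] H}
    (hskew : ∀ p q, ⟪J p, Q q⟫_ℂ = -⟪Q p, J q⟫_ℂ) {B : ℝ} (hB : 0 ≤ B)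
    (hQ : ∀ p, ‖Q p‖ ^ 2 ≤ B ^ 2 * (‖p‖ ^ 2 - ‖J p‖ ^ 2)) {e : ℝ} (he : 0 < e) (p : K) :
    ‖⟪J p, Q p⟫_ℂ‖ ≤ B * (⟪p, cfc (fun x => √(x + e) * √(1 - x + e)) (adjoint J ∘L J) p⟫_ℂ).re := by
  have sM := spectrum_adjoint_subset J hJ
  have aM := (isPositive_adjoint_comp_self J).isSelfAdjoint
  have eM : ∀ q, (⟪q, (adjoint J ∘L J) q⟫_ℂ).re = ‖J q‖ ^ 2 := by
    intro q
    rw [comp_apply, adjoint_inner_right]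
    exact inner_self_eq_norm_sq (𝕜 := ℂ) _
  generalize adjoint J ∘L J = M at *
  have hs : ∀ x ∈ Icc (0 : ℝ) 1, 0 < √(x + e) := fun x hx => sqrt_pos.2 (by linarith [hx.1])
  have ht : ∀ x ∈ Icc (0 : ℝ) 1, 0 < √(1 - x + e) := fun x hx => sqrt_pos.2 (by linarith [hx.2])
  have cs : ContinuousOn (fun x => √(x + e)) (Icc 0 1) := by fun_prop
  have ct : ContinuousOn (fun x => √(1 - x + e)) (Icc 0 1) := by fun_prop
  have csi : ContinuousOn (fun x => (√(x + e))⁻¹) (Icc 0 1) := cs.inv₀ fun x hx => (hs x hx).ne'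
  have cti : ContinuousOn (fun x => (√(1 - x + e))⁻¹) (Icc 0 1) := ct.inv₀ fun x hx => (ht x hx).ne'
  have cw : ContinuousOn (fun x => √(√(x + e) * (√(1 - x + e))⁻¹)) (Icc 0 1) :=
    Real.continuous_sqrt.comp_continuousOn (cs.mul cti)
  have c1 : ∀ q : K, cfc (fun _ : ℝ => (1 : ℝ)) M q = q := fun q => by
    rw [cfc_const_one ℝ M]; rfl
  have nsq : ∀ (f k : ℝ → ℝ), ContinuousOn f (Icc 0 1) → (∀ x ∈ Icc (0 : ℝ) 1, f x * f x = k x) →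
      ∀ q, ‖cfc f M q‖ ^ 2 = (⟪q, cfc k M q⟫_ℂ).re := fun f k cf hk q => by
    have h1 : ‖cfc f M q‖ ^ 2 = (⟪cfc f M q, cfc f M q⟫_ℂ).re :=
      (inner_self_eq_norm_sq (𝕜 := ℂ) _).symm
    rw [h1, inner_cfc_left, cfc_apply_cfc sM cf cf hk]
  have ns : ∀ q, ‖cfc (fun x => √(x + e)) M q‖ ^ 2 = ‖J q‖ ^ 2 + e * ‖q‖ ^ 2 := fun q => by
    rw [nsq _ (fun x => x + e) cs (fun x hx => mul_self_sqrt (by linarith [hx.1])),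
      cfc_add_const e (fun x => x) M continuousOn_id, cfc_id' ℝ M, add_apply, inner_add_right,
      add_re, eM, Algebra.algebraMap_eq_smul_one, smul_apply, one_apply_eq_self,
      ← coe_smul, inner_smul_right, re_ofReal_mul]
    congr 2
    exact inner_self_eq_norm_sq (𝕜 := ℂ) q
  have nt : ∀ q, ‖cfc (fun x => √(1 - x + e)) M q‖ ^ 2 = (‖q‖ ^ 2 - ‖J q‖ ^ 2) + e * ‖q‖ ^ 2 :=
    fun q => by
    have e0 : cfc (fun x : ℝ => 1 - x + e) M = cfc (fun x : ℝ => (1 + e) - x) M :=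
      cfc_congr fun x _ => by ring
    rw [nsq _ (fun x => 1 - x + e) ct (fun x hx => mul_self_sqrt (by linarith [hx.2])), e0,
      cfc_sub (fun _ => 1 + e) (fun x => x) M continuousOn_const continuousOn_id,
      cfc_const (1 + e) M, cfc_id' ℝ M, sub_apply, inner_sub_right,
      sub_re, eM, Algebra.algebraMap_eq_smul_one, smul_apply, one_apply_eq_self,
      ← coe_smul, inner_smul_right, re_ofReal_mul]
    have : (⟪q, q⟫_ℂ).re = ‖q‖ ^ 2 := inner_self_eq_norm_sq (𝕜 := ℂ) q
    rw [this]
    ring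
  have ii : ∀ {f g : ℝ → ℝ}, ContinuousOn f (Icc 0 1) → ContinuousOn g (Icc 0 1) →
      (∀ x ∈ Icc (0 : ℝ) 1, f x * g x = 1) → ∀ q, cfc f M (cfc g M q) = q := fun cf cg hfg q => by
    rw [cfc_apply_cfc sM cf cg hfg, c1]
  have its := ii cti ct fun x hx => inv_mul_cancel₀ (ht x hx).ne'
  have isi := ii cs csi fun x hx => mul_inv_cancel₀ (hs x hx).ne'
  have isi' := ii csi cs fun x hx => inv_mul_cancel₀ (hs x hx).ne'
  have iti := ii ct cti fun x hx => mul_inv_cancel₀ (ht x hx).ne'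
  set V : K →L[ℂ] H := J ∘L cfc (fun x => (√(x + e))⁻¹) M with hV
  set Y : K →L[ℂ] K := adjoint V ∘L (Q ∘L cfc (fun x => (√(1 - x + e))⁻¹) M) with hYdef
  have nV : ‖V‖ ≤ 1 := by
    refine V.opNorm_le_bound zero_le_one fun q => ?_
    rw [one_mul]
    have h1 := ns (cfc (fun x => (√(x + e))⁻¹) M q)
    rw [isi] at h1
    refine pow_le_pow_iff_left₀ (norm_nonneg _) (norm_nonneg _) two_ne_zero |>.1 ?_
    rw [h1]
    exact le_add_of_nonneg_right (by positivity)
  have nY : ∀ f, ‖Y f‖ ≤ B * ‖f‖ := by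
    intro f
    have h1 : ‖adjoint V‖ ≤ 1 := by rwa [LinearIsometryEquiv.norm_map]
    refine (le_of_opNorm_le _ h1 _).trans ?_
    rw [one_mul]
    refine pow_le_pow_iff_left₀ (norm_nonneg _) (by positivity) two_ne_zero |>.1 ?_
    have h2 := nt (cfc (fun x => (√(1 - x + e))⁻¹) M f)
    rw [iti] at h2
    rw [mul_pow, h2]
    refine (hQ _).trans (mul_le_mul_of_nonneg_left ?_ (sq_nonneg B))
    exact le_add_of_nonneg_right (by positivity)
  have hSS : ∀ f g, ⟪cfc (fun x => √(√(x + e) * (√(1 - x + e))⁻¹)) M f,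
      cfc (fun x => √(√(x + e) * (√(1 - x + e))⁻¹)) M g⟫_ℂ =
      ⟪cfc (fun x => (√(1 - x + e))⁻¹) M f, cfc (fun x => √(x + e)) M g⟫_ℂ := by
    intro f g
    rw [inner_cfc_left, inner_cfc_left,
      cfc_apply_cfc sM cw cw (h := fun x => √(x + e) * (√(1 - x + e))⁻¹) (fun x hx =>
        mul_self_sqrt (mul_nonneg (hs x hx).le (inv_nonneg.2 (ht x hx).le))),
      cfc_apply_cfc sM cti cs (h := fun x => √(x + e) * (√(1 - x + e))⁻¹) (fun x hx => mul_comm _ _)]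
  have key : ∀ f g, ⟪cfc (fun x => √(√(x + e) * (√(1 - x + e))⁻¹)) M f,
      cfc (fun x => √(√(x + e) * (√(1 - x + e))⁻¹)) M (Y g)⟫_ℂ =
      ⟪J (cfc (fun x => (√(1 - x + e))⁻¹) M f), Q (cfc (fun x => (√(1 - x + e))⁻¹) M g)⟫_ℂ := by
    intro f g
    rw [hSS, ← inner_cfc_left, hYdef, comp_apply, adjoint_inner_right, hV, comp_apply, isi']
    rfl
  have main := norm_inner_le_of_antisymmetric
    (cfc (fun x => √(√(x + e) * (√(1 - x + e))⁻¹)) M) Y hB nY (fun f g => by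
      rw [key, hskew, ← inner_conj_symm (cfc (fun x => √(√(x + e) * (√(1 - x + e))⁻¹)) M (Y f)), key,
        inner_conj_symm]) (cfc (fun x => √(1 - x + e)) M p)
  rw [key, its] at main
  refine main.trans_eq ?_
  congr 1
  rw [nsq _ (fun x => √(x + e) * (√(1 - x + e))⁻¹) cw (fun x hx =>
        mul_self_sqrt (mul_nonneg (hs x hx).le (inv_nonneg.2 (ht x hx).le))), inner_cfc_left,
    cfc_apply_cfc sM (f := fun x => √(x + e) * (√(1 - x + e))⁻¹) (cs.mul cti) ct (h := fun x => √(x + e)) (fun x hx => by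
      rw [mul_assoc, inv_mul_cancel₀ (ht x hx).ne', mul_one]),
    cfc_apply_cfc sM ct cs (h := fun x => √(x + e) * √(1 - x + e)) (fun x hx => mul_comm _ _)]

/-- The Heinz inequality: if `Q` is antisymmetric and bounded by `B L^{1/2}`, then
`|⟨u, Q u⟩| ≤ B ‖L^{1/4} u‖²`. -/
theorem norm_inner_le_of_isPow (hJ : ∀ p, ‖J p‖ ≤ ‖p‖) {Q : K →L[ℂ] H}
    (hskew : ∀ p q, ⟪J p, Q q⟫_ℂ = -⟪Q p, J q⟫_ℂ) {B : ℝ} (hB : 0 ≤ B)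
    (hQ : ∀ p, ‖Q p‖ ^ 2 ≤ B ^ 2 * (‖p‖ ^ 2 - ‖J p‖ ^ 2)) {p : K} {v : H}
    (hv : IsPow (J ∘L adjoint J) (1 / 4) (J p) v) :
    ‖⟪J p, Q p⟫_ℂ‖ ≤ B * ‖v‖ ^ 2 := by
  have sM := spectrum_adjoint_subset J hJ
  refine le_trans ?_ (mul_le_mul_of_nonneg_left (re_inner_cfc_le_of_isPow hJ hv) hB)
  refine ge_of_tendsto ((tendsto_re_inner_cfc sM (F := fun e x => √(x + e) * √(1 - x + e))
    (fun e he => by fun_prop) (fun e he x hx => ?_) p).const_mul B) ?_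
  · have h0 : 0 ≤ x * (1 - x) := mul_nonneg hx.1 (by linarith [hx.2])
    have h1 : x * (1 - x) ≤ (x + e) * (1 - x + e) := by nlinarith
    rw [← Real.sqrt_mul hx.1, ← Real.sqrt_mul (by linarith [hx.1])]
    rw [abs_of_nonneg (sub_nonneg.2 (Real.sqrt_le_sqrt h1))]
    refine (sqrt_sub_sqrt_le h0 h1).trans_eq ?_
    congr 1
    ring
  · filter_upwards [self_mem_nhdsWithin] with e he using
      norm_inner_le_regularized hJ hskew hB hQ he p

end Heinz

variable {A : E n → E n} {a a' v v' : ℝ → ℝ} {C : ℝ}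

theorem norm_inner_morawetzCLM_le (hn : 3 ≤ n) (hA : ContDiffOn ℝ 1 A {0}ᶜ)
    (h : Weight n a a' v v' C) {B : ℝ} (hB : 0 ≤ B) (ha : ∀ r, 0 < r → a r ≤ B)
    (hv : ∀ r, 0 < r → |v r| ≤ B / r) (p : covGradGraph A) :
    ofReal ‖⟪p.1.fst, morawetzCLM hn hA h p⟫_ℂ‖ ≤ ofReal (2 * B) * quarterNormSq A p.1.fst := by
  have hn2 : ∀ p : covGradGraph A, ‖p‖ ^ 2 = ‖p.1.fst‖ ^ 2 + ‖p.1.snd‖ ^ 2 := fun p =>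
    WithLp.prod_norm_sq_eq_of_L2 p.1
  have hmain : ∀ w : L2 n, IsPow (resolvent A) (1 / 4) p.1.fst w →
      ‖⟪p.1.fst, morawetzCLM hn hA h p⟫_ℂ‖ ≤ 2 * B * ‖w‖ ^ 2 := by
    intro w hw
    refine norm_inner_le_of_isPow (J := embed A) (fun p => ?_) (Q := morawetzCLM hn hA h)
      (fun p q => inner_morawetzCLM hn hA h p q) (by positivity) (fun p => ?_) hw
    · change ‖p.1.fst‖ ≤ ‖p‖
      refine pow_le_pow_iff_left₀ (norm_nonneg _) (norm_nonneg _) two_ne_zero |>.1 ?_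
      rw [hn2]
      exact le_add_of_nonneg_right (sq_nonneg _)
    · have h1 := pow_le_pow_left₀ (norm_nonneg _) (norm_morawetzCLM_le hn hA h hB ha hv p) 2
      rw [mul_pow] at h1
      refine h1.trans_eq ?_
      rw [hn2]
      change _ = (2 * B) ^ 2 * (‖p.1.fst‖ ^ 2 + ‖p.1.snd‖ ^ 2 - ‖p.1.fst‖ ^ 2)
      ring
  rw [quarterNormSq]
  rcases hB.eq_or_lt with rfl | hB'
  · have : ‖morawetzCLM hn hA h p‖ ≤ 0 := by
      simpa using norm_morawetzCLM_le hn hA h le_rfl ha hv p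
    rw [norm_le_zero_iff.1 this]
    simp
  · rw [mul_iInf_of_ne (by simpa using hB') ofReal_ne_top]
    refine le_iInf fun w => ?_
    rw [mul_iInf_of_ne (by simpa using hB') ofReal_ne_top]
    refine le_iInf fun hw => ?_
    rw [← ofReal_norm, ← ofReal_pow (norm_nonneg _), ← ofReal_mul (by positivity)]
    exact ofReal_le_ofReal (hmain w hw)

end

section

variable {A : E n → E n} {A₀ : E n → ℝ}

/-! ### The evolution -/

/-- `-Δ_A` is bounded with respect to the graph norm of `H`. -/
theorem exists_negLaplacian_on_graph (hn : 3 ≤ n) (hA : GaugeConditions A₀ A) :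
    ∃ S : (hamiltonian A₀ A).graph →L[ℂ] L2 n, ∀ γ : (hamiltonian A₀ A).graph,
      (γ.1.1, S γ) ∈ negLaplacianGraph A ∧
        ∃ V : L2 n, (V =ᵐ[volume] fun x => (A₀ x : ℂ) * γ.1.1 x) ∧ γ.1.2 = S γ + V := by
  have hcl : IsClosed ((hamiltonian A₀ A).graph : Set (L2 n × L2 n)) := hA.hamiltonian_pos.1.isClosed
  have : CompleteSpace (hamiltonian A₀ A).graph := hcl.completeSpace_coe
  have huniq : ∀ {u L L' : L2 n}, (u, L) ∈ negLaplacianGraph A → (u, L') ∈ negLaplacianGraph A →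
      L = L' := fun h h' => LinearPMap.mem_graph_snd_inj _
        ((mem_graph_negLaplacian hn hA.contDiff_A).2 h)
        ((mem_graph_negLaplacian hn hA.contDiff_A).2 h') rfl
  choose L V hL hV hLV using fun γ : (hamiltonian A₀ A).graph =>
    exists_of_mem_graph_hamiltonian hn hA.contDiff_A (u := γ.1.1) (f := γ.1.2) γ.2
  let S : (hamiltonian A₀ A).graph →ₗ[ℂ] L2 n :=
    { toFun := L
      map_add' := fun γ δ => huniq (hL (γ + δ)) ((negLaplacianGraph A).add_mem (hL γ) (hL δ))
      map_smul' := fun c γ => huniq (hL (c • γ)) ((negLaplacianGraph A).smul_mem c (hL γ)) }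
  have hS : Continuous S := by
    refine LinearMap.continuous_of_isClosed_graph (g := S) ?_
    have h1 := isClosed_negLaplacianGraph hn hA.contDiff_A hA.negLaplacian_pos.1
    have h2 : (S.graph : Set ((hamiltonian A₀ A).graph × L2 n)) =
        (fun q => (q.1.1.1, q.2)) ⁻¹' (negLaplacianGraph A : Set (L2 n × L2 n)) := by
      ext ⟨γ, l⟩
      constructor
      · intro h
        have h : l = L γ := (LinearMap.mem_graph_iff _ _).1 h
        change (γ.1.1, l) ∈ negLaplacianGraph A
        rw [h]
        exact hL γ
      · intro h
        exact (LinearMap.mem_graph_iff _ _).2 (huniq h (hL γ))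
    rw [h2]
    exact h1.preimage (by fun_prop)
  exact ⟨⟨S, hS⟩, fun γ => ⟨hL γ, V γ, hV γ, hLV γ⟩⟩

theorem norm_sub_sq_le_of_weak {p q : covGradGraph A} {L L' : L2 n}
    (hp : ∀ r ∈ covGradGraph A, ⟪r.snd, p.1.snd⟫_ℂ = ⟪r.fst, L⟫_ℂ)
    (hq : ∀ r ∈ covGradGraph A, ⟪r.snd, q.1.snd⟫_ℂ = ⟪r.fst, L'⟫_ℂ) :
    ‖p - q‖ ^ 2 ≤ ‖p.1.fst - q.1.fst‖ ^ 2 + ‖p.1.fst - q.1.fst‖ * ‖L - L'‖ := by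
  have h1 : ‖p - q‖ ^ 2 = ‖p.1.fst - q.1.fst‖ ^ 2 + ‖p.1.snd - q.1.snd‖ ^ 2 :=
    WithLp.prod_norm_sq_eq_of_L2 (p - q).1
  have h2 : ‖p.1.snd - q.1.snd‖ ^ 2 = (⟪p.1.fst - q.1.fst, L - L'⟫_ℂ).re := by
    have h3 : ⟪p.1.snd - q.1.snd, p.1.snd - q.1.snd⟫_ℂ = ⟪p.1.fst - q.1.fst, L - L'⟫_ℂ := by
      have h4 := hp _ (p - q).2
      have h5 := hq _ (p - q).2
      rw [inner_sub_right, inner_sub_right]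
      exact congrArg₂ (· - ·) h4 h5
    rw [← h3]
    exact (inner_self_eq_norm_sq (𝕜 := ℂ) _).symm
  rw [h1, h2]
  refine add_le_add le_rfl ?_
  exact (Complex.re_le_norm _).trans (norm_inner_le_norm _ _)

theorem IsSolution.exists_data (hn : 3 ≤ n) (hA : GaugeConditions A₀ A) {g : ℝ → ℝ} {T : ℝ≥0∞}
    {u : ℝ → L2 n} (hu : IsSolution A₀ A g T u) {T' : ℝ} (hT : 0 ≤ T') (hT' : ofReal T' ≤ T) :
    ∃ (P : ℝ → covGradGraph A) (du : ℝ → L2 n), Continuous P ∧ Continuous du ∧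
      ∀ t ∈ Icc 0 T', (P t).1.fst = u t ∧ HasDerivWithinAt u (du t) (Icc 0 T') t ∧
        ∃ L V N : L2 n, DomainData A₀ A g (P t) L V N ∧ L + V + N = I • du t := by
  obtain ⟨Hu, du, cH, cd, h⟩ := hu
  obtain ⟨S, hS⟩ := exists_negLaplacian_on_graph hn hA
  have hsub : Icc 0 T' ⊆ timeInterval T := fun t ht =>
    ⟨ht.1, (ofReal_le_ofReal ht.2).trans hT'⟩
  set τ : ℝ → ℝ := fun t => (projIcc 0 T' hT t : ℝ) with hτ
  have cτ : Continuous τ := continuous_subtype_val.comp continuous_projIcc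
  have mτ : ∀ t, τ t ∈ timeInterval T := fun t => hsub (projIcc 0 T' hT t).2
  have eτ : ∀ t ∈ Icc 0 T', τ t = t := fun t ht => by rw [hτ]; simp only [projIcc_of_mem hT ht]
  have cu : ContinuousOn u (timeInterval T) := fun t ht => (h t ht).2.1.continuousWithinAt
  set γ : ℝ → (hamiltonian A₀ A).graph := fun t => ⟨(u (τ t), Hu (τ t)), (h _ (mτ t)).1⟩ with hγ
  have cγ : Continuous γ :=
    ((cu.comp_continuous cτ mτ).prodMk (cH.comp_continuous cτ mτ)).subtype_mk _
  have cS : Continuous fun t => S (γ t) := S.continuous.comp cγ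
  have cu' : Continuous fun t => u (τ t) := cu.comp_continuous cτ mτ
  choose w hw hw' using fun t => (hS (γ t)).1
  set P : ℝ → covGradGraph A := fun t => ⟨WithLp.toLp 2 (u (τ t), w t), hw t⟩ with hP
  refine ⟨P, fun t => du (τ t), ?_, cd.comp_continuous cτ mτ, fun t ht => ?_⟩
  · refine continuous_iff_continuousAt.2 fun s => ?_
    refine tendsto_iff_norm_sub_tendsto_zero.2 ?_
    have h0 : Tendsto (fun t => √(‖u (τ t) - u (τ s)‖ ^ 2 +
        ‖u (τ t) - u (τ s)‖ * ‖S (γ t) - S (γ s)‖)) (𝓝 s) (𝓝 0) := by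
      have hc : Continuous fun t => √(‖u (τ t) - u (τ s)‖ ^ 2 +
        ‖u (τ t) - u (τ s)‖ * ‖S (γ t) - S (γ s)‖) :=
        Real.continuous_sqrt.comp (((cu'.sub continuous_const).norm.pow 2).add
          ((cu'.sub continuous_const).norm.mul (cS.sub continuous_const).norm))
      have := hc.tendsto s
      simpa using this
    refine squeeze_zero (fun t => norm_nonneg _) (fun t => ?_) h0
    exact Real.le_sqrt_of_sq_le (norm_sub_sq_le_of_weak (hw' t) (hw' s))
  · have hd := (h t (hsub ht)).2.1.mono hsub
    obtain ⟨V, hV, hHV⟩ := (hS (γ t)).2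
    simp only [eτ t ht]
    refine ⟨by simp only [hP, eτ t ht]; rfl, hd, S (γ t), V, I • du t - Hu t, ⟨hw' t, hV, ?_⟩, ?_⟩
    · filter_upwards [(h t (hsub ht)).2.2, Lp.coeFn_sub (I • du t) (Hu t),
        Lp.coeFn_smul I (du t)] with x h1 h2 h3
      simp only [hP, eτ t ht]
      rw [h2, Pi.sub_apply, h3, Pi.smul_apply, smul_eq_mul, h1]
      rfl
    · have e : Hu t = S (γ t) + V := by
        rw [← hHV]
        simp only [hγ, eτ t ht]
      rw [e]
      abel

theorem hasDerivWithinAt_im_inner (hn : 3 ≤ n) (hA : ContDiffOn ℝ 1 A {0}ᶜ) {a a' v v' : ℝ → ℝ}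
    {C : ℝ} (h : Weight n a a' v v' C) {P : ℝ → covGradGraph A} (hP : Continuous P) {s : Set ℝ}
    {t : ℝ} {d : L2 n} (hd : HasDerivWithinAt (fun t => (P t).1.fst) d s t) :
    HasDerivWithinAt (fun t => (⟪(P t).1.fst, morawetzCLM hn hA h (P t)⟫_ℂ).im)
      (2 * (⟪d, morawetzCLM hn hA h (P t)⟫_ℂ).im) s t := by
  set Q := morawetzCLM hn hA h
  have cQ : Continuous fun t => Q (P t) := Q.continuous.comp hP
  rw [hasDerivWithinAt_iff_tendsto_slope] at hd ⊢
  have h1 : Tendsto (fun y => (⟪slope (fun t => (P t).1.fst) t y, Q (P y)⟫_ℂ).im +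
      (⟪slope (fun t => (P t).1.fst) t y, Q (P t)⟫_ℂ).im) (𝓝[s \ {t}] t)
      (𝓝 ((⟪d, Q (P t)⟫_ℂ).im + (⟪d, Q (P t)⟫_ℂ).im)) := by
    refine ((continuous_im.tendsto _).comp (hd.inner ?_)).add
      ((continuous_im.tendsto _).comp (hd.inner tendsto_const_nhds))
    exact (cQ.tendsto t).mono_left nhdsWithin_le_nhds
  rw [← two_mul] at h1
  have hsm : ∀ (r : ℝ) (f k : L2 n), (⟪r • f, k⟫_ℂ).im = r * (⟪f, k⟫_ℂ).im := fun r f k => by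
    rw [RCLike.real_smul_eq_coe_smul (K := ℂ), inner_smul_real_left, Complex.smul_im, smul_eq_mul]
  refine h1.congr fun y => ?_
  rw [slope_def_field, slope_def_module, hsm, hsm, ← mul_add, div_eq_inv_mul]
  congr 1
  have e1 := inner_morawetzCLM hn hA h (P t) (P y)
  have e2 := inner_morawetzCLM hn hA h (P t) (P t)
  have e3 : (⟪(P y).1.fst, Q (P t)⟫_ℂ).im = -(⟪Q (P t), (P y).1.fst⟫_ℂ).im := by
    rw [← inner_conj_symm, conj_im]
  have e4 : (⟪(P t).1.fst, Q (P t)⟫_ℂ).im = -(⟪Q (P t), (P t).1.fst⟫_ℂ).im := by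
    rw [← inner_conj_symm, conj_im]
  have e1' := congrArg Complex.im e1
  have e2' := congrArg Complex.im e2
  rw [neg_im] at e1' e2'
  rw [inner_sub_left, inner_sub_left, sub_im, sub_im]
  linarith

end

section

variable {A : E n → E n} {A₀ : E n → ℝ} {g G κ : ℝ → ℝ} {s0 s1 T' : ℝ}

/-! ### The Morawetz inequality for solutions -/

/-- A solution on `[0, T']`, together with its covariant gradient and its time derivative. -/
structure Evolution (A₀ : E n → ℝ) (A : E n → E n) (g : ℝ → ℝ) (T' : ℝ) (P : ℝ → covGradGraph A)
    (du : ℝ → L2 n) : Prop where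
  nonneg : 0 ≤ T'
  continuous_P : Continuous P
  continuous_du : Continuous du
  hasDerivWithinAt : ∀ t ∈ Icc 0 T', HasDerivWithinAt (fun t => (P t).1.fst) (du t) (Icc 0 T') t
  data : ∀ t ∈ Icc 0 T', ∃ L V N : L2 n, DomainData A₀ A g (P t) L V N ∧ L + V + N = I • du t

theorem IsSolution.exists_evolution (hn : 3 ≤ n) (hA : GaugeConditions A₀ A) {T : ℝ≥0∞}
    {u : ℝ → L2 n} (hu : IsSolution A₀ A g T u) (hT : 0 ≤ T') (hT' : ofReal T' ≤ T) :
    ∃ (P : ℝ → covGradGraph A) (du : ℝ → L2 n), Evolution A₀ A g T' P du ∧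
      ∀ t ∈ Icc 0 T', (P t).1.fst = u t := by
  obtain ⟨P, du, cP, cd, h⟩ := hu.exists_data hn hA hT hT'
  refine ⟨P, du, ⟨hT, cP, cd, fun t ht => ?_, fun t ht => (h t ht).2.2⟩, fun t ht => (h t ht).1⟩
  exact (h t ht).2.1.congr (fun s hs => (h s hs).1) (h t ht).1

theorem lintegral_ofReal_le_add {d : ℝ → ℝ} {μ : Measure ℝ} (hd : Integrable d μ) :
    ∫⁻ t, ofReal (d t) ∂μ ≤ (∫⁻ t, ofReal (-d t) ∂μ) + ofReal |∫ t, d t ∂μ| := by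
  have h1 := integral_eq_lintegral_pos_part_sub_lintegral_neg_part hd
  have f1 : ∫⁻ t, ofReal (d t) ∂μ ≠ ⊤ := (lintegral_ofReal_le_lintegral_enorm d).trans_lt hd.2 |>.ne
  have f2 : ∫⁻ t, ofReal (-d t) ∂μ ≠ ⊤ :=
    (lintegral_ofReal_le_lintegral_enorm fun t => -d t).trans_lt hd.neg.2 |>.ne
  rw [← ofReal_toReal f1, ← ofReal_toReal f2, ← ofReal_add toReal_nonneg (abs_nonneg _)]
  refine ofReal_le_ofReal ?_
  have := le_abs_self (∫ t, d t ∂μ)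
  linarith

theorem Evolution.morawetz_ineq {P : ℝ → covGradGraph A} {du : ℝ → L2 n}
    (hE : Evolution A₀ A g T' P du) (h : RadialKernel κ s0 s1) (hn : 3 ≤ n)
    (hA : ContDiffOn ℝ 1 A {0}ᶜ) (hA₀ : ContDiffOn ℝ 1 A₀ {0}ᶜ) (hg : Defocusing g G) {S : ℝ≥0∞}
    (hS : ∀ t ∈ Icc 0 T', quarterNormSq A (P t).1.fst ≤ S) :
    ∫⁻ t in Icc 0 T', ∫⁻ x, ofReal (morawetz n κ (mom κ 0 s1) G x ((P t).1.fst x) ((P t).1.snd x)) ≤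
      ofReal (4 * n * mom κ 1 s1) * S +
      ∫⁻ t in Icc 0 T', ∫⁻ x, ofReal (wt κ (mom κ 0 s1) ‖x‖ * errorDensity A₀ A x) *
        ‖(P t).1.fst x‖ₑ ^ 2 := by
  have hW := h.weight hn
  set Q := morawetzCLM hn hA hW with hQ
  set d : ℝ → ℝ := fun t => 2 * (⟪du t, Q (P t)⟫_ℂ).im with hd
  set m : ℝ → ℝ := fun t => (⟪(P t).1.fst, Q (P t)⟫_ℂ).im with hm
  have cd : Continuous d := continuous_const.mul (continuous_im.comp
    (hE.continuous_du.inner (Q.continuous.comp hE.continuous_P)))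
  have cm : Continuous m := continuous_im.comp
    (((fstG A).continuous.comp hE.continuous_P).inner (Q.continuous.comp hE.continuous_P))
  have hpt : ∀ t ∈ Icc 0 T', (∫⁻ x, ofReal
      (morawetz n κ (mom κ 0 s1) G x ((P t).1.fst x) ((P t).1.snd x))) + ofReal (-d t) ≤
      ofReal (d t) + ∫⁻ x, ofReal (wt κ (mom κ 0 s1) ‖x‖ * errorDensity A₀ A x) *
        ‖(P t).1.fst x‖ₑ ^ 2 := by
    intro t ht
    obtain ⟨L, V, N, hD, hsum⟩ := hE.data t ht
    refine MagneticNLS.morawetz_ineq h hn hA hA₀ hg hD ?_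
    rw [← two_mul_re_inner_morawetzCLM hn hA hW, hsum, inner_smul_left]
    simp [hd, hQ]
  have hint := setLIntegral_mono' (μ := volume) measurableSet_Icc hpt
  have m1 : Measurable fun t => ofReal (-d t) := (continuous_ofReal.comp cd.neg).measurable
  have m2 : Measurable fun t => ofReal (d t) := (continuous_ofReal.comp cd).measurable
  rw [lintegral_add_right _ m1, lintegral_add_left m2] at hint
  have id : IntegrableOn d (Icc 0 T') := cd.continuousOn.integrableOn_Icc
  have hle := lintegral_ofReal_le_add id
  have hftc : ∫ t in Icc 0 T', d t = m T' - m 0 := by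
    rw [integral_Icc_eq_integral_Ioc, ← intervalIntegral.integral_of_le hE.nonneg]
    refine intervalIntegral.integral_eq_sub_of_hasDeriv_right_of_le hE.nonneg cm.continuousOn
      (fun t ht => ?_) (cd.intervalIntegrable _ _)
    have h1 := hasDerivWithinAt_im_inner hn hA hW hE.continuous_P
      (hE.hasDerivWithinAt t (Ioo_subset_Icc_self ht))
    exact (h1.hasDerivAt (Icc_mem_nhds ht.1 ht.2)).hasDerivWithinAt
  have hm1 : 0 ≤ mom κ 1 s1 := h.mom_nonneg 1 (h.pos.le.trans h.le)
  have hn3 : (3 : ℝ) ≤ n := by exact_mod_cast hn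
  have hB : 0 ≤ n * mom κ 1 s1 := by positivity
  have hmb : ∀ t ∈ Icc 0 T', ofReal |m t| ≤ ofReal (2 * (n * mom κ 1 s1)) * S := by
    intro t ht
    refine le_trans (ofReal_le_ofReal (Complex.abs_im_le_norm _)) ?_
    refine (norm_inner_morawetzCLM_le hn hA hW hB (fun r hr => ?_) (fun r hr => ?_) (P t)).trans
      (by gcongr; exact hS t ht)
    · exact (h.wt_le_moment hr.le).trans (by nlinarith)
    · rw [abs_of_nonneg (h.wtDiv_nonneg hn hr.le)]
      exact h.wtDiv_le hn hr
  have hΔ : ofReal |m T' - m 0| ≤ ofReal (4 * n * mom κ 1 s1) * S := by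
    have e : ofReal (4 * n * mom κ 1 s1) * S =
        ofReal (2 * (n * mom κ 1 s1)) * S + ofReal (2 * (n * mom κ 1 s1)) * S := by
      rw [← add_mul, ← ofReal_add (by positivity) (by positivity)]
      congr 2
      ring
    rw [e]
    refine le_trans (ofReal_le_ofReal (abs_sub _ _)) (ofReal_add_le.trans ?_)
    exact add_le_add (hmb T' ⟨hE.nonneg, le_rfl⟩) (hmb 0 ⟨le_rfl, hE.nonneg⟩)
  rw [hftc] at hle
  have f2 : ∫⁻ t in Icc 0 T', ofReal (-d t) ≠ ⊤ :=
    (lintegral_ofReal_le_lintegral_enorm fun t => -d t).trans_lt id.neg.2 |>.ne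
  refine (ENNReal.add_le_add_iff_right f2).1 (hint.trans ?_)
  calc _ ≤ _ := add_le_add (hle.trans (add_le_add le_rfl hΔ)) le_rfl
    _ = _ := by ring

theorem Evolution.lintegral_hardy_lt_top {P : ℝ → covGradGraph A} {du : ℝ → L2 n}
    (hE : Evolution A₀ A g T' P du) (hn : 3 ≤ n) (hA : ContDiffOn ℝ 1 A {0}ᶜ) :
    ∫⁻ t in Icc 0 T', ∫⁻ x, ‖(P t).1.fst x‖ₑ ^ 2 / ‖x‖ₑ ^ 2 < ⊤ := by
  have hb : ∀ t, ∫⁻ x, ‖(P t).1.fst x‖ₑ ^ 2 / ‖x‖ₑ ^ 2 ≤ ofReal (4 * ‖(P t).1.snd‖ ^ 2) := by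
    intro t
    refine (hardy hn hA (P t).2).trans_eq ?_
    rw [lintegral_enorm_sq, ofReal_mul (by norm_num)]
    simp
  refine lt_of_le_of_lt (lintegral_mono fun t => hb t) ?_
  have hc : Continuous fun t => 4 * ‖(P t).1.snd‖ ^ 2 :=
    continuous_const.mul ((((sndG A).continuous.comp hE.continuous_P).norm).pow 2)
  have hi : IntegrableOn (fun t => 4 * ‖(P t).1.snd‖ ^ 2) (Icc 0 T') := hc.continuousOn.integrableOn_Icc
  exact (lintegral_ofReal_le_lintegral_enorm _).trans_lt hi.2

theorem lintegral_timeInterval_le {T : ℝ≥0∞} {F : ℝ → ℝ≥0∞} {K : ℝ≥0∞}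
    (h : ∀ T', 0 ≤ T' → ofReal T' ≤ T → ∫⁻ t in Icc 0 T', F t ≤ K) :
    ∫⁻ t in timeInterval T, F t ≤ K := by
  rcases eq_or_ne T ⊤ with rfl | hT
  · have e : timeInterval ⊤ = ⋃ k : ℕ, Icc (0 : ℝ) k := by
      ext t
      simp only [timeInterval, le_top, and_true, mem_ofPred_eq, mem_iUnion, mem_Icc]
      exact ⟨fun ht => ⟨⌈t⌉₊, ht, Nat.le_ceil t⟩, fun ⟨k, hk⟩ => hk.1⟩
    rw [e, setLIntegral_iUnion_of_directed]
    · exact iSup_le fun k => h k (Nat.cast_nonneg k) le_top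
    · exact Monotone.directed_le fun i j hij => Icc_subset_Icc_right (by exact_mod_cast hij)
  · have e : timeInterval T = Icc 0 T.toReal := by
      ext t
      simp only [timeInterval, mem_ofPred_eq, mem_Icc]
      rw [ENNReal.ofReal_le_iff_le_toReal hT]
    rw [e]
    exact h _ toReal_nonneg (by rw [ofReal_toReal hT])

end

section

variable {A : E n → E n} {A₀ : E n → ℝ} {g G κ : ℝ → ℝ} {s0 s1 R : ℝ}

/-! ### Lower bounds for the positive terms -/

theorem exists_radialKernel (hR : 0 < R) : ∃ κ, RadialKernel κ R (2 * R) ∧ mom κ 1 (2 * R) = 1 := by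
  set κ : ℝ → ℝ := fun r => max 0 (min (r - R) (2 * R - r)) with hκ
  have h : RadialKernel κ R (2 * R) :=
    { continuous := by fun_prop
      nonneg := fun r => le_max_left _ _
      pos := hR
      le := by linarith
      left := fun r hr => max_eq_left ((min_le_left _ _).trans (by linarith))
      right := fun r hr => max_eq_left ((min_le_right _ _).trans (by linarith)) }
  have hI : 0 < mom κ 1 (2 * R) := by
    have h1 := h.mom_sub 1 R (2 * R)
    rw [h.mom_left 1 hR.le le_rfl, sub_zero] at h1
    rw [h1]
    refine intervalIntegral.intervalIntegral_pos_of_pos_on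
      ((h.continuous_moment 1).intervalIntegrable _ _) (fun r hr => ?_) (by linarith)
    have : 0 < κ r := lt_max_of_lt_right (lt_min (by linarith [hr.1]) (by linarith [hr.2]))
    have h2 : 0 < r := hR.trans hr.1
    positivity
  set I := mom κ 1 (2 * R)
  refine ⟨fun r => I⁻¹ * κ r, ?_, ?_⟩
  · exact
    { continuous := continuous_const.mul h.continuous
      nonneg := fun r => mul_nonneg (inv_nonneg.2 hI.le) (h.nonneg r)
      pos := hR
      le := h.le
      left := fun r hr => by rw [h.left r hr, mul_zero]
      right := fun r hr => by rw [h.right r hr, mul_zero] }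
  · have e : mom (fun r => I⁻¹ * κ r) 1 (2 * R) = I⁻¹ * mom κ 1 (2 * R) := by
      rw [mom, mom, ← intervalIntegral.integral_const_mul]
      refine intervalIntegral.integral_congr fun r _ => ?_
      ring
    rw [e]
    exact inv_mul_cancel₀ hI.ne'

section Pointwise

theorem morawetz_terms_nonneg (h : RadialKernel κ s0 s1) (hn : 3 ≤ n) (hg : Defocusing g G) (x : E n)
    (z : ℂ) (w : CVec n) :
    0 ≤ 2 * wt' κ (mom κ 0 s1) ‖x‖ * ‖radial x w + (((n - 3) / 2 / ‖x‖ : ℝ) : ℂ) * z‖ ^ 2 ∧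
    0 ≤ κ ‖x‖ / (2 * ‖x‖) * ‖z‖ ^ 2 ∧
    0 ≤ (n - 1) * (n - 3) / 2 * (wt κ (mom κ 0 s1) ‖x‖ / ‖x‖ ^ 3) * ‖z‖ ^ 2 ∧
    0 ≤ 1 / 2 * (wt κ (mom κ 0 s1) ‖x‖ / ‖x‖) * ‖tangential x w‖ ^ 2 ∧
    0 ≤ wtDiv n κ (mom κ 0 s1) ‖x‖ * G (‖z‖ ^ 2) := by
  have hn3 := sub_three_nonneg hn
  have hn1 : (0 : ℝ) ≤ (n - 1) * (n - 3) / 2 := by nlinarith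
  have h1 := h.wt_nonneg (norm_nonneg x)
  have h2 := h.wt'_nonneg (norm_nonneg x)
  have h3 := h.wtDiv_nonneg hn (norm_nonneg x)
  have h4 := hg.G_nonneg _ (sq_nonneg ‖z‖)
  have h5 := h.nonneg ‖x‖
  refine ⟨?_, ?_, ?_, ?_, ?_⟩ <;> positivity

theorem le_morawetz_of_le_norm (h : RadialKernel κ s0 s1) (h1 : mom κ 1 s1 = 1) (hn : 3 ≤ n)
    (hg : Defocusing g G) {x : E n} (hx : s1 ≤ ‖x‖) (z : ℂ) (w : CVec n) :
    ‖tangential x w‖ ^ 2 / ‖x‖ ≤ 6 * morawetz n κ (mom κ 0 s1) G x z w ∧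
    (n - 1) * G (‖z‖ ^ 2) / ‖x‖ ≤ 3 * morawetz n κ (mom κ 0 s1) G x z w ∧
    (n - 1) * (n - 3) * (‖z‖ ^ 2 / ‖x‖ ^ 3) ≤ 6 * morawetz n κ (mom κ 0 s1) G x z w := by
  obtain ⟨t1, t2, t3, t4, t5⟩ := morawetz_terms_nonneg h hn hg x z w
  have hr : 0 < ‖x‖ := (h.pos.trans_le h.le).trans_le hx
  have ha := h.wt_right hx
  rw [h1] at ha
  have hn3 := sub_three_nonneg hn
  have hn1 : (0 : ℝ) ≤ (n - 1) * (n - 3) / 2 := by nlinarith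
  have hn1' : (0 : ℝ) ≤ n - 1 := by linarith
  have hG := hg.G_nonneg _ (sq_nonneg ‖z‖)
  have a1 : 1 / 3 * (‖tangential x w‖ ^ 2 / ‖x‖) ≤
      wt κ (mom κ 0 s1) ‖x‖ / ‖x‖ * ‖tangential x w‖ ^ 2 := by
    calc 1 / 3 * (‖tangential x w‖ ^ 2 / ‖x‖) = 1 / 3 * ‖tangential x w‖ ^ 2 / ‖x‖ := by ring
      _ ≤ wt κ (mom κ 0 s1) ‖x‖ * ‖tangential x w‖ ^ 2 / ‖x‖ :=
        div_le_div_of_nonneg_right (mul_le_mul_of_nonneg_right ha (sq_nonneg _)) hr.le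
      _ = _ := by ring
  have a2 : 1 / 3 * ((n - 1) * G (‖z‖ ^ 2) / ‖x‖) ≤ wtDiv n κ (mom κ 0 s1) ‖x‖ * G (‖z‖ ^ 2) := by
    have h5 : (n - 1) * (1 / 3 / ‖x‖) ≤ wtDiv n κ (mom κ 0 s1) ‖x‖ := by
      rw [wtDiv]
      have : (n - 1) * (1 / 3 / ‖x‖) ≤ (n - 1) * (wt κ (mom κ 0 s1) ‖x‖ / ‖x‖) := by gcongr
      linarith [h.wt'_nonneg hr.le]
    calc 1 / 3 * ((n - 1) * G (‖z‖ ^ 2) / ‖x‖) = (n - 1) * (1 / 3 / ‖x‖) * G (‖z‖ ^ 2) := by ring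
      _ ≤ _ := by gcongr
  have a3 : (n - 1) * (n - 3) / 2 * (1 / 3 * (‖z‖ ^ 2 / ‖x‖ ^ 3)) ≤
      (n - 1) * (n - 3) / 2 * (wt κ (mom κ 0 s1) ‖x‖ / ‖x‖ ^ 3) * ‖z‖ ^ 2 := by
    rw [mul_assoc]
    refine mul_le_mul_of_nonneg_left ?_ hn1
    calc 1 / 3 * (‖z‖ ^ 2 / ‖x‖ ^ 3) = 1 / 3 * ‖z‖ ^ 2 / ‖x‖ ^ 3 := by ring
      _ ≤ wt κ (mom κ 0 s1) ‖x‖ * ‖z‖ ^ 2 / ‖x‖ ^ 3 :=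
        div_le_div_of_nonneg_right (mul_le_mul_of_nonneg_right ha (sq_nonneg _)) (by positivity)
      _ = _ := by ring
  have hM : morawetz n κ (mom κ 0 s1) G x z w =
    2 * wt' κ (mom κ 0 s1) ‖x‖ * ‖radial x w + (((n - 3) / 2 / ‖x‖ : ℝ) : ℂ) * z‖ ^ 2 +
    κ ‖x‖ / (2 * ‖x‖) * ‖z‖ ^ 2 +
    (n - 1) * (n - 3) / 2 * (wt κ (mom κ 0 s1) ‖x‖ / ‖x‖ ^ 3) * ‖z‖ ^ 2 +
    1 / 2 * (wt κ (mom κ 0 s1) ‖x‖ / ‖x‖) * ‖tangential x w‖ ^ 2 +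
    wtDiv n κ (mom κ 0 s1) ‖x‖ * G (‖z‖ ^ 2) := by
    unfold morawetz; ring
  rw [hM]
  refine ⟨?_, ?_, ?_⟩
  · linarith
  · linarith
  · linarith

theorem le_morawetz_of_norm_le (h : RadialKernel κ R (2 * R)) (h1 : mom κ 1 (2 * R) = 1) (hn : 3 ≤ n)
    (hg : Defocusing g G) {x : E n} (hx0 : x ≠ 0) (hx : ‖x‖ ≤ R) (z : ℂ) (w : CVec n) :
    (‖w‖ ^ 2 + (n - 1) / 2 * G (‖z‖ ^ 2)) / R ≤ 12 * morawetz n κ (mom κ 0 (2 * R)) G x z w := by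
  obtain ⟨t1, t2, t3, t4, t5⟩ := morawetz_terms_nonneg h hn hg x z w
  have hr : 0 < ‖x‖ := norm_pos_iff.2 hx0
  have hR := h.pos
  have hc : 1 / (2 * R) ≤ mom κ 0 (2 * R) := by
    have hR2 : 0 < 2 * R := by linarith
    have h2 := h.mom_one_le hR2.le
    rw [h1] at h2
    rw [div_le_iff₀ hR2, mul_comm]
    exact h2
  have hn3 := sub_three_nonneg hn
  have hn1 : (0 : ℝ) ≤ (n - 1) * (n - 3) / 2 := by nlinarith
  have hn1' : (0 : ℝ) ≤ n - 1 := by linarith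
  have hG := hg.G_nonneg _ (sq_nonneg ‖z‖)
  have ea := h.wt_left hr.le hx
  have ea' := h.wt'_left hr.le hx
  set c := mom κ 0 (2 * R)
  have ea1 : wt κ c ‖x‖ / ‖x‖ = c / 3 := by rw [ea]; field_simp
  have ea2 : wt κ c ‖x‖ / ‖x‖ ^ 3 = c / 3 / ‖x‖ ^ 2 := by rw [ea]; field_simp
  have hM : morawetz n κ c G x z w =
    2 * wt' κ c ‖x‖ * ‖radial x w + (((n - 3) / 2 / ‖x‖ : ℝ) : ℂ) * z‖ ^ 2 +
    κ ‖x‖ / (2 * ‖x‖) * ‖z‖ ^ 2 +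
    (n - 1) * (n - 3) / 2 * (wt κ c ‖x‖ / ‖x‖ ^ 3) * ‖z‖ ^ 2 +
    1 / 2 * (wt κ c ‖x‖ / ‖x‖) * ‖tangential x w‖ ^ 2 +
    wtDiv n κ c ‖x‖ * G (‖z‖ ^ 2) := by
    unfold morawetz; ring
  rw [hM]
  have hv : wtDiv n κ c ‖x‖ = n * (c / 3) := by rw [wtDiv, ea', ea1]; ring
  rw [hv, ea', ea1, ea2] at *
  set Y := ‖radial x w + (((n - 3) / 2 / ‖x‖ : ℝ) : ℂ) * z‖ with hY
  have hrad : ‖radial x w‖ ^ 2 ≤ 2 * Y ^ 2 + 2 * (((n - 3) / 2 / ‖x‖) * ‖z‖) ^ 2 := by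
    have h2 : ‖radial x w‖ ≤ Y + (n - 3) / 2 / ‖x‖ * ‖z‖ := by
      have e : radial x w = (radial x w + (((n - 3) / 2 / ‖x‖ : ℝ) : ℂ) * z) -
        (((n - 3) / 2 / ‖x‖ : ℝ) : ℂ) * z := by ring
      have h3 : ‖(((n - 3) / 2 / ‖x‖ : ℝ) : ℂ) * z‖ = (n - 3) / 2 / ‖x‖ * ‖z‖ := by
        rw [norm_mul, norm_real, norm_eq_abs, abs_of_nonneg (by positivity)]
      rw [← h3]
      conv_lhs => rw [e]
      exact norm_sub_le _ _
    have h4 := pow_le_pow_left₀ (norm_nonneg _) h2 2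
    nlinarith [sq_nonneg (Y - (n - 3) / 2 / ‖x‖ * ‖z‖)]
  have hw := norm_sq_eq_radial_add hx0 w
  rw [hw]
  have hb : 2 * (((n - 3) / 2 / ‖x‖) * ‖z‖) ^ 2 ≤ (n - 1) * (n - 3) / 2 * (‖z‖ ^ 2 / ‖x‖ ^ 2) := by
    have e : 2 * (((n - 3) / 2 / ‖x‖) * ‖z‖) ^ 2 = (n - 3) * (n - 3) / 2 * (‖z‖ ^ 2 / ‖x‖ ^ 2) := by
      field_simp
    rw [e]
    gcongr
    linarith
  have hcR : 1 / R ≤ 2 * c := by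
    have e : 1 / R = 2 * (1 / (2 * R)) := by field_simp
    rw [e]
    linarith
  set q := (n - 1) * (n - 3) / 2 * (‖z‖ ^ 2 / ‖x‖ ^ 2) with hq
  have hq0 : 0 ≤ q := by positivity
  have e3 : (n - 1) * (n - 3) / 2 * (c / 3 / ‖x‖ ^ 2) * ‖z‖ ^ 2 = c / 3 * q := by rw [hq]; ring
  rw [e3] at *
  have hsum : 0 ≤ 2 * Y ^ 2 + q + ‖tangential x w‖ ^ 2 + (n - 1) / 2 * G (‖z‖ ^ 2) := by positivity
  have hc0 : 0 ≤ c := le_trans (by positivity) hc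
  have hnG : (n - 1) / 2 * G (‖z‖ ^ 2) ≤ n * G (‖z‖ ^ 2) / 2 := by nlinarith
  have hGc : 0 ≤ c * G (‖z‖ ^ 2) := mul_nonneg hc0 hG
  have hqc : 0 ≤ c * q := mul_nonneg hc0 hq0
  have hYc : 0 ≤ c * Y ^ 2 := by positivity
  have hTc : 0 ≤ c * ‖tangential x w‖ ^ 2 := by positivity
  have hnGc : 0 ≤ n * (c * G (‖z‖ ^ 2)) := by positivity
  calc (‖radial x w‖ ^ 2 + ‖tangential x w‖ ^ 2 + (n - 1) / 2 * G (‖z‖ ^ 2)) / R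
      ≤ (2 * Y ^ 2 + q + ‖tangential x w‖ ^ 2 + (n - 1) / 2 * G (‖z‖ ^ 2)) / R := by
        gcongr; linarith
    _ = (2 * Y ^ 2 + q + ‖tangential x w‖ ^ 2 + (n - 1) / 2 * G (‖z‖ ^ 2)) * (1 / R) := by ring
    _ ≤ (2 * Y ^ 2 + q + ‖tangential x w‖ ^ 2 + (n - 1) / 2 * G (‖z‖ ^ 2)) * (2 * c) := by gcongr
    _ ≤ _ := by linarith

end Pointwise

/-! ### Measurability in time, and removal of the cutoff near the origin -/

theorem measurable_lintegral_mul {V : Type*} [NormedAddCommGroup V] [InnerProductSpace ℂ V]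
    {c : E n → ℝ≥0∞} (hc : Measurable c) {φ : V → ℝ≥0∞} (hφ : Continuous φ)
    {f : ℝ → Lp V 2 (volume : Measure (E n))} (hf : Continuous f) :
    Measurable fun t => ∫⁻ x, φ (f t x) * c x := by
  have hl : LowerSemicontinuous fun f : Lp V 2 (volume : Measure (E n)) => ∫⁻ x, φ (f x) * c x := by
    refine lowerSemicontinuous_lintegral_Lp (γ := fun x z => φ z * c x) (fun x => ?_) fun f hf => ?_
    · exact LowerSemicontinuous.comp (lowerSemicontinuous_mul_const (c x)) (g := φ) hφ
    · exact (hφ.comp_aestronglyMeasurable hf).aemeasurable.mul hc.aemeasurable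
  exact (hl.comp hf).measurable

theorem lintegral_lintegral_le_of_annuli (hn : 3 ≤ n) {F : ℝ → E n → ℝ≥0∞} {s : Set ℝ} {K : ℝ≥0∞}
    (hm : ∀ ρ, 0 < ρ → Measurable fun t => ∫⁻ x in {x | ρ ≤ ‖x‖}, F t x)
    (h : ∀ ρ, 0 < ρ → ∫⁻ t in s, ∫⁻ x in {x | ρ ≤ ‖x‖}, F t x ≤ K) :
    ∫⁻ t in s, ∫⁻ x, F t x ≤ K := by
  have hρ : ∀ k : ℕ, (0 : ℝ) < 1 / (k + 1) := fun k => Nat.one_div_pos_of_nat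
  have hmono : Monotone fun k : ℕ => {x : E n | 1 / ((k : ℝ) + 1) ≤ ‖x‖} := fun i j hij x hx =>
    (Nat.one_div_le_one_div hij).trans (mem_ofPred_eq ▸ hx)
  have e : (⋃ k : ℕ, {x : E n | 1 / ((k : ℝ) + 1) ≤ ‖x‖}) = {0}ᶜ := by
    ext x
    simp only [mem_iUnion, mem_ofPred_eq, mem_compl_iff, mem_singleton_iff]
    constructor
    · rintro ⟨k, hk⟩ rfl
      rw [norm_zero] at hk
      exact absurd (hρ k) (not_lt.2 hk)
    · intro hx
      obtain ⟨k, hk⟩ := exists_nat_one_div_lt (norm_pos_iff.2 hx)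
      exact ⟨k, hk.le⟩
  have e2 : ∀ t, ∫⁻ x, F t x = ⨆ k : ℕ, ∫⁻ x in {x | 1 / ((k : ℝ) + 1) ≤ ‖x‖}, F t x := by
    intro t
    rw [← setLIntegral_iUnion_of_directed _ hmono.directed_le, e,
      Measure.restrict_eq_self_of_ae_mem (s := {0}ᶜ) (ae_ne_zero hn)]
  simp only [e2]
  rw [lintegral_iSup (fun k => hm _ (hρ k)) fun i j hij t => lintegral_mono_set (hmono hij)]
  exact iSup_le fun k => h _ (hρ k)

end

section

variable {A : E n → E n} {A₀ : E n → ℝ} {g G κ : ℝ → ℝ} {s0 s1 R T' : ℝ}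

/-! ### Consequences of a bound for the positive terms -/

theorem enorm_sq_div {V : Type*} [SeminormedAddCommGroup V] (z : V) {x : E n} (hx : 0 < ‖x‖) :
    ‖z‖ₑ ^ 2 / ‖x‖ₑ = ofReal (‖z‖ ^ 2 / ‖x‖) := by
  simpa using enorm_sq_div_pow z hx 1

theorem setLIntegral_div_pow {γ : E n → ℝ≥0∞} {ρ : ℝ} (k : ℕ) :
    ∫⁻ x in {x : E n | ρ ≤ ‖x‖}, γ x / ‖x‖ₑ ^ k =
      ∫⁻ x, γ x * ({x : E n | ρ ≤ ‖x‖}.indicator (fun x => (‖x‖ₑ ^ k)⁻¹) x) := by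
  rw [← lintegral_indicator (measurableSet_le measurable_const measurable_norm)]
  refine lintegral_congr fun x => ?_
  by_cases hx : x ∈ {x : E n | ρ ≤ ‖x‖} <;> simp [hx, div_eq_mul_inv]

theorem measurable_div_pow {V : Type*} [NormedAddCommGroup V] [InnerProductSpace ℂ V]
    {φ : V → ℝ≥0∞} (hφ : Continuous φ) {f : ℝ → Lp V 2 (volume : Measure (E n))} (hf : Continuous f)
    (ρ : ℝ) (k : ℕ) :
    Measurable fun t => ∫⁻ x in {x : E n | ρ ≤ ‖x‖}, φ (f t x) / ‖x‖ₑ ^ k := by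
  simp only [setLIntegral_div_pow]
  refine measurable_lintegral_mul (Measurable.indicator ?_
    (measurableSet_le measurable_const measurable_norm)) hφ hf
  exact (measurable_enorm.pow_const k).inv

/-- The positive terms of the Morawetz inequality have space-time integrals at most `K`, for all the
normalized kernels supported in `[R, 2 R]`. -/
def MorawetzBound (G : ℝ → ℝ) (T' : ℝ) (P : ℝ → covGradGraph A) (K : ℝ≥0∞) : Prop :=
  ∀ (R : ℝ) (κ : ℝ → ℝ), RadialKernel κ R (2 * R) → mom κ 1 (2 * R) = 1 →
    ∫⁻ t in Icc 0 T', ∫⁻ x, ofReal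
      (morawetz n κ (mom κ 0 (2 * R)) G x ((P t).1.fst x) ((P t).1.snd x)) ≤ K

variable {P : ℝ → covGradGraph A} {K : ℝ≥0∞}

theorem MorawetzBound.lintegral_le (hb : MorawetzBound G T' P K) (hn : 3 ≤ n)
    {F : ℝ → E n → ℝ≥0∞} {c : ℝ} (hc : 0 ≤ c)
    (hm : ∀ ρ, 0 < ρ → Measurable fun t => ∫⁻ x in {x | ρ ≤ ‖x‖}, F t x)
    (hF : ∀ κ ρ t x, 0 < ρ → RadialKernel κ (ρ / 2) ρ → mom κ 1 ρ = 1 → ρ ≤ ‖x‖ → F t x ≤ ofReal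
        (c * morawetz n κ (mom κ 0 ρ) G x ((P t).1.fst x) ((P t).1.snd x))) :
    ∫⁻ t in Icc 0 T', ∫⁻ x, F t x ≤ ofReal c * K := by
  refine lintegral_lintegral_le_of_annuli hn hm fun ρ hρ => ?_
  obtain ⟨κ, h, h1⟩ := exists_radialKernel (half_pos hρ)
  have hK := hb (ρ / 2) κ h h1
  rw [mul_div_cancel₀ ρ two_ne_zero] at h h1 hK
  refine le_trans ?_ (mul_le_mul_right hK (ofReal c))
  rw [← lintegral_const_mul' _ _ ofReal_ne_top]
  refine lintegral_mono fun t => ?_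
  rw [← lintegral_const_mul' _ _ ofReal_ne_top]
  refine le_trans ?_ (setLIntegral_le_lintegral {x : E n | ρ ≤ ‖x‖} _)
  refine setLIntegral_mono' (measurableSet_le measurable_const measurable_norm) fun x hx => ?_
  rw [← ofReal_mul hc]
  exact hF κ ρ t x hρ h h1 hx

theorem measurable_setLIntegral_add {F H : ℝ → E n → ℝ≥0∞} {s : Set (E n)}
    (hm : ∀ t, AEMeasurable (F t) (volume.restrict s)) (hF : Measurable fun t => ∫⁻ x in s, F t x)
    (hH : Measurable fun t => ∫⁻ x in s, H t x) :
    Measurable fun t => ∫⁻ x in s, (F t x + H t x) := by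
  simp only [lintegral_add_left' (hm _)]
  exact hF.add hH

theorem measurable_setLIntegral_tangential (hP : Continuous P) (ρ : ℝ) :
    Measurable fun t => ∫⁻ x in {x : E n | ρ ≤ ‖x‖},
      ‖tangential x ((P t).1.snd x)‖ₑ ^ 2 / ‖x‖ₑ := by
  have h1 := measurable_div_pow (V := CVec n) (φ := fun z => ‖z‖ₑ ^ 2) (by fun_prop)
    ((tangentialCLM (n := n)).continuous.comp ((sndG A).continuous.comp hP)) ρ 1
  convert h1 using 2 with t
  refine lintegral_congr_ae (ae_restrict_of_ae ?_)
  filter_upwards [tangentialCLM_ae ((P t).1.snd)] with x hx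
  have e : (⇑tangentialCLM ∘ ⇑(sndG A) ∘ P) t = tangentialCLM (P t).1.snd := rfl
  rw [e, hx, pow_one]

theorem Defocusing.continuous_ofReal_mul (hg : Defocusing g G) (c : ℝ) :
    Continuous fun z : ℂ => ofReal (c * G (‖z‖ ^ 2)) := by
  have h : Continuous fun z : ℂ => G (‖z‖ ^ 2) :=
    hg.continuous_G.comp_continuous (by fun_prop) fun z => mem_Ici.2 (sq_nonneg _)
  exact continuous_ofReal.comp (continuous_const.mul h)

theorem Defocusing.measurable_setLIntegral (hg : Defocusing g G) (hP : Continuous P) (c ρ : ℝ) :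
    Measurable fun t => ∫⁻ x in {x : E n | ρ ≤ ‖x‖},
      ofReal (c * G (‖(P t).1.fst x‖ ^ 2)) / ‖x‖ₑ := by
  have h1 := measurable_div_pow (hg.continuous_ofReal_mul c) ((fstG A).continuous.comp hP) ρ 1
  simp only [pow_one] at h1
  exact h1

theorem MorawetzBound.tangential (hb : MorawetzBound G T' P K) (hP : Continuous P) (hn : 3 ≤ n)
    (hg : Defocusing g G) :
    ∫⁻ t in Icc 0 T', ∫⁻ x, ‖tangential x ((P t).1.snd x)‖ₑ ^ 2 / ‖x‖ₑ ≤ ofReal 6 * K := by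
  refine hb.lintegral_le hn (by norm_num) (fun ρ _ => measurable_setLIntegral_tangential hP ρ)
    fun κ ρ t x hρ h h1 hx => ?_
  rw [enorm_sq_div _ (hρ.trans_le hx)]
  exact ofReal_le_ofReal (le_morawetz_of_le_norm h h1 hn hg hx _ _).1

theorem MorawetzBound.tangential_add_potential (hb : MorawetzBound G T' P K) (hP : Continuous P)
    (hn : 3 ≤ n) (hg : Defocusing g G) {M : ℝ} (hM : 0 ≤ M) :
    ∫⁻ t in Icc 0 T', ∫⁻ x, (‖MagneticNLS.tangential x ((P t).1.snd x)‖ₑ ^ 2 / ‖x‖ₑ +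
      ofReal ((n - 1) * M * G (‖(P t).1.fst x‖ ^ 2)) / ‖x‖ₑ) ≤
      ofReal (6 + 3 * M) * K := by
  refine hb.lintegral_le hn (by positivity) (fun ρ _ => ?_) fun κ ρ t x hρ h h1 hx => ?_
  · refine measurable_setLIntegral_add (fun t => ?_) (measurable_setLIntegral_tangential hP ρ)
      (hg.measurable_setLIntegral hP _ ρ)
    exact (((aestronglyMeasurable_tangential (Lp.aestronglyMeasurable (P t).1.snd)).enorm.pow_const
      2).div measurable_enorm.aemeasurable).restrict
  · have hx0 := hρ.trans_le hx
    obtain ⟨l1, l2, -⟩ := le_morawetz_of_le_norm h h1 hn hg hx ((P t).1.fst x) ((P t).1.snd x)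
    have hG := hg.G_nonneg _ (sq_nonneg ‖(P t).1.fst x‖)
    have hn1 := sub_one_nonneg hn
    rw [enorm_sq_div _ hx0, ← ofReal_norm x, ← ofReal_div_of_pos hx0,
      ← ofReal_add (by positivity) (by positivity)]
    refine ofReal_le_ofReal ?_
    have e : (n - 1) * M * G (‖(P t).1.fst x‖ ^ 2) / ‖x‖ =
      M * ((n - 1) * G (‖(P t).1.fst x‖ ^ 2) / ‖x‖) := by ring
    rw [e]
    linarith [mul_le_mul_of_nonneg_left l2 hM]

theorem MorawetzBound.cube_add_potential (hb : MorawetzBound G T' P K) (hP : Continuous P)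
    (hn : 4 ≤ n) (hg : Defocusing g G) :
    ∫⁻ t in Icc 0 T', ∫⁻ x, (‖(P t).1.fst x‖ₑ ^ 2 / ‖x‖ₑ ^ 3 +
      ofReal ((n - 1) * G (‖(P t).1.fst x‖ ^ 2)) / ‖x‖ₑ) ≤ ofReal 9 * K := by
  refine hb.lintegral_le (by omega) (by norm_num) (fun ρ _ => ?_) fun κ ρ t x hρ h h1 hx => ?_
  · refine measurable_setLIntegral_add (fun t => ?_)
      (measurable_div_pow (φ := fun z : ℂ => ‖z‖ₑ ^ 2) (by fun_prop)
        ((fstG A).continuous.comp hP) ρ 3) (hg.measurable_setLIntegral hP _ ρ)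
    exact (((Lp.aestronglyMeasurable (P t).1.fst).enorm.pow_const 2).div
      (measurable_enorm.pow_const 3).aemeasurable).restrict
  · have hx0 := hρ.trans_le hx
    obtain ⟨-, l2, l3⟩ := le_morawetz_of_le_norm h h1 (by omega) hg hx ((P t).1.fst x) ((P t).1.snd x)
    have hG := hg.G_nonneg _ (sq_nonneg ‖(P t).1.fst x‖)
    have h4 : (4 : ℝ) ≤ n := by exact_mod_cast hn
    have hn1 : (0 : ℝ) ≤ n - 1 := by linarith
    have hq : 0 ≤ ‖(P t).1.fst x‖ ^ 2 / ‖x‖ ^ 3 := by positivity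
    have h5 : 1 ≤ ((n : ℝ) - 1) * (n - 3) := by nlinarith
    rw [enorm_sq_div_pow _ hx0, ← ofReal_norm x, ← ofReal_div_of_pos hx0,
      ← ofReal_add (by positivity) (by positivity)]
    refine ofReal_le_ofReal ?_
    linarith [le_mul_of_one_le_left hq h5]

theorem MorawetzBound.lintegral_closedBall (hb : MorawetzBound G T' P K) (hn : 3 ≤ n) (hg : Defocusing g G)
    (hR : 0 < R) :
    (ofReal R)⁻¹ * ∫⁻ t in Icc 0 T', ∫⁻ x in closedBall 0 R,
      (‖(P t).1.snd x‖ₑ ^ 2 + ofReal ((n - 1) / 2 * G (‖(P t).1.fst x‖ ^ 2))) ≤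
      ofReal 12 * K := by
  obtain ⟨κ, h, h1⟩ := exists_radialKernel hR
  have hK := hb R κ h h1
  have hn1 : (0 : ℝ) ≤ (n - 1) / 2 := by
    have : (3 : ℝ) ≤ n := by exact_mod_cast hn
    linarith
  refine le_trans ?_ (mul_le_mul_right hK (ofReal 12))
  rw [← lintegral_const_mul' _ _ ofReal_ne_top, ← lintegral_const_mul' _ _ (by simpa using hR)]
  refine lintegral_mono fun t => ?_
  rw [← lintegral_const_mul' _ _ ofReal_ne_top, ← lintegral_const_mul' _ _ (by simpa using hR)]
  refine le_trans ?_ (setLIntegral_le_lintegral (closedBall (0 : E n) R) _)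
  refine setLIntegral_mono_ae' measurableSet_closedBall ?_
  filter_upwards [ae_ne_zero hn] with x hx0 hx
  rw [mem_closedBall_zero_iff] at hx
  have hG := hg.G_nonneg _ (sq_nonneg ‖(P t).1.fst x‖)
  rw [← ofReal_mul (by norm_num), ← ofReal_norm, ← ofReal_pow (norm_nonneg _),
    ← ofReal_add (by positivity) (by positivity), mul_comm, ← div_eq_mul_inv,
    ← ofReal_div_of_pos hR]
  exact ofReal_le_ofReal (le_morawetz_of_norm_le h h1 hn hg hx0 hx _ _)

end

section

variable {A : E n → E n} {A₀ : E n → ℝ} {g G κ : ℝ → ℝ} {s0 s1 R T' : ℝ}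

/-! ### Dimension at least four -/

theorem SmallnessHigh.ae_errorDensity_le (hs : SmallnessHigh A₀ A) (hn : 4 ≤ n) :
    ∀ᵐ x : E n, ‖x‖ ^ 3 * errorDensity A₀ A x ≤ 4 / 9 * ((n - 1) * (n - 3)) := by
  have h1 := enorm_ae_le_eLpNormEssSup (fun x : E n => ‖x‖ ^ 2 * ‖trapping A x‖) volume
  have h2 := enorm_ae_le_eLpNormEssSup (fun x : E n => ‖x‖ ^ 3 * radialDerivPos A₀ x) volume
  rw [SmallnessHigh, eLpNorm_exponent_top, eLpNorm_exponent_top] at hs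
  have h4 : (4 : ℝ) ≤ n := by exact_mod_cast hn
  filter_upwards [h1, h2] with x hx1 hx2
  have hd : 0 ≤ radialDerivPos A₀ x := le_max_right _ _
  rw [Real.enorm_of_nonneg (by positivity)] at hx1 hx2
  have h3 : ofReal ((‖x‖ ^ 2 * ‖trapping A x‖) ^ 2 + 2 * (‖x‖ ^ 3 * radialDerivPos A₀ x)) ≤
      ofReal (2 / 3 * ((n : ℝ) - 1) * ((n : ℝ) - 3)) := by
    rw [ofReal_add (by positivity) (by positivity), ofReal_pow (by positivity),
      ofReal_mul zero_le_two, ofReal_ofNat]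
    refine le_trans ?_ hs.le
    gcongr
  rw [ofReal_le_ofReal_iff (by nlinarith)] at h3
  have h5 : 0 ≤ ‖x‖ ^ 3 * radialDerivPos A₀ x := by positivity
  rw [errorDensity]
  nlinarith

theorem Evolution.morawetzBound_high {P : ℝ → covGradGraph A} {du : ℝ → L2 n}
    (hE : Evolution A₀ A g T' P du) (hn : 4 ≤ n) (hA : ContDiffOn ℝ 1 A {0}ᶜ)
    (hA₀ : ContDiffOn ℝ 1 A₀ {0}ᶜ) (hs : SmallnessHigh A₀ A) (hg : Defocusing g G) {S : ℝ≥0∞}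
    (hS : ∀ t ∈ Icc 0 T', quarterNormSq A (P t).1.fst ≤ S) :
    MorawetzBound G T' P (9 * (ofReal (4 * n) * S)) := by
  intro R κ h h1
  have hM := hE.morawetz_ineq h (by omega) hA hA₀ hg hS
  rw [h1, mul_one] at hM
  set c := mom κ 0 (2 * R) with hc
  have h4 : (4 : ℝ) ≤ n := by exact_mod_cast hn
  have hN : (0 : ℝ) ≤ (n - 1) * (n - 3) / 2 := by nlinarith
  have hc0 : 0 ≤ c := h.mom_nonneg 0 (h.pos.le.trans h.le)
  set y := ∫⁻ t in Icc 0 T', ∫⁻ x, ofReal ((n - 1) * (n - 3) / 2 * (wt κ c ‖x‖ / ‖x‖ ^ 3)) *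
    ‖(P t).1.fst x‖ₑ ^ 2 with hy
  have hyM : y ≤ ∫⁻ t in Icc 0 T', ∫⁻ x, ofReal
      (morawetz n κ c G x ((P t).1.fst x) ((P t).1.snd x)) := by
    refine lintegral_mono fun t => lintegral_mono fun x => ?_
    obtain ⟨t1, t2, t3, t4, t5⟩ := morawetz_terms_nonneg h (by omega : 3 ≤ n) hg x
      ((P t).1.fst x) ((P t).1.snd x)
    have ha : 0 ≤ wt κ c ‖x‖ / ‖x‖ ^ 3 := div_nonneg (h.wt_nonneg (norm_nonneg _)) (by positivity)
    rw [← ofReal_norm, ← ofReal_pow (norm_nonneg _), ← ofReal_mul (by positivity)]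
    refine ofReal_le_ofReal ?_
    rw [morawetz, add_mul]
    linarith
  have hyt : y ≠ ⊤ := by
    have hle : y ≤ ofReal ((n - 1) * (n - 3) / 2 * (c / 2)) *
        ∫⁻ t in Icc 0 T', ∫⁻ x, ‖(P t).1.fst x‖ₑ ^ 2 / ‖x‖ₑ ^ 2 := by
      rw [← lintegral_const_mul' _ _ ofReal_ne_top]
      refine lintegral_mono fun t => ?_
      rw [← lintegral_const_mul' _ _ ofReal_ne_top]
      refine lintegral_mono_ae ?_
      filter_upwards [ae_ne_zero (by omega)] with x hx
      have hr := norm_pos_iff.2 hx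
      rw [enorm_sq_div_pow _ hr, ← ofReal_mul (by positivity), ← ofReal_norm,
        ← ofReal_pow (norm_nonneg _), ← ofReal_mul (mul_nonneg hN
          (div_nonneg (h.wt_nonneg (norm_nonneg _)) (by positivity)))]
      refine ofReal_le_ofReal ?_
      rw [mul_assoc, mul_assoc]
      refine mul_le_mul_of_nonneg_left ?_ hN
      have e : c / 2 * (‖(P t).1.fst x‖ ^ 2 / ‖x‖ ^ 2) =
        c / 2 * ‖x‖ / ‖x‖ ^ 3 * ‖(P t).1.fst x‖ ^ 2 := by field_simp
      rw [e]
      gcongr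
      exact h.wt_le_mul hr.le
    exact (hle.trans_lt (ENNReal.mul_lt_top ofReal_lt_top
      (hE.lintegral_hardy_lt_top (by omega) hA))).ne
  have herr : ∫⁻ t in Icc 0 T', ∫⁻ x, ofReal (wt κ c ‖x‖ * errorDensity A₀ A x) *
      ‖(P t).1.fst x‖ₑ ^ 2 ≤ ofReal (8 / 9) * y := by
    rw [hy, ← lintegral_const_mul' _ _ ofReal_ne_top]
    refine lintegral_mono fun t => ?_
    rw [← lintegral_const_mul' _ _ ofReal_ne_top]
    refine lintegral_mono_ae ?_
    filter_upwards [hs.ae_errorDensity_le hn, ae_ne_zero (by omega)] with x hx hx0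
    have hr := norm_pos_iff.2 hx0
    rw [← mul_assoc, ← ofReal_mul (by norm_num)]
    refine mul_le_mul' (ofReal_le_ofReal ?_) le_rfl
    have e : 8 / 9 * ((n - 1) * (n - 3) / 2 * (wt κ c ‖x‖ / ‖x‖ ^ 3)) =
      wt κ c ‖x‖ * (4 / 9 * ((n - 1) * (n - 3)) / ‖x‖ ^ 3) := by ring
    rw [e]
    refine mul_le_mul_of_nonneg_left ?_ (h.wt_nonneg (norm_nonneg _))
    rw [le_div_iff₀ (by positivity), mul_comm]
    exact hx
  have hbound := hM.trans (add_le_add_right herr _)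
  set X := ofReal (4 * n) * S
  have h9 : ofReal (8 / 9) * y + ofReal (1 / 9) * y = y := by
    rw [← add_mul, ← ofReal_add (by norm_num) (by norm_num)]
    norm_num
  have hy9 : ofReal (1 / 9) * y ≤ X := by
    have h6 : ofReal (8 / 9) * y + ofReal (1 / 9) * y ≤ ofReal (8 / 9) * y + X := by
      rw [h9, add_comm _ X]
      exact hyM.trans hbound
    exact (ENNReal.add_le_add_iff_left (mul_ne_top ofReal_ne_top hyt)).1 h6
  have e8 : ofReal (8 / 9) * y = 8 * (ofReal (1 / 9) * y) := by
    rw [← mul_assoc, ← ofReal_ofNat 8, ← ofReal_mul (by norm_num)]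
    norm_num
  refine hbound.trans ?_
  rw [e8]
  calc X + 8 * (ofReal (1 / 9) * y) ≤ X + 8 * X := by gcongr
    _ = 9 * X := by ring

theorem smoothingHigh_le (hn : 4 ≤ n) (hA : GaugeConditions A₀ A) (hs : SmallnessHigh A₀ A)
    (hg : Defocusing g G) {T : ℝ≥0∞} {u : ℝ → L2 n} (hu : IsSolution A₀ A g T u) :
    smoothingHigh A G T u ≤ ofReal (27 * (36 * n)) *
      ⨆ t ∈ timeInterval T, quarterNormSq A (u t) := by
  set S := ⨆ t ∈ timeInterval T, quarterNormSq A (u t) with hS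
  have hn3 : 3 ≤ n := by omega
  set K := 9 * (ofReal (4 * n) * S) with hK
  have key : ∀ T', 0 ≤ T' → ofReal T' ≤ T → ∃ P : ℝ → covGradGraph A, Continuous P ∧
      (∀ t ∈ Icc 0 T', u t = (P t).1.fst ∧ covGrad A (u t) = (P t).1.snd) ∧
      MorawetzBound G T' P K := by
    intro T' h0 hT'
    obtain ⟨P, du, hE, hPu⟩ := hu.exists_evolution hn3 hA h0 hT'
    refine ⟨P, hE.continuous_P, fun t ht => ⟨(hPu t ht).symm, ?_⟩,
      hE.morawetzBound_high hn hA.contDiff_A hA.contDiff_A₀ hs hg fun t ht => ?_⟩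
    · rw [← hPu t ht]
      exact covGrad_eq hn3 hA.contDiff_A (P t)
    · rw [hPu t ht]
      exact le_iSup₂_of_le t ⟨ht.1, (ofReal_le_ofReal ht.2).trans hT'⟩ le_rfl
  have b1 : ∫⁻ t in timeInterval T, ∫⁻ x : E n,
      ‖tangential x (covGrad A (u t) x)‖ₑ ^ 2 / ‖x‖ₑ ≤ ofReal 6 * K := by
    refine lintegral_timeInterval_le fun T' h0 hT' => ?_
    obtain ⟨P, cP, hP, hb⟩ := key T' h0 hT'
    refine le_trans (setLIntegral_mono' measurableSet_Icc fun t ht => ?_) (hb.tangential cP hn3 hg)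
    rw [(hP t ht).2]
  have b2 : ⨆ R ∈ Ioi (0 : ℝ), (ofReal R)⁻¹ *
      ∫⁻ t in timeInterval T, ∫⁻ x in closedBall (0 : E n) R, (‖covGrad A (u t) x‖ₑ ^ 2 +
          ofReal (((n : ℝ) - 1) / 2 * G (‖u t x‖ ^ 2))) ≤ ofReal 12 * K := by
    refine iSup₂_le fun R hR => ?_
    have hR' : (ofReal R)⁻¹ ≠ ⊤ := by simpa using hR
    rw [← lintegral_const_mul' _ _ hR']
    refine lintegral_timeInterval_le fun T' h0 hT' => ?_
    obtain ⟨P, cP, hP, hb⟩ := key T' h0 hT'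
    rw [lintegral_const_mul' _ _ hR']
    refine le_trans (mul_le_mul_right (setLIntegral_mono' measurableSet_Icc fun t ht => ?_) _)
      (hb.lintegral_closedBall hn3 hg hR)
    rw [(hP t ht).2, (hP t ht).1]
  have b3 : ∫⁻ t in timeInterval T, ∫⁻ x : E n, (‖u t x‖ₑ ^ 2 / ‖x‖ₑ ^ 3 +
      ofReal (((n : ℝ) - 1) * G (‖u t x‖ ^ 2)) / ‖x‖ₑ) ≤ ofReal 9 * K := by
    refine lintegral_timeInterval_le fun T' h0 hT' => ?_
    obtain ⟨P, cP, hP, hb⟩ := key T' h0 hT'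
    refine le_trans (setLIntegral_mono' measurableSet_Icc fun t ht => ?_)
      (hb.cube_add_potential cP hn hg)
    rw [(hP t ht).1]
  refine (add_le_add (add_le_add b1 b2) b3).trans_eq ?_
  rw [← add_mul, ← add_mul, ← ofReal_add (by norm_num) (by norm_num),
    ← ofReal_add (by norm_num) (by norm_num), hK, ← mul_assoc, ← mul_assoc,
    ← ofReal_ofNat 9, ← ofReal_mul (by norm_num), ← ofReal_mul (by norm_num)]
  congr 2
  ring

end

section

variable {A : E n → E n} {κ : ℝ → ℝ} {s0 s1 T' : ℝ}

/-! ### The radial distribution of a solution -/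

/-- The image under `(t, x) ↦ |x|` of the measure `|u|² / |x|² dx dt` on `[0, T'] × ℝⁿ`. -/
def radialLaw (P : ℝ → covGradGraph A) (T' : ℝ) : Measure ℝ :=
  (volume.restrict (Icc 0 T')).bind fun t =>
    ((volume : Measure (E n)).withDensity fun x => ‖(P t).1.fst x‖ₑ ^ 2 / ‖x‖ₑ ^ 2).map norm

theorem aemeasurable_hardy_density (f : L2 n) :
    AEMeasurable (fun x : E n => ‖f x‖ₑ ^ 2 / ‖x‖ₑ ^ 2) volume :=
  ((Lp.aestronglyMeasurable f).enorm.pow_const 2).div (measurable_enorm.pow_const 2).aemeasurable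

theorem lintegral_radialLaw {P : ℝ → covGradGraph A} (hP : Continuous P) {f : ℝ → ℝ≥0∞}
    (hf : Measurable f) :
    ∫⁻ r, f r ∂radialLaw P T' =
      ∫⁻ t in Icc 0 T', ∫⁻ x, f ‖x‖ * (‖(P t).1.fst x‖ₑ ^ 2 / ‖x‖ₑ ^ 2) := by
  have hm : Measurable fun t => ((volume : Measure (E n)).withDensity
      fun x => ‖(P t).1.fst x‖ₑ ^ 2 / ‖x‖ₑ ^ 2).map norm := by
    refine Measure.measurable_of_measurable_coe _ fun s hs => ?_
    have h1 := measurable_lintegral_mul (c := (norm ⁻¹' s).indicator fun x : E n => (‖x‖ₑ ^ 2)⁻¹)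
      ((measurable_enorm.pow_const 2).inv.indicator (measurable_norm hs))
      (φ := fun z : ℂ => ‖z‖ₑ ^ 2) (by fun_prop) ((fstG A).continuous.comp hP)
    convert h1 using 2 with t
    rw [Measure.map_apply measurable_norm hs, withDensity_apply _ (measurable_norm hs),
      ← lintegral_indicator (measurable_norm hs)]
    refine lintegral_congr fun x => ?_
    by_cases hx : x ∈ norm ⁻¹' s
    · rw [indicator_of_mem hx, indicator_of_mem hx, div_eq_mul_inv]
      rfl
    · rw [indicator_of_notMem hx, indicator_of_notMem hx, mul_zero]
  rw [radialLaw, Measure.lintegral_bind hm.aemeasurable hf.aemeasurable]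
  refine lintegral_congr fun t => ?_
  rw [lintegral_map hf measurable_norm]
  refine (lintegral_withDensity_eq_lintegral_mul₀ (g := fun x : E n => f ‖x‖)
    (aemeasurable_hardy_density (P t).1.fst) (hf.comp measurable_norm).aemeasurable).trans ?_
  exact lintegral_congr fun x => mul_comm _ _

theorem isFiniteMeasure_radialLaw {P : ℝ → covGradGraph A} (hP : Continuous P)
    (h : ∫⁻ t in Icc 0 T', ∫⁻ x, ‖(P t).1.fst x‖ₑ ^ 2 / ‖x‖ₑ ^ 2 < ⊤) :
    IsFiniteMeasure (radialLaw P T') := by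
  refine ⟨?_⟩
  rw [← lintegral_one, lintegral_radialLaw hP measurable_const]
  simpa only [one_mul] using h

/-! ### Comparison with Lebesgue measure -/

theorem RadialKernel.ofReal_mom_zero (h : RadialKernel κ s0 s1) :
    ofReal (mom κ 0 s1) = ∫⁻ r in Ioc 0 s1, ofReal (κ r) := by
  rw [mom, intervalIntegral.integral_of_le (h.pos.le.trans h.le)]
  simp only [pow_zero, one_mul]
  exact ofReal_integral_eq_lintegral_ofReal (h.continuous.integrableOn_Ioc) (ae_of_all _ h.nonneg)

theorem restrict_le_smul_volume {ν : Measure ℝ} [IsFiniteMeasure ν] {s : ℝ≥0∞} (hs : s ≠ ⊤)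
    (h : ∀ κ s0 s1, RadialKernel κ s0 s1 → ∫⁻ r, ofReal (κ r) ∂ν ≤ s * ofReal (mom κ 0 s1)) :
    ν.restrict (Ioi 0) ≤ s • volume := by
  have hopen : ∀ K V : Set ℝ, IsCompact K → IsOpen V → K ⊆ V → V ⊆ Ioi 0 → ν K ≤ s * volume V := by
    intro K V hK hV hKV hV0
    obtain ⟨f, f1, fc, fV, f01⟩ := exists_continuousMap_one_of_isCompact_subset_isOpen hK hV hKV
    rcases K.eq_empty_or_nonempty with rfl | ⟨k, hk⟩
    · simp
    have hne : (tsupport f).Nonempty := ⟨k, subset_tsupport _ (by simp [f1 hk])⟩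
    obtain ⟨a, ha, hamin⟩ := fc.exists_isLeast hne
    obtain ⟨b, hb, hbmax⟩ := fc.exists_isGreatest hne
    have ha0 : 0 < a := hV0 (fV ha)
    have hκ : RadialKernel f (a / 2) (b + 1) :=
      { continuous := f.continuous
        nonneg := fun r => (f01 r).1
        pos := half_pos ha0
        le := by linarith [hamin hb]
        left := fun r hr => image_eq_zero_of_notMem_tsupport fun hr' => by linarith [hamin hr']
        right := fun r hr => image_eq_zero_of_notMem_tsupport fun hr' => by linarith [hbmax hr'] }
    calc ν K = ∫⁻ r in K, 1 ∂ν := by simp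
      _ ≤ ∫⁻ r in K, ofReal (f r) ∂ν :=
        setLIntegral_mono' hK.measurableSet fun r hr => by simp [f1 hr]
      _ ≤ ∫⁻ r, ofReal (f r) ∂ν := setLIntegral_le_lintegral _ _
      _ ≤ s * ofReal (mom f 0 (b + 1)) := h _ _ _ hκ
      _ ≤ s * volume V := by
        gcongr
        rw [hκ.ofReal_mom_zero, ← lintegral_indicator_one hV.measurableSet]
        refine (setLIntegral_le_lintegral _ _).trans (lintegral_mono fun r => ?_)
        by_cases hr : r ∈ V
        · simpa [hr] using (f01 r).2
        · simp [image_eq_zero_of_notMem_tsupport fun hr' => hr (fV hr')]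
  have hcomp : ∀ K : Set ℝ, IsCompact K → K ⊆ Ioi 0 → ν K ≤ s * volume K := by
    intro K hK hK0
    have hb : ∀ k : ℕ, ν K ≤ s * (volume K + (k : ℝ≥0∞)⁻¹) := by
      intro k
      obtain ⟨U, hKU, hU, hle⟩ := K.exists_isOpen_le_add volume (ε := (k : ℝ≥0∞)⁻¹)
        (ENNReal.inv_ne_zero.2 (ENNReal.natCast_ne_top k))
      refine (hopen K (U ∩ Ioi 0) hK (hU.inter isOpen_Ioi) (subset_inter hKU hK0)
        inter_subset_right).trans ?_
      gcongr
      exact (measure_mono inter_subset_left).trans hle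
    refine ge_of_tendsto' (x := atTop) (f := fun k : ℕ => s * (volume K + (k : ℝ≥0∞)⁻¹)) ?_ hb
    have := ENNReal.Tendsto.const_mul (a := s) ((tendsto_const_nhds (x := volume K)).add
      ENNReal.tendsto_inv_nat_nhds_zero) (Or.inr hs)
    simpa using this
  refine Measure.le_iff.2 fun B hB => ?_
  rw [Measure.restrict_apply hB, Measure.smul_apply, smul_eq_mul]
  refine le_of_forall_lt fun r hr => ?_
  obtain ⟨K, hKB, hK, hlt⟩ := (hB.inter measurableSet_Ioi).exists_lt_isCompact hr
  refine hlt.trans_le ((hcomp K hK fun x hx => (hKB hx).2).trans ?_)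
  gcongr
  exact fun x hx => (hKB hx).1

/-! ### A first bound for the radial distribution -/

theorem RadialKernel.exists_mul_le (h : RadialKernel κ s0 s1) : ∃ D, 0 ≤ D ∧ ∀ r, r * κ r ≤ D := by
  obtain ⟨D, hD⟩ := (isCompact_Icc (a := s0) (b := s1)).exists_bound_of_continuousOn
    (f := fun r => r * κ r) (continuous_id.mul h.continuous).continuousOn
  refine ⟨max D 0, le_max_right _ _, fun r => ?_⟩
  by_cases hr : r ∈ Icc s0 s1
  · exact (le_abs_self _).trans ((hD r hr).trans (le_max_left _ _))
  · have : κ r = 0 := by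
      rw [mem_Icc, not_and_or, not_le, not_le] at hr
      exact hr.elim (fun hr => h.left r hr.le) fun hr => h.right r hr.le
    rw [this, mul_zero]
    exact le_max_right _ _

theorem lintegral_kernel_le (h : RadialKernel κ s0 s1) (hn : 3 ≤ n) (hA : ContDiffOn ℝ 1 A {0}ᶜ)
    (p : covGradGraph A) :
    ∫⁻ x, ofReal (κ ‖x‖ / ‖x‖) * ‖p.1.fst x‖ₑ ^ 2 ≤
      10 * ofReal (mom κ 0 s1) * ofReal (‖p.1.snd‖ ^ 2) := by
  obtain ⟨m, rfl⟩ : ∃ m, n = m + 3 := ⟨n - 3, by omega⟩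
  obtain ⟨D, hD0, hD⟩ := h.exists_mul_le
  set c := mom κ 0 s1 with hc
  have hc0 : 0 ≤ c := h.mom_nonneg 0 (h.pos.le.trans h.le)
  have hn1 : (((m + 3 : ℕ) : ℝ) - 1) = m + 2 := by push_cast; ring
  set η : ℝ → ℝ := fun r => mom κ (m + 1) r / r ^ (m + 2) with hη
  have hηb : ∀ r, 0 < r → |η r| ≤ c / r := by
    intro r hr
    have h1 : mom κ (m + 1) r ≤ r ^ (m + 1) * mom κ 0 r := by
      simpa using h.mom_add_le hr.le 0 (m + 1)
    have h2 : mom κ 0 r ≤ c := by linarith [h.tail_nonneg hr.le 0]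
    rw [abs_of_nonneg (div_nonneg (h.mom_nonneg _ hr.le) (by positivity)),
      div_le_div_iff₀ (by positivity) hr]
    calc mom κ (m + 1) r * r ≤ (r ^ (m + 1) * c) * r := by gcongr; exact h1.trans (by gcongr)
      _ = c * r ^ (m + 2) := by ring
  set η' : ℝ → ℝ := fun r => κ r / r - (m + 2) * η r / r with hη'
  have hd : ∀ r, 0 < r → HasDerivAt η (η' r) r := by
    intro r hr
    have h1 : HasDerivAt η _ r :=
      (h.hasDerivAt_mom (m + 1) r).div (hasDerivAt_pow (m + 2) r) (by positivity)
    refine h1.congr_deriv ?_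
    change _ = κ r / r - (m + 2) * (mom κ (m + 1) r / r ^ (m + 2)) / r
    field_simp
    push_cast
    ring
  have hηc : ContinuousOn η (Ioi 0) := fun r hr => (hd r hr).continuousAt.continuousWithinAt
  have hη'c : ContinuousOn η' (Ioi 0) :=
    (h.continuous.continuousOn.div continuousOn_id fun r hr => ne_of_gt hr).sub
      ((continuousOn_const.mul hηc).div continuousOn_id fun r hr => ne_of_gt hr)
  have hκb : ∀ r, 0 < r → κ r / r ≤ D / r ^ 2 := by
    intro r hr
    rw [div_le_div_iff₀ hr (by positivity)]
    nlinarith [hD r]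
  have hη'b : ∀ r, 0 < r → |η' r| ≤ (D + (m + 2) * c) / r ^ 2 := by
    intro r hr
    have h1 : |(m + 2) * η r / r| ≤ (m + 2) * c / r ^ 2 := by
      rw [abs_div, abs_mul, abs_of_pos hr, abs_of_nonneg (by positivity : (0 : ℝ) ≤ m + 2)]
      calc (m + 2) * |η r| / r ≤ (m + 2) * (c / r) / r := by gcongr; exact hηb r hr
        _ = (m + 2) * c / r ^ 2 := by field_simp
    have h2 : |κ r / r| ≤ D / r ^ 2 := by
      rw [abs_of_nonneg (div_nonneg (h.nonneg r) hr.le)]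
      exact hκb r hr
    rw [add_div]
    exact (abs_sub _ _).trans (add_le_add h2 h1)
  have hibp := radial_ibp hn hA p hd hη'c (C := c + (D + (m + 2) * c)) (by positivity)
    (fun r hr => (hηb r hr).trans (by gcongr; nlinarith [mul_nonneg (Nat.cast_nonneg (α := ℝ) m) hc0]))
    (fun r hr => (hη'b r hr).trans (div_le_div_of_nonneg_right (by linarith) (by positivity)))
  have e1 : ∀ x : E (m + 3), (η' ‖x‖ + (((m + 3 : ℕ) : ℝ) - 1) * η ‖x‖ / ‖x‖) = κ ‖x‖ / ‖x‖ := by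
    intro x
    rw [hn1]
    simp only [hη']
    ring
  simp only [e1] at hibp
  have hi : Integrable fun x => κ ‖x‖ / ‖x‖ * ‖p.1.fst x‖ ^ 2 :=
    integrable_hardy_sq hn hA p (Measurable.aestronglyMeasurable
      ((h.continuous.measurable.comp measurable_norm).div measurable_norm)) hD0 fun x hx => by
        rw [abs_of_nonneg (div_nonneg (h.nonneg _) (norm_nonneg _))]
        exact hκb _ (norm_pos_iff.2 hx)
  have e2 : ∫⁻ x, ofReal (κ ‖x‖ / ‖x‖) * ‖p.1.fst x‖ₑ ^ 2 =
      ofReal (∫ x, κ ‖x‖ / ‖x‖ * ‖p.1.fst x‖ ^ 2) := by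
    have hnn : ∀ x : E (m + 3), 0 ≤ κ ‖x‖ / ‖x‖ := fun x => div_nonneg (h.nonneg _) (norm_nonneg _)
    rw [ofReal_integral_eq_lintegral_ofReal hi (ae_of_all _ fun x =>
      mul_nonneg (hnn x) (sq_nonneg _))]
    refine lintegral_congr fun x => ?_
    rw [ofReal_mul (hnn x), ofReal_pow (norm_nonneg _), ofReal_norm]
  rw [e2]
  set J := ∫ x, η ‖x‖ * (⟪p.1.fst x, radialCLM p.1.snd x⟫_ℂ).re with hJ
  have e3 : ∫ x, κ ‖x‖ / ‖x‖ * ‖p.1.fst x‖ ^ 2 = 2 * -J := by linarith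
  have hJb : ‖J‖ₑ ≤ ofReal c * (5 * ofReal (‖p.1.snd‖ ^ 2)) := by
    have hh := hardy hn hA p.2
    rw [lintegral_enorm_sq] at hh
    calc ‖J‖ₑ ≤ ∫⁻ x, ‖η ‖x‖ * (⟪p.1.fst x, radialCLM p.1.snd x⟫_ℂ).re‖ₑ :=
        enorm_integral_le_lintegral_enorm _
      _ ≤ ∫⁻ x, ofReal c * (‖p.1.fst x‖ₑ ^ 2 / ‖x‖ₑ ^ 2 + ‖p.1.snd x‖ₑ ^ 2) := by
        refine lintegral_mono_ae ?_
        filter_upwards [ae_ne_zero hn, radialCLM_ae p.1.snd] with x hx hr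
        have hx0 := norm_pos_iff.2 hx
        rw [hr, enorm_sq_div_pow _ hx0, ← ofReal_norm, ← ofReal_norm (p.1.snd x),
          ← ofReal_pow (norm_nonneg _), ← ofReal_add (by positivity) (by positivity),
          ← ofReal_mul hc0]
        refine ofReal_le_ofReal ?_
        have i1 : |(⟪p.1.fst x, radial x (p.1.snd x)⟫_ℂ).re| ≤ ‖p.1.fst x‖ * ‖p.1.snd x‖ :=
          (abs_re_le_norm _).trans ((norm_inner_le_norm _ _).trans
            (mul_le_mul_of_nonneg_left (norm_radial_le _ _) (norm_nonneg _)))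
        rw [norm_mul, norm_eq_abs, norm_eq_abs]
        calc |η ‖x‖| * |(⟪p.1.fst x, radial x (p.1.snd x)⟫_ℂ).re|
            ≤ c / ‖x‖ * (‖p.1.fst x‖ * ‖p.1.snd x‖) := by
              gcongr
              exact hηb _ hx0
          _ = c * (‖p.1.fst x‖ / ‖x‖ * ‖p.1.snd x‖) := by ring
          _ ≤ c * (‖p.1.fst x‖ ^ 2 / ‖x‖ ^ 2 + ‖p.1.snd x‖ ^ 2) := by
              rw [← div_pow]
              gcongr
              nlinarith [sq_nonneg (‖p.1.fst x‖ / ‖x‖ - ‖p.1.snd x‖),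
                sq_nonneg (‖p.1.fst x‖ / ‖x‖), sq_nonneg ‖p.1.snd x‖]
      _ = ofReal c * ((∫⁻ x, ‖p.1.fst x‖ₑ ^ 2 / ‖x‖ₑ ^ 2) + ofReal (‖p.1.snd‖ ^ 2)) := by
        rw [lintegral_const_mul' _ _ ofReal_ne_top,
          lintegral_add_left' (aemeasurable_hardy_density _), lintegral_enorm_sq]
      _ ≤ ofReal c * (4 * ofReal (‖p.1.snd‖ ^ 2) + ofReal (‖p.1.snd‖ ^ 2)) := by
        gcongr
      _ = _ := by ring
  rw [e3, ofReal_mul zero_le_two, ofReal_ofNat]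
  calc 2 * ofReal (-J) ≤ 2 * ‖J‖ₑ := by
        gcongr
        rw [← ofReal_norm]
        exact ofReal_le_ofReal (neg_le_abs J)
    _ ≤ 2 * (ofReal c * (5 * ofReal (‖p.1.snd‖ ^ 2))) := by gcongr
    _ = _ := by ring

end

section

variable {A : E n → E n} {A₀ : E n → ℝ} {g G κ : ℝ → ℝ} {s0 s1 T' δ : ℝ} {q : ℝ → ℝ≥0∞} {e : ℝ≥0∞}

/-! ### Kernels damped near the origin -/

section Damped

theorem damped_nonneg (hδ : 0 < δ) (r : ℝ) : 0 ≤ (max δ r)⁻¹ :=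
  inv_nonneg.2 (hδ.le.trans (le_max_left _ _))

theorem mul_damped_le_one (hδ : 0 < δ) (r : ℝ) : r * (max δ r)⁻¹ ≤ 1 := by
  have h : 0 < max δ r := lt_max_of_lt_left hδ
  rw [← div_eq_mul_inv, div_le_one h]
  exact le_max_right _ _

theorem mul_damped_mono (hδ : 0 < δ) {ρ r : ℝ} (hρ : 0 ≤ ρ) (h : ρ ≤ r) :
    ρ * (max δ ρ)⁻¹ ≤ r * (max δ r)⁻¹ := by
  have h1 : 0 < max δ ρ := lt_max_of_lt_left hδ
  have h2 : 0 < max δ r := lt_max_of_lt_left hδ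
  rw [← div_eq_mul_inv, ← div_eq_mul_inv, div_le_div_iff₀ h1 h2]
  rcases le_total δ r with hr | hr
  · rw [max_eq_right hr, mul_comm]
    exact mul_le_mul_of_nonneg_left (le_max_right _ _) (hρ.trans h)
  · rw [max_eq_left hr, max_eq_left (h.trans hr)]
    gcongr

theorem damped_anti (hδ : 0 < δ) {ρ r : ℝ} (h : r ≤ ρ) : (max δ ρ)⁻¹ ≤ (max δ r)⁻¹ :=
  inv_anti₀ (lt_max_of_lt_left hδ) (max_le_max le_rfl h)

theorem continuous_damped (hδ : 0 < δ) : Continuous fun r : ℝ => (max δ r)⁻¹ :=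
  (continuous_const.max continuous_id).inv₀ fun _ => (lt_max_of_lt_left hδ).ne'

theorem RadialKernel.damped (h : RadialKernel κ s0 s1) (hδ : 0 < δ) :
    RadialKernel (fun r => κ r * (max δ r)⁻¹) s0 s1 where
  continuous := h.continuous.mul (continuous_damped hδ)
  nonneg r := mul_nonneg (h.nonneg r) (damped_nonneg hδ r)
  pos := h.pos
  le := h.le
  left r hr := by rw [h.left r hr, zero_mul]
  right r hr := by rw [h.right r hr, zero_mul]

theorem RadialKernel.mom_one_damped_le (h : RadialKernel κ s0 s1) (hδ : 0 < δ) {r : ℝ} (hr : 0 ≤ r) :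
    mom (fun r => κ r * (max δ r)⁻¹) 1 r ≤ r * (max δ r)⁻¹ * mom κ 0 r := by
  rw [mom, mom, ← intervalIntegral.integral_const_mul]
  refine integral_mono_on hr (((h.damped hδ).continuous_moment _).intervalIntegrable _ _)
    (((h.continuous_moment _).const_mul _).intervalIntegrable _ _) fun ρ hρ => ?_
  calc ρ ^ 1 * (κ ρ * (max δ ρ)⁻¹) = ρ * (max δ ρ)⁻¹ * (ρ ^ 0 * κ ρ) := by ring
    _ ≤ _ := mul_le_mul_of_nonneg_right (mul_damped_mono hδ hρ.1 hρ.2)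
      (mul_nonneg (by simp) (h.nonneg ρ))

theorem RadialKernel.tail_damped_le (h : RadialKernel κ s0 s1) (hδ : 0 < δ) (r : ℝ) :
    mom (fun r => κ r * (max δ r)⁻¹) 0 s1 - mom (fun r => κ r * (max δ r)⁻¹) 0 r ≤
      (max δ r)⁻¹ * (mom κ 0 s1 - mom κ 0 r) := by
  rcases le_total r s1 with hr | hr
  · rw [(h.damped hδ).mom_sub, h.mom_sub, ← intervalIntegral.integral_const_mul]
    refine integral_mono_on hr (((h.damped hδ).continuous_moment _).intervalIntegrable _ _)
      (((h.continuous_moment _).const_mul _).intervalIntegrable _ _) fun ρ hρ => ?_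
    calc ρ ^ 0 * (κ ρ * (max δ ρ)⁻¹) = (max δ ρ)⁻¹ * (ρ ^ 0 * κ ρ) := by ring
      _ ≤ _ := mul_le_mul_of_nonneg_right (damped_anti hδ hρ.1) (mul_nonneg (by simp) (h.nonneg ρ))
  · rw [(h.damped hδ).mom_right 0 hr, h.mom_right 0 hr, sub_self, sub_self, mul_zero]

theorem RadialKernel.wt_damped_le (h : RadialKernel κ s0 s1) (hδ : 0 < δ) {r : ℝ} (hr : 0 ≤ r) :
    wt (fun r => κ r * (max δ r)⁻¹) (mom (fun r => κ r * (max δ r)⁻¹) 0 s1) r ≤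
      1 / 2 * mom κ 0 s1 * (r * (max δ r)⁻¹) := by
  have h1 := (h.damped hδ).wt_le hr
  have h2 := h.mom_one_damped_le hδ hr
  have h3 := mul_le_mul_of_nonneg_left (h.tail_damped_le hδ r) hr
  have h4 := mul_nonneg (mul_nonneg hr (damped_nonneg hδ r)) (h.tail_nonneg hr 0)
  linarith

theorem RadialKernel.mom_one_damped_le_mom_zero (h : RadialKernel κ s0 s1) (hδ : 0 < δ) :
    mom (fun r => κ r * (max δ r)⁻¹) 1 s1 ≤ mom κ 0 s1 := by
  have hs : 0 ≤ s1 := h.pos.le.trans h.le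
  exact (h.mom_one_damped_le hδ hs).trans
    (mul_le_of_le_one_left (h.mom_nonneg 0 hs) (mul_damped_le_one hδ s1))

theorem RadialKernel.measurable_wt (h : RadialKernel κ s0 s1) (c : ℝ) : Measurable (wt κ c) := by
  have m : ∀ i, Measurable (mom κ i) := fun i =>
    (continuous_iff_continuousAt.2 fun r => (h.hasDerivAt_mom i r).continuousAt).measurable
  have m0 := m 0
  have m1 := m 1
  have m3 := m 3
  unfold wt
  fun_prop

end Damped

/-! ### The Morawetz inequality for the radial distribution -/

theorem Evolution.radialLaw_ineq {P : ℝ → covGradGraph A} {du : ℝ → L2 n}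
    (hE : Evolution A₀ A g T' P du) (hn : 3 ≤ n) (hA : ContDiffOn ℝ 1 A {0}ᶜ)
    (hA₀ : ContDiffOn ℝ 1 A₀ {0}ᶜ) (hg : Defocusing g G) {S : ℝ≥0∞}
    (hS : ∀ t ∈ Icc 0 T', quarterNormSq A (P t).1.fst ≤ S) (hqm : Measurable q)
    (hq : ∀ x : E n, x ≠ 0 → ofReal (‖x‖ ^ 2 * errorDensity A₀ A x) ≤ q ‖x‖)
    (h : RadialKernel κ s0 s1) :
    ∫⁻ t in Icc 0 T', ∫⁻ x, ofReal (morawetz n κ (mom κ 0 s1) G x ((P t).1.fst x) ((P t).1.snd x)) ≤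
      ofReal (mom κ 1 s1) * (ofReal (4 * n) * S) +
      ∫⁻ r, ofReal (wt κ (mom κ 0 s1) r) * q r ∂radialLaw P T' := by
  refine (hE.morawetz_ineq h hn hA hA₀ hg hS).trans (add_le_add (le_of_eq ?_) ?_)
  · rw [mul_comm (4 * (n : ℝ)), ofReal_mul (h.mom_nonneg 1 (h.pos.le.trans h.le)), mul_assoc]
  · rw [lintegral_radialLaw (f := fun r => ofReal (wt κ (mom κ 0 s1) r) * q r) hE.continuous_P
      ((h.measurable_wt _).ennreal_ofReal.mul hqm)]
    refine lintegral_mono fun t => lintegral_mono_ae ?_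
    filter_upwards [ae_ne_zero hn] with x hx
    have hr := norm_pos_iff.2 hx
    have hw := h.wt_nonneg (norm_nonneg x)
    have he := errorDensity_nonneg A₀ A x
    rw [enorm_sq_div_pow _ hr]
    calc ofReal (wt κ (mom κ 0 s1) ‖x‖ * errorDensity A₀ A x) * ‖(P t).1.fst x‖ₑ ^ 2
        = ofReal (wt κ (mom κ 0 s1) ‖x‖) * ofReal (‖x‖ ^ 2 * errorDensity A₀ A x) *
          ofReal (‖(P t).1.fst x‖ ^ 2 / ‖x‖ ^ 2) := by
          rw [← ofReal_norm, ← ofReal_pow (norm_nonneg _), ← ofReal_mul (by positivity),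
            ← ofReal_mul (by positivity), ← ofReal_mul (by positivity)]
          congr 1
          field_simp
      _ ≤ _ := by
          gcongr
          exact hq x hx

theorem ofReal_two_mul (a : ℝ) : 2 * ofReal a = ofReal (2 * a) := by
  rw [ofReal_mul zero_le_two, ofReal_ofNat]

theorem lintegral_radialLaw_kernel_le {P : ℝ → covGradGraph A} (hP : Continuous P)
    (hn : 3 ≤ n) (hg : Defocusing g G) (h : RadialKernel κ s0 s1) :
    ∫⁻ r, ofReal (r * κ r) ∂radialLaw P T' ≤ 2 * ∫⁻ t in Icc 0 T', ∫⁻ x, ofReal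
        (morawetz n κ (mom κ 0 s1) G x ((P t).1.fst x) ((P t).1.snd x)) := by
  rw [lintegral_radialLaw (f := fun r => ofReal (r * κ r)) hP
      (measurable_id.mul h.continuous.measurable).ennreal_ofReal,
    ← lintegral_const_mul' _ _ ofNat_ne_top]
  refine lintegral_mono fun t => ?_
  rw [← lintegral_const_mul' _ _ ofNat_ne_top]
  refine lintegral_mono_ae ?_
  filter_upwards [ae_ne_zero hn] with x hx
  have hr := norm_pos_iff.2 hx
  obtain ⟨t1, t2, t3, t4, t5⟩ := morawetz_terms_nonneg h hn hg x ((P t).1.fst x) ((P t).1.snd x)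
  rw [enorm_sq_div_pow _ hr, ← ofReal_mul (mul_nonneg hr.le (h.nonneg _)), ofReal_two_mul]
  refine ofReal_le_ofReal ?_
  have e : ‖x‖ * κ ‖x‖ * (‖(P t).1.fst x‖ ^ 2 / ‖x‖ ^ 2) =
    2 * (κ ‖x‖ / (2 * ‖x‖) * ‖(P t).1.fst x‖ ^ 2) := by field_simp
  rw [e, morawetz, add_mul]
  linarith

/-! ### The radial distribution has a bounded density -/

theorem lintegral_le_of_restrict_le {ν : Measure ℝ} {s : ℝ≥0∞} (h : ν.restrict (Ioi 0) ≤ s • volume)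
    (hq0 : ∀ r, r ≤ 0 → q r = 0) (hq1 : ∫⁻ r, q r ≤ ofReal (1 / 2)) :
    ∫⁻ r, q r ∂ν ≤ s * ofReal (1 / 2) := by
  have e : ∫⁻ r, q r ∂ν = ∫⁻ r in Ioi 0, q r ∂ν := by
    rw [← lintegral_indicator measurableSet_Ioi]
    refine lintegral_congr fun r => ?_
    by_cases hr : r ∈ Ioi (0 : ℝ)
    · rw [indicator_of_mem hr]
    · rw [indicator_of_notMem hr, hq0 r (not_lt.1 hr)]
  rw [e]
  refine (lintegral_mono' h le_rfl).trans ?_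
  rw [lintegral_smul_measure, smul_eq_mul]
  gcongr

theorem restrict_le_of_damped_ineq {μ : Measure ℝ} [IsFiniteMeasure μ] (hqm : Measurable q)
    (hq0 : ∀ r, r ≤ 0 → q r = 0) (hq1 : ∫⁻ r, q r ≤ ofReal (1 / 2)) (he : e ≠ ⊤)
    {s : ℝ≥0∞} (hs : s ≠ ⊤)
    (hb : ∀ κ s0 s1, RadialKernel κ s0 s1 → ∫⁻ r, ofReal (r * κ r) ∂μ ≤ s * ofReal (mom κ 0 s1))
    (hm : ∀ κ s0 s1, RadialKernel κ s0 s1 → ∫⁻ r, ofReal (r * κ r) ∂μ ≤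
      2 * (ofReal (mom κ 1 s1) * e + ∫⁻ r, ofReal (wt κ (mom κ 0 s1) r) * q r ∂μ)) :
    μ.restrict (Ioi 0) ≤ (4 * e) • volume := by
  refine restrict_le_smul_volume (mul_ne_top ofNat_ne_top he) fun κ δ b h0 => ?_
  have hδ := h0.pos
  set w : ℝ → ℝ≥0∞ := fun r => ofReal (r * (max δ r)⁻¹) with hw
  have wm : Measurable w := (measurable_id.mul (continuous_damped hδ).measurable).ennreal_ofReal
  set ν := μ.withDensity w with hν
  have hνfin : IsFiniteMeasure ν := by
    refine ⟨?_⟩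
    rw [hν, withDensity_apply _ MeasurableSet.univ]
    refine lt_of_le_of_lt (lintegral_mono (g := fun _ => 1) fun r => ?_) ?_
    · exact (ofReal_le_ofReal (mul_damped_le_one hδ r)).trans_eq ofReal_one
    · simp
  have hνint : ∀ κ : ℝ → ℝ, Continuous κ → (∀ r, 0 ≤ κ r) → ∫⁻ r, ofReal (κ r) ∂ν =
      ∫⁻ r, ofReal (r * (κ r * (max δ r)⁻¹)) ∂μ := by
    intro κ hκ hκ0
    rw [hν, lintegral_withDensity_eq_lintegral_mul _ wm hκ.measurable.ennreal_ofReal]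
    refine lintegral_congr fun r => ?_
    rw [Pi.mul_apply, hw, mul_comm, ← ofReal_mul (hκ0 r)]
    congr 1
    ring
  have hstep : ∀ s : ℝ≥0∞, s ≠ ⊤ → (∀ κ s0 s1, RadialKernel κ s0 s1 →
      ∫⁻ r, ofReal (κ r) ∂ν ≤ s * ofReal (mom κ 0 s1)) →
      ∀ κ s0 s1, RadialKernel κ s0 s1 →
        ∫⁻ r, ofReal (κ r) ∂ν ≤ (2 * e + s / 2) * ofReal (mom κ 0 s1) := by
    intro s hs hP κ s0 s1 h
    have hle := lintegral_le_of_restrict_le (restrict_le_smul_volume hs hP) hq0 hq1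
    rw [hν, lintegral_withDensity_eq_lintegral_mul _ wm hqm] at hle
    rw [hνint κ h.continuous h.nonneg]
    refine (hm _ _ _ (h.damped hδ)).trans ?_
    have h1 : ∫⁻ r, ofReal (wt (fun r => κ r * (max δ r)⁻¹)
        (mom (fun r => κ r * (max δ r)⁻¹) 0 s1) r) * q r ∂μ ≤
        ofReal (1 / 2 * mom κ 0 s1) * (s * ofReal (1 / 2)) := by
      refine le_trans ?_ (mul_le_mul_right hle _)
      rw [← lintegral_const_mul' _ _ ofReal_ne_top]
      refine lintegral_mono fun r => ?_
      rcases le_or_gt r 0 with hr | hr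
      · simp [hq0 r hr]
      · rw [Pi.mul_apply, ← mul_assoc, hw, ← ofReal_mul
          (mul_nonneg (by norm_num) (h.mom_nonneg 0 (h.pos.le.trans h.le)))]
        gcongr
        exact h.wt_damped_le hδ hr.le
    have h2 := h.mom_one_damped_le_mom_zero hδ
    calc 2 * (ofReal (mom (fun r => κ r * (max δ r)⁻¹) 1 s1) * e + _)
        ≤ 2 * (ofReal (mom κ 0 s1) * e +
          ofReal (1 / 2 * mom κ 0 s1) * (s * ofReal (1 / 2))) := by gcongr
      _ = (2 * e + s / 2) * ofReal (mom κ 0 s1) := by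
        have e2 : ofReal (1 / 2) = 2⁻¹ := by
          rw [one_div, ofReal_inv_of_pos two_pos, ofReal_ofNat]
        rw [ofReal_mul (by norm_num), e2, div_eq_mul_inv]
        have e3 : (2 : ℝ≥0∞) * 2⁻¹ = 1 := ENNReal.mul_inv_cancel two_ne_zero ofNat_ne_top
        calc 2 * (ofReal (mom κ 0 s1) * e + 2⁻¹ * ofReal (mom κ 0 s1) * (s * 2⁻¹))
            = 2 * e * ofReal (mom κ 0 s1) + (2 * 2⁻¹) * (s * 2⁻¹ * ofReal (mom κ 0 s1)) := by ring
          _ = _ := by rw [e3]; ring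
  set a := ofReal δ⁻¹ * s with ha
  have hat : a ≠ ⊤ := mul_ne_top ofReal_ne_top hs
  have hbase : ∀ κ s0 s1, RadialKernel κ s0 s1 →
      ∫⁻ r, ofReal (κ r) ∂ν ≤ a * ofReal (mom κ 0 s1) := by
    intro κ s0 s1 h
    rw [hνint κ h.continuous h.nonneg, ha, mul_assoc]
    refine le_trans ?_ (mul_le_mul_right (hb κ s0 s1 h) _)
    rw [← lintegral_const_mul' _ _ ofReal_ne_top]
    refine lintegral_mono fun r => ?_
    rw [← ofReal_mul (inv_nonneg.2 hδ.le)]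
    rcases le_or_gt r 0 with hr | hr
    · rw [h.left r (hr.trans h.pos.le)]
      simp
    · refine ofReal_le_ofReal ?_
      have h1 : (max δ r)⁻¹ ≤ δ⁻¹ := inv_anti₀ hδ (le_max_left _ _)
      calc r * (κ r * (max δ r)⁻¹) = (max δ r)⁻¹ * (r * κ r) := by ring
        _ ≤ _ := mul_le_mul_of_nonneg_right h1 (mul_nonneg hr.le (h.nonneg r))
  have hiter : ∀ k : ℕ, ∀ κ s0 s1, RadialKernel κ s0 s1 →
      ∫⁻ r, ofReal (κ r) ∂ν ≤ (4 * e + a * 2⁻¹ ^ k) * ofReal (mom κ 0 s1) := by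
    intro k
    induction k with
    | zero =>
      intro κ s0 s1 h
      refine (hbase κ s0 s1 h).trans ?_
      gcongr
      simp
    | succ k ih =>
      intro κ s0 s1 h
      refine (hstep _ ?_ ih κ s0 s1 h).trans_eq ?_
      · exact ENNReal.add_ne_top.2 ⟨mul_ne_top ofNat_ne_top he,
          mul_ne_top hat (pow_ne_top (by simp))⟩
      · congr 1
        have e3 : (2 : ℝ≥0∞) * 2⁻¹ = 1 := ENNReal.mul_inv_cancel two_ne_zero ofNat_ne_top
        calc 2 * e + (4 * e + a * 2⁻¹ ^ k) / 2
            = 2 * e + 2 * (2 * 2⁻¹) * e + a * 2⁻¹ ^ (k + 1) := by rw [div_eq_mul_inv]; ring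
          _ = _ := by rw [e3]; ring
  have hlim : ∫⁻ r, ofReal (κ r) ∂ν ≤ 4 * e * ofReal (mom κ 0 b) := by
    refine ge_of_tendsto' (x := atTop)
      (f := fun k : ℕ => (4 * e + a * 2⁻¹ ^ k) * ofReal (mom κ 0 b)) ?_
      fun k => hiter k κ δ b h0
    refine ENNReal.Tendsto.mul_const ?_ (Or.inr ofReal_ne_top)
    have h1 := ENNReal.Tendsto.const_mul (a := a) (ENNReal.tendsto_pow_atTop_nhds_zero_of_lt_one
      (r := 2⁻¹) (by simp)) (Or.inr hat)
    simpa using (tendsto_const_nhds (x := 4 * e)).add h1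
  refine le_trans (le_of_eq ?_) hlim
  rw [hνint κ h0.continuous h0.nonneg]
  refine lintegral_congr fun r => ?_
  rcases le_total r δ with hr | hr
  · simp [h0.left r hr]
  · have : r ≠ 0 := (hδ.trans_le hr).ne'
    rw [max_eq_right hr, mul_comm, mul_assoc, inv_mul_cancel₀ this, mul_one]

end

section

variable {A : E n → E n} {A₀ : E n → ℝ} {g G κ : ℝ → ℝ} {s0 s1 T' δ : ℝ} {q : ℝ → ℝ≥0∞} {e : ℝ≥0∞}

/-! ### Suprema over spheres -/

theorem exists_measurable_iSup_sphere {f : E n → ℝ} (hf : ContinuousOn f {0}ᶜ) :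
    ∃ q : ℝ → ℝ≥0∞, Measurable q ∧ (∀ r, r ≤ 0 → q r = 0) ∧
      ∀ r, 0 < r → q r = ⨆ x ∈ sphere (0 : E n) r, ofReal (f x) := by
  set F : Ioi (0 : ℝ) → ℝ≥0∞ := fun r => ⨆ y : sphere (0 : E n) 1,
    ofReal (f ((r : ℝ) • (y : E n))) with hF
  have hFm : Measurable F := by
    refine LowerSemicontinuous.measurable (lowerSemicontinuous_iSup fun y => ?_)
    refine Continuous.lowerSemicontinuous (continuous_ofReal.comp ?_)
    refine hf.comp_continuous (continuous_subtype_val.smul continuous_const) fun r => ?_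
    have hy : (y : E n) ≠ 0 := ne_zero_of_mem_unit_sphere y
    exact smul_ne_zero (ne_of_gt r.2) hy
  refine ⟨fun r => if h : r ∈ Ioi (0 : ℝ) then F ⟨r, h⟩ else 0,
    Measurable.dite hFm measurable_const measurableSet_Ioi, fun r hr => dif_neg (not_lt.2 hr),
    fun r hr => ?_⟩
  refine (dif_pos (mem_Ioi.2 hr)).trans ?_
  refine le_antisymm (iSup_le fun y => ?_) (iSup₂_le fun x hx => ?_)
  · refine le_iSup₂_of_le (r • (y : E n)) ?_ le_rfl
    rw [mem_sphere_zero_iff_norm, norm_smul, norm_eq_of_mem_sphere, mul_one, norm_eq_abs,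
      abs_of_pos hr]
  · rw [mem_sphere_zero_iff_norm] at hx
    refine le_iSup_of_le ⟨r⁻¹ • x, ?_⟩ ?_
    · rw [mem_sphere_zero_iff_norm, norm_smul, hx, norm_eq_abs, abs_of_pos (inv_pos.2 hr),
        inv_mul_cancel₀ hr.ne']
    · rw [smul_inv_smul₀ hr.ne']

theorem SmallnessThree.exists_majorant {M : ℝ} (hs : SmallnessThree A₀ A M) (hM : 0 < M)
    (hA : ContDiffOn ℝ 1 A {0}ᶜ) (hA₀ : ContDiffOn ℝ 1 A₀ {0}ᶜ) :
    ∃ q : ℝ → ℝ≥0∞, Measurable q ∧ (∀ r, r ≤ 0 → q r = 0) ∧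
      (∀ x : E n, x ≠ 0 → ofReal (‖x‖ ^ 2 * errorDensity A₀ A x) ≤ q ‖x‖) ∧
      ∫⁻ r, q r ≤ ofReal (1 / 2) := by
  obtain ⟨q1, m1, z1, e1⟩ := exists_measurable_iSup_sphere
    (f := fun x : E n => (‖x‖ ^ (3 / 2 : ℝ) * ‖trapping A x‖) ^ 2)
    (((continuous_norm.continuousOn.rpow_const fun x _ => Or.inr (by norm_num)).mul
      (continuousOn_norm_trapping hA)).pow 2)
  obtain ⟨q2, m2, z2, e2⟩ := exists_measurable_iSup_sphere
    (f := fun x : E n => ‖x‖ ^ 2 * radialDerivPos A₀ x)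
    ((continuous_norm.continuousOn.pow 2).mul (continuousOn_radialDerivPos hA₀))
  refine ⟨fun r => ofReal (2 / 3) * q1 r + q2 r, (m1.const_mul _).add m2,
    fun r hr => by simp [z1 r hr, z2 r hr], fun x hx => ?_, ?_⟩
  · have hr := norm_pos_iff.2 hx
    have hd : 0 ≤ radialDerivPos A₀ x := le_max_right _ _
    have e3 : ‖x‖ ^ 2 * errorDensity A₀ A x =
        2 / 3 * (‖x‖ ^ (3 / 2 : ℝ) * ‖trapping A x‖) ^ 2 + ‖x‖ ^ 2 * radialDerivPos A₀ x := by
      have e4 : (‖x‖ ^ (3 / 2 : ℝ)) ^ 2 = ‖x‖ ^ 3 := by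
        rw [← Real.rpow_natCast, ← Real.rpow_mul hr.le, ← Real.rpow_natCast]
        norm_num
      rw [errorDensity, mul_pow, e4]
      ring
    change _ ≤ ofReal (2 / 3) * q1 ‖x‖ + q2 ‖x‖
    rw [e3, ofReal_add (by positivity) (by positivity), ofReal_mul (by norm_num), e1 _ hr, e2 _ hr]
    have hx' : x ∈ sphere (0 : E n) ‖x‖ := mem_sphere_zero_iff_norm.2 rfl
    gcongr
    · exact le_iSup₂ (f := fun (y : E n) (_ : y ∈ sphere (0 : E n) ‖x‖) =>
        ofReal ((‖y‖ ^ (3 / 2 : ℝ) * ‖trapping A y‖) ^ 2)) x hx'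
    · exact le_iSup₂ (f := fun (y : E n) (_ : y ∈ sphere (0 : E n) ‖x‖) =>
        ofReal (‖y‖ ^ 2 * radialDerivPos A₀ y)) x hx'
  · have e : ∀ q : ℝ → ℝ≥0∞, (∀ r, r ≤ 0 → q r = 0) → ∫⁻ r, q r = ∫⁻ r in Ioi 0, q r := by
      intro q hq
      rw [← lintegral_indicator measurableSet_Ioi]
      refine lintegral_congr fun r => ?_
      by_cases hr : r ∈ Ioi (0 : ℝ)
      · rw [indicator_of_mem hr]
      · rw [indicator_of_notMem hr, hq r (not_lt.1 hr)]
    rw [lintegral_add_right _ m2, lintegral_const_mul _ m1, e q1 z1, e q2 z2,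
      setLIntegral_congr_fun measurableSet_Ioi fun r hr => e1 r hr,
      setLIntegral_congr_fun measurableSet_Ioi fun r hr => e2 r hr]
    refine le_trans (add_le_add (mul_le_mul_left (ofReal_le_ofReal ?_) _) ?_) hs.le
    · rw [le_div_iff₀ hM]
      nlinarith [sq_nonneg (M - 1 / 2)]
    · refine le_mul_of_one_le_left zero_le ?_
      rw [← ofReal_one]
      exact ofReal_le_ofReal (by linarith)

/-! ### Dimension three: the space-time bounds -/

theorem Evolution.lintegral_norm_snd_lt_top {P : ℝ → covGradGraph A} {du : ℝ → L2 n}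
    (hE : Evolution A₀ A g T' P du) :
    ∫⁻ t in Icc 0 T', ofReal (‖(P t).1.snd‖ ^ 2) < ⊤ := by
  have hc : Continuous fun t => ‖(P t).1.snd‖ ^ 2 :=
    (((sndG A).continuous.comp hE.continuous_P).norm).pow 2
  have hi : IntegrableOn (fun t => ‖(P t).1.snd‖ ^ 2) (Icc 0 T') := hc.continuousOn.integrableOn_Icc
  exact (lintegral_ofReal_le_lintegral_enorm _).trans_lt hi.2

theorem Evolution.bounds_of_smallnessThree {P : ℝ → covGradGraph A} {du : ℝ → L2 n}
    (hE : Evolution A₀ A g T' P du) (hn : 3 ≤ n) (hA : ContDiffOn ℝ 1 A {0}ᶜ)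
    (hA₀ : ContDiffOn ℝ 1 A₀ {0}ᶜ) {M : ℝ} (hM : 0 < M) (hs : SmallnessThree A₀ A M)
    (hg : Defocusing g G) {S : ℝ≥0∞} (hS : ∀ t ∈ Icc 0 T', quarterNormSq A (P t).1.fst ≤ S)
    (he : ofReal (4 * n) * S ≠ ⊤) :
    MorawetzBound G T' P (2 * (ofReal (4 * n) * S)) ∧
      (radialLaw P T').restrict (Ioi 0) ≤ (4 * (ofReal (4 * n) * S)) • volume := by
  obtain ⟨q, hqm, hq0, hq, hq1⟩ := hs.exists_majorant hM hA hA₀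
  set e := ofReal (4 * n) * S
  have hfin : IsFiniteMeasure (radialLaw P T') :=
    isFiniteMeasure_radialLaw hE.continuous_P (hE.lintegral_hardy_lt_top hn hA)
  have hineq := fun (κ : ℝ → ℝ) (s0 s1 : ℝ) (h : RadialKernel κ s0 s1) =>
    hE.radialLaw_ineq hn hA hA₀ hg hS hqm hq h
  have hdens : (radialLaw P T').restrict (Ioi 0) ≤ (4 * e) • volume := by
    refine restrict_le_of_damped_ineq hqm hq0 hq1 he
      (s := 10 * ∫⁻ t in Icc 0 T', ofReal (‖(P t).1.snd‖ ^ 2))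
      (mul_ne_top ofNat_ne_top hE.lintegral_norm_snd_lt_top.ne)
      (fun κ s0 s1 h => ?_) fun κ s0 s1 h => ?_
    · rw [lintegral_radialLaw (f := fun r => ofReal (r * κ r)) hE.continuous_P
        (measurable_id.mul h.continuous.measurable).ennreal_ofReal, mul_assoc, mul_comm _
        (ofReal (mom κ 0 s1)), ← mul_assoc, ← lintegral_const_mul' _ _
          (mul_ne_top ofNat_ne_top ofReal_ne_top)]
      refine lintegral_mono fun t => le_trans (le_of_eq (lintegral_congr_ae ?_))
        (lintegral_kernel_le h hn hA (P t))
      filter_upwards [ae_ne_zero hn] with x hx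
      have hr := norm_pos_iff.2 hx
      rw [enorm_sq_div_pow _ hr, ← ofReal_mul (mul_nonneg hr.le (h.nonneg _)), ← ofReal_norm,
        ← ofReal_pow (norm_nonneg _), ← ofReal_mul (div_nonneg (h.nonneg _) hr.le)]
      congr 1
      field_simp
    · exact (lintegral_radialLaw_kernel_le hE.continuous_P hn hg h).trans
        (mul_le_mul_right (hineq κ s0 s1 h) _)
  refine ⟨fun R κ h h1 => ?_, hdens⟩
  have hle := lintegral_le_of_restrict_le hdens hq0 hq1
  have hR := hineq κ R (2 * R) h
  rw [h1, ofReal_one, one_mul] at hR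
  rw [two_mul e]
  refine hR.trans (add_le_add (le_refl e) ?_)
  calc ∫⁻ r, ofReal (wt κ (mom κ 0 (2 * R)) r) * q r ∂radialLaw P T'
      ≤ ∫⁻ r, ofReal (1 / 2) * q r ∂radialLaw P T' := by
        refine lintegral_mono fun r => ?_
        rcases le_or_gt r 0 with hr | hr
        · simp [hq0 r hr]
        · gcongr
          exact (h.wt_le_moment hr.le).trans_eq (by rw [h1])
    _ = ofReal (1 / 2) * ∫⁻ r, q r ∂radialLaw P T' := lintegral_const_mul _ hqm
    _ ≤ ofReal (1 / 2) * (4 * e * ofReal (1 / 2)) := by gcongr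
    _ = e := by
        have e2 : ofReal (1 / 2) = 2⁻¹ := by
          rw [one_div, ofReal_inv_of_pos two_pos, ofReal_ofNat]
        have e3 : (2 : ℝ≥0∞) * 2⁻¹ = 1 := ENNReal.mul_inv_cancel two_ne_zero ofNat_ne_top
        rw [e2]
        calc 2⁻¹ * (4 * e * 2⁻¹) = (2 * 2⁻¹) * (2 * 2⁻¹) * e := by ring
          _ = e := by rw [e3, one_mul, one_mul]

end

section

/-! ### Spherical caps -/

open scoped Pointwise in
theorem toSphere_cap_le (hn : 3 ≤ n) {y0 : E n} (hy0 : ‖y0‖ = 1) {η : ℝ} (hη : 0 < η) (hη1 : η ≤ 1) :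
    (volume : Measure (E n)).toSphere {y : sphere (0 : E n) 1 | dist (y : E n) y0 < η} ≤
      ofReal (3 * n * 2 ^ n * η ^ (n - 1)) * volume (ball (0 : E n) 1) := by
  have hnt : Nontrivial (E n) := by
    have : Nonempty (Fin n) := ⟨⟨0, by omega⟩⟩
    infer_instance
  have hms : MeasurableSet {y : sphere (0 : E n) 1 | dist (y : E n) y0 < η} :=
    measurableSet_lt (by fun_prop) measurable_const
  set N := ⌈1 / η⌉₊ with hN
  have hN1 : 1 / η ≤ N := Nat.le_ceil _
  have hN2 : (N : ℝ) < 1 / η + 1 := Nat.ceil_lt_add_one (by positivity)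
  have hN0 : 0 < (N : ℝ) := lt_of_lt_of_le (by positivity) hN1
  have hcover : Ioo (0 : ℝ) 1 • (((↑) : sphere (0 : E n) 1 → E n) ''
      {y : sphere (0 : E n) 1 | dist (y : E n) y0 < η}) ⊆
      ⋃ k ∈ Finset.range (N + 1), ball (((k : ℝ) / N) • y0) (2 * η) := by
    rintro _ ⟨ρ, hρ, _, ⟨y, hy, rfl⟩, rfl⟩
    have hρN : 0 ≤ ρ * N := by nlinarith [hρ.1]
    have hk : ⌊ρ * N⌋₊ < N + 1 := by
      refine Nat.lt_succ_of_le (Nat.floor_le_of_le ?_)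
      nlinarith [hρ.2]
    refine mem_iUnion₂.2 ⟨⌊ρ * N⌋₊, Finset.mem_range.2 hk, ?_⟩
    have h1 := Nat.floor_le hρN
    have h2 := Nat.lt_floor_add_one (ρ * N)
    rw [mem_ball, dist_eq_norm]
    have e : ρ • (y : E n) - ((⌊ρ * N⌋₊ : ℝ) / N) • y0 =
        ρ • ((y : E n) - y0) + (ρ - (⌊ρ * N⌋₊ : ℝ) / N) • y0 := by
      rw [smul_sub, sub_smul]; abel
    have h3 : ‖ρ • ((y : E n) - y0)‖ < η := by
      rw [norm_smul, norm_eq_abs, abs_of_pos hρ.1, ← dist_eq_norm]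
      refine lt_of_le_of_lt ?_ (mem_ofPred_eq ▸ hy)
      exact mul_le_of_le_one_left dist_nonneg hρ.2.le
    have h4 : ‖(ρ - (⌊ρ * N⌋₊ : ℝ) / N) • y0‖ ≤ η := by
      rw [norm_smul, hy0, mul_one, norm_eq_abs, abs_of_nonneg]
      · rw [div_le_iff₀ hη] at hN1
        rw [sub_le_iff_le_add, ← sub_le_iff_le_add', le_div_iff₀ hN0]
        nlinarith
      · rw [sub_nonneg, div_le_iff₀ hN0]
        exact h1
    change ‖ρ • (y : E n) - _‖ < _
    rw [e]
    linarith [norm_add_le (ρ • ((y : E n) - y0)) ((ρ - (⌊ρ * N⌋₊ : ℝ) / N) • y0)]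
  rw [Measure.toSphere_apply' _ hms]
  have hb : ∀ k : ℕ, volume (ball (((k : ℝ) / N) • y0) (2 * η)) =
      ofReal ((2 * η) ^ n) * volume (ball (0 : E n) 1) := by
    intro k
    rw [Measure.addHaar_ball _ _ (by positivity), finrank_euclideanSpace, Fintype.card_fin]
  calc ((Module.finrank ℝ (E n) : ℕ) : ℝ≥0∞) * volume _
      ≤ n * ∑ k ∈ Finset.range (N + 1), volume (ball (((k : ℝ) / N) • y0) (2 * η)) := by
        rw [finrank_euclideanSpace, Fintype.card_fin]
        gcongr
        exact (measure_mono hcover).trans (measure_biUnion_finset_le _ _)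
    _ = ofReal (n * ((N + 1) * (2 * η) ^ n)) * volume (ball (0 : E n) 1) := by
        simp only [hb]
        rw [Finset.sum_const, Finset.card_range, nsmul_eq_mul, ofReal_mul (by positivity),
          ofReal_mul (by positivity), ofReal_natCast, ← Nat.cast_succ,
          ofReal_natCast]
        ring
    _ ≤ _ := by
        refine mul_le_mul' (ofReal_le_ofReal ?_) le_rfl
        have h5 : (N + 1) * η ≤ 3 := by
          have : 1 / η * η = 1 := by field_simp
          nlinarith
        have e : η ^ n = η * η ^ (n - 1) := by rw [← pow_succ']; congr 1; omega
        calc (n : ℝ) * ((N + 1) * (2 * η) ^ n) = n * ((N + 1) * η) * 2 ^ n * η ^ (n - 1) := by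
              rw [mul_pow, e]; ring
          _ ≤ n * 3 * 2 ^ n * η ^ (n - 1) := by gcongr
          _ = _ := by ring

/-! ### Averages over balls centered on a sphere -/

/-- The averaged surface measure: the density of `∫_{|y|=1} (average over B(R y, δ)) dσ(y)`. -/
def capDensity (R δ : ℝ) (x : E n) : ℝ≥0∞ :=
  (volume : Measure (E n)).toSphere {y : sphere (0 : E n) 1 | dist x (R • (y : E n)) < δ} /
    volume (ball (0 : E n) δ)

theorem measurableSet_cap (R δ : ℝ) :
    MeasurableSet {z : E n × sphere (0 : E n) 1 | dist z.1 (R • (z.2 : E n)) < δ} :=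
  measurableSet_lt (by fun_prop) measurable_const

theorem measurable_capDensity (R δ : ℝ) : Measurable (capDensity R δ : E n → ℝ≥0∞) :=
  (measurable_measure_prodMk_left (measurableSet_cap R δ)).div_const _

theorem setLAverage_ball_eq (R δ : ℝ) (f : E n → ℝ≥0∞) (y : sphere (0 : E n) 1) :
    ⨍⁻ x in ball (R • (y : E n)) δ, f x ∂volume =
      (∫⁻ x, f x * {z : E n × sphere (0 : E n) 1 | dist z.1 (R • (z.2 : E n)) < δ}.indicator 1
        (x, y)) / volume (ball (0 : E n) δ) := by
  rw [setLAverage_eq, Measure.addHaar_ball_center, ← lintegral_indicator measurableSet_ball]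
  congr 1
  refine lintegral_congr fun x => ?_
  by_cases hx : dist x (R • (y : E n)) < δ
  · rw [indicator_of_mem (mem_ball.2 hx), indicator_of_mem (mem_ofPred_eq ▸ hx), Pi.one_apply,
      mul_one]
  · have hx' : (x, y) ∉ {z : E n × sphere (0 : E n) 1 | dist z.1 (R • (z.2 : E n)) < δ} := hx
    rw [indicator_of_notMem (fun h => hx (mem_ball.1 h)), indicator_of_notMem hx', mul_zero]

theorem measurable_setLAverage_ball (R δ : ℝ) {f : E n → ℝ≥0∞} (hf : Measurable f) :
    Measurable fun y : sphere (0 : E n) 1 =>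
      ⨍⁻ x in ball (R • (y : E n)) δ, f x ∂volume := by
  simp only [setLAverage_ball_eq]
  refine Measurable.div_const (Measurable.lintegral_prod_left' (f := fun z :
    E n × sphere (0 : E n) 1 => f z.1 * _) ?_) _
  exact (hf.comp measurable_fst).mul (measurable_one.indicator (measurableSet_cap R δ))

theorem lintegral_setLAverage_ball (R δ : ℝ) {f : E n → ℝ≥0∞} (hf : Measurable f) :
    ∫⁻ y : sphere (0 : E n) 1, ⨍⁻ x in ball (R • (y : E n)) δ, f x ∂volume
      ∂(volume : Measure (E n)).toSphere = ∫⁻ x, f x * capDensity R δ x := by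
  have hm : Measurable fun z : E n × sphere (0 : E n) 1 => f z.1 *
      {z : E n × sphere (0 : E n) 1 | dist z.1 (R • (z.2 : E n)) < δ}.indicator 1 z :=
    (hf.comp measurable_fst).mul (measurable_one.indicator (measurableSet_cap R δ))
  simp only [setLAverage_ball_eq, div_eq_mul_inv]
  rw [lintegral_mul_const _ (Measurable.lintegral_prod_left' hm),
    ← lintegral_lintegral_swap hm.aemeasurable, ← lintegral_mul_const _ hm.lintegral_prod_right']
  refine lintegral_congr fun x => ?_
  change (∫⁻ y, f x * {z : E n × sphere (0 : E n) 1 |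
    dist z.1 (R • (z.2 : E n)) < δ}.indicator 1 (x, y) ∂_) * _ = _
  have e : ∫⁻ y, {z : E n × sphere (0 : E n) 1 |
      dist z.1 (R • (z.2 : E n)) < δ}.indicator 1 (x, y) ∂(volume : Measure (E n)).toSphere =
      (volume : Measure (E n)).toSphere {y | dist x (R • (y : E n)) < δ} :=
    lintegral_indicator_one ((measurableSet_cap R δ).preimage measurable_prodMk_left)
  have hme : Measurable fun y => {z : E n × sphere (0 : E n) 1 |
      dist z.1 (R • (z.2 : E n)) < δ}.indicator (1 : E n × sphere (0 : E n) 1 → ℝ≥0∞) (x, y) :=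
    (measurable_one.indicator (measurableSet_cap R δ)).comp measurable_prodMk_left
  rw [capDensity, lintegral_const_mul _ hme, e, div_eq_mul_inv, ← mul_assoc]

theorem capDensity_le (hn : 3 ≤ n) {R δ : ℝ} (hR : 0 < R) (hδ : 0 < δ) (hδR : 2 * δ ≤ R) (x : E n) :
    ofReal R ^ (n - 1) * capDensity R δ x ≤ ofReal (3 * n * 4 ^ n / δ) *
        (Ioo (R - δ) (R + δ)).indicator 1 ‖x‖ := by
  have hnt : Nontrivial (E n) := by
    have : Nonempty (Fin n) := ⟨⟨0, by omega⟩⟩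
    infer_instance
  rw [capDensity]
  rcases Set.eq_empty_or_nonempty
    {y : sphere (0 : E n) 1 | dist x (R • (y : E n)) < δ} with h0 | ⟨y0, hy0⟩
  · rw [h0, measure_empty, ENNReal.zero_div, mul_zero]
    exact zero_le
  have hy1 : ‖(y0 : E n)‖ = 1 := norm_eq_of_mem_sphere y0
  have hd : dist x (R • (y0 : E n)) < δ := hy0
  have hmem : ‖x‖ ∈ Ioo (R - δ) (R + δ) := by
    have h1 : ‖R • (y0 : E n)‖ = R := by
      rw [norm_smul, hy1, mul_one, norm_eq_abs, abs_of_pos hR]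
    have h2 := abs_norm_sub_norm_le x (R • (y0 : E n))
    rw [h1, ← dist_eq_norm] at h2
    obtain ⟨h3, h4⟩ := abs_le.1 (h2.trans hd.le)
    have h5 := abs_lt.1 (h2.trans_lt hd)
    exact ⟨by linarith [h5.1], by linarith [h5.2]⟩
  rw [indicator_of_mem hmem, Pi.one_apply, mul_one]
  have hcap := toSphere_cap_le hn hy1 (η := 2 * δ / R) (by positivity) (by rwa [div_le_one hR])
  have hsub : {y : sphere (0 : E n) 1 | dist x (R • (y : E n)) < δ} ⊆
      {y : sphere (0 : E n) 1 | dist (y : E n) y0 < 2 * δ / R} := by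
    intro y hy
    have hy' : dist x (R • (y : E n)) < δ := hy
    change dist (y : E n) y0 < 2 * δ / R
    rw [lt_div_iff₀ hR]
    have h1 : dist (R • (y : E n)) (R • (y0 : E n)) = R * dist (y : E n) y0 := by
      rw [dist_smul₀, norm_eq_abs, abs_of_pos hR]
    have h2 := dist_triangle_left (R • (y : E n)) (R • (y0 : E n)) x
    rw [h1] at h2
    linarith
  have hB : volume (ball (0 : E n) δ) = ofReal (δ ^ n) * volume (ball (0 : E n) 1) := by
    rw [Measure.addHaar_ball _ _ hδ.le, finrank_euclideanSpace, Fintype.card_fin]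
  have hV0 : volume (ball (0 : E n) 1) ≠ 0 := (Metric.measure_ball_pos _ _ one_pos).ne'
  have hVt : volume (ball (0 : E n) 1) ≠ ⊤ := measure_ball_lt_top.ne
  rw [hB]
  refine (mul_le_mul_right (ENNReal.div_le_div_right ((measure_mono hsub).trans hcap) _) _).trans ?_
  rw [ENNReal.mul_div_mul_right _ _ hV0 hVt, ← ofReal_div_of_pos (by positivity),
    ← ofReal_pow hR.le, ← ofReal_mul (by positivity)]
  refine ofReal_le_ofReal ?_
  obtain ⟨m, rfl⟩ : ∃ m, n = m + 1 := ⟨n - 1, by omega⟩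
  rw [Nat.add_sub_cancel]
  calc R ^ m * (3 * ((m + 1 : ℕ) : ℝ) * 2 ^ (m + 1) * (2 * δ / R) ^ m / δ ^ (m + 1))
      = 3 * ((m + 1 : ℕ) : ℝ) * (2 ^ (m + 1) * 2 ^ m) / δ := by
        rw [div_pow, mul_pow, pow_succ δ m]
        field_simp
    _ ≤ 3 * ((m + 1 : ℕ) : ℝ) * 4 ^ (m + 1) / δ := by
        gcongr
        rw [show (4 : ℝ) = 2 * 2 by norm_num, mul_pow]
        gcongr <;> simp

end

section

variable {A : E n → E n} {A₀ : E n → ℝ} {g G : ℝ → ℝ} {T' R : ℝ} {e : ℝ≥0∞}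

/-! ### The sphere term -/

theorem sphereIntegral_preciseSq_le (hR : 0 < R) (u : L2 n) :
    sphereIntegral R (preciseSq u) ≤ liminf (fun k : ℕ => ofReal R ^ (n - 1) *
      ∫⁻ x, ‖u x‖ₑ ^ 2 * capDensity R (R / (k + 2)) x) atTop := by
  have hu : Measurable fun x => ‖u x‖ₑ ^ 2 := (Lp.stronglyMeasurable u).measurable.enorm.pow_const 2
  have ht : Tendsto (fun k : ℕ => R / ((k : ℝ) + 2)) atTop (𝓝[>] 0) := by
    refine tendsto_nhdsWithin_iff.2 ⟨?_, Eventually.of_forall fun k => ?_⟩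
    · exact tendsto_const_nhds.div_atTop
        (tendsto_atTop_add_const_right _ _ tendsto_natCast_atTop_atTop)
    · exact mem_Ioi.2 (by positivity)
  have h1 : ∫⁻ y : sphere (0 : E n) 1, preciseSq u (R • (y : E n))
      ∂(volume : Measure (E n)).toSphere ≤
      liminf (fun k : ℕ => ∫⁻ x, ‖u x‖ₑ ^ 2 * capDensity R (R / (k + 2)) x) atTop := by
    simp only [← lintegral_setLAverage_ball R _ hu]
    refine le_trans (lintegral_mono fun y => ?_)
      (lintegral_liminf_le fun k : ℕ => measurable_setLAverage_ball R (R / (k + 2)) hu)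
    rw [preciseSq]
    exact liminf_le_liminf_of_le (u := fun δ : ℝ =>
      ⨍⁻ x in ball (R • (y : E n)) δ, ‖u x‖ₑ ^ 2 ∂volume) ht
  rw [sphereIntegral]
  refine (mul_le_mul_right h1 _).trans ?_
  have h2 := ENNReal.le_liminf_mul (f := atTop) (u := fun _ : ℕ => ofReal R ^ (n - 1))
    (v := fun k : ℕ => ∫⁻ x, ‖u x‖ₑ ^ 2 * capDensity R (R / (k + 2)) x)
  rw [liminf_const] at h2
  exact h2

theorem lintegral_capDensity_le (hn : 3 ≤ n) {P : ℝ → covGradGraph A} (hP : Continuous P)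
    (hμ : (radialLaw P T').restrict (Ioi 0) ≤ (4 * e) • volume) (hR : 0 < R) {δ : ℝ} (hδ : 0 < δ)
    (hδR : 2 * δ ≤ R) :
    ∫⁻ t in Icc 0 T', ofReal R ^ (n - 1) * ∫⁻ x, ‖(P t).1.fst x‖ₑ ^ 2 * capDensity R δ x ≤
      ofReal R ^ 2 * (ofReal (96 * n * 4 ^ n) * e) := by
  have hRn : ofReal R ^ (n - 1) ≠ ⊤ := pow_ne_top ofReal_ne_top
  set J := Ioo (R - δ) (R + δ) with hJ
  have hJm : Measurable (J.indicator (1 : ℝ → ℝ≥0∞)) := measurable_one.indicator measurableSet_Ioo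
  have h1 : ∀ t, ofReal R ^ (n - 1) * ∫⁻ x, ‖(P t).1.fst x‖ₑ ^ 2 * capDensity R δ x ≤
      ofReal (3 * n * 4 ^ n / δ * (4 * R ^ 2)) *
        ∫⁻ x, J.indicator 1 ‖x‖ * (‖(P t).1.fst x‖ₑ ^ 2 / ‖x‖ₑ ^ 2) := by
    intro t
    rw [← lintegral_const_mul' _ _ hRn, ← lintegral_const_mul' _ _ ofReal_ne_top]
    refine lintegral_mono_ae ?_
    filter_upwards [ae_ne_zero hn] with x hx
    have hr := norm_pos_iff.2 hx
    calc ofReal R ^ (n - 1) * (‖(P t).1.fst x‖ₑ ^ 2 * capDensity R δ x)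
        = ‖(P t).1.fst x‖ₑ ^ 2 * (ofReal R ^ (n - 1) * capDensity R δ x) := by ring
      _ ≤ ‖(P t).1.fst x‖ₑ ^ 2 * (ofReal (3 * n * 4 ^ n / δ) * J.indicator 1 ‖x‖) := by
        exact mul_le_mul_right (capDensity_le hn hR hδ hδR x) _
      _ ≤ _ := by
        by_cases hxJ : ‖x‖ ∈ J
        · rw [indicator_of_mem hxJ, Pi.one_apply, mul_one, one_mul, enorm_sq_div_pow _ hr,
            ← ofReal_mul (by positivity), ← ofReal_norm,
            ← ofReal_pow (norm_nonneg _), ← ofReal_mul (by positivity)]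
          refine ofReal_le_ofReal ?_
          have h2 : ‖x‖ ≤ 2 * R := by linarith [hxJ.2]
          have h3 : ‖x‖ ^ 2 ≤ 4 * R ^ 2 := by nlinarith
          calc ‖(P t).1.fst x‖ ^ 2 * (3 * n * 4 ^ n / δ)
              = 3 * n * 4 ^ n / δ * ‖x‖ ^ 2 * (‖(P t).1.fst x‖ ^ 2 / ‖x‖ ^ 2) := by field_simp
            _ ≤ _ := by
              refine mul_le_mul_of_nonneg_right ?_ (by positivity)
              exact mul_le_mul_of_nonneg_left h3 (by positivity)
        · rw [indicator_of_notMem hxJ, mul_zero, mul_zero]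
          exact zero_le
  refine (lintegral_mono h1).trans ?_
  rw [lintegral_const_mul' _ _ ofReal_ne_top, ← lintegral_radialLaw hP hJm,
    lintegral_indicator_one measurableSet_Ioo]
  have hJ0 : J ⊆ Ioi 0 := fun r hr => mem_Ioi.2 (by linarith [hr.1])
  have h4 : radialLaw P T' J ≤ 4 * e * ofReal (2 * δ) := by
    have h5 := hμ J
    rw [Measure.restrict_apply measurableSet_Ioo, inter_eq_self_of_subset_left hJ0,
      Measure.smul_apply, smul_eq_mul, hJ, Real.volume_Ioo] at h5
    convert h5 using 3
    ring
  refine (mul_le_mul_right h4 _).trans_eq ?_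
  rw [← ofReal_pow hR.le, ← mul_assoc (ofReal (R ^ 2)),
    ← ofReal_mul (by positivity), mul_comm (4 * e), ← mul_assoc, ← mul_assoc,
    ← ofReal_mul (by positivity), ← ofReal_ofNat 4,
    ← ofReal_mul (by positivity)]
  congr 2
  field_simp
  norm_num

theorem lintegral_sphereIntegral_le (hn : 3 ≤ n) {P : ℝ → covGradGraph A} (hP : Continuous P)
    (hμ : (radialLaw P T').restrict (Ioi 0) ≤ (4 * e) • volume) (hR : 0 < R) :
    (ofReal R ^ 2)⁻¹ * ∫⁻ t in Icc 0 T', sphereIntegral R (preciseSq (P t).1.fst) ≤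
      ofReal (96 * n * 4 ^ n) * e := by
  have h1 : ∫⁻ t in Icc 0 T', sphereIntegral R (preciseSq (P t).1.fst) ≤
      ofReal R ^ 2 * (ofReal (96 * n * 4 ^ n) * e) := by
    refine (lintegral_mono fun t => sphereIntegral_preciseSq_le hR (P t).1.fst).trans ?_
    refine (lintegral_liminf_le fun k : ℕ => (measurable_lintegral_mul
      (measurable_capDensity R (R / (k + 2))) (φ := fun z : ℂ => ‖z‖ₑ ^ 2) (by fun_prop)
      ((fstG A).continuous.comp hP)).const_mul _).trans ?_
    refine liminf_le_of_le (by isBoundedDefault) fun b hb => ?_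
    obtain ⟨k, hk⟩ := hb.exists
    refine hk.trans (lintegral_capDensity_le hn hP hμ hR (by positivity) ?_)
    rw [← mul_div_assoc, div_le_iff₀ (by positivity)]
    nlinarith [mul_nonneg hR.le (Nat.cast_nonneg (α := ℝ) k)]
  have h0 : ofReal R ^ 2 ≠ 0 := pow_ne_zero _ (by simpa using hR)
  have ht : ofReal R ^ 2 ≠ ⊤ := pow_ne_top ofReal_ne_top
  refine (mul_le_mul_right h1 _).trans_eq ?_
  rw [← mul_assoc, ENNReal.inv_mul_cancel h0 ht, one_mul]

/-! ### Dimension three -/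

theorem smoothingThree_le {A : E 3 → E 3} {A₀ : E 3 → ℝ} (hA : GaugeConditions A₀ A) {M : ℝ}
    (hM : 0 < M) (hs : SmallnessThree A₀ A M) (hg : Defocusing g G) {T : ℝ≥0∞} {u : ℝ → L2 3}
    (hu : IsSolution A₀ A g T u) :
    smoothingThree A G M T u ≤ ofReal ((36 + 6 * M + 96 * 3 * 4 ^ 3) * 12) *
      ⨆ t ∈ timeInterval T, quarterNormSq A (u t) := by
  set S := ⨆ t ∈ timeInterval T, quarterNormSq A (u t) with hS
  rcases eq_or_ne S ⊤ with hSt | hSt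
  · rw [hSt, ENNReal.mul_top (by rw [Ne, ENNReal.ofReal_eq_zero, not_le]; positivity)]
    exact le_top
  have hn3 : 3 ≤ 3 := le_rfl
  set e := ofReal (4 * (3 : ℕ)) * S with he
  have het : e ≠ ⊤ := mul_ne_top ofReal_ne_top hSt
  have key : ∀ T', 0 ≤ T' → ofReal T' ≤ T → ∃ P : ℝ → covGradGraph A, Continuous P ∧
      (∀ t ∈ Icc 0 T', u t = (P t).1.fst ∧ covGrad A (u t) = (P t).1.snd) ∧
      MorawetzBound G T' P (2 * e) ∧
      (radialLaw P T').restrict (Ioi 0) ≤ (4 * e) • volume := by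
    intro T' h0 hT'
    obtain ⟨P, du, hE, hPu⟩ := hu.exists_evolution hn3 hA h0 hT'
    refine ⟨P, hE.continuous_P, fun t ht => ⟨(hPu t ht).symm, ?_⟩,
      hE.bounds_of_smallnessThree hn3 hA.contDiff_A hA.contDiff_A₀ hM hs hg (fun t ht => ?_) het⟩
    · rw [← hPu t ht]
      exact covGrad_eq hn3 hA.contDiff_A (P t)
    · rw [hPu t ht]
      exact le_iSup₂_of_le t ⟨ht.1, (ofReal_le_ofReal ht.2).trans hT'⟩ le_rfl
  have b1 : ∫⁻ t in timeInterval T, ∫⁻ x : E 3, (‖tangential x (covGrad A (u t) x)‖ₑ ^ 2 / ‖x‖ₑ +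
        ofReal (2 * M * G (‖u t x‖ ^ 2)) / ‖x‖ₑ) ≤
      ofReal (6 + 3 * M) * (2 * e) := by
    refine lintegral_timeInterval_le fun T' h0 hT' => ?_
    obtain ⟨P, cP, hP, hb, -⟩ := key T' h0 hT'
    refine le_trans (setLIntegral_mono' measurableSet_Icc fun t ht => ?_)
      (hb.tangential_add_potential cP hn3 hg hM.le)
    rw [(hP t ht).2, (hP t ht).1]
    norm_num
  have b2 : ⨆ R ∈ Ioi (0 : ℝ), (ofReal R)⁻¹ *
      ∫⁻ t in timeInterval T, ∫⁻ x in closedBall (0 : E 3) R,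
        (‖covGrad A (u t) x‖ₑ ^ 2 + ofReal (G (‖u t x‖ ^ 2))) ≤
      ofReal 12 * (2 * e) := by
    refine iSup₂_le fun R hR => ?_
    have hR' : (ofReal R)⁻¹ ≠ ⊤ := by simpa using hR
    rw [← lintegral_const_mul' _ _ hR']
    refine lintegral_timeInterval_le fun T' h0 hT' => ?_
    obtain ⟨P, cP, hP, hb, -⟩ := key T' h0 hT'
    rw [lintegral_const_mul' _ _ hR']
    refine le_trans (mul_le_mul_right (setLIntegral_mono' measurableSet_Icc fun t ht => ?_) _)
      (hb.lintegral_closedBall hn3 hg hR)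
    rw [(hP t ht).2, (hP t ht).1]
    norm_num
  have b3 : ⨆ R ∈ Ioi (0 : ℝ), (ofReal R ^ 2)⁻¹ *
      ∫⁻ t in timeInterval T, sphereIntegral R (preciseSq (u t)) ≤
      ofReal (96 * (3 : ℕ) * 4 ^ 3) * e := by
    refine iSup₂_le fun R hR => ?_
    have hR' : (ofReal R ^ 2)⁻¹ ≠ ⊤ := ENNReal.inv_ne_top.2 (pow_ne_zero _ (by simpa using hR))
    rw [← lintegral_const_mul' _ _ hR']
    refine lintegral_timeInterval_le fun T' h0 hT' => ?_
    obtain ⟨P, cP, hP, -, hμ⟩ := key T' h0 hT'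
    rw [lintegral_const_mul' _ _ hR']
    refine le_trans (mul_le_mul_right (setLIntegral_mono' measurableSet_Icc fun t ht => ?_) _)
      (lintegral_sphereIntegral_le hn3 cP hμ hR)
    rw [(hP t ht).1]
  refine (add_le_add (add_le_add b1 b2) b3).trans_eq ?_
  rw [← add_mul, ← ofReal_add (by positivity) (by norm_num), ← mul_assoc, ← add_mul, he,
    ← mul_assoc, ← ofReal_ofNat 2, ← ofReal_mul (by positivity),
    ← ofReal_add (by positivity) (by positivity), ← ofReal_mul (by positivity)]
  congr 2
  push_cast
  ring

end

end

end MagneticNLS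

theorem corollary2p3 (n : ℕ) (A₀ : MagneticNLS.E n → ℝ) (A : MagneticNLS.E n → MagneticNLS.E n)
    (hA : MagneticNLS.GaugeConditions A₀ A) :
    (n = 3 → ∀ M : ℝ, 0 < M → MagneticNLS.SmallnessThree A₀ A M →
      ∃ C : ℝ≥0, ∀ g G : ℝ → ℝ, MagneticNLS.Defocusing g G →
        ∀ T : ℝ≥0∞, 0 < T → ∀ u : ℝ → MagneticNLS.L2 n, MagneticNLS.IsSolution A₀ A g T u →
          MagneticNLS.smoothingThree A G M T u ≤
            C * ⨆ t ∈ MagneticNLS.timeInterval T, MagneticNLS.quarterNormSq A (u t)) ∧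
    (4 ≤ n → MagneticNLS.SmallnessHigh A₀ A → ∃ C : ℝ≥0, ∀ g G : ℝ → ℝ, MagneticNLS.Defocusing g G →
        ∀ T : ℝ≥0∞, 0 < T → ∀ u : ℝ → MagneticNLS.L2 n, MagneticNLS.IsSolution A₀ A g T u →
          MagneticNLS.smoothingHigh A G T u ≤
            C * ⨆ t ∈ MagneticNLS.timeInterval T, MagneticNLS.quarterNormSq A (u t)) := by
  refine ⟨fun hn M hM hs => ?_, fun hn hs => ⟨_, fun g G hg T _ u hu =>
    MagneticNLS.smoothingHigh_le hn hA hs hg hu⟩⟩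
  subst hn
  exact ⟨_, fun g G hg T _ u hu => MagneticNLS.smoothingThree_le hA hM hs hg hu⟩
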